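/- Let $n\ge 1$. A weighted graph over $\mathbb F_3$ on the vertices $1,\dots,n$ is a symmetric matrix $\Gamma\in\mathbb F_3^{n\times n}$ with zero diagonal; $\{u,v\}$ is an edge if $\Gamma_{uv}\neq 0$, and $\Gamma$ is connected if the simple graph formed by its edges is connected. For a vertex $w$ define * $\gamma$-local scaling about $w$, for $\gamma\in\mathbb F_3\setminus\{0\}$: multiply $\Gamma_{uv}$ by $\gamma$ whenever $u=w$ or $v=w$, and leave all other entries unchanged; * $\gamma$-local complementation about $w$, for $\gamma\in\mathbb F_3$: replace $\Gamma_{uv}$ by $\Gamma_{uv}+\gamma\Gamma_{uw}\Gamma_{vw}$ for all $u\ne v$. Consider the connected weighted graphs on $n$ vertices up to relabelling of the vertices (that is, up to $\Gamma_{uv}\mapsto\Gamma_{\sigma(u)\sigma(v)}$ with $\sigma\in S_n$). Join two of these isomorphism classes if one arises from the other by a local scaling or a local complementation. The connected components of the resulting graph are called orbits; the size $|V|$ of an orbit is the number of isomorphism classes in it. For a weighted graph, regard the weights as integers in $\{0,1,2\}$. Let $|e|$ be its number of edges, let its total weight be the sum of the weights of its edges, and let its encoding be $\sum_{i\ge 0}a_i4^i$,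 where $a_0a_1a_2\dots$ are the entries above the diagonal, read row by row: $\Gamma_{12},\Gamma_{13},\dots,\Gamma_{1n},\Gamma_{23},\dots,\Gamma_{n-1,n}$. The representative of an orbit is the labelled weighted graph, among all those whose isomorphism class lies in the orbit, for which the triple $(|e|,\text{total weight},\text{encoding})$ is lexicographically smallest. **Claim.** There are exactly $1,3,5,21,73$ orbits for $n=3,4,5,6,7$ respectively, hence $103$ orbits for $3\le n\le 7$. They are given by the following list. Each orbit occurs exactly once, as a triple $(|V|,|e|,a_0a_1a_2\dots)$ consisting of the size of the orbit, the number of edges of its representative, and the entries above the diagonal of the representative, read row by row. For each $n$ the list is ordered by non-decreasing $(|e|,\text{total weight})$ of the representative (lexicographically). $n=3$ (row 1): $(7,2,110)$. $n=4$ (rows 2–4): $(10,3,111000)$; $(37,3,101100)$; $(6,4,021110)$. $n=5$ (rows 5–9): $(11,4,1111000000)$; $(88,4,1011100000)$; $(255,4,0101110000)$; $(219,5,0011101100)$; $(139,5,0211110000)$. $n=6$ (rows 10–30): $(14,5,111110000000000)$; $(116,5,101111000000000)$; $(66,5,100111100000000)$; $(666,5,010111100000000)$; $(420,5,110010010100000)$;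 $(1850,5,001011010100000)$; $(162,6,011011110000000)$; $(164,6,110011010100000)$; $(4698,6,001111010100000)$; $(7572,6,000110101110000)$; $(180,6,021111100000000)$; $(331,6,021011110000000)$; $(164,6,210011010100000)$; $(1008,6,201011010100000)$; $(980,6,010210011100000)$; $(1892,6,000210101110000)$; $(1200,7,001211011100000)$; $(1572,7,101010210110000)$; $(119,8,001210211110000)$; $(462,9,001111011101100)$; $(940,9,001111011210100)$. $n=7$ (rows 31–103): $(15,6,111111000000000000000)$; $(137,6,101111100000000000000)$; $(156,6,100111110000000000000)$; $(852,6,010111110000000000000)$; $(483,6,010011111000000000000)$; $(565,6,110011001001000000000)$; $(1069,6,100011101001000000000)$; $(5052,6,001011101001000000000)$; $(5853,6,010101001101000000000)$; $(1155,6,001001010101100000000)$; $(13923,6,000101010101100000000)$; $(576,7,011011111000000000000)$; $(577,7,110011101001000000000)$; $(6451,7,001111101001000000000)$; $(3144,7,010101101101000000000)$; $(14703,7,001101101101000000000)$; $(3153,7,101001010101100000000)$; $(14724,7,100101010101100000000)$; $(71046,7,000111010101100000000)$; $(35091,7,001011100010010100000)$; $(48207,7,000011001011010100000)$; $(239,7,021111110000000000000)$;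 $(896,7,021011111000000000000)$; $(577,7,210011101001000000000)$; $(2695,7,201011101001000000000)$; $(1597,7,010211001101000000000)$; $(3132,7,020101101101000000000)$; $(4872,7,000211101101000000000)$; $(1360,7,100011021001100000000)$; $(3153,7,201001010101100000000)$; $(14724,7,200101010101100000000)$; $(14679,7,002101010101100000000)$; $(35418,7,000211010101100000000)$; $(7440,7,000011021101100000000)$; $(48207,7,000021001011010100000)$; $(71244,8,000111010111100000000)$; $(57072,8,000111110010010100000)$; $(71400,8,011001001101010100000)$; $(357,8,021101111100000000000)$; $(7818,8,001211101101000000000)$; $(2162,8,101011021001100000000)$; $(2062,8,211001010101100000000)$; $(29340,8,102101010101100000000)$; $(15600,8,010011021101100000000)$; $(37260,8,000121010111100000000)$; $(2631,8,001101011102100000000)$; $(23634,8,020101110010010100000)$; $(35589,8,021001001101010100000)$; $(11802,8,000011201101010100000)$; $(71400,8,100101002101010100000)$; $(338868,8,002011001011010100000)$; $(1030,8,002121000111100000000)$; $(10084,9,001011011011110000000)$; $(59454,9,000111110011010100000)$; $(19872,9,002011011011110000000)$; $(5016,9,011101011102100000000)$; $(59454,9,000111210011010100000)$; $(170580,9,000112011011010100000)$;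 $(173784,9,000111102011010100000)$; $(9669,9,000112001111010100000)$; $(4107,9,001211021101100000000)$; $(2136,9,002121100111100000000)$; $(15288,10,001111101101010100000)$; $(88380,10,000111010111110100000)$; $(58908,10,001011101010110110000)$; $(8214,10,001111101102100100000)$; $(24702,10,011021101101010100000)$; $(114528,10,010112001111010100000)$; $(175464,10,001011101010210110000)$; $(58908,10,000112010112110100000)$; $(38388,10,001102101010210110000)$; $(16745,11,001211100110101110000)$; $(16745,11,000121210110101110000)$. -/

import Mathlib

/-- A weighted graph on the vertices `0, …, n - 1` with edge weights in `𝔽_d` (`d` prime) and no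
self-loops, given by its adjacency matrix `Γ`; the weight `0` means that there is no edge. -/
@[ext]
structure WeightedGraph (d n : ℕ) where
  Γ : Matrix (Fin n) (Fin n) (ZMod d)
  symm : ∀ u v, Γ u v = Γ v u
  loopless : ∀ u, Γ u u = 0

namespace WeightedGraph

variable {d n : ℕ}

/-- `γ`-local scaling about the vertex `w`. -/
def localScaling (G : WeightedGraph d n) (γ : ZMod d) (w : Fin n) : WeightedGraph d n where
  Γ := fun u v => if u = w ∨ v = w then γ * G.Γ u v else G.Γ u v
  symm := fun u v => by simp only [G.symm u v, or_comm]
  loopless := fun u => by simp [G.loopless u]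

/-- `γ`-local complementation about the vertex `w`. -/
def localComplementation (G : WeightedGraph d n) (γ : ZMod d) (w : Fin n) :
    WeightedGraph d n where
  Γ := fun u v => if u ≠ v then G.Γ u v + γ * G.Γ u w * G.Γ v w else G.Γ u v
  symm := fun u v => by
    simp only [G.symm u v, ne_comm (a := u) (b := v), mul_right_comm γ (G.Γ u w)]
  loopless := fun u => by simp [G.loopless u]

/-- `H` arises from `G` by one local scaling, with a nonzero factor, or one local
complementation. -/
def LocalMove (G H : WeightedGraph d n) : Prop :=
  (∃ γ : ZMod d, γ ≠ 0 ∧ ∃ w, H = G.localScaling γ w) ∨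
    ∃ (γ : ZMod d) (w : Fin n), H = G.localComplementation γ w

/-- The underlying simple graph. -/
def support (G : WeightedGraph d n) : SimpleGraph (Fin n) where
  Adj u v := G.Γ u v ≠ 0
  symm := ⟨fun u v h => by rwa [G.symm v u]⟩
  loopless := ⟨fun u h => h (G.loopless u)⟩

/-- `H` is a relabelling of the vertices of `G`. -/
def Isomorphic (G H : WeightedGraph d n) : Prop :=
  ∃ σ : Equiv.Perm (Fin n), ∀ u v, H.Γ (σ u) (σ v) = G.Γ u v

theorem isomorphic_equivalence : Equivalence (Isomorphic (d := d) (n := n)) where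
  refl _ := ⟨1, fun _ _ => rfl⟩
  symm := fun ⟨σ, h⟩ => ⟨σ⁻¹, fun u v => by rw [← h]; simp⟩
  trans := fun ⟨σ, h⟩ ⟨τ, k⟩ => ⟨τ * σ, fun u v => by simp [h, k]⟩

/-- The entries above the diagonal, row by row, as integers in `{0, …, d - 1}`. -/
def upperTriangle (G : WeightedGraph d n) : List ℕ :=
  (List.finRange n).flatMap fun u =>
    ((List.finRange n).filter fun v => u < v).map fun v => (G.Γ u v).val

/-- The number of edges. -/
def edgeCount (G : WeightedGraph d n) : ℕ := G.upperTriangle.countP (· ≠ 0)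

/-- The sum of all edge weights, as integers in `{0, …, d - 1}`. -/
def totalWeight (G : WeightedGraph d n) : ℕ := G.upperTriangle.sum

/-- The integer encoding of a graph with weights in `{0, 1, 2}`: two bits for each entry of the
vectorized upper triangle, the first entry being the least significant one. -/
def encoding (G : WeightedGraph 3 n) : ℕ := Nat.ofDigits 4 G.upperTriangle

/-- The triple (number of edges, total weight, encoding), compared lexicographically. -/
def key (G : WeightedGraph 3 n) : ℕ ×ₗ ℕ ×ₗ ℕ :=
  toLex (G.edgeCount, toLex (G.totalWeight, G.encoding))

end WeightedGraph

/-- Connected weighted graphs over `𝔽_3` on `n` labelled vertices. -/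
abbrev ConnectedGraph (n : ℕ) := {G : WeightedGraph 3 n // G.support.Connected}

/-- Equality up to vertex relabelling. -/
def relabelSetoid (n : ℕ) : Setoid (ConnectedGraph n) where
  r G H := G.1.Isomorphic H.1
  iseqv :=
    ⟨fun G => WeightedGraph.isomorphic_equivalence.refl G.1,
      fun h => WeightedGraph.isomorphic_equivalence.symm h,
      fun h k => WeightedGraph.isomorphic_equivalence.trans h k⟩

/-- Connected weighted graphs over `𝔽_3` on `n` vertices, up to relabelling. -/
abbrev UnlabelledGraph (n : ℕ) := Quotient (relabelSetoid n)

/-- The atlas: its vertices are the connected weighted graphs up to relabelling, and two of them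
are joined by an edge if one arises from the other by a local scaling or a local complementation.
(Self-loops are left out; they have no influence on the connected components.) -/
def orbitAtlas (n : ℕ) : SimpleGraph (UnlabelledGraph n) :=
  SimpleGraph.fromRel fun x y => ∃ G H : ConnectedGraph n,
    Quotient.mk (relabelSetoid n) G = x ∧ Quotient.mk (relabelSetoid n) H = y ∧
      G.1.LocalMove H.1

/-- The orbits are the connected components of the atlas. -/
abbrev Orbit (n : ℕ) := (orbitAtlas n).ConnectedComponent

/-- The number of vertices of the orbit graph. -/
noncomputable def Orbit.size {n : ℕ} (O : Orbit n) : ℕ := O.supp.ncard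

/-- The orbit of a connected weighted graph. -/
def orbitOf {n : ℕ} (G : ConnectedGraph n) : Orbit n :=
  (orbitAtlas n).connectedComponentMk (Quotient.mk (relabelSetoid n) G)

/-- `G` is the representative of its orbit: it has the minimum number of edges, among those the
minimum total weight, and among those the smallest encoding. -/
def IsRepresentative {n : ℕ} (G : ConnectedGraph n) : Prop :=
  ∀ H : ConnectedGraph n, orbitOf H = orbitOf G → G.1.key ≤ H.1.key

/-- A row of the table: the number of vertices of the orbit graph, the number of edges of the
representative, and the upper triangle of the adjacency matrix of the representative. -/
structure TableRow where
  orbitSize : ℕ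
  edges : ℕ
  representative : List ℕ

/-- The table of all orbits with `3 ≤ n ≤ 7` vertices. -/
def orbitTable : ℕ → List TableRow
  | 3 => [
      ⟨7, 2, [1, 1, 0]⟩]
  | 4 => [
      ⟨10, 3, [1, 1, 1, 0, 0, 0]⟩,
      ⟨37, 3, [1, 0, 1, 1, 0, 0]⟩,
      ⟨6, 4, [0, 2, 1, 1, 1, 0]⟩]
  | 5 => [
      ⟨11, 4, [1, 1, 1, 1, 0, 0, 0, 0, 0, 0]⟩,
      ⟨88, 4, [1, 0, 1, 1, 1, 0, 0, 0, 0, 0]⟩,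
      ⟨255, 4, [0, 1, 0, 1, 1, 1, 0, 0, 0, 0]⟩,
      ⟨219, 5, [0, 0, 1, 1, 1, 0, 1, 1, 0, 0]⟩,
      ⟨139, 5, [0, 2, 1, 1, 1, 1, 0, 0, 0, 0]⟩]
  | 6 => [
      ⟨14, 5, [1, 1, 1, 1, 1, 0, 0, 0, 0, 0, 0, 0, 0, 0, 0]⟩,
      ⟨116, 5, [1, 0, 1, 1, 1, 1, 0, 0, 0, 0, 0, 0, 0, 0, 0]⟩,
      ⟨66, 5, [1, 0, 0, 1, 1, 1, 1, 0, 0, 0, 0, 0, 0, 0, 0]⟩,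
      ⟨666, 5, [0, 1, 0, 1, 1, 1, 1, 0, 0, 0, 0, 0, 0, 0, 0]⟩,
      ⟨420, 5, [1, 1, 0, 0, 1, 0, 0, 1, 0, 1, 0, 0, 0, 0, 0]⟩,
      ⟨1850, 5, [0, 0, 1, 0, 1, 1, 0, 1, 0, 1, 0, 0, 0, 0, 0]⟩,
      ⟨162, 6, [0, 1, 1, 0, 1, 1, 1, 1, 0, 0, 0, 0, 0, 0, 0]⟩,
      ⟨164, 6, [1, 1, 0, 0, 1, 1, 0, 1, 0, 1, 0, 0, 0, 0, 0]⟩,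
      ⟨4698, 6, [0, 0, 1, 1, 1, 1, 0, 1, 0, 1, 0, 0, 0, 0, 0]⟩,
      ⟨7572, 6, [0, 0, 0, 1, 1, 0, 1, 0, 1, 1, 1, 0, 0, 0, 0]⟩,
      ⟨180, 6, [0, 2, 1, 1, 1, 1, 1, 0, 0, 0, 0, 0, 0, 0, 0]⟩,
      ⟨331, 6, [0, 2, 1, 0, 1, 1, 1, 1, 0, 0, 0, 0, 0, 0, 0]⟩,
      ⟨164, 6, [2, 1, 0, 0, 1, 1, 0, 1, 0, 1, 0, 0, 0, 0, 0]⟩,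
      ⟨1008, 6, [2, 0, 1, 0, 1, 1, 0, 1, 0, 1, 0, 0, 0, 0, 0]⟩,
      ⟨980, 6, [0, 1, 0, 2, 1, 0, 0, 1, 1, 1, 0, 0, 0, 0, 0]⟩,
      ⟨1892, 6, [0, 0, 0, 2, 1, 0, 1, 0, 1, 1, 1, 0, 0, 0, 0]⟩,
      ⟨1200, 7, [0, 0, 1, 2, 1, 1, 0, 1, 1, 1, 0, 0, 0, 0, 0]⟩,
      ⟨1572, 7, [1, 0, 1, 0, 1, 0, 2, 1, 0, 1, 1, 0, 0, 0, 0]⟩,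
      ⟨119, 8, [0, 0, 1, 2, 1, 0, 2, 1, 1, 1, 1, 0, 0, 0, 0]⟩,
      ⟨462, 9, [0, 0, 1, 1, 1, 1, 0, 1, 1, 1, 0, 1, 1, 0, 0]⟩,
      ⟨940, 9, [0, 0, 1, 1, 1, 1, 0, 1, 1, 2, 1, 0, 1, 0, 0]⟩]
  | 7 => [
      ⟨15, 6, [1, 1, 1, 1, 1, 1, 0, 0, 0, 0, 0, 0, 0, 0, 0, 0, 0, 0, 0, 0, 0]⟩,
      ⟨137, 6, [1, 0, 1, 1, 1, 1, 1, 0, 0, 0, 0, 0, 0, 0, 0, 0, 0, 0, 0, 0, 0]⟩,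
      ⟨156, 6, [1, 0, 0, 1, 1, 1, 1, 1, 0, 0, 0, 0, 0, 0, 0, 0, 0, 0, 0, 0, 0]⟩,
      ⟨852, 6, [0, 1, 0, 1, 1, 1, 1, 1, 0, 0, 0, 0, 0, 0, 0, 0, 0, 0, 0, 0, 0]⟩,
      ⟨483, 6, [0, 1, 0, 0, 1, 1, 1, 1, 1, 0, 0, 0, 0, 0, 0, 0, 0, 0, 0, 0, 0]⟩,
      ⟨565, 6, [1, 1, 0, 0, 1, 1, 0, 0, 1, 0, 0, 1, 0, 0, 0, 0, 0, 0, 0, 0, 0]⟩,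
      ⟨1069, 6, [1, 0, 0, 0, 1, 1, 1, 0, 1, 0, 0, 1, 0, 0, 0, 0, 0, 0, 0, 0, 0]⟩,
      ⟨5052, 6, [0, 0, 1, 0, 1, 1, 1, 0, 1, 0, 0, 1, 0, 0, 0, 0, 0, 0, 0, 0, 0]⟩,
      ⟨5853, 6, [0, 1, 0, 1, 0, 1, 0, 0, 1, 1, 0, 1, 0, 0, 0, 0, 0, 0, 0, 0, 0]⟩,
      ⟨1155, 6, [0, 0, 1, 0, 0, 1, 0, 1, 0, 1, 0, 1, 1, 0, 0, 0, 0, 0, 0, 0, 0]⟩,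
      ⟨13923, 6, [0, 0, 0, 1, 0, 1, 0, 1, 0, 1, 0, 1, 1, 0, 0, 0, 0, 0, 0, 0, 0]⟩,
      ⟨576, 7, [0, 1, 1, 0, 1, 1, 1, 1, 1, 0, 0, 0, 0, 0, 0, 0, 0, 0, 0, 0, 0]⟩,
      ⟨577, 7, [1, 1, 0, 0, 1, 1, 1, 0, 1, 0, 0, 1, 0, 0, 0, 0, 0, 0, 0, 0, 0]⟩,
      ⟨6451, 7, [0, 0, 1, 1, 1, 1, 1, 0, 1, 0, 0, 1, 0, 0, 0, 0, 0, 0, 0, 0, 0]⟩,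
      ⟨3144, 7, [0, 1, 0, 1, 0, 1, 1, 0, 1, 1, 0, 1, 0, 0, 0, 0, 0, 0, 0, 0, 0]⟩,
      ⟨14703, 7, [0, 0, 1, 1, 0, 1, 1, 0, 1, 1, 0, 1, 0, 0, 0, 0, 0, 0, 0, 0, 0]⟩,
      ⟨3153, 7, [1, 0, 1, 0, 0, 1, 0, 1, 0, 1, 0, 1, 1, 0, 0, 0, 0, 0, 0, 0, 0]⟩,
      ⟨14724, 7, [1, 0, 0, 1, 0, 1, 0, 1, 0, 1, 0, 1, 1, 0, 0, 0, 0, 0, 0, 0, 0]⟩,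
      ⟨71046, 7, [0, 0, 0, 1, 1, 1, 0, 1, 0, 1, 0, 1, 1, 0, 0, 0, 0, 0, 0, 0, 0]⟩,
      ⟨35091, 7, [0, 0, 1, 0, 1, 1, 1, 0, 0, 0, 1, 0, 0, 1, 0, 1, 0, 0, 0, 0, 0]⟩,
      ⟨48207, 7, [0, 0, 0, 0, 1, 1, 0, 0, 1, 0, 1, 1, 0, 1, 0, 1, 0, 0, 0, 0, 0]⟩,
      ⟨239, 7, [0, 2, 1, 1, 1, 1, 1, 1, 0, 0, 0, 0, 0, 0, 0, 0, 0, 0, 0, 0, 0]⟩,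
      ⟨896, 7, [0, 2, 1, 0, 1, 1, 1, 1, 1, 0, 0, 0, 0, 0, 0, 0, 0, 0, 0, 0, 0]⟩,
      ⟨577, 7, [2, 1, 0, 0, 1, 1, 1, 0, 1, 0, 0, 1, 0, 0, 0, 0, 0, 0, 0, 0, 0]⟩,
      ⟨2695, 7, [2, 0, 1, 0, 1, 1, 1, 0, 1, 0, 0, 1, 0, 0, 0, 0, 0, 0, 0, 0, 0]⟩,
      ⟨1597, 7, [0, 1, 0, 2, 1, 1, 0, 0, 1, 1, 0, 1, 0, 0, 0, 0, 0, 0, 0, 0, 0]⟩,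
      ⟨3132, 7, [0, 2, 0, 1, 0, 1, 1, 0, 1, 1, 0, 1, 0, 0, 0, 0, 0, 0, 0, 0, 0]⟩,
      ⟨4872, 7, [0, 0, 0, 2, 1, 1, 1, 0, 1, 1, 0, 1, 0, 0, 0, 0, 0, 0, 0, 0, 0]⟩,
      ⟨1360, 7, [1, 0, 0, 0, 1, 1, 0, 2, 1, 0, 0, 1, 1, 0, 0, 0, 0, 0, 0, 0, 0]⟩,
      ⟨3153, 7, [2, 0, 1, 0, 0, 1, 0, 1, 0, 1, 0, 1, 1, 0, 0, 0, 0, 0, 0, 0, 0]⟩,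
      ⟨14724, 7, [2, 0, 0, 1, 0, 1, 0, 1, 0, 1, 0, 1, 1, 0, 0, 0, 0, 0, 0, 0, 0]⟩,
      ⟨14679, 7, [0, 0, 2, 1, 0, 1, 0, 1, 0, 1, 0, 1, 1, 0, 0, 0, 0, 0, 0, 0, 0]⟩,
      ⟨35418, 7, [0, 0, 0, 2, 1, 1, 0, 1, 0, 1, 0, 1, 1, 0, 0, 0, 0, 0, 0, 0, 0]⟩,
      ⟨7440, 7, [0, 0, 0, 0, 1, 1, 0, 2, 1, 1, 0, 1, 1, 0, 0, 0, 0, 0, 0, 0, 0]⟩,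
      ⟨48207, 7, [0, 0, 0, 0, 2, 1, 0, 0, 1, 0, 1, 1, 0, 1, 0, 1, 0, 0, 0, 0, 0]⟩,
      ⟨71244, 8, [0, 0, 0, 1, 1, 1, 0, 1, 0, 1, 1, 1, 1, 0, 0, 0, 0, 0, 0, 0, 0]⟩,
      ⟨57072, 8, [0, 0, 0, 1, 1, 1, 1, 1, 0, 0, 1, 0, 0, 1, 0, 1, 0, 0, 0, 0, 0]⟩,
      ⟨71400, 8, [0, 1, 1, 0, 0, 1, 0, 0, 1, 1, 0, 1, 0, 1, 0, 1, 0, 0, 0, 0, 0]⟩,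
      ⟨357, 8, [0, 2, 1, 1, 0, 1, 1, 1, 1, 1, 0, 0, 0, 0, 0, 0, 0, 0, 0, 0, 0]⟩,
      ⟨7818, 8, [0, 0, 1, 2, 1, 1, 1, 0, 1, 1, 0, 1, 0, 0, 0, 0, 0, 0, 0, 0, 0]⟩,
      ⟨2162, 8, [1, 0, 1, 0, 1, 1, 0, 2, 1, 0, 0, 1, 1, 0, 0, 0, 0, 0, 0, 0, 0]⟩,
      ⟨2062, 8, [2, 1, 1, 0, 0, 1, 0, 1, 0, 1, 0, 1, 1, 0, 0, 0, 0, 0, 0, 0, 0]⟩,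
      ⟨29340, 8, [1, 0, 2, 1, 0, 1, 0, 1, 0, 1, 0, 1, 1, 0, 0, 0, 0, 0, 0, 0, 0]⟩,
      ⟨15600, 8, [0, 1, 0, 0, 1, 1, 0, 2, 1, 1, 0, 1, 1, 0, 0, 0, 0, 0, 0, 0, 0]⟩,
      ⟨37260, 8, [0, 0, 0, 1, 2, 1, 0, 1, 0, 1, 1, 1, 1, 0, 0, 0, 0, 0, 0, 0, 0]⟩,
      ⟨2631, 8, [0, 0, 1, 1, 0, 1, 0, 1, 1, 1, 0, 2, 1, 0, 0, 0, 0, 0, 0, 0, 0]⟩,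
      ⟨23634, 8, [0, 2, 0, 1, 0, 1, 1, 1, 0, 0, 1, 0, 0, 1, 0, 1, 0, 0, 0, 0, 0]⟩,
      ⟨35589, 8, [0, 2, 1, 0, 0, 1, 0, 0, 1, 1, 0, 1, 0, 1, 0, 1, 0, 0, 0, 0, 0]⟩,
      ⟨11802, 8, [0, 0, 0, 0, 1, 1, 2, 0, 1, 1, 0, 1, 0, 1, 0, 1, 0, 0, 0, 0, 0]⟩,
      ⟨71400, 8, [1, 0, 0, 1, 0, 1, 0, 0, 2, 1, 0, 1, 0, 1, 0, 1, 0, 0, 0, 0, 0]⟩,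
      ⟨338868, 8, [0, 0, 2, 0, 1, 1, 0, 0, 1, 0, 1, 1, 0, 1, 0, 1, 0, 0, 0, 0, 0]⟩,
      ⟨1030, 8, [0, 0, 2, 1, 2, 1, 0, 0, 0, 1, 1, 1, 1, 0, 0, 0, 0, 0, 0, 0, 0]⟩,
      ⟨10084, 9, [0, 0, 1, 0, 1, 1, 0, 1, 1, 0, 1, 1, 1, 1, 0, 0, 0, 0, 0, 0, 0]⟩,
      ⟨59454, 9, [0, 0, 0, 1, 1, 1, 1, 1, 0, 0, 1, 1, 0, 1, 0, 1, 0, 0, 0, 0, 0]⟩,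
      ⟨19872, 9, [0, 0, 2, 0, 1, 1, 0, 1, 1, 0, 1, 1, 1, 1, 0, 0, 0, 0, 0, 0, 0]⟩,
      ⟨5016, 9, [0, 1, 1, 1, 0, 1, 0, 1, 1, 1, 0, 2, 1, 0, 0, 0, 0, 0, 0, 0, 0]⟩,
      ⟨59454, 9, [0, 0, 0, 1, 1, 1, 2, 1, 0, 0, 1, 1, 0, 1, 0, 1, 0, 0, 0, 0, 0]⟩,
      ⟨170580, 9, [0, 0, 0, 1, 1, 2, 0, 1, 1, 0, 1, 1, 0, 1, 0, 1, 0, 0, 0, 0, 0]⟩,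
      ⟨173784, 9, [0, 0, 0, 1, 1, 1, 1, 0, 2, 0, 1, 1, 0, 1, 0, 1, 0, 0, 0, 0, 0]⟩,
      ⟨9669, 9, [0, 0, 0, 1, 1, 2, 0, 0, 1, 1, 1, 1, 0, 1, 0, 1, 0, 0, 0, 0, 0]⟩,
      ⟨4107, 9, [0, 0, 1, 2, 1, 1, 0, 2, 1, 1, 0, 1, 1, 0, 0, 0, 0, 0, 0, 0, 0]⟩,
      ⟨2136, 9, [0, 0, 2, 1, 2, 1, 1, 0, 0, 1, 1, 1, 1, 0, 0, 0, 0, 0, 0, 0, 0]⟩,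
      ⟨15288, 10, [0, 0, 1, 1, 1, 1, 1, 0, 1, 1, 0, 1, 0, 1, 0, 1, 0, 0, 0, 0, 0]⟩,
      ⟨88380, 10, [0, 0, 0, 1, 1, 1, 0, 1, 0, 1, 1, 1, 1, 1, 0, 1, 0, 0, 0, 0, 0]⟩,
      ⟨58908, 10, [0, 0, 1, 0, 1, 1, 1, 0, 1, 0, 1, 0, 1, 1, 0, 1, 1, 0, 0, 0, 0]⟩,
      ⟨8214, 10, [0, 0, 1, 1, 1, 1, 1, 0, 1, 1, 0, 2, 1, 0, 0, 1, 0, 0, 0, 0, 0]⟩,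
      ⟨24702, 10, [0, 1, 1, 0, 2, 1, 1, 0, 1, 1, 0, 1, 0, 1, 0, 1, 0, 0, 0, 0, 0]⟩,
      ⟨114528, 10, [0, 1, 0, 1, 1, 2, 0, 0, 1, 1, 1, 1, 0, 1, 0, 1, 0, 0, 0, 0, 0]⟩,
      ⟨175464, 10, [0, 0, 1, 0, 1, 1, 1, 0, 1, 0, 1, 0, 2, 1, 0, 1, 1, 0, 0, 0, 0]⟩,
      ⟨58908, 10, [0, 0, 0, 1, 1, 2, 0, 1, 0, 1, 1, 2, 1, 1, 0, 1, 0, 0, 0, 0, 0]⟩,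
      ⟨38388, 10, [0, 0, 1, 1, 0, 2, 1, 0, 1, 0, 1, 0, 2, 1, 0, 1, 1, 0, 0, 0, 0]⟩,
      ⟨16745, 11, [0, 0, 1, 2, 1, 1, 1, 0, 0, 1, 1, 0, 1, 0, 1, 1, 1, 0, 0, 0, 0]⟩,
      ⟨16745, 11, [0, 0, 0, 1, 2, 1, 2, 1, 0, 1, 1, 0, 1, 0, 1, 1, 1, 0, 0, 0, 0]⟩]
  | _ => []

/-!
Over `𝔽_3` a weighted graph `Γ` on `n` vertices is the same thing as a Lagrangian subspace
`{(ξ, Γ ξ)}` of `𝔽_3 ^ (2 n)` together with a frame that is transversal to it: a basis of the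
symplectic plane at each vertex. A local scaling or a local complementation only changes the frame
(`WeightedGraph.CliffordEquiv.of_localMove`), so an orbit is contained in a Clifford class, that is,
in the set of the graphs of one Lagrangian subspace with respect to all frames, up to relabelling.
Since the diagonal of `Γ` is zero, the graph is determined by the first halves of the bases
(`WeightedGraph.LocalClifford.unique`), and so the graphs of a Clifford class are indexed by one of
the eight nonzero covectors at each vertex.

The orbits are never enumerated. For a list of graphs three inequalities are proved which can only
hold together if they are equalities (`TightCover`):

* Completeness: the list meets all the orbits. This goes by induction on the number of vertices
  (`exists_reach_succ`). An extension of a graph by one more vertex is given by the vector of new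
  weights; every walk of local operations that leads from the old graph to itself, up to relabelling
  and signs (a loop), permutes these vectors, and the loops of a certificate carry all the vectors to
  a few remaining ones, whose extensions are led to the list by explicit walks.
* Upper bounds for the sizes of the Clifford classes of the graphs in the list
  (`ncard_cliffordClass_le_popcount`). Frames that differ by a symmetry of the Lagrangian subspace
  give isomorphic graphs; so the size is at most the number of transversal frames that do not come
  after their images under some given symmetries.
* The sum of these bounds is at most the number of all isomorphism classes, which is bounded from
  below by the orbit-counting lemma for the relabellings (`le_card_graphClass`).

Consequently the bounds are the exact sizes, different graphs in the list lie in different Clifford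
classes, and the orbits are exactly the Clifford classes of connected graphs.

The minimality of a representative (`le_key_of_isKeyMinimal`) uses that the entry of the graph of a
frame at two vertices vanishes only if some point at the first one together with all the points at
the second one gives frames that are not transversal. This bounds the number of edges for all frames
at once; the few graphs that attain the bound are compared with the representative by a search
through the orders of their vertices and the signs of their weights.

The certificates are verified by evaluation in the kernel. Sets of frames are represented by the
binary digits of natural numbers, so that an operation on sets is a single operation on numbers. The
functions that are evaluated are written with recursors and with the basic operations on `ℕ`,
because these are reduced directly.
-/

/-! ### Local Clifford equivalence of weighted graphs -/

namespace WeightedGraph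

section LocalClifford

variable {n : ℕ}

open Matrix

/-- The graph `G` with its vertices renamed along `σ`. -/
def relabel {d : ℕ} (G : WeightedGraph d n) (σ : Equiv.Perm (Fin n)) : WeightedGraph d n where
  Γ u v := G.Γ (σ u) (σ v)
  symm _ _ := G.symm _ _
  loopless _ := G.loopless _

theorem relabel_relabel {d : ℕ} (G : WeightedGraph d n) (σ τ : Equiv.Perm (Fin n)) :
    (G.relabel σ).relabel τ = G.relabel (σ * τ) := rfl

theorem relabel_one {d : ℕ} (G : WeightedGraph d n) : G.relabel 1 = G := rfl

theorem isomorphic_iff {d : ℕ} {G H : WeightedGraph d n} :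
    G.Isomorphic H ↔ ∃ σ, G = H.relabel σ := by
  constructor
  · rintro ⟨σ, h⟩
    exact ⟨σ, by ext u v; exact (h u v).symm⟩
  · rintro ⟨σ, rfl⟩
    exact ⟨σ, fun u v => rfl⟩

theorem isomorphic_relabel {d : ℕ} (G : WeightedGraph d n) (σ : Equiv.Perm (Fin n)) :
    (G.relabel σ).Isomorphic G := isomorphic_iff.2 ⟨σ, rfl⟩

/-- The local symplectic maps with the blocks `[a v, b v; c v, d v]` of determinant one carry the
Lagrangian subspace `{(ξ, Γ ξ)}` of `G` onto that of `H`. -/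
structure LocalClifford (a b c d : Fin n → ZMod 3) (G H : WeightedGraph 3 n) : Prop where
  det : ∀ v, a v * d v - b v * c v = 1
  map : H.Γ * (diagonal a + diagonal b * G.Γ) = diagonal c + diagonal d * G.Γ

namespace LocalClifford

variable {a b c d a' b' c' d' : Fin n → ZMod 3} {G H K : WeightedGraph 3 n}

/-- The matrix equation of `LocalClifford`, entry by entry. -/
theorem map_iff : H.Γ * (diagonal a + diagonal b * G.Γ) = diagonal c + diagonal d * G.Γ ↔
    ∀ u v, H.Γ u v * a v + ∑ k, H.Γ u k * (b k * G.Γ k v) =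
      (if u = v then c u else 0) + d u * G.Γ u v := by
  rw [← Matrix.ext_iff]
  refine forall_congr' fun u => forall_congr' fun v => ?_
  rw [Matrix.mul_add, Matrix.add_apply, Matrix.add_apply, Matrix.mul_diagonal,
    Matrix.diagonal_mul, Matrix.diagonal_apply, Matrix.mul_apply]
  simp only [Matrix.diagonal_mul]

theorem refl (G : WeightedGraph 3 n) :
    LocalClifford (fun _ => 1) (fun _ => 0) (fun _ => 0) (fun _ => 1) G G := by
  refine ⟨by simp, map_iff.2 fun u v => ?_⟩
  simp

/-- An explicit inverse of the matrix `A + B Γ` of a local Clifford map. -/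
theorem inv_mul (h : LocalClifford a b c d G H) :
    (diagonal d - diagonal b * H.Γ) * (diagonal a + diagonal b * G.Γ) = 1 := by
  rw [Matrix.sub_mul, Matrix.mul_assoc, h.map, Matrix.mul_add, Matrix.mul_add,
    ← Matrix.mul_assoc, ← Matrix.mul_assoc]
  simp only [Matrix.diagonal_mul_diagonal]
  have h1 : (fun i => b i * d i) = fun i => d i * b i := by ext i; ring
  rw [h1]
  have h2 : diagonal (fun i => d i * a i) - diagonal (fun i => b i * c i) =
      (1 : Matrix (Fin n) (Fin n) (ZMod 3)) := by
    rw [Matrix.diagonal_sub, ← Matrix.diagonal_one]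
    congr 1
    ext i
    rw [mul_comm (d i), h.det]
  rw [add_sub_add_right_eq_sub, h2]

theorem mul_inv (h : LocalClifford a b c d G H) :
    (diagonal a + diagonal b * G.Γ) * (diagonal d - diagonal b * H.Γ) = 1 :=
  mul_eq_one_comm.1 h.inv_mul

theorem trans (h : LocalClifford a b c d G H) (k : LocalClifford a' b' c' d' H K) :
    LocalClifford (fun v => a' v * a v + b' v * c v) (fun v => a' v * b v + b' v * d v)
      (fun v => c' v * a v + d' v * c v) (fun v => c' v * b v + d' v * d v) G K := by
  refine ⟨fun v => ?_, ?_⟩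
  · linear_combination (a' v * d' v - b' v * c' v) * h.det v + k.det v
  · have e (x y : Fin n → ZMod 3) :
        diagonal (fun v => x v * a v + y v * c v) + diagonal (fun v => x v * b v + y v * d v) * G.Γ
          = diagonal x * (diagonal a + diagonal b * G.Γ)
            + diagonal y * (diagonal c + diagonal d * G.Γ) := by
      simp only [← Matrix.diagonal_add, ← Matrix.diagonal_mul_diagonal]
      noncomm_ring
    rw [e, e, ← h.map, ← Matrix.mul_assoc, ← Matrix.mul_assoc, ← Matrix.add_mul, ← Matrix.add_mul,
      ← Matrix.mul_assoc, k.map]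

theorem symm (h : LocalClifford a b c d G H) :
    LocalClifford d (fun v => -b v) (fun v => -c v) a H G := by
  refine ⟨fun v => by linear_combination h.det v, ?_⟩
  have e : diagonal d + diagonal (fun v => -b v) * H.Γ = diagonal d - diagonal b * H.Γ := by
    rw [show diagonal (fun v => -b v) = -diagonal b from (Matrix.diagonal_neg b).symm]
    noncomm_ring
  have e' : diagonal (fun v => -c v) + diagonal a * H.Γ = diagonal a * H.Γ - diagonal c := by
    rw [show diagonal (fun v => -c v) = -diagonal c from (Matrix.diagonal_neg c).symm]
    noncomm_ring
  have h2 : (diagonal a * H.Γ - diagonal c) * (diagonal a + diagonal b * G.Γ) = G.Γ := by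
    rw [Matrix.sub_mul, Matrix.mul_assoc, h.map, Matrix.mul_add, Matrix.mul_add,
      ← Matrix.mul_assoc, ← Matrix.mul_assoc]
    simp only [Matrix.diagonal_mul_diagonal]
    have h1 : (fun i => c i * a i) = fun i => a i * c i := by ext i; ring
    rw [h1, add_sub_add_left_eq_sub, ← Matrix.sub_mul, Matrix.diagonal_sub]
    have h3 : (fun i => a i * d i - c i * b i) = fun _ => 1 := by
      ext i; linear_combination h.det i
    rw [h3, Matrix.diagonal_one, Matrix.one_mul]
  rw [e, e']
  calc G.Γ * (diagonal d - diagonal b * H.Γ)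
      = (diagonal a * H.Γ - diagonal c) * ((diagonal a + diagonal b * G.Γ) *
          (diagonal d - diagonal b * H.Γ)) := by rw [← Matrix.mul_assoc, h2]
    _ = _ := by rw [h.mul_inv, Matrix.mul_one]

/-- A zero diagonal leaves no freedom: the frame `(a, b)` determines the graph. -/
theorem unique (h : LocalClifford a b c d G H) (k : LocalClifford a b c' d' G K) : H = K := by
  have key : (K.Γ - H.Γ) =
      diagonal (fun v => d v * (c' v - c v) - c v * (d' v - d v)) := by
    have h1 : (K.Γ - H.Γ) * (diagonal a + diagonal b * G.Γ) =
        diagonal (fun v => d v * (c' v - c v) - c v * (d' v - d v)) *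
          (diagonal a + diagonal b * G.Γ) := by
      rw [Matrix.sub_mul, h.map, k.map, Matrix.mul_add, ← Matrix.mul_assoc]
      simp only [Matrix.diagonal_mul_diagonal]
      have e1 : (fun v => (d v * (c' v - c v) - c v * (d' v - d v)) * a v) =
          fun v => c' v - c v := by
        ext v; linear_combination (c' v) * h.det v - c v * k.det v
      have e2 : (fun v => (d v * (c' v - c v) - c v * (d' v - d v)) * b v) =
          fun v => d' v - d v := by
        ext v; linear_combination (d' v) * h.det v - d v * k.det v
      rw [e1, e2, ← Matrix.diagonal_sub, ← Matrix.diagonal_sub]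
      noncomm_ring
    calc K.Γ - H.Γ = (K.Γ - H.Γ) * ((diagonal a + diagonal b * G.Γ) *
          (diagonal d - diagonal b * H.Γ)) := by rw [h.mul_inv, Matrix.mul_one]
      _ = _ := by rw [← Matrix.mul_assoc, h1, Matrix.mul_assoc, h.mul_inv, Matrix.mul_one]
  ext u v
  by_cases huv : u = v
  · subst huv; rw [H.loopless, K.loopless]
  · have := congrFun (congrFun key u) v
    rw [Matrix.sub_apply, Matrix.diagonal_apply_ne _ huv, sub_eq_zero] at this
    exact this.symm

theorem relabel (h : LocalClifford a b c d G H) (σ : Equiv.Perm (Fin n)) :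
    LocalClifford (a ∘ σ) (b ∘ σ) (c ∘ σ) (d ∘ σ) (G.relabel σ) (H.relabel σ) := by
  refine ⟨fun v => h.det _, map_iff.2 fun u v => ?_⟩
  have := map_iff.1 h.map (σ u) (σ v)
  simp only [EmbeddingLike.apply_eq_iff_eq] at this
  rw [← Equiv.sum_comp σ] at this
  exact this

/-- Multiplying the frame at the vertices with `ε v = -1` by `-1` changes the signs of the edges
accordingly. -/
theorem sign (h : LocalClifford a b c d G H) {ε : Fin n → ZMod 3} (hε : ∀ v, ε v * ε v = 1)
    (hK : ∀ u v, K.Γ u v = ε u * ε v * H.Γ u v) :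
    LocalClifford (fun v => ε v * a v) (fun v => ε v * b v) (fun v => ε v * c v)
      (fun v => ε v * d v) G K := by
  refine ⟨fun v => by linear_combination (ε v * ε v) * h.det v + hε v, map_iff.2 fun u v => ?_⟩
  have := map_iff.1 h.map u v
  have e : ∀ k, K.Γ u k * (ε k * b k * G.Γ k v) = ε u * (H.Γ u k * (b k * G.Γ k v)) := fun k => by
    rw [hK]; linear_combination (ε u * H.Γ u k * b k * G.Γ k v) * hε k
  rw [Finset.sum_congr rfl fun k _ => e k, ← Finset.mul_sum, hK]
  have h2 : ε u * ε v * H.Γ u v * (ε v * a v) = ε u * (H.Γ u v * a v) := by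
    linear_combination (ε u * H.Γ u v * a v) * hε v
  rw [h2, ← mul_add, this]
  split_ifs <;> ring

theorem neg (h : LocalClifford a b c d G H) :
    LocalClifford (fun v => -a v) (fun v => -b v) (fun v => -c v) (fun v => -d v) G H := by
  have := h.sign (K := H) (ε := fun _ => -1) (by simp) (by simp)
  simpa using this

end LocalClifford

/-- `H` is, up to relabelling, the image of `G` under local symplectic maps. -/
def CliffordEquiv (G H : WeightedGraph 3 n) : Prop :=
  ∃ σ a b c d, LocalClifford a b c d G (H.relabel σ)

namespace CliffordEquiv

variable {G H K : WeightedGraph 3 n}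

theorem refl (G : WeightedGraph 3 n) : CliffordEquiv G G := ⟨1, _, _, _, _, LocalClifford.refl G⟩

theorem symm : CliffordEquiv G H → CliffordEquiv H G := by
  rintro ⟨σ, a, b, c, d, h⟩
  have := h.symm.relabel σ⁻¹
  rw [relabel_relabel, mul_inv_cancel, relabel_one] at this
  exact ⟨σ⁻¹, _, _, _, _, this⟩

theorem trans : CliffordEquiv G H → CliffordEquiv H K → CliffordEquiv G K := by
  rintro ⟨σ, a, b, c, d, h⟩ ⟨τ, a', b', c', d', k⟩
  have := h.trans (k.relabel σ)
  rw [relabel_relabel] at this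
  exact ⟨_, _, _, _, _, this⟩

theorem of_isomorphic (h : G.Isomorphic H) : CliffordEquiv G H := by
  obtain ⟨σ, rfl⟩ := isomorphic_iff.1 h
  exact ⟨σ, _, _, _, _, LocalClifford.refl _⟩

theorem of_localMove (h : G.LocalMove H) : CliffordEquiv G H := by
  rcases h with ⟨γ, hγ, w, rfl⟩ | ⟨γ, w, rfl⟩
  · have h2 : γ * γ = 1 := by revert γ; decide
    refine ⟨1, _, _, _, _, (LocalClifford.refl G).sign (ε := fun v => if v = w then γ else 1)
      (fun v => ?_) fun u v => ?_⟩
    · split_ifs <;> simp [h2]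
    · simp only [relabel_one, localScaling]
      by_cases hu : u = w <;> by_cases hv : v = w <;> simp [hu, hv, G.loopless]
  · refine ⟨1, fun _ => 1, fun v => if v = w then -γ else 0, fun u => -γ * (G.Γ u w * G.Γ u w),
      fun _ => 1, fun v => ?_, LocalClifford.map_iff.2 fun u v => ?_⟩
    · split_ifs with h
      · subst h; simp [G.loopless]
      · simp
    · rw [Finset.sum_eq_single w (fun k _ hk => by simp [hk]) (by simp), relabel_one]
      simp only [localComplementation, if_true]
      by_cases huv : u = v
      · subst huv
        by_cases huw : u = w
        · subst huw; simp [G.loopless]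
        · simp only [ne_eq, not_true_eq_false, if_false, huw, not_false_eq_true, if_true,
            G.loopless, G.symm w u]
          ring
      · by_cases huw : u = w
        · subst huw; simp [huv, G.loopless]
        · simp only [ne_eq, huv, huw, not_false_eq_true, if_true, if_false, G.loopless,
            G.symm w v]
          ring

end CliffordEquiv

end LocalClifford

end WeightedGraph

/-! ### Orbits and the counting principle -/

namespace WeightedGraph

variable {n : ℕ}

instance : Finite (WeightedGraph 3 n) :=
  Finite.of_injective WeightedGraph.Γ fun _ _ h => WeightedGraph.ext h

theorem LocalMove.symm {G H : WeightedGraph 3 n} (h : G.LocalMove H) : H.LocalMove G := by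
  rcases h with ⟨γ, hγ, w, rfl⟩ | ⟨γ, w, rfl⟩
  · have h2 : γ * γ = 1 := by revert γ; decide
    refine Or.inl ⟨γ, hγ, w, ?_⟩
    ext u v
    simp only [localScaling]
    split_ifs
    · rw [← mul_assoc, h2, one_mul]
    · rfl
  · refine Or.inr ⟨-γ, w, ?_⟩
    ext u v
    simp only [localComplementation, G.loopless]
    by_cases huv : u = v
    · simp [huv]
    · by_cases huw : u = w <;> by_cases hvw : v = w <;> simp [huv, huw, hvw, G.loopless]

theorem LocalMove.connected {G H : WeightedGraph 3 n} (h : G.LocalMove H)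
    (hG : G.support.Connected) : H.support.Connected := by
  have key : ∀ u v, G.support.Adj u v → H.support.Reachable u v := by
    rcases h with ⟨γ, hγ, w, rfl⟩ | ⟨γ, w, rfl⟩
    · intro u v huv
      refine SimpleGraph.Adj.reachable ?_
      change (if u = w ∨ v = w then γ * G.Γ u v else G.Γ u v) ≠ 0
      split_ifs
      · exact mul_ne_zero hγ huv
      · exact huv
    · have hw : ∀ u, G.Γ u w ≠ 0 → (G.localComplementation γ w).support.Adj u w := by
        intro u hu
        change (if u ≠ w then G.Γ u w + γ * G.Γ u w * G.Γ w w else G.Γ u w) ≠ 0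
        simpa [G.loopless w] using hu
      intro u v huv
      by_cases hu : G.Γ u w = 0
      · refine SimpleGraph.Adj.reachable ?_
        change (if u ≠ v then G.Γ u v + γ * G.Γ u w * G.Γ v w else G.Γ u v) ≠ 0
        simpa [hu] using show G.Γ u v ≠ 0 from huv
      by_cases hv : G.Γ v w = 0
      · refine SimpleGraph.Adj.reachable ?_
        change (if u ≠ v then G.Γ u v + γ * G.Γ u w * G.Γ v w else G.Γ u v) ≠ 0
        simpa [hv] using show G.Γ u v ≠ 0 from huv
      · exact (hw u hu).reachable.trans (hw v hv).reachable.symm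
  have := hG.nonempty
  refine ⟨fun u v => ?_⟩
  obtain ⟨p⟩ := hG.preconnected u v
  induction p with
  | nil => exact SimpleGraph.Reachable.refl _
  | cons h _ ih => exact (key _ _ h).trans ih

theorem Isomorphic.connected {G H : WeightedGraph 3 n} (h : G.Isomorphic H)
    (hG : G.support.Connected) : H.support.Connected := by
  obtain ⟨σ, h⟩ := h
  let e : G.support ≃g H.support := ⟨σ, fun {u v} => by
    change H.Γ (σ u) (σ v) ≠ 0 ↔ G.Γ u v ≠ 0
    rw [h]⟩
  exact e.connected_iff.1 hG

/-- Reachability by local scalings, local complementations and relabellings. -/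
def Reach : WeightedGraph 3 n → WeightedGraph 3 n → Prop :=
  Relation.ReflTransGen fun G H => G.LocalMove H ∨ G.Isomorphic H

namespace Reach

variable {G H K : WeightedGraph 3 n}

theorem refl (G : WeightedGraph 3 n) : Reach G G := Relation.ReflTransGen.refl

theorem trans : Reach G H → Reach H K → Reach G K := Relation.ReflTransGen.trans

theorem of_localMove (h : G.LocalMove H) : Reach G H := Relation.ReflTransGen.single (Or.inl h)

theorem of_isomorphic (h : G.Isomorphic H) : Reach G H := Relation.ReflTransGen.single (Or.inr h)

theorem symm (h : Reach G H) : Reach H G := by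
  induction h with
  | refl => exact refl _
  | tail _ h ih =>
    refine Reach.trans ?_ ih
    exact h.elim (fun h => of_localMove h.symm)
      fun h => of_isomorphic (isomorphic_equivalence.symm h)

theorem cliffordEquiv (h : Reach G H) : CliffordEquiv G H := by
  induction h with
  | refl => exact CliffordEquiv.refl _
  | tail _ h ih =>
    exact ih.trans (h.elim CliffordEquiv.of_localMove CliffordEquiv.of_isomorphic)

theorem connected (h : Reach G H) (hG : G.support.Connected) : H.support.Connected := by
  induction h with
  | refl => exact hG
  | tail _ h ih => exact h.elim (·.connected ih) (·.connected ih)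

end Reach

end WeightedGraph

section Orbits

open WeightedGraph

variable {n : ℕ}

theorem orbitOf_eq_of_reach {G H : WeightedGraph 3 n} (h : Reach G H)
    (hG : G.support.Connected) (hH : H.support.Connected) :
    orbitOf (n := n) ⟨G, hG⟩ = orbitOf ⟨H, hH⟩ := by
  induction h with
  | refl => rfl
  | @tail K L hK h ih =>
    have hKc := Reach.connected hK hG
    rw [ih hKc]
    rcases h with h | h
    · refine SimpleGraph.ConnectedComponent.sound ?_
      by_cases e : Quotient.mk (relabelSetoid n) ⟨K, hKc⟩ = Quotient.mk (relabelSetoid n) ⟨L, hH⟩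
      · rw [e]
      · exact SimpleGraph.Adj.reachable
          ((SimpleGraph.fromRel_adj _ _ _).2 ⟨e, Or.inl ⟨_, _, rfl, rfl, h⟩⟩)
    · unfold orbitOf
      rw [Quotient.sound (s := relabelSetoid n) (a := ⟨K, hKc⟩) (b := ⟨L, hH⟩) h]

theorem cliffordEquiv_of_orbitOf_eq {G H : ConnectedGraph n} (h : orbitOf G = orbitOf H) :
    CliffordEquiv G.1 H.1 := by
  obtain ⟨p⟩ := SimpleGraph.ConnectedComponent.exact h
  suffices ∀ x y : UnlabelledGraph n, (orbitAtlas n).Walk x y → ∀ G H : ConnectedGraph n,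
      Quotient.mk (relabelSetoid n) G = x → Quotient.mk (relabelSetoid n) H = y →
      CliffordEquiv G.1 H.1 from this _ _ p _ _ rfl rfl
  intro x y p
  induction p with
  | nil =>
    intro G H hG hH
    exact CliffordEquiv.of_isomorphic (Quotient.exact (hG.trans hH.symm))
  | cons h _ ih =>
    intro G H hG hH
    obtain ⟨-, ⟨A, B, hA, hB, hm⟩ | ⟨A, B, hA, hB, hm⟩⟩ := (SimpleGraph.fromRel_adj _ _ _).1 h
    · exact (CliffordEquiv.of_isomorphic (Quotient.exact (hG.trans hA.symm))).trans
        ((CliffordEquiv.of_localMove hm).trans (ih B H hB hH))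
    · exact (CliffordEquiv.of_isomorphic (Quotient.exact (hG.trans hB.symm))).trans
        ((CliffordEquiv.of_localMove hm.symm).trans (ih A H hA hH))

/-- Equality up to vertex relabelling, for graphs that need not be connected. -/
def isoSetoid (n : ℕ) : Setoid (WeightedGraph 3 n) := ⟨Isomorphic, isomorphic_equivalence⟩

/-- All weighted graphs up to relabelling. -/
abbrev GraphClass (n : ℕ) := Quotient (isoSetoid n)

/-- The isomorphism classes of the graphs that are Clifford equivalent to `G`. -/
def cliffordClass (G : WeightedGraph 3 n) : Set (GraphClass n) :=
  {c | ∃ H, Quotient.mk (isoSetoid n) H = c ∧ CliffordEquiv G H}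

/-- The data from which the orbits are read off: a list of graphs that meets every orbit, together
with upper bounds for the sizes of their Clifford classes whose sum is at most the number of all
isomorphism classes. -/
structure TightCover (n t : ℕ) where
  reps : Fin t → WeightedGraph 3 n
  bound : Fin t → ℕ
  complete : ∀ G, ∃ i, Reach G (reps i)
  ncard_le : ∀ i, (cliffordClass (reps i)).ncard ≤ bound i
  sum_le : ∑ i, bound i ≤ Nat.card (GraphClass n)

namespace TightCover

variable {t : ℕ}

theorem card_le_sum (C : TightCover n t) (s : Finset (Fin t))
    (hs : ∀ i, ∃ j ∈ s, CliffordEquiv (C.reps i) (C.reps j)) :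
    Nat.card (GraphClass n) ≤ ∑ i ∈ s, (cliffordClass (C.reps i)).ncard := by
  rw [← Set.ncard_univ]
  have : (Set.univ : Set (GraphClass n)) ⊆ ⋃ i ∈ s, cliffordClass (C.reps i) := by
    rintro c -
    induction c using Quotient.inductionOn with | _ G => ?_
    obtain ⟨i, hi⟩ := C.complete G
    obtain ⟨j, hj, hij⟩ := hs i
    simp only [Set.mem_iUnion]
    exact ⟨j, hj, G, rfl, (hi.cliffordEquiv.trans hij).symm⟩
  exact (Set.ncard_le_ncard this (Set.toFinite _)).trans (Finset.set_ncard_biUnion_le _ _)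

/-- Since the bounds add up to no more than the number of classes, each of them is attained. -/
theorem ncard_eq (C : TightCover n t) (i : Fin t) :
    (cliffordClass (C.reps i)).ncard = C.bound i := by
  have h := C.card_le_sum Finset.univ fun i => ⟨i, Finset.mem_univ _, CliffordEquiv.refl _⟩
  have h1 : ∑ i, (cliffordClass (C.reps i)).ncard = ∑ i, C.bound i :=
    le_antisymm (Finset.sum_le_sum fun i _ => C.ncard_le i) (C.sum_le.trans h)
  exact (Finset.sum_eq_sum_iff_of_le fun i _ => C.ncard_le i).1 h1 i (Finset.mem_univ _)

/-- For the same reason no two of the graphs are Clifford equivalent. -/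
theorem eq_of_cliffordEquiv (C : TightCover n t) {i j : Fin t}
    (hij : CliffordEquiv (C.reps i) (C.reps j)) : i = j := by
  by_contra hne
  have h := C.card_le_sum (Finset.univ.erase j) fun k => by
    by_cases hk : k = j
    · exact ⟨i, by simpa using hne, hk ▸ hij.symm⟩
    · exact ⟨k, by simpa using hk, CliffordEquiv.refl _⟩
  have h1 : ∑ k ∈ Finset.univ.erase j, (cliffordClass (C.reps k)).ncard + C.bound j =
      ∑ k, C.bound k := by
    rw [Finset.sum_congr rfl fun k _ => C.ncard_eq k]
    exact Finset.sum_erase_add _ _ (Finset.mem_univ j)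
  have h2 : 0 < C.bound j := by
    rw [← C.ncard_eq, Set.ncard_pos (Set.toFinite _)]
    exact ⟨_, C.reps j, rfl, CliffordEquiv.refl _⟩
  have := C.sum_le
  omega

/-- Each Clifford class contains just one graph of the list, and all its graphs are led to it. -/
theorem reach_of_cliffordEquiv (C : TightCover n t) {G H : WeightedGraph 3 n}
    (h : CliffordEquiv G H) : Reach G H := by
  obtain ⟨i, hi⟩ := C.complete G
  obtain ⟨j, hj⟩ := C.complete H
  obtain rfl := C.eq_of_cliffordEquiv
    ((hi.cliffordEquiv.symm.trans h).trans hj.cliffordEquiv)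
  exact hi.trans hj.symm

theorem orbitOf_eq_iff (C : TightCover n t) {G H : ConnectedGraph n} :
    orbitOf G = orbitOf H ↔ CliffordEquiv G.1 H.1 :=
  ⟨cliffordEquiv_of_orbitOf_eq,
    fun h => orbitOf_eq_of_reach (C.reach_of_cliffordEquiv h) G.2 H.2⟩

theorem size_orbitOf (C : TightCover n t) (G : ConnectedGraph n) :
    (orbitOf G).size = (cliffordClass G.1).ncard := by
  let f : UnlabelledGraph n → GraphClass n :=
    Quotient.map (sa := relabelSetoid n) (sb := isoSetoid n) Subtype.val fun _ _ h => h
  have hf : Function.Injective f := by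
    intro x y
    induction x using Quotient.inductionOn
    induction y using Quotient.inductionOn
    exact fun h => Quotient.sound (Quotient.exact (s := isoSetoid n) h)
  unfold Orbit.size
  rw [← Set.ncard_image_of_injective _ hf]
  congr 1
  ext c
  constructor
  · rintro ⟨x, hx, rfl⟩
    induction x using Quotient.inductionOn with | _ H => ?_
    exact ⟨H.1, rfl, (cliffordEquiv_of_orbitOf_eq (G := H) (H := G) hx).symm⟩
  · rintro ⟨H, rfl, h⟩
    have hH := (C.reach_of_cliffordEquiv h).connected G.2
    refine ⟨Quotient.mk _ ⟨H, hH⟩, ?_, rfl⟩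
    exact C.orbitOf_eq_iff (G := ⟨H, hH⟩) |>.2 h.symm

/-- The connected graphs of a tight cover are in bijection with the orbits. -/
theorem bijective_orbitOf (C : TightCover n t) {m : ℕ} (g : Fin m → ConnectedGraph n)
    (e : Fin m → Fin t)
    (he : Function.Injective e) (hg : ∀ k, (g k).1 = C.reps (e k))
    (hc : ∀ i, (C.reps i).support.Connected → ∃ k, e k = i) :
    Function.Bijective fun k => orbitOf (g k) := by
  constructor
  · intro k l h
    refine he (C.eq_of_cliffordEquiv ?_)
    rw [← hg, ← hg]
    exact cliffordEquiv_of_orbitOf_eq h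
  · intro O
    induction O using SimpleGraph.ConnectedComponent.ind with | _ x => ?_
    induction x using Quotient.inductionOn with | _ G => ?_
    obtain ⟨i, hi⟩ := C.complete G.1
    obtain ⟨k, rfl⟩ := hc i (hi.connected G.2)
    refine ⟨k, ?_⟩
    refine C.orbitOf_eq_iff.2 ?_
    rw [hg]
    exact hi.cliffordEquiv.symm

end TightCover

end Orbits

/-! ### Numbering the frames -/

section Frames

variable {n : ℕ}

/-- The digit of `i` at the position `v` in base `b`. -/
def dgt (b i v : ℕ) : ℕ := i / b ^ v % b

theorem dgt_lt {b : ℕ} (hb : 0 < b) (i v : ℕ) : dgt b i v < b := Nat.mod_lt _ hb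

theorem exists_dgt_eq {b : ℕ} (f : Fin n → ℕ) (hf : ∀ v, f v < b) :
    ∃ i < b ^ n, ∀ v : Fin n, dgt b i v = f v := by
  let g : Fin n → Fin b := fun v => ⟨f v, hf v⟩
  refine ⟨finFunctionFinEquiv g, (finFunctionFinEquiv g).2, fun v => ?_⟩
  have := congrArg Fin.val (congrFun (finFunctionFinEquiv.symm_apply_apply g) v)
  simpa [g, dgt, finFunctionFinEquiv] using this

theorem dgt_ext {b : ℕ} (hb : 0 < b) : ∀ {n i j : ℕ}, i < b ^ n → j < b ^ n →
    (∀ v < n, dgt b i v = dgt b j v) → i = j := by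
  intro n
  induction n with
  | zero => intro i j hi hj _; simp at hi hj; omega
  | succ n ih =>
    intro i j hi hj h
    have h0 := h 0 (by omega)
    simp only [dgt, pow_zero, Nat.div_one] at h0
    have h1 : i / b = j / b := by
      refine ih ?_ ?_ fun v hv => ?_
      · rw [Nat.div_lt_iff_lt_mul hb]; rwa [pow_succ] at hi
      · rw [Nat.div_lt_iff_lt_mul hb]; rwa [pow_succ] at hj
      · have := h (v + 1) (by omega)
        simpa only [dgt, pow_succ', Nat.div_div_eq_div_mul] using this
    rw [← Nat.div_add_mod i b, ← Nat.div_add_mod j b, h0, h1]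

/-- An entry of a list, found by recursion on the list. -/
def nth {α : Type} (d : α) (l : List α) : ℕ → α :=
  List.rec (fun _ => d) (fun a _ ih i => Nat.rec a (fun k _ => ih k) i) l

theorem nth_eq_getD {α : Type} (d : α) (l : List α) (i : ℕ) : nth d l i = l.getD i d := by
  induction l generalizing i with
  | nil => rfl
  | cons a l ih =>
    cases i with
    | zero => rfl
    | succ k => exact ih k

/-- First coordinates of the eight nonzero covectors on `𝔽_3 ^ 2`. The covectors with the
indices `q` and `q + 4` are opposite to each other. -/
def vecA (e : ℕ) : ℕ := nth 0 [1, 1, 1, 0, 2, 2, 2, 0] e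

/-- Second coordinates of the eight nonzero covectors. -/
def vecB (e : ℕ) : ℕ := nth 0 [0, 1, 2, 1, 0, 2, 1, 2] e

/-- The index of the covector of the frame `(p, s)` at the vertex `v`: the point of the projective
line is the digit of `p` in base four, the sign is the digit of `s` in base two. -/
def frameIdx (p s v : ℕ) : ℕ := dgt 4 p v + 4 * dgt 2 s v

/-- The first coordinates of the covectors of a frame. -/
def frameA (n p s : ℕ) (v : Fin n) : ZMod 3 := vecA (frameIdx p s v)

/-- The second coordinates of the covectors of a frame. -/
def frameB (n p s : ℕ) (v : Fin n) : ZMod 3 := vecB (frameIdx p s v)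

/-- `H` is the graph of the Lagrangian subspace of `G` with respect to the frame `(p, s)`. -/
def FramedBy (G : WeightedGraph 3 n) (p s : ℕ) (H : WeightedGraph 3 n) : Prop :=
  ∃ c d, WeightedGraph.LocalClifford (frameA n p s) (frameB n p s) c d G H

theorem FramedBy.unique {G H K : WeightedGraph 3 n} {p s : ℕ} (h : FramedBy G p s H)
    (k : FramedBy G p s K) : H = K := by
  obtain ⟨c, d, h⟩ := h
  obtain ⟨c', d', k⟩ := k
  exact h.unique k

theorem exists_idx_of_ne_zero (a b : ZMod 3) (h : ¬(a = 0 ∧ b = 0)) :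
    ∃ q < 4, ∃ s < 2, a = (vecA (q + 4 * s) : ℕ) ∧ b = (vecB (q + 4 * s) : ℕ) := by
  revert a b; decide

theorem exists_framedBy {a b c d : Fin n → ZMod 3} {G H : WeightedGraph 3 n}
    (h : WeightedGraph.LocalClifford a b c d G H) :
    ∃ p < 4 ^ n, ∃ s < 2 ^ n, a = frameA n p s ∧ b = frameB n p s := by
  have h0 (v) : ¬(a v = 0 ∧ b v = 0) := by
    rintro ⟨h1, h2⟩
    have := h.det v
    rw [h1, h2] at this
    simp at this
  choose q hq s hs ha hb using fun v => exists_idx_of_ne_zero (a v) (b v) (h0 v)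
  obtain ⟨p, hp, hp'⟩ := exists_dgt_eq q hq
  obtain ⟨t, ht, ht'⟩ := exists_dgt_eq s hs
  refine ⟨p, hp, t, ht, ?_, ?_⟩
  · ext v; rw [frameA, frameIdx, hp', ht', ha]
  · ext v; rw [frameB, frameIdx, hp', ht', hb]

/-- The frame `(p, s)` leads to `H`, and no earlier frame leads to an isomorphic graph; the frames
are ordered by points, and then by signs. -/
def IsFirstFrame (G : WeightedGraph 3 n) (p s : ℕ) (H : WeightedGraph 3 n) : Prop :=
  FramedBy G p s H ∧ ∀ p' < 4 ^ n, ∀ s' < 2 ^ n, ∀ H', FramedBy G p' s' H' → H'.Isomorphic H →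
    p < p' ∨ p = p' ∧ s ≤ s'

theorem exists_isFirstFrame {G H : WeightedGraph 3 n} (h : WeightedGraph.CliffordEquiv G H) :
    ∃ p < 4 ^ n, ∃ s < 2 ^ n, ∃ H', IsFirstFrame G p s H' ∧ H'.Isomorphic H := by
  classical
  let Q : ℕ → Prop := fun m => ∃ p < 4 ^ n, ∃ s < 2 ^ n, ∃ H', FramedBy G p s H' ∧
    H'.Isomorphic H ∧ m = p * 2 ^ n + s
  have hQ : ∃ m, Q m := by
    obtain ⟨σ, a, b, c, d, h⟩ := h
    obtain ⟨p, hp, s, hs, rfl, rfl⟩ := exists_framedBy h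
    exact ⟨_, p, hp, s, hs, _, ⟨c, d, h⟩, WeightedGraph.isomorphic_relabel _ _, rfl⟩
  obtain ⟨p, hp, s, hs, H', hH', hi, hm⟩ := Nat.find_spec hQ
  refine ⟨p, hp, s, hs, H', ⟨hH', fun p' hp' s' hs' K hK hi' => ?_⟩, hi⟩
  have hle := Nat.find_min' hQ ⟨p', hp', s', hs', K, hK,
    WeightedGraph.isomorphic_equivalence.trans hi' hi, rfl⟩
  rw [hm] at hle
  by_contra hcon
  push Not at hcon
  obtain ⟨h1, h2⟩ := hcon
  rcases h1.lt_or_eq with h1 | h1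
  · have : (p' + 1) * 2 ^ n ≤ p * 2 ^ n := Nat.mul_le_mul_right _ h1
    rw [add_mul, one_mul] at this
    omega
  · have := h2 h1.symm
    rw [h1] at hle
    omega

/-- The isomorphism classes in the Clifford class of `G` are counted by the first frames. -/
theorem ncard_cliffordClass_le (G : WeightedGraph 3 n) (T : Finset ℕ)
    (hT : ∀ p < 4 ^ n, ∀ s < 2 ^ n, ∀ H, IsFirstFrame G p s H → s * 4 ^ n + p ∈ T) :
    (cliffordClass G).ncard ≤ T.card := by
  classical
  have h (c : GraphClass n) (hc : c ∈ cliffordClass G) : ∃ p < 4 ^ n, ∃ s < 2 ^ n, ∃ H',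
      IsFirstFrame G p s H' ∧ Quotient.mk (isoSetoid n) H' = c := by
    obtain ⟨H, rfl, h⟩ := hc
    obtain ⟨p, hp, s, hs, H', h1, h2⟩ := exists_isFirstFrame h
    exact ⟨p, hp, s, hs, H', h1, Quotient.sound (s := isoSetoid n) h2⟩
  choose! p hp s hs H' h1 h2 using h
  rw [← Set.ncard_coe_finset]
  refine Set.ncard_le_ncard_of_injOn (fun c => s c * 4 ^ n + p c)
    (fun c hc => hT _ (hp c hc) _ (hs c hc) _ (h1 c hc)) (fun c hc c' hc' he => ?_)
    (Finset.finite_toSet T)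
  have e1 : p c = p c' := by
    have := congrArg (· % 4 ^ n) he
    simpa [Nat.add_mod, Nat.mod_eq_of_lt (hp c hc),
      Nat.mod_eq_of_lt (hp c' hc')] using this
  have e2 : s c = s c' := by
    simp only [e1] at he
    exact Nat.eq_of_mul_eq_mul_right (by positivity) (Nat.add_right_cancel he)
  have h3 := (h1 c hc).1
  rw [e1, e2] at h3
  rw [← h2 c hc, ← h2 c' hc', h3.unique (h1 c' hc').1]

end Frames

/-! ### Sets of numbers as bit masks -/

section Masks

/-- The number `m` with `len` binary digits, repeated `2 ^ k` times. -/
def tile (k : ℕ) : ℕ → ℕ → ℕ :=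
  Nat.rec (fun _ m => m)
    (fun _ ih len m => ih (Nat.mul 2 len) (Nat.lor m (Nat.shiftLeft m len))) k

theorem tile_succ (k len m : ℕ) : tile (k + 1) len m = tile k (2 * len) (m ||| m <<< len) := rfl

theorem testBit_tile {k len m i : ℕ} (hm : m < 2 ^ len) (hi : i < len * 2 ^ k) :
    (tile k len m).testBit i = m.testBit (i % len) := by
  induction k generalizing len m with
  | zero => rw [pow_zero, mul_one] at hi; rw [Nat.mod_eq_of_lt hi]; rfl
  | succ k ih =>
    have h0 : 0 < len := by
      rcases Nat.eq_zero_or_pos len with h | h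
      · simp [h] at hi
      · exact h
    have hm' : m <<< len < 2 ^ (2 * len) := by
      rw [Nat.shiftLeft_eq, two_mul, pow_add]
      exact Nat.mul_lt_mul_of_pos_right hm (by positivity)
    rw [tile_succ, ih (Nat.or_lt_two_pow (hm.trans_le (Nat.pow_le_pow_right (by omega)
      (by omega))) hm') (by rw [pow_succ] at hi; linarith), Nat.testBit_or,
      Nat.testBit_shiftLeft]
    have h1 : i % len = i % (2 * len) % len := (Nat.mod_mul_left_mod i 2 len).symm
    have h2 : i % (2 * len) < 2 * len := Nat.mod_lt _ (by omega)
    rw [h1]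
    generalize i % (2 * len) = r at h2
    by_cases hr : r < len
    · simp [Nat.mod_eq_of_lt hr, hr]
    · have h3 : m.testBit r = false := Nat.testBit_lt_two_pow
        (hm.trans_le (Nat.pow_le_pow_right (by omega) (by omega)))
      have h4 : r % len = r - len := by
        rw [Nat.mod_eq_sub_mod (by omega), Nat.mod_eq_of_lt (by omega)]
      simp [h3, h4, not_lt.1 hr]

/-- The set of the numbers below `2 ^ N`, as a mask. -/
def full (N : ℕ) : ℕ := Nat.sub (Nat.pow 2 N) 1

theorem testBit_full {N i : ℕ} : (full N).testBit i = true ↔ i < N := by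
  change (2 ^ N - 1).testBit i = true ↔ i < N
  rw [Nat.testBit_two_pow_sub_one]; simp

/-- The set of the `i` for which `i / len` is congruent to `q` modulo `r`. -/
def stripe (k len r q : ℕ) : ℕ := tile k (Nat.mul len r) (Nat.shiftLeft (full len) (Nat.mul q len))

theorem testBit_stripe {k len r q i : ℕ} (hq : q < r) (hi : i < len * r * 2 ^ k) :
    (stripe k len r q).testBit i = true ↔ i / len % r = q := by
  have hlen : 0 < len := by
    rcases Nat.eq_zero_or_pos len with h | h
    · simp [h] at hi
    · exact h
  have hm : full len <<< (q * len) < 2 ^ (len * r) := by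
    have h1 : full len < 2 ^ len := Nat.sub_lt (pow_pos (by omega) _) (by omega)
    rw [Nat.shiftLeft_eq]
    calc full len * 2 ^ (q * len) < 2 ^ len * 2 ^ (q * len) :=
          Nat.mul_lt_mul_of_pos_right h1 (by positivity)
      _ = 2 ^ (len * (q + 1)) := by rw [← pow_add]; ring_nf
      _ ≤ _ := Nat.pow_le_pow_right (by omega) (Nat.mul_le_mul_left _ hq)
  change (tile k (len * r) (full len <<< (q * len))).testBit i = true ↔ _
  rw [testBit_tile hm hi, Nat.testBit_shiftLeft, Bool.and_eq_true, testBit_full, decide_eq_true_eq,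
    ← Nat.mod_mul_right_div_self]
  generalize i % (len * r) = x
  constructor
  · rintro ⟨h1, h2⟩
    rw [Nat.div_eq_iff hlen]
    constructor <;> omega
  · intro h
    rw [Nat.div_eq_iff hlen] at h
    constructor <;> omega

/-- The set of the numbers below `4 ^ n` with the digit `q` at the position `v`, in base four. -/
def digitMask (n v q : ℕ) : ℕ := stripe (Nat.mul 2 (Nat.sub n (Nat.succ v))) (Nat.pow 4 v) 4 q

theorem testBit_digitMask {n v q i : ℕ} (hv : v < n) (hq : q < 4) (hi : i < 4 ^ n) :
    (digitMask n v q).testBit i = true ↔ dgt 4 i v = q := by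
  refine testBit_stripe hq ?_
  have : 4 ^ v * 4 * 2 ^ (2 * (n - (v + 1))) = 4 ^ n := by
    rw [pow_mul, ← pow_succ, show (2 : ℕ) ^ 2 = 4 from rfl, ← pow_add]
    congr 1
    omega
  change i < 4 ^ v * 4 * 2 ^ (2 * (n - (v + 1)))
  rwa [this]

/-- The sum of the `32` shifts of `X` that are restricted to the multiples of `32`. -/
def foldShifts (X mask : ℕ) (w : ℕ) : ℕ :=
  Nat.rec 0 (fun j ih => Nat.add (Nat.land (Nat.shiftRight X j) mask) ih) w

/-- The number of elements of the set `X` of numbers below `32 * 2 ^ k`: the sum of its elements in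
the sense of binary digits is taken modulo `2 ^ 32 - 1` after each residue class modulo `32` has
been moved to the multiples of `32`. -/
def popcount (k X : ℕ) : ℕ :=
  Nat.mod (foldShifts X (stripe k 1 32 0) 32) (Nat.sub (Nat.pow 2 32) 1)

theorem sum_testBit {N : ℕ} (X : ℕ) :
    X % 2 ^ N = ∑ i ∈ Finset.range N, if X.testBit i then 2 ^ i else 0 := by
  induction N with
  | zero => simp [Nat.mod_one]
  | succ N ih =>
    rw [Finset.sum_range_succ, ← ih, pow_succ, Nat.mod_mul, Nat.testBit_eq_decide_div_mod_eq]
    rcases Nat.mod_two_eq_zero_or_one (X / 2 ^ N) with h | h <;> simp [h]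

/-- The bound on `k` makes the number of elements less than the modulus of `popcount`. -/
theorem card_filter_testBit (k X : ℕ) (hk : k < 27) :
    ((Finset.range (32 * 2 ^ k)).filter fun i => X.testBit i).card = popcount k X := by
  set N := 32 * 2 ^ k with hN
  have hmask (j) : (stripe k 1 32 0).testBit j = true → j < N ∧ j % 32 = 0 := by
    intro h
    have hj : j < N := by
      by_contra hcon
      have hlt : ∀ (k len m : ℕ), m < 2 ^ len → tile k len m < 2 ^ (len * 2 ^ k) := by
        intro k
        induction k with
        | zero => intro len m hm; simpa [tile] using hm
        | succ k ih =>
          intro len m hm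
          rw [tile_succ, show len * 2 ^ (k + 1) = 2 * len * 2 ^ k by ring]
          refine ih _ _ (Nat.or_lt_two_pow (hm.trans_le (Nat.pow_le_pow_right (by omega)
            (by omega))) ?_)
          rw [Nat.shiftLeft_eq, two_mul, pow_add]
          exact Nat.mul_lt_mul_of_pos_right hm (by positivity)
      have := Nat.testBit_lt_two_pow ((hlt k 32 1 (by norm_num)).trans_le
        (Nat.pow_le_pow_right (n := 2) (by omega) (not_lt.1 hcon)))
      change (tile k 32 1).testBit j = true at h
      rw [this] at h
      exact Bool.noConfusion h
    exact ⟨hj, by simpa using (testBit_stripe (len := 1) (by omega) (by simpa using hj)).1 h⟩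
  have hmask' (j) (h1 : j < N) (h2 : j % 32 = 0) : (stripe k 1 32 0).testBit j = true :=
    (testBit_stripe (len := 1) (by omega) (by simpa using h1)).2 (by simpa using h2)
  -- the multiples of `32` contribute powers of `2 ^ 32`, which are congruent to one
  have hpow (i : ℕ) (h : i % 32 = 0) : 2 ^ i ≡ 1 [MOD 2 ^ 32 - 1] := by
    obtain ⟨m, rfl⟩ := Nat.dvd_of_mod_eq_zero h
    rw [pow_mul]
    simpa using (show 2 ^ 32 ≡ 1 [MOD 2 ^ 32 - 1] from by decide +kernel).pow m
  -- one shift counts the elements of one residue class modulo `32`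
  have hstep (j : ℕ) (hj : j < 32) : Nat.land (Nat.shiftRight X j) (stripe k 1 32 0) ≡
      ((Finset.range N).filter fun i => X.testBit i ∧ i % 32 = j).card [MOD 2 ^ 32 - 1] := by
    change (X >>> j) &&& stripe k 1 32 0 ≡ _ [MOD _]
    set Y := (X >>> j) &&& stripe k 1 32 0 with hY
    have hYbit (i) : Y.testBit i = true ↔ X.testBit (i + j) ∧ i < N ∧ i % 32 = 0 := by
      rw [hY, Nat.testBit_and, Nat.testBit_shiftRight, Bool.and_eq_true, add_comm j]
      exact and_congr_right fun _ => ⟨hmask i, fun h => hmask' i h.1 h.2⟩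
    have hYlt : Y % 2 ^ N = Y := Nat.mod_eq_of_lt (Nat.lt_pow_two_of_testBit _ fun i hi => by
      rw [← Bool.not_eq_true, hYbit]; omega)
    have h1 : Y ≡ ((Finset.range N).filter fun i => X.testBit (i + j) ∧ i % 32 = 0).card
        [MOD 2 ^ 32 - 1] := by
      conv_lhs => rw [← hYlt, sum_testBit, ← Finset.sum_filter]
      rw [Finset.card_eq_sum_ones]
      have e : (Finset.range N).filter (fun i => Y.testBit i = true) =
          (Finset.range N).filter fun i => X.testBit (i + j) ∧ i % 32 = 0 := by
        refine Finset.filter_congr fun i hi => ?_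
        rw [hYbit]
        have := Finset.mem_range.1 hi
        tauto
      rw [e]
      exact Nat.ModEq.sum fun i hi => hpow i (Finset.mem_filter.1 hi).2.2
    refine h1.trans ?_
    suffices h2 : ((Finset.range N).filter fun i => X.testBit (i + j) ∧ i % 32 = 0).card =
        ((Finset.range N).filter fun i => X.testBit i ∧ i % 32 = j).card by rw [h2]
    refine Finset.card_bij (fun i _ => i + j) (fun i hi => ?_) (fun _ _ _ _ h => by omega)
      fun i hi => ?_
    · simp only [Finset.mem_filter, Finset.mem_range] at hi ⊢
      have : i + 32 ≤ N ∨ N < i + 32 := by omega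
      refine ⟨?_, hi.2.1, by omega⟩
      omega
    · simp only [Finset.mem_filter, Finset.mem_range] at hi
      refine ⟨i - j, ?_, by omega⟩
      simp only [Finset.mem_filter, Finset.mem_range]
      have : j ≤ i := by rw [← hi.2.2]; exact Nat.mod_le _ _
      rw [Nat.sub_add_cancel this]
      exact ⟨by omega, hi.2.1, by omega⟩
  have hsum (w : ℕ) (hw : w ≤ 32) : foldShifts X (stripe k 1 32 0) w ≡
      ((Finset.range N).filter fun i => X.testBit i ∧ i % 32 < w).card [MOD 2 ^ 32 - 1] := by
    induction w with
    | zero => simp [foldShifts, Nat.ModEq.refl]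
    | succ w ih =>
      have h1 : (Finset.range N).filter (fun i => X.testBit i = true ∧ i % 32 < w + 1) =
          (Finset.range N).filter (fun i => X.testBit i ∧ i % 32 = w) ∪
          (Finset.range N).filter (fun i => X.testBit i ∧ i % 32 < w) := by
        ext i; simp only [Finset.mem_union, Finset.mem_filter]
        constructor
        · rintro ⟨h, h', h''⟩
          rcases Nat.lt_succ_iff_lt_or_eq.1 h'' with h2 | h2
          · exact Or.inr ⟨h, h', h2⟩
          · exact Or.inl ⟨h, h', h2⟩
        · rintro (⟨h, h', h''⟩ | ⟨h, h', h''⟩) <;> exact ⟨h, h', by omega⟩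
      rw [h1, Finset.card_union_of_disjoint]
      · exact (hstep w (by omega)).add (ih (by omega))
      · rw [Finset.disjoint_filter]
        rintro i - ⟨_, h2⟩ ⟨_, h3⟩
        omega
  have h := hsum 32 le_rfl
  have e : (Finset.range N).filter (fun i => X.testBit i = true ∧ i % 32 < 32) =
      (Finset.range N).filter fun i => X.testBit i := by
    refine Finset.filter_congr fun i _ => ?_
    simp [Nat.mod_lt]
  rw [e] at h
  -- the residue is the cardinality itself, which is less than the modulus
  have hlt : ((Finset.range N).filter fun i => X.testBit i).card < 2 ^ 32 - 1 := by
    calc _ ≤ N := (Finset.card_filter_le _ _).trans (by simp)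
      _ ≤ 32 * 2 ^ 26 := Nat.mul_le_mul_left _ (Nat.pow_le_pow_right (by omega) (by omega))
      _ < _ := by norm_num
  exact (Nat.mod_eq_of_lt hlt).symm.trans h.symm

end Masks

/-! ### Graphs given by numbers -/

section Codes

/-- The conjunction of `f 0, …, f (n - 1)`. -/
def allLt (n : ℕ) (f : ℕ → Bool) : Bool := Nat.rec true (fun k ih => Bool.rec false ih (f k)) n

theorem allLt_eq_true {n : ℕ} {f : ℕ → Bool} : allLt n f = true ↔ ∀ k < n, f k = true := by
  induction n with
  | zero => simp [allLt]
  | succ n ih =>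
    have : allLt (n + 1) f = (f n && allLt n f) := by
      change (Bool.rec false (allLt n f) (f n) : Bool) = _
      cases f n <;> rfl
    rw [this, Bool.and_eq_true, ih]
    constructor
    · rintro ⟨h1, h2⟩ k hk
      rcases Nat.lt_succ_iff_lt_or_eq.1 hk with h | rfl
      · exact h2 k h
      · exact h1
    · exact fun h => ⟨h n (by omega), fun k hk => h k (by omega)⟩

/-- The sum of `f 0, …, f (n - 1)`. -/
def sumLt (n : ℕ) (f : ℕ → ℕ) : ℕ := Nat.rec 0 (fun k ih => Nat.add ih (f k)) n

theorem sumLt_succ (n : ℕ) (f : ℕ → ℕ) : sumLt (n + 1) f = sumLt n f + f n := rfl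

theorem sumLt_eq (n : ℕ) (f : ℕ → ℕ) : sumLt n f = ∑ k : Fin n, f k := by
  induction n with
  | zero => rfl
  | succ n ih => rw [sumLt_succ, ih, Fin.sum_univ_castSucc]; rfl

/-- The union of the masks `f 0, …, f (n - 1)`. -/
def orLt (n : ℕ) (f : ℕ → ℕ) : ℕ := Nat.rec 0 (fun k ih => Nat.lor ih (f k)) n

theorem testBit_orLt {n i : ℕ} {f : ℕ → ℕ} :
    (orLt n f).testBit i = true ↔ ∃ k < n, (f k).testBit i = true := by
  induction n with
  | zero => simp [orLt]
  | succ n ih =>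
    have : orLt (n + 1) f = orLt n f ||| f n := rfl
    rw [this, Nat.testBit_or, Bool.or_eq_true, ih]
    constructor
    · rintro (⟨k, hk, h⟩ | h)
      · exact ⟨k, by omega, h⟩
      · exact ⟨n, by omega, h⟩
    · rintro ⟨k, hk, h⟩
      rcases Nat.lt_succ_iff_lt_or_eq.1 hk with h' | rfl
      · exact Or.inl ⟨k, h', h⟩
      · exact Or.inr h

/-- The number with the digits `f 0, …, f (n - 1)` in base `b`. -/
def pack (b n : ℕ) (f : ℕ → ℕ) : ℕ := sumLt n fun v => Nat.mul (f v) (Nat.pow b v)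

theorem pack_succ' (b n : ℕ) (f : ℕ → ℕ) :
    pack b (n + 1) f = f 0 + b * pack b n fun v => f (v + 1) := by
  unfold pack
  rw [sumLt_eq, sumLt_eq, Fin.sum_univ_succ, Finset.mul_sum]
  congr 1
  · simp
  · refine Finset.sum_congr rfl fun v _ => ?_
    change f (v + 1) * b ^ (v.1 + 1) = b * (f (v + 1) * b ^ v.1)
    ring

theorem pack_add (b n : ℕ) (f g : ℕ → ℕ) :
    pack b n f + pack b n g = pack b n fun v => f v + g v := by
  unfold pack
  rw [sumLt_eq, sumLt_eq, sumLt_eq, ← Finset.sum_add_distrib]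
  exact Finset.sum_congr rfl fun v _ => (Nat.add_mul _ _ _).symm

theorem mul_pack (b n m : ℕ) (f : ℕ → ℕ) : m * pack b n f = pack b n fun v => m * f v := by
  unfold pack
  rw [sumLt_eq, sumLt_eq, Finset.mul_sum]
  exact Finset.sum_congr rfl fun v _ => (Nat.mul_assoc _ _ _).symm

theorem pack_congr {b n : ℕ} {f g : ℕ → ℕ} (h : ∀ v < n, f v = g v) : pack b n f = pack b n g := by
  unfold pack
  rw [sumLt_eq, sumLt_eq]
  exact Finset.sum_congr rfl fun v _ => by rw [h v v.2]

theorem pack_lt {b n : ℕ} {f : ℕ → ℕ} (hf : ∀ v < n, f v < b) : pack b n f < b ^ n := by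
  induction n generalizing f with
  | zero => simp [pack, sumLt]
  | succ n ih =>
    rw [pack_succ', pow_succ']
    have h0 := hf 0 (by omega)
    have := ih (f := fun v => f (v + 1)) fun v hv => hf _ (by omega)
    calc _ < b + b * pack b n fun v => f (v + 1) := by omega
      _ = b * ((pack b n fun v => f (v + 1)) + 1) := by ring
      _ ≤ _ := Nat.mul_le_mul_left _ this

theorem dgt_pack {b n v : ℕ} {f : ℕ → ℕ} (hv : v < n) (hf : ∀ v < n, f v < b) :
    dgt b (pack b n f) v = f v := by
  induction n generalizing f v with
  | zero => omega
  | succ n ih =>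
    have h0 := hf 0 (by omega)
    rw [pack_succ']
    cases v with
    | zero => simp [dgt, Nat.mod_eq_of_lt h0]
    | succ v =>
      rw [dgt, pow_succ', ← Nat.div_div_eq_div_mul, Nat.add_mul_div_left _ _ (by omega),
        Nat.div_eq_of_lt h0, zero_add]
      exact ih (by omega) fun v hv => hf _ (by omega)

/-- The position of the pair `u < v` in the upper triangle of a matrix of size `n`, read row by
row. -/
def pairIdx (n u v : ℕ) : ℕ :=
  Nat.add (Nat.div (Nat.mul u (Nat.sub (Nat.mul 2 n) (Nat.succ u))) 2) (Nat.sub v (Nat.succ u))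

/-- The entry of the symmetric matrix with zero diagonal whose entries above the diagonal are the
digits of `c` in base four. -/
def entry (n c u v : ℕ) : ℕ :=
  Bool.rec
    (Bool.rec 0 (Nat.mod (Nat.div c (Nat.pow 4 (pairIdx n v u))) 4) (Nat.ble (Nat.succ v) u))
    (Nat.mod (Nat.div c (Nat.pow 4 (pairIdx n u v))) 4) (Nat.ble (Nat.succ u) v)

theorem entry_of_lt {n c u v : ℕ} (h : u < v) : entry n c u v = dgt 4 c (pairIdx n u v) := by
  have : Nat.ble (Nat.succ u) v = true := Nat.ble_eq_true_of_le h
  rw [entry, this]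
  rfl

theorem entry_self (n c u : ℕ) : entry n c u u = 0 := by
  have : Nat.ble (Nat.succ u) u = false := Bool.eq_false_iff.2 fun h => by
    have := Nat.le_of_ble_eq_true h; omega
  rw [entry, this]

theorem entry_comm (n c u v : ℕ) : entry n c u v = entry n c v u := by
  rcases lt_trichotomy u v with h | rfl | h
  · have h1 : Nat.ble (Nat.succ v) u = false := Bool.eq_false_iff.2 fun h => by
      have := Nat.le_of_ble_eq_true h; omega
    rw [entry_of_lt h, entry, h1, Nat.ble_eq_true_of_le h]
    rfl
  · rfl
  · have h1 : Nat.ble (Nat.succ u) v = false := Bool.eq_false_iff.2 fun h => by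
      have := Nat.le_of_ble_eq_true h; omega
    rw [entry_of_lt h, entry, h1, Nat.ble_eq_true_of_le h]
    rfl

theorem entry_lt (n c u v : ℕ) : entry n c u v < 4 := by
  rcases lt_trichotomy u v with h | rfl | h
  · rw [entry_of_lt h]; exact dgt_lt (by omega) _ _
  · rw [entry_self]; omega
  · rw [entry_comm, entry_of_lt h]; exact dgt_lt (by omega) _ _

/-- The weighted graph whose weights are given by a function on pairs of numbers. -/
def ofFun (n : ℕ) (g : ℕ → ℕ → ℕ) (h : ∀ u v, g u v = g v u) (h0 : ∀ u, g u u = 0) :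
    WeightedGraph 3 n where
  Γ u v := (g u v : ℕ)
  symm u v := by rw [h]
  loopless u := by simp [h0]

/-- The weighted graph with a given encoding. -/
def ofCode (n c : ℕ) : WeightedGraph 3 n := ofFun n (entry n c) (entry_comm n c) (entry_self n c)

theorem ofCode_apply (n c : ℕ) (u v : Fin n) : (ofCode n c).Γ u v = (entry n c u v : ℕ) := rfl

theorem cast_eq_cast_iff {a b : ℕ} : (a : ZMod 3) = b ↔ a % 3 = b % 3 :=
  ZMod.natCast_eq_natCast_iff' a b 3

/-- The equation of a local Clifford map with the blocks `[a v, b v; c v, d v]` from the graph `g`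
to the graph `h`. -/
def isClifford (n : ℕ) (g h : ℕ → ℕ → ℕ) (a b c d : ℕ → ℕ) : Bool :=
  allLt n fun u => allLt n fun v => Nat.beq
    (Nat.mod (Nat.add (Nat.mul (h u v) (a v)) (sumLt n fun k =>
      Nat.mul (h u k) (Nat.mul (b k) (g k v)))) 3)
    (Nat.mod (Nat.add (Bool.rec 0 (c u) (Nat.beq u v)) (Nat.mul (d u) (g u v))) 3)

theorem localClifford_of_isClifford {n : ℕ} {g h : ℕ → ℕ → ℕ} {a b c d : ℕ → ℕ}
    (he : isClifford n g h a b c d = true) {G H : WeightedGraph 3 n}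
    (hG : ∀ u v : Fin n, G.Γ u v = (g u v : ℕ)) (hH : ∀ u v : Fin n, H.Γ u v = (h u v : ℕ))
    (hdet : ∀ v : Fin n, (a v * d v - b v * c v : ZMod 3) = 1) :
    WeightedGraph.LocalClifford (fun v : Fin n => (a v : ZMod 3)) (fun v => (b v : ZMod 3))
      (fun v => (c v : ZMod 3)) (fun v => (d v : ZMod 3)) G H := by
  refine ⟨hdet, WeightedGraph.LocalClifford.map_iff.2 fun u v => ?_⟩
  have h1 := allLt_eq_true.1 (allLt_eq_true.1 he u u.2) v v.2
  have h2 := cast_eq_cast_iff.2 (Nat.eq_of_beq_eq_true h1)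
  have h3 : (Bool.rec 0 (c u) (Nat.beq u v) : ℕ) = if u = v then c u else 0 := by
    by_cases huv : u = v
    · subst huv; rw [Nat.beq_refl]; simp
    · have : Nat.beq u v = false := by
        rw [Bool.eq_false_iff]; exact fun h => huv (Fin.ext (Nat.eq_of_beq_eq_true h))
      rw [this, if_neg huv]
  rw [h3, sumLt_eq] at h2
  change ((h u v * a v + ∑ k : Fin n, h u k * (b k * g k v) : ℕ) : ZMod 3) =
    (((if u = v then c u else 0) + d u * g u v : ℕ) : ZMod 3) at h2
  push_cast at h2
  simpa only [hG, hH] using h2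

end Codes

/-! ### The frames that are not transversal -/

section Singular

/-- The masks `digitMask n v q`. They are listed so that equal masks are written as equal terms,
which are evaluated only once. -/
def digitTab (n v q : ℕ) : ℕ :=
  nth 0 (nth [] [[digitMask n 0 0, digitMask n 0 1, digitMask n 0 2, digitMask n 0 3],
    [digitMask n 1 0, digitMask n 1 1, digitMask n 1 2, digitMask n 1 3],
    [digitMask n 2 0, digitMask n 2 1, digitMask n 2 2, digitMask n 2 3],
    [digitMask n 3 0, digitMask n 3 1, digitMask n 3 2, digitMask n 3 3],
    [digitMask n 4 0, digitMask n 4 1, digitMask n 4 2, digitMask n 4 3],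
    [digitMask n 5 0, digitMask n 5 1, digitMask n 5 2, digitMask n 5 3],
    [digitMask n 6 0, digitMask n 6 1, digitMask n 6 2, digitMask n 6 3]] v) q

theorem testBit_digitTab {n v q i : ℕ} (hn : n ≤ 7) (hv : v < n) (hq : q < 4) (hi : i < 4 ^ n) :
    (digitTab n v q).testBit i = true ↔ dgt 4 i v = q := by
  rw [← testBit_digitMask hv hq hi]
  have : digitTab n v q = digitMask n v q := by
    have : v < 7 := by omega
    interval_cases v <;> interval_cases q <;> rfl
  rw [this]

/-- The set of all frames, without signs. -/
def allPoints (n : ℕ) : ℕ := full (Nat.pow 4 n)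

/-- The points at the vertex `v` on which the vector `(x, y)` vanishes. -/
def kernelMask (n v x y : ℕ) : ℕ :=
  nth 0 (nth [] [[allPoints n, digitTab n v 0, digitTab n v 0],
    [digitTab n v 3, digitTab n v 2, digitTab n v 1],
    [digitTab n v 3, digitTab n v 1, digitTab n v 2]] x) (Nat.mod y 3)

theorem testBit_kernelMask {n v x i : ℕ} (y : ℕ) (hn : n ≤ 7) (hv : v < n) (hx : x < 3)
    (hi : i < 4 ^ n) : (kernelMask n v x y).testBit i = true ↔
      (vecA (dgt 4 i v) * x + vecB (dgt 4 i v) * y : ZMod 3) = 0 := by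
  have hy : (y : ZMod 3) = (y % 3 : ℕ) := by simp
  have hq : dgt 4 i v < 4 := dgt_lt (by omega) _ _
  have h (q : ℕ) (hq : q < 4) := testBit_digitTab hn hv hq hi
  have hf : (allPoints n).testBit i = true := testBit_full.2 hi
  have hy3 : y % 3 < 3 := Nat.mod_lt _ (by omega)
  rw [hy]
  change (nth 0 (nth [] _ x) (y % 3)).testBit i = true ↔ _
  generalize y % 3 = z at hy3
  have key : ∀ x < 3, ∀ z < 3, ∀ q < 4,
      ((vecA q : ℕ) * (x : ℕ) + (vecB q : ℕ) * (z : ℕ) : ZMod 3) = 0 ↔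
      (x = 0 ∧ z = 0) ∨ q = nth 0 (nth [] [[0, 0, 0], [3, 2, 1], [3, 1, 2]] x) z ∧
        ¬(x = 0 ∧ z = 0) := by
    intro x hx z hz q hq
    interval_cases x <;> interval_cases z <;> interval_cases q <;> decide
  rw [key x hx z hy3 _ hq]
  interval_cases x <;> interval_cases z <;> simp [nth_eq_getD, hf, h]

/-- The intersection of the masks `f v (w v)` over the functions `f v` of a list, where the numbers
`w v` are packed into one number. -/
def leafMask (n : ℕ) (fs : List (ℕ → ℕ)) : ℕ → ℕ :=
  List.rec (fun _ => allPoints n)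
    (fun f _ ih z => Nat.land (f (Nat.mod z 256)) (ih (Nat.div z 256))) fs

theorem testBit_leafMask {n i : ℕ} (hi : i < 4 ^ n) (k : ℕ) (f : ℕ → ℕ → ℕ) (w : ℕ → ℕ)
    (hw : ∀ v < k, w v < 256) :
    (leafMask n ((List.range k).map f) (pack 256 k w)).testBit i = true ↔
      ∀ v < k, (f v (w v)).testBit i = true := by
  induction k generalizing f w with
  | zero => exact iff_of_true (testBit_full.2 hi) fun v hv => absurd hv (Nat.not_lt_zero v)
  | succ k ih =>
    have h0 := hw 0 (by omega)
    rw [List.range_succ_eq_map, List.map_cons, List.map_map, pack_succ']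
    change (f 0 ((w 0 + 256 * _) % 256) &&& leafMask n _ ((w 0 + 256 * _) / 256)).testBit i = _ ↔ _
    rw [Nat.add_mul_mod_self_left, Nat.mod_eq_of_lt h0, Nat.add_mul_div_left _ _ (by omega),
      Nat.div_eq_of_lt h0, zero_add, Nat.testBit_and, Bool.and_eq_true,
      show f ∘ Nat.succ = fun v => f (v + 1) from rfl,
      ih (fun v => f (v + 1)) (fun v => w (v + 1)) fun v hv => hw _ (by omega)]
    constructor
    · rintro ⟨h1, h2⟩ v hv
      cases v with
      | zero => exact h1
      | succ v => exact h2 v (by omega)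
    · exact fun h => ⟨h 0 (by omega), fun v hv => h _ (by omega)⟩

/-- A row of the adjacency matrix, packed into one number. -/
def packedRow (n c j : ℕ) : ℕ := pack 256 n (entry n c j)

/-- The union of the leaf masks over all the ways of choosing coefficients at the vertices below
`k`; the number `z` is the combination of rows for the coefficients at the other vertices. -/
def spanMask (n c k : ℕ) : List (ℕ → ℕ) → ℕ → ℕ :=
  Nat.rec (fun xs z => leafMask n xs z)
    (fun k ih xs z => Nat.lor (ih (kernelMask n k 0 :: xs) z)
      (Nat.lor (ih (kernelMask n k 1 :: xs) (Nat.add z (packedRow n c k)))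
        (ih (kernelMask n k 2 :: xs) (Nat.add z (Nat.add (packedRow n c k) (packedRow n c k)))))) k

/-- The same for nonzero combinations with the leading coefficient one. -/
def leadingMask (n c k : ℕ) : List (ℕ → ℕ) → ℕ :=
  Nat.rec (fun _ => 0)
    (fun k ih xs => Nat.lor (ih (kernelMask n k 0 :: xs))
      (spanMask n c k (kernelMask n k 1 :: xs) (packedRow n c k))) k

/-- The frames at which some nonzero vector `(ξ, Γ ξ)` vanishes at all vertices. -/
def singularMask (n c : ℕ) : ℕ := leadingMask n c n []

theorem testBit_spanMask {n c i : ℕ} (k : ℕ) (xs : List (ℕ → ℕ)) (z : ℕ) :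
    (spanMask n c k xs z).testBit i = true ↔ ∃ ξ : ℕ → ℕ, (∀ j < k, ξ j < 3) ∧
      (leafMask n ((List.range k).map (fun v => kernelMask n v (ξ v)) ++ xs)
        (z + sumLt k fun j => ξ j * packedRow n c j)).testBit i = true := by
  induction k generalizing xs z with
  | zero =>
    constructor
    · exact fun h => ⟨fun _ => 0, by simp, h⟩
    · rintro ⟨ξ, _, h⟩; exact h
  | succ k ih =>
    have e : spanMask n c (k + 1) xs z = spanMask n c k (kernelMask n k 0 :: xs) z |||
      (spanMask n c k (kernelMask n k 1 :: xs) (z + packedRow n c k) |||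
        spanMask n c k (kernelMask n k 2 :: xs) (z + (packedRow n c k + packedRow n c k))) := rfl
    have h3 : (spanMask n c (k + 1) xs z).testBit i = true ↔ ∃ x < 3,
        (spanMask n c k (kernelMask n k x :: xs) (z + x * packedRow n c k)).testBit i = true := by
      rw [e, Nat.testBit_or, Nat.testBit_or, Bool.or_eq_true, Bool.or_eq_true]
      constructor
      · rintro (h | h | h)
        · exact ⟨0, by omega, by simpa using h⟩
        · exact ⟨1, by omega, by simpa using h⟩
        · exact ⟨2, by omega, by rwa [two_mul]⟩
      · rintro ⟨x, hx, h⟩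
        interval_cases x
        · exact Or.inl (by simpa using h)
        · exact Or.inr (Or.inl (by simpa using h))
        · exact Or.inr (Or.inr (by rwa [two_mul] at h))
    rw [h3]
    constructor
    · rintro ⟨x, hx, h⟩
      obtain ⟨ξ, hξ, h⟩ := (ih _ _).1 h
      refine ⟨fun j => if j = k then x else ξ j, fun j hj => ?_, ?_⟩
      · by_cases hjk : j = k
        · simpa [hjk] using hx
        · simpa [hjk] using hξ j (by omega)
      · have e1 : (List.range k).map (fun v => kernelMask n v (if v = k then x else ξ v)) =
            (List.range k).map fun v => kernelMask n v (ξ v) :=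
          List.map_congr_left fun v hv => by
            rw [if_neg (List.mem_range.1 hv).ne]
        have e2 : (sumLt k fun j => (if j = k then x else ξ j) * packedRow n c j) =
            sumLt k fun j => ξ j * packedRow n c j := by
          rw [sumLt_eq, sumLt_eq]
          exact Finset.sum_congr rfl fun v _ => by rw [if_neg v.2.ne]
        rw [List.range_succ, List.map_append, e1, sumLt_succ, e2]
        rw [List.append_assoc]
        simpa [add_assoc, add_comm, add_left_comm] using h
    · rintro ⟨ξ, hξ, h⟩
      refine ⟨ξ k, hξ k (by omega), (ih _ _).2 ⟨ξ, fun j hj => hξ j (by omega), ?_⟩⟩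
      rw [List.range_succ, List.map_append, List.append_assoc, sumLt_succ] at h
      simpa [add_assoc, add_comm, add_left_comm] using h

theorem testBit_leadingMask {n c i : ℕ} (k : ℕ) (xs : List (ℕ → ℕ)) :
    (leadingMask n c k xs).testBit i = true ↔ ∃ ξ : ℕ → ℕ, (∀ j < k, ξ j < 3) ∧
      (∃ m < k, ξ m = 1 ∧ ∀ j < k, m < j → ξ j = 0) ∧
      (leafMask n ((List.range k).map (fun v => kernelMask n v (ξ v)) ++ xs)
        (sumLt k fun j => ξ j * packedRow n c j)).testBit i = true := by
  induction k generalizing xs with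
  | zero => simp [leadingMask]
  | succ k ih =>
    have e : leadingMask n c (k + 1) xs = leadingMask n c k (kernelMask n k 0 :: xs) |||
      spanMask n c k (kernelMask n k 1 :: xs) (packedRow n c k) := rfl
    have e1 (x : ℕ) (ξ : ℕ → ℕ) :
        (List.range k).map (fun v => kernelMask n v (if v = k then x else ξ v)) =
          (List.range k).map fun v => kernelMask n v (ξ v) :=
      List.map_congr_left fun v hv => by
        rw [if_neg (List.mem_range.1 hv).ne]
    have e2 (x : ℕ) (ξ : ℕ → ℕ) :
        (sumLt k fun j => (if j = k then x else ξ j) * packedRow n c j) =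
          sumLt k fun j => ξ j * packedRow n c j := by
      rw [sumLt_eq, sumLt_eq]
      exact Finset.sum_congr rfl fun v _ => by rw [if_neg v.2.ne]
    rw [e, Nat.testBit_or, Bool.or_eq_true, ih, testBit_spanMask]
    constructor
    · rintro (⟨ξ, hξ, ⟨m, hm, h1, h0⟩, h⟩ | ⟨ξ, hξ, h⟩)
      · refine ⟨fun j => if j = k then 0 else ξ j, fun j hj => ?_, ⟨m, by omega, ?_, ?_⟩, ?_⟩
        · by_cases hjk : j = k
          · simp [hjk]
          · simpa [hjk] using hξ j (by omega)
        · simpa [hm.ne] using h1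
        · intro j hj hmj
          by_cases hjk : j = k
          · simp [hjk]
          · simpa [hjk] using h0 j (by omega) hmj
        · rw [List.range_succ, List.map_append, e1, sumLt_succ, e2, List.append_assoc]
          simpa using h
      · refine ⟨fun j => if j = k then 1 else ξ j, fun j hj => ?_, ⟨k, by omega, ?_, ?_⟩, ?_⟩
        · by_cases hjk : j = k
          · simp [hjk]
          · simpa [hjk] using hξ j (by omega)
        · simp
        · intro j hj hmj; omega
        · rw [List.range_succ, List.map_append, e1, sumLt_succ, e2, List.append_assoc]
          simpa [add_comm] using h
    · rintro ⟨ξ, hξ, ⟨m, hm, h1, h0⟩, h⟩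
      rw [List.range_succ, List.map_append, List.append_assoc, sumLt_succ] at h
      rcases Nat.lt_succ_iff_lt_or_eq.1 hm with hmk | rfl
      · refine Or.inl ⟨ξ, fun j hj => hξ j (by omega),
          ⟨m, hmk, h1, fun j hj hmj => h0 j (by omega) hmj⟩, ?_⟩
        simpa [h0 k (by omega) hmk] using h
      · refine Or.inr ⟨ξ, fun j hj => hξ j (by omega), ?_⟩
        simpa [h1, add_comm] using h

open Matrix in
theorem testBit_singularMask {n c p : ℕ} (hn : n ≤ 7) (hp : p < 4 ^ n) :
    (singularMask n c).testBit p = true ↔ ∃ x : Fin n → ZMod 3, x ≠ 0 ∧ ∀ v : Fin n,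
      vecA (dgt 4 p v) * x v + vecB (dgt 4 p v) * ((ofCode n c).Γ *ᵥ x) v = 0 := by
  have key (ξ : ℕ → ℕ) (hξ : ∀ j < n, ξ j < 3) (x : Fin n → ZMod 3)
      (hx : ∀ v : Fin n, x v = (ξ v : ℕ)) :
      (leafMask n ((List.range n).map (fun v => kernelMask n v (ξ v)) ++ [])
        (sumLt n fun j => ξ j * packedRow n c j)).testBit p = true ↔
      ∀ v : Fin n, vecA (dgt 4 p v) * x v + vecB (dgt 4 p v) * ((ofCode n c).Γ *ᵥ x) v = 0 := by
    have hsum : ∀ k, (sumLt k fun j => ξ j * packedRow n c j) =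
        pack 256 n fun v => sumLt k fun j => ξ j * entry n c j v := by
      intro k
      induction k with
      | zero =>
        refine Eq.trans ?_ (mul_pack 256 n 0 (fun _ => 0))
        simp [sumLt]
      | succ k ih =>
        rw [sumLt_succ, ih, packedRow, mul_pack, pack_add]
        rfl
    have hw (v : ℕ) : (sumLt n fun j => ξ j * entry n c j v) < 256 := by
      rw [sumLt_eq]
      calc _ ≤ ∑ k : Fin n, 2 * 3 := Finset.sum_le_sum fun k _ =>
            Nat.mul_le_mul (Nat.lt_succ_iff.1 (hξ k k.2)) (Nat.lt_succ_iff.1 (entry_lt _ _ _ _))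
        _ < 256 := by simp; omega
    rw [hsum, List.append_nil, testBit_leafMask hp n _ _ fun v _ => hw v]
    rw [← Fin.forall_iff (p := fun v => (kernelMask n v (ξ v)
      (sumLt n fun j => ξ j * entry n c j v)).testBit p = true)]
    refine forall_congr' fun v => ?_
    rw [testBit_kernelMask _ hn v.2 (hξ v v.2) hp, sumLt_eq, hx, Matrix.mulVec, dotProduct]
    push_cast
    have : ∑ k : Fin n, (ξ k : ZMod 3) * (entry n c k v : ℕ) =
        ∑ k : Fin n, (ofCode n c).Γ v k * x k :=
      Finset.sum_congr rfl fun k _ => by rw [hx, ofCode_apply, entry_comm, mul_comm]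
    rw [this]
  rw [singularMask, testBit_leadingMask]
  constructor
  · rintro ⟨ξ, hξ, ⟨m, hm, h1, h0⟩, h⟩
    refine ⟨fun v => (ξ v : ℕ), fun hx => ?_, (key ξ hξ _ fun v => rfl).1 h⟩
    have := congrFun hx ⟨m, hm⟩
    simp [h1] at this
  · rintro ⟨x, hx, h⟩
    -- a multiple of `x` has the leading coefficient one
    obtain ⟨m, hm, hmax⟩ : ∃ m, x m ≠ 0 ∧ ∀ j, m < j → x j = 0 := by
      obtain ⟨v, hv⟩ := Function.ne_iff.1 hx
      have hne : (Finset.univ.filter fun j => x j ≠ 0).Nonempty := ⟨v, by simpa using hv⟩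
      refine ⟨_, (Finset.mem_filter.1 (Finset.max'_mem _ hne)).2, fun j hj => ?_⟩
      by_contra hcon
      exact absurd (Finset.le_max' _ j (by simpa using hcon)) (not_le.2 hj)
    have hsq : x m * x m = 1 := by generalize x m = y at hm; revert y; decide
    let ξ : ℕ → ℕ := fun j => if h : j < n then (x m * x ⟨j, h⟩).val else 0
    have hξx (v : Fin n) : x m * x v = (ξ v : ℕ) := by simp [ξ]
    have hξ (j : ℕ) (hj : j < n) : ξ j < 3 := by
      simp only [ξ, hj, dite_true]; exact ZMod.val_lt _
    refine ⟨ξ, hξ, ⟨m, m.2, ?_, fun j hj hmj => ?_⟩, (key ξ hξ (x m • x) ?_).2 fun v => ?_⟩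
    · simp only [ξ, m.2, dite_true, Fin.eta, hsq]; rfl
    · simp only [ξ, hj, dite_true, hmax ⟨j, hj⟩ hmj, mul_zero]; rfl
    · exact hξx
    · rw [Matrix.mulVec_smul]
      have := congrArg (x m * ·) (h v)
      simp only [Pi.smul_apply, smul_eq_mul, mul_zero] at this ⊢
      linear_combination this

theorem vec_sign : ∀ q < 4, ∀ s < 2, ∀ x y : ZMod 3,
    ((vecA (q + 4 * s) : ℕ) * x + (vecB (q + 4 * s) : ℕ) * y : ZMod 3) = 0 ↔
      ((vecA q : ℕ) * x + (vecB q : ℕ) * y : ZMod 3) = 0 := by decide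

open Matrix in
/-- A frame that leads to a graph is transversal, as its matrix has an inverse. -/
theorem FramedBy.not_testBit {n c p s : ℕ} {H : WeightedGraph 3 n} (hn : n ≤ 7) (hp : p < 4 ^ n)
    (h : FramedBy (ofCode n c) p s H) : (singularMask n c).testBit p = false := by
  rw [Bool.eq_false_iff]
  intro hbit
  obtain ⟨x, hx, hx0⟩ := (testBit_singularMask hn hp).1 hbit
  obtain ⟨C, D, h⟩ := h
  refine hx ?_
  have h1 : (diagonal (frameA n p s) + diagonal (frameB n p s) * (ofCode n c).Γ) *ᵥ x = 0 := by
    ext v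
    rw [Matrix.add_mulVec, ← Matrix.mulVec_mulVec, Pi.add_apply, Matrix.mulVec_diagonal,
      Matrix.mulVec_diagonal]
    exact (vec_sign _ (dgt_lt (by omega) _ _) _ (dgt_lt (by omega) _ _) _ _).2 (hx0 v)
  have := congrArg ((diagonal D - diagonal (frameB n p s) * H.Γ) *ᵥ ·) h1
  simpa [Matrix.mulVec_mulVec, h.inv_mul] using this

end Singular

/-! ### First frames -/

section FirstFrames

/-- The action of the `24` elements of `SL(2, 3)` on the covectors with the indices `0, …, 3`; the
indices of the four images are digits in base eight. -/
def slTab : List ℕ := [2163, 3115, 2723, 343, 903, 1295, 1672, 1008, 3416, 1553, 1505, 2457, 1602,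
  490, 2842, 4012, 1148, 2772, 3942, 574, 2254, 3893, 189, 3269]

/-- The image of the covector with the index `q` under the element with the number `t`. -/
def slImage (t q : ℕ) : ℕ := Nat.mod (Nat.div (nth 0 slTab t) (Nat.pow 8 q)) 8

theorem slImage_lt (t q : ℕ) : slImage t q < 8 := Nat.mod_lt _ (by omega)

/-- The rows of the matrix of an element of `SL(2, 3)` are its images of the covectors `(1, 0)` and
`(0, 1)`, with the indices `0` and `3`. -/
theorem slImage_det : ∀ t < 24, ((vecA (slImage t 0) : ℕ) * (vecB (slImage t 3) : ℕ) -
    (vecB (slImage t 0) : ℕ) * (vecA (slImage t 3) : ℕ) : ZMod 3) = 1 := by decide +kernel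

/-- The images of all covectors follow from those of the points, with the signs of the digits. -/
theorem vec_slImage : ∀ t < 24, ∀ q < 4, ∀ s < 2,
    ((vecA (slImage t q % 4 + 4 * ((s + slImage t q / 4) % 2)) : ℕ) : ZMod 3) =
        (vecA (q + 4 * s) : ℕ) * (vecA (slImage t 0) : ℕ) +
          (vecB (q + 4 * s) : ℕ) * (vecA (slImage t 3) : ℕ) ∧
      ((vecB (slImage t q % 4 + 4 * ((s + slImage t q / 4) % 2)) : ℕ) : ZMod 3) =
        (vecA (q + 4 * s) : ℕ) * (vecB (slImage t 0) : ℕ) +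
          (vecB (q + 4 * s) : ℕ) * (vecB (slImage t 3) : ℕ) := by decide +kernel

/-- A symmetry is encoded by digits in base `168 = 24 * 7`; they give an element of `SL(2, 3)`
and a vertex for each vertex. -/
def symVertex (S u : ℕ) : ℕ := Nat.mod (Nat.div S (Nat.pow 168 u)) 7

/-- The image of a covector at the vertex `symVertex S u`, as a covector at the vertex `u`. -/
def symImage (S u q : ℕ) : ℕ := slImage (Nat.div (Nat.mod (Nat.div S (Nat.pow 168 u)) 168) 7) q

theorem symIdx_lt (S u : ℕ) : S / 168 ^ u % 168 / 7 < 24 := by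
  have := Nat.mod_lt (S / 168 ^ u) (show 0 < 168 by omega)
  omega

/-- The number `S` encodes an automorphism of the Lagrangian subspace of the graph `g`. -/
def isSymmetry (n : ℕ) (g : ℕ → ℕ → ℕ) (S : ℕ) : Bool :=
  Bool.rec false
    (isClifford n g (fun u v => g (symVertex S u) (symVertex S v))
      (fun u => vecA (symImage S u 0)) (fun u => vecB (symImage S u 0))
      (fun u => vecA (symImage S u 3)) (fun u => vecB (symImage S u 3)))
    (Nat.beq (orLt n fun u => Nat.shiftLeft 1 (symVertex S u)) (full n))

/-- A function on `0, …, n - 1` whose values form the set `{0, …, n - 1}` is a permutation. -/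
theorem exists_perm_of_orLt {n : ℕ} {f : ℕ → ℕ}
    (h : Nat.beq (orLt n fun u => Nat.shiftLeft 1 (f u)) (full n) = true) :
    ∃ τ : Equiv.Perm (Fin n), ∀ u : Fin n, (τ u : ℕ) = f u := by
  have h1 (i) : (∃ k < n, f k = i) ↔ i < n := by
    rw [← testBit_full, ← Nat.eq_of_beq_eq_true h, testBit_orLt]
    refine exists_congr fun k => and_congr_right fun _ => ?_
    change _ ↔ (1 <<< f k).testBit i = true
    rw [Nat.one_shiftLeft, Nat.testBit_two_pow]
    simp
  let g : Fin n → Fin n := fun u => ⟨f u, (h1 _).1 ⟨u, u.2, rfl⟩⟩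
  have hg : Function.Surjective g := fun v => by
    obtain ⟨k, hk, h⟩ := (h1 v).2 v.2
    exact ⟨⟨k, hk⟩, Fin.ext h⟩
  exact ⟨Equiv.ofBijective g (Finite.injective_iff_bijective.1 (Finite.injective_iff_surjective.2
    hg)), fun u => rfl⟩

/-- A symmetry carries a frame for a graph to a frame for a relabelling of this graph. So a first
frame does not come after its images under symmetries. -/
theorem IsFirstFrame.le_of_isSymmetry {n c p s S : ℕ} {H : WeightedGraph 3 n}
    (h : IsFirstFrame (ofCode n c) p s H) (hS : isSymmetry n (entry n c) S = true) :
    (∀ u < n, symVertex S u < n) ∧ ∃ p' < 4 ^ n, ∃ s' < 2 ^ n,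
      (∀ u < n, dgt 4 p' u = symImage S u (dgt 4 p (symVertex S u)) % 4) ∧
      (∀ u < n, dgt 2 s' u =
        (dgt 2 s (symVertex S u) + symImage S u (dgt 4 p (symVertex S u)) / 4) % 2) ∧
      (p < p' ∨ p = p' ∧ s ≤ s') := by
  have hb : Nat.beq (orLt n fun u => Nat.shiftLeft 1 (symVertex S u)) (full n) = true := by
    by_contra hcon
    rw [isSymmetry, Bool.eq_false_iff.2 hcon] at hS
    exact absurd hS (by simp)
  rw [isSymmetry, hb] at hS
  obtain ⟨τ, hτ⟩ := exists_perm_of_orLt hb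
  obtain ⟨p', hp', hpd⟩ := exists_dgt_eq (n := n) (b := 4)
    (fun u => symImage S u (dgt 4 p (symVertex S u)) % 4) fun _ => Nat.mod_lt _ (by omega)
  obtain ⟨s', hs', hsd⟩ := exists_dgt_eq (n := n) (b := 2)
    (fun u => (dgt 2 s (symVertex S u) + symImage S u (dgt 4 p (symVertex S u)) / 4) % 2)
    fun _ => Nat.mod_lt _ (by omega)
  refine ⟨fun u hu => by rw [← hτ ⟨u, hu⟩]; exact (τ _).2, p', hp', s', hs',
    fun u hu => hpd ⟨u, hu⟩, fun u hu => hsd ⟨u, hu⟩, h.2 p' hp' s' hs' (H.relabel τ) ?_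
      (WeightedGraph.isomorphic_relabel _ _)⟩
  have hk := localClifford_of_isClifford hS (G := ofCode n c) (H := (ofCode n c).relabel τ)
    (fun u v => rfl) (fun u v => by
      change ((entry n c (τ u) (τ v) : ℕ) : ZMod 3) = _
      rw [hτ, hτ]) fun v => slImage_det _ (symIdx_lt S v)
  obtain ⟨⟨C, D, hf⟩, -⟩ := h
  have hc := hk.trans (hf.relabel τ)
  have ha : frameA n p' s' = fun v => (frameA n p s ∘ τ) v * (vecA (symImage S v 0) : ℕ) +
      (frameB n p s ∘ τ) v * (vecA (symImage S v 3) : ℕ) := by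
    ext u
    simp only [frameA, frameB, frameIdx, Function.comp_apply, hτ, hpd, hsd]
    exact (vec_slImage _ (symIdx_lt S u) _ (dgt_lt (by omega) p (symVertex S u)) _
      (dgt_lt (by omega) s (symVertex S u))).1
  have hb' : frameB n p' s' = fun v => (frameA n p s ∘ τ) v * (vecB (symImage S v 0) : ℕ) +
      (frameB n p s ∘ τ) v * (vecB (symImage S v 3) : ℕ) := by
    ext u
    simp only [frameA, frameB, frameIdx, Function.comp_apply, hτ, hpd, hsd]
    exact (vec_slImage _ (symIdx_lt S u) _ (dgt_lt (by omega) p (symVertex S u)) _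
      (dgt_lt (by omega) s (symVertex S u))).2
  rw [FramedBy, ha, hb']
  exact ⟨_, _, hc⟩

/-- The comparison of numbers, digit by digit: `lt u` and `eq u` are the masks for the digits at
the position `u`, and `X` is the mask for the case of equality. -/
def chainMask (lt eq : ℕ → ℕ) (X n : ℕ) : ℕ :=
  Nat.rec X (fun u ih => Nat.lor (lt u) (Nat.land (eq u) ih)) n

theorem testBit_chainMask {lt eq : ℕ → ℕ} {X n b x y i : ℕ} (hb : 0 < b)
    (hlt : ∀ u < n, (lt u).testBit i = true ↔ dgt b x u < dgt b y u)
    (heq : ∀ u < n, (eq u).testBit i = true ↔ dgt b x u = dgt b y u) :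
    (chainMask lt eq X n).testBit i = true ↔
      x % b ^ n < y % b ^ n ∨ x % b ^ n = y % b ^ n ∧ X.testBit i = true := by
  induction n with
  | zero => simp [chainMask, Nat.mod_one]
  | succ n ih =>
    change (lt n ||| (eq n &&& chainMask lt eq X n)).testBit i = true ↔ _
    rw [Nat.testBit_or, Nat.testBit_and, Bool.or_eq_true, Bool.and_eq_true, hlt n (by omega),
      heq n (by omega), ih (fun u hu => hlt u (by omega)) fun u hu => heq u (by omega),
      Nat.mod_pow_succ, Nat.mod_pow_succ]
    have hx : x % b ^ n < b ^ n := Nat.mod_lt _ (by positivity)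
    have hy : y % b ^ n < b ^ n := Nat.mod_lt _ (by positivity)
    change dgt b x n < dgt b y n ∨ _ ↔ x % b ^ n + b ^ n * dgt b x n < y % b ^ n +
      b ^ n * dgt b y n ∨ x % b ^ n + b ^ n * dgt b x n = y % b ^ n + b ^ n * dgt b y n ∧ _
    generalize x % b ^ n = r at hx
    generalize y % b ^ n = r' at hy
    generalize dgt b x n = d
    generalize dgt b y n = d'
    generalize b ^ n = B at hx hy
    rcases lt_trichotomy d d' with h | rfl | h
    · have : r + B * d < r' + B * d' := by
        calc r + B * d < B * (d + 1) := by rw [Nat.mul_succ]; omega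
          _ ≤ B * d' := Nat.mul_le_mul_left _ h
          _ ≤ _ := Nat.le_add_left _ _
      simp [h, this]
    · simp
    · have : r' + B * d' < r + B * d := by
        calc r' + B * d' < B * (d' + 1) := by rw [Nat.mul_succ]; omega
          _ ≤ B * d := Nat.mul_le_mul_left _ h
          _ ≤ _ := Nat.le_add_left _ _
      simp [h.ne', not_lt.2 h.le, not_lt.2 this.le, this.ne']

/-- The numbers below `4 ^ n` whose digit at the position `v` is less than `x`. -/
def lowTab (n v x : ℕ) : ℕ :=
  nth 0 [0, digitTab n v 0, Nat.lor (digitTab n v 0) (digitTab n v 1),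
    Nat.lor (Nat.lor (digitTab n v 0) (digitTab n v 1)) (digitTab n v 2)] x

theorem testBit_lowTab {n v x i : ℕ} (hn : n ≤ 7) (hv : v < n) (hx : x < 4) (hi : i < 4 ^ n) :
    (lowTab n v x).testBit i = true ↔ dgt 4 i v < x := by
  have h (q : ℕ) (hq : q < 4) := testBit_digitTab hn hv hq hi
  have e1 : lowTab n v 2 = digitTab n v 0 ||| digitTab n v 1 := rfl
  have e2 : lowTab n v 3 = digitTab n v 0 ||| digitTab n v 1 ||| digitTab n v 2 := rfl
  interval_cases x
  · exact iff_of_false (by simp [lowTab, nth]) (by omega)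
  · exact (h 0 (by omega)).trans (by omega)
  · rw [e1, Nat.testBit_or, Bool.or_eq_true, h 0 (by omega), h 1 (by omega)]
    omega
  · rw [e2, Nat.testBit_or, Nat.testBit_or, Bool.or_eq_true, Bool.or_eq_true, h 0 (by omega),
      h 1 (by omega), h 2 (by omega)]
    omega

/-- The frames whose point at `u` comes before that of the image under the symmetry. -/
def pointLt (n S u : ℕ) : ℕ :=
  orLt 4 fun q => Nat.land (digitTab n (symVertex S u) q) (lowTab n u (Nat.mod (symImage S u q) 4))

/-- The frames whose point at `u` is equal to that of the image under the symmetry. -/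
def pointEq (n S u : ℕ) : ℕ :=
  orLt 4 fun q => Nat.land (digitTab n (symVertex S u) q)
    (digitTab n u (Nat.mod (symImage S u q) 4))

/-- The frames at which the sign of the image under the symmetry is changed at `u`. -/
def signFlip (n S u : ℕ) : ℕ :=
  orLt 4 fun q => Bool.rec 0 (digitTab n (symVertex S u) q) (Nat.ble 4 (symImage S u q))

theorem testBit_orLt_digitTab {n v i : ℕ} {f : ℕ → ℕ} (hn : n ≤ 7) (hv : v < n) (hi : i < 4 ^ n) :
    (orLt 4 fun q => Nat.land (digitTab n v q) (f q)).testBit i = true ↔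
      (f (dgt 4 i v)).testBit i = true := by
  rw [testBit_orLt]
  constructor
  · rintro ⟨q, hq, h⟩
    change (digitTab n v q &&& f q).testBit i = true at h
    rw [Nat.testBit_and, Bool.and_eq_true, testBit_digitTab hn hv hq hi] at h
    rw [h.1]; exact h.2
  · intro h
    have hq : dgt 4 i v < 4 := dgt_lt (by omega) _ _
    refine ⟨_, hq, ?_⟩
    change (digitTab n v _ &&& f _).testBit i = true
    rw [Nat.testBit_and, Bool.and_eq_true, testBit_digitTab hn hv hq hi]
    exact ⟨rfl, h⟩

theorem testBit_pointLt {n S u i : ℕ} (hn : n ≤ 7) (hu : u < n) (hv : symVertex S u < n)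
    (hi : i < 4 ^ n) : (pointLt n S u).testBit i = true ↔
      dgt 4 i u < symImage S u (dgt 4 i (symVertex S u)) % 4 := by
  rw [pointLt, testBit_orLt_digitTab hn hv hi]
  exact testBit_lowTab hn hu (Nat.mod_lt _ (by omega)) hi

theorem testBit_pointEq {n S u i : ℕ} (hn : n ≤ 7) (hu : u < n) (hv : symVertex S u < n)
    (hi : i < 4 ^ n) : (pointEq n S u).testBit i = true ↔
      dgt 4 i u = symImage S u (dgt 4 i (symVertex S u)) % 4 := by
  rw [pointEq, testBit_orLt_digitTab hn hv hi]
  exact testBit_digitTab hn hu (Nat.mod_lt _ (by omega)) hi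

theorem testBit_signFlip {n S u i : ℕ} (hn : n ≤ 7) (hv : symVertex S u < n)
    (hi : i < 4 ^ n) : (signFlip n S u).testBit i = true ↔
      symImage S u (dgt 4 i (symVertex S u)) / 4 = 1 := by
  have h8 := slImage_lt
  have key (q : ℕ) (hq : q < 4) : (Bool.rec 0 (digitTab n (symVertex S u) q)
      (Nat.ble 4 (symImage S u q)) : ℕ).testBit i = true ↔
      symImage S u q / 4 = 1 ∧ dgt 4 i (symVertex S u) = q := by
    have hlt : symImage S u q < 8 := slImage_lt _ _
    by_cases h4 : 4 ≤ symImage S u q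
    · rw [Nat.ble_eq_true_of_le h4]
      change (digitTab n (symVertex S u) q).testBit i = true ↔ _
      rw [testBit_digitTab hn hv hq hi]
      have : symImage S u q / 4 = 1 := by omega
      simp [this]
    · have : Nat.ble 4 (symImage S u q) = false :=
        Bool.eq_false_iff.2 fun h => h4 (Nat.le_of_ble_eq_true h)
      rw [this]
      refine iff_of_false (by simp) ?_
      omega
  rw [signFlip, testBit_orLt]
  constructor
  · rintro ⟨q, hq, h⟩
    obtain ⟨h1, h2⟩ := (key q hq).1 h
    rw [h2]; exact h1
  · exact fun h => ⟨_, dgt_lt (by omega) _ _, (key _ (dgt_lt (by omega) _ _)).2 ⟨h, rfl⟩⟩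

/-- The transversal frames whose points do not come after those of their images under the
symmetries of a list. -/
def firstPoints (n c : ℕ) (L : List ℕ) : ℕ :=
  List.rec (Nat.xor (allPoints n) (singularMask n c))
    (fun S _ ih => Nat.land ih (chainMask (pointLt n S) (pointEq n S) (allPoints n) n)) L

theorem testBit_point_chain {n S p p' X : ℕ} (hn : n ≤ 7) (hp : p < 4 ^ n) (hp' : p' < 4 ^ n)
    (hS : ∀ u < n, symVertex S u < n)
    (hd : ∀ u < n, dgt 4 p' u = symImage S u (dgt 4 p (symVertex S u)) % 4) :
    (chainMask (pointLt n S) (pointEq n S) X n).testBit p = true ↔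
      p < p' ∨ p = p' ∧ X.testBit p = true := by
  rw [testBit_chainMask (b := 4) (x := p) (y := p') (by omega)
    (fun u hu => by rw [testBit_pointLt hn hu (hS u hu) hp, hd u hu])
    (fun u hu => by rw [testBit_pointEq hn hu (hS u hu) hp, hd u hu]),
    Nat.mod_eq_of_lt hp, Nat.mod_eq_of_lt hp']

theorem IsFirstFrame.testBit_firstPoints {n c p s : ℕ} {H : WeightedGraph 3 n} (hn : n ≤ 7)
    (hp : p < 4 ^ n) (h : IsFirstFrame (ofCode n c) p s H) {L : List ℕ}
    (hL : ∀ S ∈ L, isSymmetry n (entry n c) S = true) :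
    (firstPoints n c L).testBit p = true := by
  induction L with
  | nil =>
    change (allPoints n ^^^ singularMask n c).testBit p = true
    have hf : (allPoints n).testBit p = true := testBit_full.2 hp
    rw [Nat.testBit_xor, h.1.not_testBit hn hp, hf]
    rfl
  | cons S L ih =>
    change (firstPoints n c L &&& chainMask (pointLt n S) (pointEq n S) (allPoints n) n).testBit p
      = true
    obtain ⟨hS, p', hp', s', hs', hpd, hsd, hle⟩ := h.le_of_isSymmetry (hL S (by simp))
    rw [Nat.testBit_and, Bool.and_eq_true, testBit_point_chain hn hp hp' hS hpd]
    exact ⟨ih fun S hS => hL S (by simp [hS]),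
      hle.imp_right fun h => ⟨h.1, testBit_full.2 hp⟩⟩

/-- The frames, including signs with the last sign equal to zero, whose sign at `u` is one. The
frame with the points `p` and the signs `s` has the number `s * 4 ^ n + p`. -/
def signMask (n u : ℕ) : ℕ :=
  Bool.rec 0 (stripe (Nat.sub n (Nat.add u 2)) (Nat.mul (Nat.pow 4 n) (Nat.pow 2 u)) 2 1)
    (Nat.ble (Nat.add u 2) n)

/-- The masks `signMask n u`, written as equal terms. -/
def signTab (n u : ℕ) : ℕ :=
  nth 0 [signMask n 0, signMask n 1, signMask n 2, signMask n 3, signMask n 4, signMask n 5] u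

theorem frame_lt {n s p : ℕ} (hs : s < 2 ^ (n - 1)) (hp : p < 4 ^ n) :
    s * 4 ^ n + p < 4 ^ n * 2 ^ (n - 1) := by
  calc _ < (s + 1) * 4 ^ n := by rw [add_mul]; omega
    _ ≤ 2 ^ (n - 1) * 4 ^ n := Nat.mul_le_mul_right _ hs
    _ = _ := mul_comm _ _

theorem testBit_signTab {n u s p : ℕ} (hn : n ≤ 7) (hu : u < n) (hs : s < 2 ^ (n - 1))
    (hp : p < 4 ^ n) : (signTab n u).testBit (s * 4 ^ n + p) = true ↔ dgt 2 s u = 1 := by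
  have e : signTab n u = signMask n u := by
    have : u < 7 := by omega
    interval_cases u <;> try rfl
    have : n = 7 := by omega
    subst this
    rfl
  rw [e, signMask]
  by_cases h2 : u + 2 ≤ n
  · rw [show Nat.ble (Nat.add u 2) n = true from Nat.ble_eq_true_of_le h2]
    change (stripe (n - (u + 2)) (4 ^ n * 2 ^ u) 2 1).testBit _ = true ↔ _
    rw [testBit_stripe (by omega)]
    · rw [← Nat.div_div_eq_div_mul, add_comm, Nat.add_mul_div_right _ _ (by positivity),
        Nat.div_eq_of_lt hp, zero_add]
      rfl
    · rw [mul_assoc, mul_assoc, ← pow_succ', ← pow_add, show u + (n - (u + 2) + 1) = n - 1 by omega]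
      exact frame_lt hs hp
  · have : Nat.ble (Nat.add u 2) n = false :=
      Bool.eq_false_iff.2 fun h => h2 (Nat.le_of_ble_eq_true h)
    rw [this]
    refine iff_of_false (by simp) ?_
    rw [dgt, Nat.div_eq_of_lt (hs.trans_le (Nat.pow_le_pow_right (by omega) (by omega)))]
    decide

/-- A set of frames without signs, as a set of frames with signs. -/
def withSigns (n X : ℕ) : ℕ := tile (Nat.sub n 1) (Nat.pow 4 n) (Nat.land X (allPoints n))

theorem testBit_withSigns {n s p : ℕ} (X : ℕ) (hs : s < 2 ^ (n - 1)) (hp : p < 4 ^ n) :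
    (withSigns n X).testBit (s * 4 ^ n + p) = X.testBit p := by
  have hlt : allPoints n < 2 ^ 4 ^ n := Nat.sub_lt (pow_pos (by omega) _) (by omega)
  have hf : (allPoints n).testBit p = true := testBit_full.2 hp
  refine (testBit_tile (Nat.and_lt_two_pow X hlt) (frame_lt hs hp)).trans ?_
  rw [Nat.mul_add_mod_self_right, Nat.mod_eq_of_lt hp, Nat.testBit_and, hf, Bool.and_true]

/-- The signs of the image of a frame under a symmetry. -/
def imageSign (n S u : ℕ) : ℕ :=
  Nat.xor (signTab n (symVertex S u)) (withSigns n (signFlip n S u))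

theorem testBit_imageSign {n S u s p : ℕ} (hn : n ≤ 7) (hv : symVertex S u < n)
    (hs : s < 2 ^ (n - 1)) (hp : p < 4 ^ n) :
    (imageSign n S u).testBit (s * 4 ^ n + p) = true ↔
      (dgt 2 s (symVertex S u) + symImage S u (dgt 4 p (symVertex S u)) / 4) % 2 = 1 := by
  have h1 := testBit_signTab hn hv hs hp
  have h2 := testBit_signFlip hn hv hp
  have h3 : dgt 2 s (symVertex S u) < 2 := dgt_lt (by omega) _ _
  have h4 : symImage S u (dgt 4 p (symVertex S u)) < 8 := slImage_lt _ _
  change (signTab n (symVertex S u) ^^^ withSigns n (signFlip n S u)).testBit _ = true ↔ _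
  rw [Nat.testBit_xor, testBit_withSigns _ hs hp]
  cases ha : (signTab n (symVertex S u)).testBit (s * 4 ^ n + p) <;>
    cases hb : (signFlip n S u).testBit p <;> simp only [ha, hb] at h1 h2 <;>
    simp at h1 h2 ⊢ <;> omega

/-- The frames whose signs do not come after those of their images under the symmetry. -/
def signChain (n S k : ℕ) : ℕ :=
  Nat.rec (full (Nat.mul (Nat.pow 4 n) (Nat.pow 2 (Nat.sub n 1))))
    (fun u ih => Nat.xor ih (Nat.land (Nat.xor (imageSign n S u) (signTab n u))
      (Nat.xor ih (imageSign n S u)))) k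

theorem testBit_signChain {n S s s' p k : ℕ} (hn : n ≤ 7) (hS : ∀ u < n, symVertex S u < n)
    (hs : s < 2 ^ (n - 1)) (hp : p < 4 ^ n) (hk : k ≤ n)
    (hd : ∀ u < n, dgt 2 s' u =
      (dgt 2 s (symVertex S u) + symImage S u (dgt 4 p (symVertex S u)) / 4) % 2) :
    (signChain n S k).testBit (s * 4 ^ n + p) = true ↔ s % 2 ^ k ≤ s' % 2 ^ k := by
  induction k with
  | zero =>
    simp only [pow_zero, Nat.mod_one, le_refl, iff_true]
    exact testBit_full.2 (frame_lt hs hp)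
  | succ k ih =>
    have ih := ih (by omega)
    have h1 := testBit_imageSign (S := S) (u := k) hn (hS k hk) hs hp
    rw [← hd k hk] at h1
    have h2 := testBit_signTab hn hk hs hp
    have h3 : dgt 2 s k < 2 := dgt_lt (by omega) _ _
    have h4 : dgt 2 s' k < 2 := dgt_lt (by omega) _ _
    rw [Nat.mod_pow_succ, Nat.mod_pow_succ]
    have hx : s % 2 ^ k < 2 ^ k := Nat.mod_lt _ (by positivity)
    have hy : s' % 2 ^ k < 2 ^ k := Nat.mod_lt _ (by positivity)
    change (signChain n S k ^^^ ((imageSign n S k ^^^ signTab n k) &&&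
      (signChain n S k ^^^ imageSign n S k))).testBit _ = true ↔
      s % 2 ^ k + 2 ^ k * dgt 2 s k ≤ s' % 2 ^ k + 2 ^ k * dgt 2 s' k
    rw [Nat.testBit_xor, Nat.testBit_and, Nat.testBit_xor, Nat.testBit_xor]
    generalize dgt 2 s k = d at *
    generalize dgt 2 s' k = d' at *
    generalize s % 2 ^ k = r at *
    generalize s' % 2 ^ k = r' at *
    generalize 2 ^ k = B at *
    cases ha : (imageSign n S k).testBit (s * 4 ^ n + p) <;>
      cases hb : (signTab n k).testBit (s * 4 ^ n + p) <;>
      cases hc : (signChain n S k).testBit (s * 4 ^ n + p) <;>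
      simp only [ha, hb, hc] at h1 h2 ih <;>
      interval_cases d <;> interval_cases d' <;> simp at h1 h2 ih ⊢ <;> omega

/-- The frames, including signs, that do not come after their images under the symmetries of a
list, where the points `P` come from `firstPoints`. -/
def firstFrames (n P : ℕ) (L : List ℕ) : ℕ :=
  List.rec (withSigns n P)
    (fun S _ ih => Bool.rec
      (Nat.land ih (Nat.lor (withSigns n (chainMask (pointLt n S) (pointEq n S) 0 n))
        (signChain n S n))) ih
      (Nat.beq (Nat.land P (chainMask (pointLt n S) (pointEq n S) 0 n)) P)) L

theorem IsFirstFrame.testBit_firstFrames {n c p s P : ℕ} {H : WeightedGraph 3 n} (hn : n ≤ 7)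
    (hp : p < 4 ^ n) (hs : s < 2 ^ (n - 1)) (h : IsFirstFrame (ofCode n c) p s H)
    (hP : P.testBit p = true) {L : List ℕ} (hL : ∀ S ∈ L, isSymmetry n (entry n c) S = true) :
    (firstFrames n P L).testBit (s * 4 ^ n + p) = true := by
  induction L with
  | nil => exact (testBit_withSigns P hs hp).trans hP
  | cons S L ih =>
    have ih := ih fun S hS => hL S (by simp [hS])
    change (Bool.rec (firstFrames n P L &&& (withSigns n (chainMask (pointLt n S) (pointEq n S) 0 n)
      ||| signChain n S n)) (firstFrames n P L) (Nat.beq _ _) : ℕ).testBit _ = true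
    cases Nat.beq (Nat.land P (chainMask (pointLt n S) (pointEq n S) 0 n)) P with
    | true => exact ih
    | false =>
      obtain ⟨hS, p', hp', s', hs', hpd, hsd, hle⟩ := h.le_of_isSymmetry (hL S (by simp))
      change (firstFrames n P L &&& (withSigns n (chainMask (pointLt n S) (pointEq n S) 0 n)
        ||| signChain n S n)).testBit _ = true
      rw [Nat.testBit_and, Nat.testBit_or, testBit_withSigns _ hs hp, Bool.and_eq_true,
        Bool.or_eq_true, testBit_point_chain hn hp hp' hS hpd,
        testBit_signChain hn hS hs hp le_rfl hsd]
      refine ⟨ih, hle.imp Or.inl fun h => ?_⟩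
      exact (Nat.mod_le _ _).trans (h.2.trans (Nat.mod_eq_of_lt hs').ge)

theorem vec_neg : ∀ q < 4, ∀ s < 2,
    ((vecA (q + 4 * (1 - s)) : ℕ) : ZMod 3) = -(vecA (q + 4 * s) : ℕ) ∧
      ((vecB (q + 4 * (1 - s)) : ℕ) : ZMod 3) = -(vecB (q + 4 * s) : ℕ) := by decide

/-- The last sign of a first frame is zero, because all the signs may be changed. -/
theorem IsFirstFrame.sign_lt {n p s : ℕ} {G H : WeightedGraph 3 n} (hn : 0 < n) (hp : p < 4 ^ n)
    (hs : s < 2 ^ n) (h : IsFirstFrame G p s H) : s < 2 ^ (n - 1) := by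
  obtain ⟨s', hs', hd⟩ := exists_dgt_eq (n := n) (b := 2) (fun u => 1 - dgt 2 s u)
    fun _ => by omega
  have hle : s ≤ s' := by
    obtain ⟨⟨C, D, hf⟩, hmin⟩ := h
    refine ((hmin p hp s' hs' H ⟨fun v => -C v, fun v => -D v, ?_⟩
      (WeightedGraph.isomorphic_equivalence.refl H)).resolve_left (lt_irrefl p)).2
    have ha : frameA n p s' = fun v => -frameA n p s v := by
      ext u
      simp only [frameA, frameIdx, hd]
      exact (vec_neg _ (dgt_lt (by omega) _ _) _ (dgt_lt (by omega) _ _)).1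
    have hb : frameB n p s' = fun v => -frameB n p s v := by
      ext u
      simp only [frameB, frameIdx, hd]
      exact (vec_neg _ (dgt_lt (by omega) _ _) _ (dgt_lt (by omega) _ _)).2
    rw [ha, hb]
    exact hf.neg
  by_contra hcon
  have h2 : s / 2 ^ (n - 1) = 1 := by
    have hpow : 2 ^ n = 2 ^ (n - 1) * 2 := by rw [← pow_succ]; congr 1; omega
    rw [Nat.div_eq_iff (by positivity)]
    omega
  have h3 : dgt 2 s' (n - 1) = 1 - dgt 2 s (n - 1) := hd ⟨n - 1, by omega⟩
  have h4 : s' / 2 ^ (n - 1) < 2 := by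
    rw [Nat.div_lt_iff_lt_mul (by positivity), ← pow_succ', show n - 1 + 1 = n by omega]
    exact hs'
  have h5 := Nat.div_le_div_right (c := 2 ^ (n - 1)) hle
  simp only [dgt, h2] at h3
  omega

/-- The size of a Clifford class is at most the number of frames that do not come after their images
under some symmetries. -/
theorem ncard_cliffordClass_le_popcount {n c : ℕ} (h3 : 3 ≤ n) (h7 : n ≤ 7) {L : List ℕ}
    (hL : ∀ S ∈ L, isSymmetry n (entry n c) S = true) :
    (cliffordClass (ofCode n c)).ncard ≤
      popcount (3 * n - 6) (firstFrames n (firstPoints n c L) L) := by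
  rw [← card_filter_testBit _ _ (by omega)]
  refine ncard_cliffordClass_le _ _ fun p hp s hs H h => ?_
  have hs' := h.sign_lt (by omega) hp hs
  rw [Finset.mem_filter, Finset.mem_range]
  refine ⟨?_, h.testBit_firstFrames h7 hp hs' (h.testBit_firstPoints h7 hp hL) hL⟩
  have e : 32 * 2 ^ (3 * n - 6) = 4 ^ n * 2 ^ (n - 1) := by
    rw [show (4 : ℕ) = 2 ^ 2 from rfl, ← pow_mul, ← pow_add, show 32 = 2 ^ 5 from rfl, ← pow_add]
    congr 1
    omega
  rw [e]
  exact frame_lt hs' hp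

end FirstFrames

/-! ### The upper triangle of an adjacency matrix -/

section UpperTriangle

variable {n : ℕ}

/-- The pairs of vertices above the diagonal, row by row. -/
def upperPairs (n : ℕ) : List (Fin n × Fin n) :=
  (List.finRange n).flatMap fun u => ((List.finRange n).filter fun v => u < v).map fun v => (u, v)

theorem upperTriangle_eq_map (G : WeightedGraph 3 n) :
    G.upperTriangle = (upperPairs n).map fun e => (G.Γ e.1 e.2).val := by
  simp only [WeightedGraph.upperTriangle, upperPairs, List.map_flatMap, List.map_map]
  rfl

theorem two_mul_sum_upperPairs (f : Fin n → Fin n → ℕ) (h : ∀ u v, f u v = f v u)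
    (h0 : ∀ u, f u u = 0) :
    2 * ((upperPairs n).map fun e => f e.1 e.2).sum = ∑ u, ∑ v, f u v := by
  have hfilter (l : List (Fin n)) (u : Fin n) :
      ((l.filter fun v => u < v).map fun v => f u v).sum =
        (l.map fun v => if u < v then f u v else 0).sum := by
    induction l with
    | nil => rfl
    | cons a l ih => by_cases hu : u < a <;> simp [hu, ih]
  have h1 : ((upperPairs n).map fun e => f e.1 e.2).sum =
      ∑ u, ∑ v, if u < v then f u v else 0 := by
    rw [upperPairs, List.map_flatMap, List.flatMap_def, List.sum_flatten, List.map_map,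
      Fin.sum_univ_def]
    congr 1
    refine List.map_congr_left fun u _ => ?_
    rw [Function.comp_apply, List.map_map, Fin.sum_univ_def, ← hfilter]
    rfl
  have h2 : ((upperPairs n).map fun e => f e.1 e.2).sum =
      ∑ u, ∑ v, if v < u then f u v else 0 := by
    rw [h1, Finset.sum_comm]
    exact Finset.sum_congr rfl fun u _ => Finset.sum_congr rfl fun v _ => by rw [h]
  rw [two_mul]
  nth_rewrite 1 [h1]
  rw [h2, ← Finset.sum_add_distrib]
  refine Finset.sum_congr rfl fun u _ => ?_
  rw [← Finset.sum_add_distrib]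
  refine Finset.sum_congr rfl fun v _ => ?_
  rcases lt_trichotomy u v with huv | rfl | huv
  · simp [huv, not_lt.2 huv.le]
  · simp [h0]
  · simp [huv, not_lt.2 huv.le]

theorem sum_upperPairs_relabel (f : Fin n → Fin n → ℕ) (h : ∀ u v, f u v = f v u)
    (h0 : ∀ u, f u u = 0) (σ : Equiv.Perm (Fin n)) :
    ((upperPairs n).map fun e => f (σ e.1) (σ e.2)).sum =
      ((upperPairs n).map fun e => f e.1 e.2).sum := by
  have h1 := two_mul_sum_upperPairs f h h0
  have h2 := two_mul_sum_upperPairs (fun u v => f (σ u) (σ v)) (fun u v => h _ _) fun u => h0 _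
  have h3 : ∑ u, ∑ v, f (σ u) (σ v) = ∑ u, ∑ v, f u v := by
    rw [← Equiv.sum_comp σ (fun u => ∑ v, f u v)]
    exact Finset.sum_congr rfl fun u _ => Equiv.sum_comp σ (f (σ u))
  omega

theorem totalWeight_relabel (G : WeightedGraph 3 n) (σ : Equiv.Perm (Fin n)) :
    (G.relabel σ).totalWeight = G.totalWeight := by
  rw [WeightedGraph.totalWeight, WeightedGraph.totalWeight, upperTriangle_eq_map,
    upperTriangle_eq_map]
  exact sum_upperPairs_relabel (fun u v => (G.Γ u v).val) (fun u v => by rw [G.symm])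
    (fun u => by simp [G.loopless]) σ

theorem edgeCount_eq_sum (G : WeightedGraph 3 n) :
    G.edgeCount = ((upperPairs n).map fun e => if G.Γ e.1 e.2 ≠ 0 then 1 else 0).sum := by
  rw [WeightedGraph.edgeCount, upperTriangle_eq_map]
  generalize upperPairs n = l
  induction l with
  | nil => rfl
  | cons e l ih =>
    rw [List.map_cons, List.countP_cons, ih, List.map_cons, List.sum_cons, add_comm]
    simp

theorem edgeCount_relabel (G : WeightedGraph 3 n) (σ : Equiv.Perm (Fin n)) :
    (G.relabel σ).edgeCount = G.edgeCount := by
  rw [edgeCount_eq_sum, edgeCount_eq_sum]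
  exact sum_upperPairs_relabel (fun u v => if G.Γ u v ≠ 0 then 1 else 0)
    (fun u v => by rw [G.symm]) (fun u => by simp [G.loopless]) σ

theorem edgeCount_add_countP (G : WeightedGraph 3 n) :
    G.edgeCount + (upperPairs n).countP (fun e => G.Γ e.1 e.2 = 0) = (upperPairs n).length := by
  rw [edgeCount_eq_sum]
  generalize upperPairs n = l
  induction l with
  | nil => rfl
  | cons e l ih =>
    rw [List.map_cons, List.sum_cons, List.countP_cons, List.length_cons, ← ih]
    by_cases h : G.Γ e.1 e.2 = 0 <;> simp [h] <;> omega

end UpperTriangle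

/-! ### The minimum number of edges in a Clifford class -/

section Edges

/-- The set `Y` of numbers with the digit zero at the position `v`, with all other digits put
there. -/
def spreadDigit (v Y : ℕ) : ℕ := orLt 4 fun k => Nat.shiftLeft Y (Nat.mul k (Nat.pow 4 v))

/-- The numbers that can be moved into the set `V` by a change of the digit at the position `v`. -/
def someDigit (n v V : ℕ) : ℕ :=
  spreadDigit v (Nat.land (orLt 4 fun k => Nat.shiftRight V (Nat.mul k (Nat.pow 4 v)))
    (digitTab n v 0))

/-- The numbers that stay in the set `V` under all changes of the digit at the position `v`. -/
def everyDigit (n v V : ℕ) : ℕ :=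
  spreadDigit v (Nat.land (Nat.land (Nat.land V (Nat.shiftRight V (Nat.pow 4 v)))
    (Nat.land (Nat.shiftRight V (Nat.mul 2 (Nat.pow 4 v)))
      (Nat.shiftRight V (Nat.mul 3 (Nat.pow 4 v))))) (digitTab n v 0))

theorem testBit_spreadDigit {v Y i y : ℕ} (hy : y < 4) (h : Y.testBit i = true) :
    (spreadDigit v Y).testBit (i + y * 4 ^ v) = true := by
  refine testBit_orLt.2 ⟨y, hy, ?_⟩
  change (Y <<< (y * 4 ^ v)).testBit _ = true
  simpa [Nat.testBit_shiftLeft] using h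

theorem testBit_someDigit {n v V i x y : ℕ} (hn : n ≤ 7) (hv : v < n) (hi : i < 4 ^ n)
    (h0 : dgt 4 i v = 0) (hx : x < 4) (hy : y < 4) (h : V.testBit (i + x * 4 ^ v) = true) :
    (someDigit n v V).testBit (i + y * 4 ^ v) = true := by
  refine testBit_spreadDigit hy ?_
  change ((orLt 4 fun k => Nat.shiftRight V (k * 4 ^ v)) &&& digitTab n v 0).testBit i = true
  rw [Nat.testBit_and, Bool.and_eq_true, testBit_digitTab hn hv (by omega) hi]
  refine ⟨testBit_orLt.2 ⟨x, hx, ?_⟩, h0⟩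
  change (V >>> (x * 4 ^ v)).testBit i = true
  rwa [Nat.testBit_shiftRight, add_comm]

theorem testBit_everyDigit {n v V i y : ℕ} (hn : n ≤ 7) (hv : v < n) (hi : i < 4 ^ n)
    (h0 : dgt 4 i v = 0) (hy : y < 4) (h : ∀ x < 4, V.testBit (i + x * 4 ^ v) = true) :
    (everyDigit n v V).testBit (i + y * 4 ^ v) = true := by
  refine testBit_spreadDigit hy ?_
  change ((V &&& (V >>> 4 ^ v)) &&& ((V >>> (2 * 4 ^ v)) &&& (V >>> (3 * 4 ^ v))) &&&
    digitTab n v 0).testBit i = true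
  simp only [Nat.testBit_and, Bool.and_eq_true, testBit_digitTab hn hv (by omega : 0 < 4) hi,
    Nat.testBit_shiftRight, add_comm _ i]
  have h1 := h 0 (by omega)
  have h2 := h 1 (by omega)
  rw [zero_mul, add_zero] at h1
  rw [one_mul] at h2
  exact ⟨⟨⟨h1, h2⟩, h 2 (by omega), h 3 (by omega)⟩, h0⟩

/-- The frames for which the vertices `u` and `v` are not adjacent: there is a point at `u` such
that no point at `v` makes the frame transversal. -/
def nonedgeMask (n c u v : ℕ) : ℕ := someDigit n u (everyDigit n v (singularMask n c))

theorem eq_pack_dgt {n p : ℕ} (hp : p < 4 ^ n) : p = pack 4 n (dgt 4 p) :=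
  dgt_ext (b := 4) (by omega) hp (pack_lt fun _ _ => dgt_lt (b := 4) (by omega) _ _) fun _ hv =>
    (dgt_pack (f := dgt 4 p) hv fun _ _ => dgt_lt (b := 4) (by omega) _ _).symm

theorem pack_ite {b n v x : ℕ} (hv : v < n) (f : ℕ → ℕ) :
    (pack b n fun k => if k = v then x else f k) =
      (pack b n fun k => if k = v then 0 else f k) + x * b ^ v := by
  unfold pack
  rw [sumLt_eq, sumLt_eq]
  have : x * b ^ v = ∑ k : Fin n, if (k : ℕ) = v then x * b ^ (k : ℕ) else 0 := by
    rw [Finset.sum_eq_single (⟨v, hv⟩ : Fin n)]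
    · simp
    · intro k _ hk
      rw [if_neg fun h => hk (Fin.ext h)]
    · simp
  rw [this, ← Finset.sum_add_distrib]
  refine Finset.sum_congr rfl fun k _ => ?_
  change (if (k : ℕ) = v then x else f k) * b ^ (k : ℕ) =
    (if (k : ℕ) = v then 0 else f k) * b ^ (k : ℕ) + _
  split_ifs <;> simp

theorem exists_point : ∀ x y : ZMod 3, ∃ q < 4,
    ((vecA q : ℕ) * x + (vecB q : ℕ) * y : ZMod 3) = 0 := by decide

open Matrix in
/-- If `H u v = 0`, then the vector of the Lagrangian subspace whose coordinates with respect to the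
frame form the `u`-th unit vector vanishes at `v`; so it shows that there is a point at `u` for
which no point at `v` makes the frame transversal. -/
theorem FramedBy.testBit_nonedgeMask {n c p s : ℕ} {H : WeightedGraph 3 n} (hn : n ≤ 7)
    (hp : p < 4 ^ n) (h : FramedBy (ofCode n c) p s H) {u v : Fin n} (huv : u ≠ v)
    (h0 : H.Γ u v = 0) : (nonedgeMask n c u v).testBit p = true := by
  have hd4 (i k : ℕ) : dgt 4 i k < 4 := dgt_lt (by omega) _ _
  have hne : (u : ℕ) ≠ v := fun h => huv (Fin.ext h)
  obtain ⟨C, D, h⟩ := h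
  set G := ofCode n c
  set x : Fin n → ZMod 3 := (diagonal D - diagonal (frameB n p s) * H.Γ) *ᵥ Pi.single u 1 with hx
  have h1 : (diagonal (frameA n p s) + diagonal (frameB n p s) * G.Γ) *ᵥ x = Pi.single u 1 := by
    rw [hx, Matrix.mulVec_mulVec, h.mul_inv, Matrix.one_mulVec]
  have h2 : (diagonal C + diagonal D * G.Γ) *ᵥ x = H.Γ *ᵥ Pi.single u 1 := by
    rw [← h.map, ← Matrix.mulVec_mulVec, h1]
  have h1' (w) : frameA n p s w * x w + frameB n p s w * (G.Γ *ᵥ x) w =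
      (Pi.single u 1 : Fin n → ZMod 3) w := by
    rw [← h1, Matrix.add_mulVec, ← Matrix.mulVec_mulVec, Pi.add_apply, Matrix.mulVec_diagonal,
      Matrix.mulVec_diagonal]
  have h2' (w) : C w * x w + D w * (G.Γ *ᵥ x) w = H.Γ w u := by
    have := congrFun h2 w
    rw [Matrix.add_mulVec, ← Matrix.mulVec_mulVec, Pi.add_apply, Matrix.mulVec_diagonal,
      Matrix.mulVec_diagonal] at this
    rw [this, Matrix.mulVec_single_one]
    rfl
  have hx0 : x ≠ 0 := by
    intro hx0
    have := h1' u
    simp [hx0] at this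
  have e1 := h1' v
  have e2 := h2' v
  rw [Pi.single_eq_of_ne huv.symm] at e1
  rw [H.symm, h0] at e2
  have hxv : x v = 0 := by
    linear_combination D v * e1 - frameB n p s v * e2 - x v * h.det v
  have hyv : (G.Γ *ᵥ x) v = 0 := by
    linear_combination frameA n p s v * e2 - C v * e1 - (G.Γ *ᵥ x) v * h.det v
  obtain ⟨q, hq, hq0⟩ := exists_point (x u) ((G.Γ *ᵥ x) u)
  -- the points of the frame `p`, with other points at `u` and `v`
  let F : ℕ → ℕ → ℕ → ℕ := fun a b k => if k = u then a else if k = v then b else dgt 4 p k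
  have hF (a b) (ha : a < 4) (hb : b < 4) (k : ℕ) : F a b k < 4 := by
    simp only [F]
    split_ifs
    · exact ha
    · exact hb
    · exact hd4 _ _
  have hlt (a b) (ha : a < 4) (hb : b < 4) : pack 4 n (F a b) < 4 ^ n :=
    pack_lt fun k _ => hF a b ha hb k
  have hdg (a b) (ha : a < 4) (hb : b < 4) (k : ℕ) (hk : k < n) :
      dgt 4 (pack 4 n (F a b)) k = F a b k := dgt_pack hk fun k _ => hF a b ha hb k
  have hFu (a b) : pack 4 n (F a b) = pack 4 n (F 0 b) + a * 4 ^ (u : ℕ) := pack_ite u.2 _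
  have hFv (a b) : pack 4 n (F a b) = pack 4 n (F a 0) + b * 4 ^ (v : ℕ) := by
    have hsw (b) : F a b = fun k : ℕ => if k = v then b else if k = u then a else dgt 4 p k := by
      ext k
      simp only [F]
      by_cases h1 : k = u
      · have h2 : k ≠ v := fun h2 => hne (h1.symm.trans h2)
        simp [h1, hne]
      · simp [h1]
    rw [hsw, hsw]
    exact pack_ite v.2 _
  have hbit (b) (hb : b < 4) : (singularMask n c).testBit (pack 4 n (F q b)) = true := by
    refine (testBit_singularMask hn (hlt _ _ hq hb)).2 ⟨x, hx0, fun w => ?_⟩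
    rw [hdg _ _ hq hb w w.2]
    by_cases hwu : w = u
    · subst hwu
      simpa [F] using hq0
    · have hwu' : (w : ℕ) ≠ u := fun h => hwu (Fin.ext h)
      by_cases hwv : w = v
      · rw [hwv, hxv, hyv, mul_zero, mul_zero, add_zero]
      · have hwv' : (w : ℕ) ≠ v := fun h => hwv (Fin.ext h)
        simp only [F, hwu', hwv', if_false]
        refine (vec_sign _ (hd4 _ _) _ (dgt_lt (by omega) s w) _ _).1 ?_
        have := h1' w
        rwa [Pi.single_eq_of_ne hwu] at this
  have hp' : p = pack 4 n (F (dgt 4 p u) (dgt 4 p v)) := by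
    conv_lhs => rw [eq_pack_dgt hp]
    refine pack_congr fun k _ => ?_
    simp only [F]
    split_ifs with h1 h2
    · rw [h1]
    · rw [h2]
    · rfl
  rw [hp', hFu]
  refine testBit_someDigit hn u.2 (hlt _ _ (by omega) (hd4 _ _)) ?_ hq (hd4 _ _) ?_
  · rw [hdg _ _ (by omega) (hd4 _ _) u u.2]
    simp [F]
  · rw [← hFu, hFv]
    refine testBit_everyDigit hn v.2 (hlt _ _ hq (by omega)) ?_ (hd4 _ _) fun y hy => ?_
    · rw [hdg _ _ hq (by omega) v v.2]
      simp [F, hne.symm]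
    · rw [← hFv]
      exact hbit y hy

/-- The frames that belong to at least `j` of the sets `N u v`, for the pairs of a list. -/
def atLeastMask {n : ℕ} (N : ℕ → ℕ → ℕ) (l : List (Fin n × Fin n)) : ℕ → ℕ :=
  List.rec (fun j => Nat.rec (allPoints n) (fun _ _ => 0) j)
    (fun e _ ih j => Nat.rec (allPoints n)
      (fun k _ => Nat.lor (ih (Nat.succ k)) (Nat.land (N e.1 e.2) (ih k))) j) l

theorem testBit_atLeastMask {n p j : ℕ} (hp : p < 4 ^ n) {N : ℕ → ℕ → ℕ}
    {l : List (Fin n × Fin n)} {P : Fin n × Fin n → Bool}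
    (hN : ∀ e ∈ l, P e = true → (N e.1 e.2).testBit p = true) (hj : j ≤ l.countP P) :
    (atLeastMask N l j).testBit p = true := by
  have hf : (allPoints n).testBit p = true := testBit_full.2 hp
  induction l generalizing j with
  | nil =>
    obtain rfl : j = 0 := by simpa using hj
    exact hf
  | cons e l ih =>
    cases j with
    | zero => exact hf
    | succ k =>
      change (atLeastMask N l (k + 1) ||| (N e.1 e.2 &&& atLeastMask N l k)).testBit p = true
      rw [Nat.testBit_or, Nat.testBit_and, Bool.or_eq_true, Bool.and_eq_true]
      have ih (j) := ih (j := j) fun e he => hN e (by simp [he])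
      rw [List.countP_cons] at hj
      by_cases he : P e = true
      · rw [if_pos he] at hj
        exact Or.inr ⟨hN e (by simp) he, ih k (by omega)⟩
      · rw [if_neg he] at hj
        exact Or.inl (ih (k + 1) (by omega))

/-- The frames in `P` that may lead to graphs with at most `e` edges. -/
def fewEdges (n c P e : ℕ) : ℕ :=
  Nat.land P (atLeastMask (nonedgeMask n c) (upperPairs n) (Nat.sub (upperPairs n).length e))

theorem ne_of_mem_upperPairs {n : ℕ} {e : Fin n × Fin n} (he : e ∈ upperPairs n) : e.1 ≠ e.2 := by
  simp only [upperPairs, List.mem_flatMap, List.mem_map, List.mem_filter] at he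
  obtain ⟨u, -, v, ⟨-, h⟩, rfl⟩ := he
  exact (of_decide_eq_true h).ne

theorem FramedBy.testBit_fewEdges {n c p s P e : ℕ} {H : WeightedGraph 3 n} (hn : n ≤ 7)
    (hp : p < 4 ^ n) (h : FramedBy (ofCode n c) p s H) (hP : P.testBit p = true)
    (he : H.edgeCount ≤ e) : (fewEdges n c P e).testBit p = true := by
  change (P &&& atLeastMask (nonedgeMask n c) (upperPairs n) ((upperPairs n).length - e)).testBit p
    = true
  rw [Nat.testBit_and, hP, Bool.true_and]
  refine testBit_atLeastMask hp (P := fun e => H.Γ e.1 e.2 = 0) (fun e he h0 => ?_) ?_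
  · exact h.testBit_nonedgeMask hn hp (ne_of_mem_upperPairs he) (of_decide_eq_true h0)
  · have := edgeCount_add_countP H
    omega

end Edges

/-! ### The smallest encoding of a weighted graph -/

section Encoding

/-- The digits in the row of the vertex `x`, for the vertices of the list `l`. -/
def rowValue (K : ℕ → ℕ → ℕ) (x : ℕ) (l : List ℕ) : ℕ :=
  List.rec 0 (fun y _ ih => Nat.add (K x y) (Nat.mul 4 ih)) l

/-- The encoding of the matrix `K` with rows and columns in the order of a list. -/
def listEncoding (K : ℕ → ℕ → ℕ) : List ℕ → ℕ
  | [] => 0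
  | x :: l => rowValue K x l + 4 ^ l.length * listEncoding K l

theorem rowValue_eq (K : ℕ → ℕ → ℕ) (x : ℕ) (l : List ℕ) :
    rowValue K x l = Nat.ofDigits 4 (l.map (K x)) := by
  induction l with
  | nil => rfl
  | cons y l ih =>
    rw [List.map_cons, Nat.ofDigits_cons, ← ih]
    rfl

theorem listEncoding_eq (K : ℕ → ℕ → ℕ) : ∀ l : List ℕ, ∀ r : ℕ → List ℕ,
    (∀ i < l.length, r i = l.drop (i + 1)) →
    listEncoding K l = Nat.ofDigits 4 ((List.range l.length).flatMap fun i =>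
      (r i).map (K (l.getD i 0)))
  | [], _, _ => rfl
  | x :: l, r, h => by
    rw [listEncoding, rowValue_eq, listEncoding_eq K l (fun i => r (i + 1)) fun i hi => by
      rw [h _ (by simpa using hi)]; rfl]
    rw [List.length_cons, List.range_succ_eq_map, List.flatMap_cons, Nat.ofDigits_append,
      h 0 (by simp), List.flatMap_map]
    simp

theorem encoding_relabel {n : ℕ} (G : WeightedGraph 3 n) (K : ℕ → ℕ → ℕ)
    (hK : ∀ u v : Fin n, (G.Γ u v).val = K u v) (σ : Equiv.Perm (Fin n)) :
    (G.relabel σ).encoding = listEncoding K ((List.finRange n).map fun u => (σ u : ℕ)) := by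
  have hr (i) (hi : i < n) : ((List.finRange n).filter fun v => i < v.1).map (fun v => (σ v : ℕ)) =
      ((List.finRange n).map fun u => (σ u : ℕ)).drop (i + 1) := by
    rw [← List.map_drop]
    congr 1
    have h1 : List.finRange n = (List.finRange n).take (i + 1) ++ (List.finRange n).drop (i + 1) :=
      (List.take_append_drop _ _).symm
    conv_lhs => rw [h1, List.filter_append]
    rw [List.filter_eq_nil_iff.2, List.filter_eq_self.2, List.nil_append]
    · intro v hv
      obtain ⟨j, hj, rfl⟩ := List.mem_iff_getElem.1 hv
      simp
      omega
    · intro v hv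
      obtain ⟨j, hj, rfl⟩ := List.mem_iff_getElem.1 hv
      simp at hj ⊢
      omega
  rw [listEncoding_eq K _ (fun i => ((List.finRange n).filter fun v => i < v.1).map
    fun v => (σ v : ℕ)) fun i hi => hr i (by simpa using hi)]
  rw [WeightedGraph.encoding, WeightedGraph.upperTriangle]
  congr 1
  rw [List.length_map, List.length_finRange, ← List.map_coe_finRange_eq_range, List.flatMap_map]
  refine List.flatMap_congr fun u _ => ?_
  rw [List.map_map]
  refine List.map_congr_left fun v _ => ?_
  simp [WeightedGraph.relabel, hK]

/-- The number of digits of an encoding of size `N` that belong to the first `k` rows. -/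
def rowsLength (k : ℕ) : ℕ → ℕ :=
  Nat.rec (fun _ => 0) (fun _ ih N => Nat.add (Nat.sub N 1) (ih (Nat.sub N 1))) k

theorem mul_listEncoding_le (K : ℕ → ℕ → ℕ) (l r : List ℕ) :
    4 ^ rowsLength l.length (l.length + r.length) * listEncoding K r ≤ listEncoding K (l ++ r) := by
  induction l with
  | nil => simp [rowsLength]
  | cons x l ih =>
    rw [List.cons_append, listEncoding, List.length_cons, List.length_append]
    have e : rowsLength (l.length + 1) (l.length + 1 + r.length) =
        l.length + r.length + rowsLength l.length (l.length + r.length) := by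
      change (l.length + 1 + r.length - 1) +
        rowsLength l.length (l.length + 1 + r.length - 1) = _
      rw [show l.length + 1 + r.length - 1 = l.length + r.length by omega]
    rw [e, pow_add, mul_assoc]
    exact (Nat.mul_le_mul_left _ ih).trans (Nat.le_add_left _ _)

/-- Membership in a list of numbers. -/
def isMember (x : ℕ) (l : List ℕ) : Bool :=
  List.rec false (fun y _ ih => Bool.rec ih true (Nat.beq x y)) l

theorem isMember_eq_true {x : ℕ} {l : List ℕ} : isMember x l = true ↔ x ∈ l := by
  induction l with
  | nil => simp [isMember]
  | cons y l ih =>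
    rw [List.mem_cons, ← ih]
    change (Bool.rec (isMember x l) true (Nat.beq x y) : Bool) = true ↔ _
    by_cases h : x = y
    · subst h; rw [Nat.beq_refl]; simp
    · have : Nat.beq x y = false := Bool.eq_false_iff.2 fun h' => h (Nat.eq_of_beq_eq_true h')
      rw [this]; simp [h]

/-- No order of the vertices `0, …, n - 1` that ends with the list `r`, of encoding `z`, has an
encoding less than `T`. The search fills `k` more positions, from the last one to the first one, and
gives up an order when its last rows are already greater than those of `T`. -/
def noSmallerOrder (n : ℕ) (K : ℕ → ℕ → ℕ) (T k : ℕ) : List ℕ → ℕ → Bool :=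
  Nat.rec (fun _ z => Nat.ble T z)
    (fun k ih r z => allLt n fun x => Bool.rec
      (Bool.rec true
        (ih (x :: r) (Nat.add (rowValue K x r) (Nat.mul (Nat.pow 4 (Nat.sub n (Nat.succ k))) z)))
        (Nat.ble (Nat.add (rowValue K x r) (Nat.mul (Nat.pow 4 (Nat.sub n (Nat.succ k))) z))
          (Nat.div T (Nat.pow 4 (rowsLength k n)))))
      true (isMember x r)) k

theorem le_of_noSmallerOrder {n : ℕ} {K : ℕ → ℕ → ℕ} {T : ℕ} (l r : List ℕ)
    (hlen : l.length + r.length = n) (hnd : (l.reverse ++ r).Nodup)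
    (hlt : ∀ x ∈ l, x < n)
    (h : noSmallerOrder n K T l.length r (listEncoding K r) = true) :
    T ≤ listEncoding K (l.reverse ++ r) := by
  induction l generalizing r with
  | nil => exact Nat.le_of_ble_eq_true h
  | cons x l ih =>
    have hr : n - (l.length + 1) = r.length := by simp at hlen; omega
    have hx := allLt_eq_true.1 h x (hlt x (by simp))
    have hmem : isMember x r = false := Bool.eq_false_iff.2 fun hm => by
      rw [isMember_eq_true] at hm
      rw [List.reverse_cons, List.append_assoc] at hnd
      have := (List.nodup_append.1 hnd).2.1
      simp [hm] at this
    rw [hmem] at hx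
    have hz : rowValue K x r + 4 ^ (n - (l.length + 1)) * listEncoding K r =
        listEncoding K (x :: r) := by
      rw [hr]; rfl
    change (Bool.rec true (noSmallerOrder n K T l.length (x :: r)
      (rowValue K x r + 4 ^ (n - (l.length + 1)) * listEncoding K r))
      (Nat.ble (rowValue K x r + 4 ^ (n - (l.length + 1)) * listEncoding K r)
        (T / 4 ^ rowsLength l.length n)) : Bool) = true at hx
    rw [hz] at hx
    rw [List.reverse_cons, List.append_assoc, List.singleton_append] at hnd ⊢
    have hlen' : l.length + (x :: r).length = n := by
      rw [← hlen, List.length_cons, List.length_cons]; omega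
    by_cases hle : listEncoding K (x :: r) ≤ T / 4 ^ rowsLength l.length n
    · rw [Nat.ble_eq_true_of_le hle] at hx
      exact ih (x :: r) hlen' hnd (fun y hy => hlt y (by simp [hy])) hx
    · have h1 := mul_listEncoding_le K l.reverse (x :: r)
      rw [List.length_reverse, hlen'] at h1
      refine le_trans ?_ h1
      have h2 := Nat.lt_mul_div_succ T (show 0 < 4 ^ rowsLength l.length n by positivity)
      exact h2.le.trans (Nat.mul_le_mul_left _ (not_le.1 hle))

theorem le_encoding_relabel {n T : ℕ} (G : WeightedGraph 3 n) (K : ℕ → ℕ → ℕ)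
    (hK : ∀ u v : Fin n, (G.Γ u v).val = K u v) (h : noSmallerOrder n K T n [] 0 = true)
    (σ : Equiv.Perm (Fin n)) : T ≤ (G.relabel σ).encoding := by
  rw [encoding_relabel G K hK σ]
  have hlen : ((List.finRange n).map fun u => (σ u : ℕ)).reverse.length = n := by simp
  have := le_of_noSmallerOrder (n := n) (K := K) (T := T)
    ((List.finRange n).map fun u => (σ u : ℕ)).reverse [] (by rw [hlen]; rfl)
    (by
      rw [List.reverse_reverse, List.append_nil]
      exact (List.nodup_finRange n).map fun u v h => σ.injective (Fin.ext h))
    (by simp) (by rw [hlen]; exact h)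
  simpa using this

end Encoding

/-! ### Representatives -/

section Representatives

/-- The weights of a graph after a change of signs by the binary digits of `s`. -/
def signedEntry (n c s u v : ℕ) : ℕ :=
  Nat.mod (Nat.mul (entry n c u v)
    (Nat.succ (Nat.mod (Nat.add (Nat.mod (Nat.div s (Nat.pow 2 u)) 2)
      (Nat.mod (Nat.div s (Nat.pow 2 v)) 2)) 2))) 3

/-- The sum of the weights `K u v` over the pairs of vertices. -/
def pairSum (n : ℕ) (K : ℕ → ℕ → ℕ) : ℕ :=
  List.rec 0 (fun e _ ih => Nat.add (K e.1 e.2) ih) (upperPairs n)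

theorem pairSum_eq (n : ℕ) (K : ℕ → ℕ → ℕ) :
    pairSum n K = ((upperPairs n).map fun e => K e.1 e.2).sum := by
  unfold pairSum
  generalize upperPairs n = l
  induction l with
  | nil => rfl
  | cons e l ih => rw [List.map_cons, List.sum_cons, ← ih]; rfl

/-- All the graphs that arise from the graph `h` by changes of signs and relabelling have at least
the total weight `w`, and in the case of equality at least the encoding `T`. -/
def isMinimalUpToSigns (n w T h : ℕ) : Bool :=
  allLt (Nat.pow 2 (Nat.sub n 1)) fun s => Bool.rec
    (Bool.rec false (noSmallerOrder n (signedEntry n h s) T n [] 0)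
      (Nat.beq w (pairSum n (signedEntry n h s))))
    true (Nat.ble (Nat.succ w) (pairSum n (signedEntry n h s)))

theorem le_of_isMinimalUpToSigns {n w T h s : ℕ} (hs : s < 2 ^ (n - 1))
    (hm : isMinimalUpToSigns n w T h = true) {G : WeightedGraph 3 n}
    (hG : ∀ u v : Fin n, (G.Γ u v).val = signedEntry n h s u v) (σ : Equiv.Perm (Fin n)) :
    w < (G.relabel σ).totalWeight ∨
      w = (G.relabel σ).totalWeight ∧ T ≤ (G.relabel σ).encoding := by
  have e : (G.relabel σ).totalWeight = pairSum n (signedEntry n h s) := by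
    rw [totalWeight_relabel, pairSum_eq, WeightedGraph.totalWeight, upperTriangle_eq_map]
    congr 1
    exact List.map_congr_left fun e _ => hG _ _
  rw [e]
  have h1 := allLt_eq_true.1 hm s hs
  by_cases hlt : w < pairSum n (signedEntry n h s)
  · exact Or.inl hlt
  · have h2 : Nat.ble (Nat.succ w) (pairSum n (signedEntry n h s)) = false :=
      Bool.eq_false_iff.2 fun h => hlt (Nat.le_of_ble_eq_true h)
    simp only [h2] at h1
    by_cases heq : w = pairSum n (signedEntry n h s)
    · have h3 : Nat.beq w (pairSum n (signedEntry n h s)) = true := by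
        rw [← heq]; exact Nat.beq_refl w
      simp only [h3] at h1
      exact Or.inr ⟨heq, le_encoding_relabel G _ hG h1 σ⟩
    · have h3 : Nat.beq w (pairSum n (signedEntry n h s)) = false :=
        Bool.eq_false_iff.2 fun h => heq (Nat.eq_of_beq_eq_true h)
      simp only [h3] at h1
      exact absurd h1 (by simp)

/-- The graph `h` is the graph of the Lagrangian subspace of `c` with respect to the frame with the
points `p`; the digits of `X` in base eight are the indices of the second halves of the frame. -/
def isFramed (n c p h X : ℕ) : Bool :=
  Bool.rec false
    (isClifford n (entry n c) (entry n h)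
      (fun v => vecA (Nat.mod (Nat.div p (Nat.pow 4 v)) 4))
      (fun v => vecB (Nat.mod (Nat.div p (Nat.pow 4 v)) 4))
      (fun v => vecA (Nat.mod (Nat.div X (Nat.pow 8 v)) 8))
      (fun v => vecB (Nat.mod (Nat.div X (Nat.pow 8 v)) 8)))
    (allLt n fun v => Nat.beq 1 (Nat.mod (Nat.add
      (Nat.mul (vecA (Nat.mod (Nat.div p (Nat.pow 4 v)) 4))
        (vecB (Nat.mod (Nat.div X (Nat.pow 8 v)) 8)))
      (Nat.mul 2 (Nat.mul (vecB (Nat.mod (Nat.div p (Nat.pow 4 v)) 4))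
        (vecA (Nat.mod (Nat.div X (Nat.pow 8 v)) 8))))) 3))

theorem frameIdx_zero (p v : ℕ) : frameIdx p 0 v = dgt 4 p v := by simp [frameIdx, dgt]

theorem framedBy_of_isFramed {n c p h X : ℕ} (hf : isFramed n c p h X = true) :
    FramedBy (ofCode n c) p 0 (ofCode n h) := by
  have h1 : ∀ v : Fin n, (vecA (dgt 4 p v) * vecB (dgt 8 X v) -
      vecB (dgt 4 p v) * vecA (dgt 8 X v) : ZMod 3) = 1 := by
    intro v
    by_contra hcon
    have h2 := allLt_eq_true.1 (Bool.of_not_eq_false (b := allLt n _) fun h0 => by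
      rw [isFramed, h0] at hf
      exact absurd hf (by simp)) v v.2
    have h3 := congrArg (Nat.cast (R := ZMod 3)) (Nat.eq_of_beq_eq_true h2)
    change ((1 : ℕ) : ZMod 3) = (((vecA (dgt 4 p v) * vecB (dgt 8 X v) +
      2 * (vecB (dgt 4 p v) * vecA (dgt 8 X v))) % 3 : ℕ) : ZMod 3) at h3
    rw [ZMod.natCast_mod] at h3
    push_cast at h3
    refine hcon ?_
    rw [h3]
    have h30 : (3 : ZMod 3) = 0 := by decide
    linear_combination -(vecB (dgt 4 p v) * vecA (dgt 8 X v) : ZMod 3) * h30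
  have h2 : isClifford n (entry n c) (entry n h) (fun v => vecA (dgt 4 p v))
      (fun v => vecB (dgt 4 p v)) (fun v => vecA (dgt 8 X v))
      (fun v => vecB (dgt 8 X v)) = true := by
    rw [isFramed] at hf
    revert hf
    cases (allLt n _ : Bool) with
    | true => exact id
    | false => exact fun hf => absurd hf (by simp)
  refine ⟨fun v => (vecA (dgt 8 X v) : ℕ), fun v => (vecB (dgt 8 X v) : ℕ), ?_⟩
  have := localClifford_of_isClifford h2 (G := ofCode n c) (H := ofCode n h) (fun _ _ => rfl)
    (fun _ _ => rfl) h1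
  have ha : frameA n p 0 = fun v : Fin n => ((vecA (dgt 4 p v) : ℕ) : ZMod 3) := by
    ext v; rw [frameA, frameIdx_zero]
  have hb : frameB n p 0 = fun v : Fin n => ((vecB (dgt 4 p v) : ℕ) : ZMod 3) := by
    ext v; rw [frameB, frameIdx_zero]
  rw [ha, hb]
  exact this

/-- The signs of a frame change the signs of the weights. -/
theorem FramedBy.val_eq_signedEntry {n c p s h : ℕ} {H : WeightedGraph 3 n}
    (h0 : FramedBy (ofCode n c) p 0 (ofCode n h)) (hs : FramedBy (ofCode n c) p s H)
    (u v : Fin n) : (H.Γ u v).val = signedEntry n h s u v := by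
  let ε : Fin n → ZMod 3 := fun v => if dgt 2 s v = 0 then 1 else -1
  have hε (v) : ε v * ε v = 1 := by simp only [ε]; split_ifs <;> simp
  let K : WeightedGraph 3 n := ⟨fun u v => ε u * ε v * (ofCode n h).Γ u v,
    fun u v => by rw [(ofCode n h).symm, mul_comm (ε u)], fun u => by simp [(ofCode n h).loopless]⟩
  have hsign : ∀ q < 4, ∀ t < 2, ((vecA (q + 4 * t) : ℕ) : ZMod 3) =
      (if t = 0 then 1 else -1) * (vecA q : ℕ) ∧ ((vecB (q + 4 * t) : ℕ) : ZMod 3) =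
      (if t = 0 then 1 else -1) * (vecB q : ℕ) := by decide
  obtain ⟨C, D, h0⟩ := h0
  obtain ⟨C', D', hs⟩ := hs
  have hK := h0.sign (K := K) hε fun _ _ => rfl
  have ha : (fun v => ε v * frameA n p 0 v) = frameA n p s := by
    ext v
    simp only [frameA, frameIdx_zero, ε]
    exact ((hsign _ (dgt_lt (by omega) _ _) _ (dgt_lt (by omega) _ _)).1).symm
  have hb : (fun v => ε v * frameB n p 0 v) = frameB n p s := by
    ext v
    simp only [frameB, frameIdx_zero, ε]
    exact ((hsign _ (dgt_lt (by omega) _ _) _ (dgt_lt (by omega) _ _)).2).symm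
  rw [ha, hb] at hK
  rw [hs.unique hK]
  have e : ε u * ε v = ((dgt 2 s u + dgt 2 s v) % 2 + 1 : ℕ) := by
    have h1 := dgt_lt (b := 2) (by omega) s u
    have h2 := dgt_lt (b := 2) (by omega) s v
    simp only [ε]
    generalize dgt 2 s u = a at *
    generalize dgt 2 s v = b at *
    interval_cases a <;> interval_cases b <;> decide
  change (ε u * ε v * (ofCode n h).Γ u v).val =
    (entry n h u v * ((dgt 2 s u + dgt 2 s v) % 2 + 1)) % 3
  rw [e, ofCode_apply, ← Nat.cast_mul, ZMod.val_natCast, mul_comm]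

/-- No graph in the Clifford class of `c` has a smaller key than `(e, w, T)`. The list `F` has to
contain all the frames in the set `P` that may lead to graphs with `e` edges, together with these
graphs and the second halves of the frames. -/
def isKeyMinimal (n c P e w T : ℕ) (F : List (ℕ × ℕ × ℕ)) : Bool :=
  (Nat.beq (fewEdges n c P (Nat.sub e 1)) 0 &&
    Nat.beq (Nat.land (fewEdges n c P e)
      (Nat.xor (allPoints n) (List.rec 0 (fun f _ ih => Nat.lor (Nat.pow 2 f.1) ih) F))) 0) &&
    F.all fun f => isFramed n c f.1 f.2.1 f.2.2 && isMinimalUpToSigns n w T f.2.1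

/-- Every isomorphism class in the Clifford class has a first frame, whose points are in the set
`firstPoints`; so it suffices to check the frames in this set. -/
theorem le_key_of_isKeyMinimal {n c e w T : ℕ} {L : List ℕ} {F : List (ℕ × ℕ × ℕ)} (hn : 0 < n)
    (h7 : n ≤ 7) (hL : ∀ S ∈ L, isSymmetry n (entry n c) S = true)
    (h : isKeyMinimal n c (firstPoints n c L) e w T F = true) {H : WeightedGraph 3 n}
    (hH : WeightedGraph.CliffordEquiv (ofCode n c) H) : toLex (e, toLex (w, T)) ≤ H.key := by
  obtain ⟨p, hp, s, hs, H', hf, hi⟩ := exists_isFirstFrame hH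
  have hs' := hf.sign_lt hn hp hs
  have hP := hf.testBit_firstPoints h7 hp hL
  obtain ⟨σ, rfl⟩ := WeightedGraph.isomorphic_iff.1 (WeightedGraph.isomorphic_equivalence.symm hi)
  simp only [isKeyMinimal, Bool.and_eq_true, List.all_eq_true] at h
  obtain ⟨⟨h1, h2⟩, h3⟩ := h
  have he : e ≤ H'.edgeCount := by
    by_contra hlt
    have := hf.1.testBit_fewEdges h7 hp hP (show H'.edgeCount ≤ e - 1 by omega)
    rw [show fewEdges n c (firstPoints n c L) (e - 1) = 0 from Nat.eq_of_beq_eq_true h1] at this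
    simp at this
  rw [WeightedGraph.key, edgeCount_relabel, Prod.Lex.toLex_le_toLex]
  rcases he.lt_or_eq with he | he
  · exact Or.inl he
  refine Or.inr ⟨he, ?_⟩
  have hbit := hf.1.testBit_fewEdges h7 hp hP he.ge
  have hmem : ∃ f ∈ F, f.1 = p := by
    have hor (F : List (ℕ × ℕ × ℕ)) : (List.rec 0 (fun f _ ih => Nat.lor (Nat.pow 2 f.1) ih) F :
        ℕ).testBit p = true ↔ ∃ f ∈ F, f.1 = p := by
      induction F with
      | nil => simp
      | cons f F ih =>
        change (2 ^ f.1 ||| _).testBit p = true ↔ _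
        rw [Nat.testBit_or, Bool.or_eq_true, ih, Nat.testBit_two_pow]
        simp
    rw [← hor]
    by_contra hcon
    have hz := congrArg (·.testBit p) (Nat.eq_of_beq_eq_true h2)
    change (fewEdges n c (firstPoints n c L) e &&& (allPoints n ^^^ _)).testBit p =
      (0 : ℕ).testBit p at hz
    rw [Nat.testBit_and, hbit, Nat.testBit_xor, Bool.eq_false_iff.2 hcon,
      show (allPoints n).testBit p = true from testBit_full.2 hp] at hz
    simp at hz
  obtain ⟨f, hfF, rfl⟩ := hmem
  obtain ⟨h4, h5⟩ := h3 f hfF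
  rw [Prod.Lex.toLex_le_toLex]
  exact le_of_isMinimalUpToSigns hs' h5
    ((framedBy_of_isFramed h4).val_eq_signedEntry hf.1) σ

end Representatives

/-! ### Sequences of local complementations -/

section Words

open WeightedGraph

/-- The number whose digits in base four are the entries above the diagonal of a matrix. -/
def encode (n : ℕ) (f : ℕ → ℕ → ℕ) : ℕ :=
  List.rec 0 (fun e _ ih => Nat.add (f e.1 e.2) (Nat.mul 4 ih)) (upperPairs n)

theorem getElem?_upperPairs {n : ℕ} (hn : n ≤ 7) : ∀ u v : Fin n, u < v →
    (upperPairs n)[pairIdx n u v]? = some (u, v) := by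
  interval_cases n <;> decide +kernel

theorem entry_encode {n u v : ℕ} {f : ℕ → ℕ → ℕ} (hn : n ≤ 7) (huv : u < v) (hv : v < n)
    (hf : ∀ u v, f u v < 4) : entry n (encode n f) u v = f u v := by
  rw [entry_of_lt huv]
  have h := getElem?_upperPairs hn ⟨u, huv.trans hv⟩ ⟨v, hv⟩ huv
  unfold encode
  generalize upperPairs n = l at h
  change l[pairIdx n u v]? = _ at h
  generalize pairIdx n u v = i at h
  induction l generalizing i with
  | nil => simp at h
  | cons e l ih =>
    change (f e.1 e.2 + 4 * _) / 4 ^ i % 4 = _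
    cases i with
    | zero =>
      obtain rfl : e = _ := by simpa using h
      rw [pow_zero, Nat.div_one, Nat.add_mul_mod_self_left, Nat.mod_eq_of_lt (hf _ _)]
    | succ i =>
      rw [pow_succ', ← Nat.div_div_eq_div_mul, Nat.add_mul_div_left _ _ (by omega),
        Nat.div_eq_of_lt (hf _ _), zero_add]
      exact ih i (by simpa using h)

theorem eq_ofCode_encode {n : ℕ} {f : ℕ → ℕ → ℕ} (hn : n ≤ 7) (hf : ∀ u v, f u v < 4)
    {G : WeightedGraph 3 n} (hG : ∀ u v : Fin n, u < v → G.Γ u v = (f u v : ℕ)) :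
    G = ofCode n (encode n f) := by
  ext u v
  rcases lt_trichotomy u v with h | rfl | h
  · rw [hG u v h, ofCode_apply, entry_encode hn h v.2 hf]
  · rw [G.loopless, (ofCode n _).loopless]
  · rw [G.symm, hG v u h, (ofCode n _).symm, ofCode_apply, entry_encode hn h u.2 hf]

/-- The factor and the vertex of a local complementation are encoded by one number. -/
def opVertex (op : ℕ) : ℕ := Nat.mod op 7

/-- The factor of a local complementation. -/
def opFactor (op : ℕ) : ℕ := Nat.succ (Nat.div op 7)

/-- A local complementation, for graphs given by numbers. -/
def complementCode (n c op : ℕ) : ℕ :=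
  encode n fun u v => Nat.mod (Nat.add (entry n c u v)
    (Nat.mul (opFactor op) (Nat.mul (entry n c u (opVertex op)) (entry n c v (opVertex op))))) 3

theorem ofCode_complementCode {n c op : ℕ} (hn : n ≤ 7) (h : opVertex op < n) :
    ofCode n (complementCode n c op) =
      (ofCode n c).localComplementation (opFactor op : ℕ) ⟨opVertex op, h⟩ := by
  symm
  refine eq_ofCode_encode hn (fun u v => ?_) fun u v huv => ?_
  · exact (Nat.mod_lt _ (by omega)).trans (by omega)
  · change (if u ≠ v then _ else _) = (((entry n c u v + opFactor op * (entry n c u (opVertex op) *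
      entry n c v (opVertex op))) % 3 : ℕ) : ZMod 3)
    rw [if_pos huv.ne, ZMod.natCast_mod, ofCode_apply, ofCode_apply, ofCode_apply]
    push_cast
    ring

/-- A sequence of local complementations, for graphs given by numbers. -/
def runWord (n : ℕ) (W : List ℕ) : ℕ → ℕ :=
  List.rec (fun c => c) (fun op _ ih c => ih (complementCode n c op)) W

theorem reach_runWord {n : ℕ} (hn : n ≤ 7) {W : List ℕ} (hW : ∀ op ∈ W, opVertex op < n) (c : ℕ) :
    Reach (ofCode n c) (ofCode n (runWord n W c)) := by
  induction W generalizing c with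
  | nil => exact Reach.refl _
  | cons op W ih =>
    have h := hW op (by simp)
    refine Reach.trans (Reach.of_localMove (Or.inr ⟨_, _, ofCode_complementCode hn h⟩)) ?_
    exact ih (fun op h => hW op (by simp [h])) _

/-- Changes of signs are local scalings. -/
theorem Reach.of_sign {n : ℕ} {G H : WeightedGraph 3 n} {ε : Fin n → ZMod 3} (hε : ∀ v, ε v ≠ 0)
    (h : ∀ u v, H.Γ u v = ε u * ε v * G.Γ u v) : Reach G H := by
  classical
  have key (s : Finset (Fin n)) : ∀ K : WeightedGraph 3 n, (∀ u v, K.Γ u v =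
      (if u ∈ s then ε u else 1) * (if v ∈ s then ε v else 1) * G.Γ u v) → Reach G K := by
    induction s using Finset.induction_on with
    | empty =>
      intro K hK
      obtain rfl : K = G := by ext u v; simpa using hK u v
      exact Reach.refl _
    | insert w s hw ih =>
      intro K hK
      let K' : WeightedGraph 3 n := ⟨fun u v => (if u ∈ s then ε u else 1) *
        (if v ∈ s then ε v else 1) * G.Γ u v,
        fun u v => by rw [G.symm, mul_comm (if u ∈ s then ε u else 1)],
        fun u => by simp [G.loopless]⟩
      refine (ih K' fun u v => rfl).trans (Reach.of_localMove (Or.inl ⟨ε w, hε w, w, ?_⟩))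
      ext u v
      rw [hK]
      change _ = if u = w ∨ v = w then ε w * ((if u ∈ s then ε u else 1) *
        (if v ∈ s then ε v else 1) * G.Γ u v) else (if u ∈ s then ε u else 1) *
        (if v ∈ s then ε v else 1) * G.Γ u v
      by_cases hu : u = w <;> by_cases hv : v = w
      · simp [hu, hv, G.loopless]
      · simp [hu, hv, hw, mul_assoc]
      · simp only [hu, hv, hw, Finset.mem_insert, if_true, if_false, or_true, or_false,
          false_or, mul_one]
        ring
      · simp [hu, hv]
  exact key Finset.univ H fun u v => by simpa using h u v

/-- A signed permutation of the vertices is encoded by digits in base `14`. -/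
def signedVertex (m u : ℕ) : ℕ := Nat.mod (Nat.mod (Nat.div m (Nat.pow 14 u)) 14) 7

/-- The signs of a signed permutation, as `1` and `2`. -/
def vertexSign (m u : ℕ) : ℕ := Nat.succ (Nat.div (Nat.mod (Nat.div m (Nat.pow 14 u)) 14) 7)

theorem vertexSign_mul_self (m u : ℕ) :
    ((vertexSign m u : ℕ) : ZMod 3) * (vertexSign m u : ℕ) = 1 := by
  have : ∀ x < 14, ((x / 7 + 1 : ℕ) : ZMod 3) * (x / 7 + 1 : ℕ) = 1 := by decide
  exact this _ (Nat.mod_lt _ (by omega))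

/-- The graph `c` is obtained from the graph `c'` by the signed permutation `m`. -/
def isSignedRelabelling (n c c' m : ℕ) : Bool :=
  Bool.rec false
    (allLt n fun v => allLt v fun u => Nat.beq
      (Nat.mod (entry n c (signedVertex m u) (signedVertex m v)) 3)
      (Nat.mod (Nat.mul (Nat.mul (vertexSign m u) (vertexSign m v)) (entry n c' u v)) 3))
    (Nat.beq (orLt n fun u => Nat.shiftLeft 1 (signedVertex m u)) (full n))

theorem exists_perm_of_isSignedRelabelling {n c c' m : ℕ}
    (h : isSignedRelabelling n c c' m = true) : ∃ σ : Equiv.Perm (Fin n),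
      (∀ u : Fin n, (σ u : ℕ) = signedVertex m u) ∧ ∀ u v, (ofCode n c').Γ u v =
        (vertexSign m u : ℕ) * (vertexSign m v : ℕ) * (ofCode n c).Γ (σ u) (σ v) := by
  have hb : Nat.beq (orLt n fun u => Nat.shiftLeft 1 (signedVertex m u)) (full n) = true := by
    by_contra hcon
    rw [isSignedRelabelling, Bool.eq_false_iff.2 hcon] at h
    exact absurd h (by simp)
  rw [isSignedRelabelling, hb] at h
  obtain ⟨σ, hσ⟩ := exists_perm_of_orLt hb
  have key (u v : Fin n) (huv : u < v) : (ofCode n c').Γ u v =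
      (vertexSign m u : ℕ) * (vertexSign m v : ℕ) * (ofCode n c).Γ (σ u) (σ v) := by
    have h1 := allLt_eq_true.1 (allLt_eq_true.1 h v v.2) u huv
    have h2 := cast_eq_cast_iff.2 (Nat.eq_of_beq_eq_true h1)
    rw [ofCode_apply, ofCode_apply, hσ, hσ, h2]
    change _ = _ * (((vertexSign m u * vertexSign m v * entry n c' u v : ℕ)) : ZMod 3)
    push_cast
    linear_combination (-(entry n c' u v : ZMod 3)) * (vertexSign_mul_self m u) -
      (entry n c' u v : ZMod 3) * (vertexSign m u * vertexSign m u : ZMod 3) *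
        vertexSign_mul_self m v
  refine ⟨σ, hσ, fun u v => ?_⟩
  rcases lt_trichotomy u v with h | rfl | h
  · exact key u v h
  · rw [WeightedGraph.loopless, WeightedGraph.loopless, mul_zero]
  · rw [(ofCode n c').symm, (ofCode n c).symm, key v u h]
    ring

theorem reach_of_isSignedRelabelling {n c c' m : ℕ} (h : isSignedRelabelling n c c' m = true) :
    Reach (ofCode n c) (ofCode n c') := by
  obtain ⟨σ, -, hσ⟩ := exists_perm_of_isSignedRelabelling h
  refine (Reach.of_isomorphic (isomorphic_equivalence.symm (isomorphic_relabel _ σ))).trans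
    (Reach.of_sign (ε := fun v => (vertexSign m v : ℕ)) (fun v h0 => ?_) hσ)
  have := vertexSign_mul_self m v
  rw [h0] at this
  simp at this

end Words

/-! ### Graphs with one more vertex -/

section Extensions

open WeightedGraph

variable {n : ℕ}

/-- The graph `G` without its last vertex. -/
def dropLast (G : WeightedGraph 3 (n + 1)) : WeightedGraph 3 n where
  Γ u v := G.Γ u.castSucc v.castSucc
  symm _ _ := G.symm _ _
  loopless _ := G.loopless _

/-- The graph `G` is the graph `H` with one more vertex, which is joined to the other vertices by
edges with the weights `y`. -/
structure IsExtension (H : WeightedGraph 3 n) (y : Fin n → ZMod 3) (G : WeightedGraph 3 (n + 1)) :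
    Prop where
  dropLast : dropLast G = H
  last : ∀ u : Fin n, G.Γ u.castSucc (Fin.last n) = y u

namespace IsExtension

variable {H : WeightedGraph 3 n} {y : Fin n → ZMod 3} {G G' : WeightedGraph 3 (n + 1)}

theorem unique (h : IsExtension H y G) (h' : IsExtension H y G') : G = G' := by
  ext u v
  induction u using Fin.lastCases with
  | last =>
    induction v using Fin.lastCases with
    | last => rw [G.loopless, G'.loopless]
    | cast v => rw [G.symm, G'.symm, h.last, h'.last]
  | cast u =>
    induction v using Fin.lastCases with
    | last => rw [h.last, h'.last]
    | cast v =>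
      change (_root_.dropLast G).Γ u v = (_root_.dropLast G').Γ u v
      rw [h.dropLast, h'.dropLast]

theorem localComplementation (h : IsExtension H y G) (γ : ZMod 3) (w : Fin n) :
    IsExtension (H.localComplementation γ w) (fun u => y u + γ * H.Γ u w * y w)
      (G.localComplementation γ w.castSucc) := by
  obtain ⟨rfl, hy⟩ := h
  refine ⟨?_, fun u => ?_⟩
  · ext u v
    simp [_root_.dropLast, WeightedGraph.localComplementation]
  · change (if u.castSucc ≠ Fin.last n then G.Γ u.castSucc (Fin.last n) +
      γ * G.Γ u.castSucc w.castSucc * G.Γ (Fin.last n) w.castSucc else _) = _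
    rw [if_pos (Fin.castSucc_lt_last u).ne, hy, G.symm (Fin.last n), hy]
    rfl

theorem localScaling (h : IsExtension H y G) (γ : ZMod 3) (w : Fin n) :
    IsExtension (H.localScaling γ w) (fun u => if u = w then γ * y u else y u)
      (G.localScaling γ w.castSucc) := by
  obtain ⟨rfl, hy⟩ := h
  refine ⟨?_, fun u => ?_⟩
  · ext u v
    simp [_root_.dropLast, WeightedGraph.localScaling]
  · change (if u.castSucc = w.castSucc ∨ Fin.last n = w.castSucc then
      γ * G.Γ u.castSucc (Fin.last n) else G.Γ u.castSucc (Fin.last n)) = _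
    simp [hy, (Fin.castSucc_lt_last w).ne']

theorem relabel (h : IsExtension H y G) (σ : Equiv.Perm (Fin n)) :
    ∃ τ, IsExtension (H.relabel σ) (y ∘ σ) (G.relabel τ) := by
  obtain ⟨rfl, hy⟩ := h
  let τ : Equiv.Perm (Fin (n + 1)) :=
    (finSuccEquivLast.trans (Equiv.optionCongr σ)).trans finSuccEquivLast.symm
  have h1 (u : Fin n) : τ u.castSucc = (σ u).castSucc := by simp [τ]
  have h2 : τ (Fin.last n) = Fin.last n := by simp [τ]
  refine ⟨τ, ?_, fun u => ?_⟩
  · ext u v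
    change G.Γ (τ u.castSucc) (τ v.castSucc) = G.Γ (σ u).castSucc (σ v).castSucc
    rw [h1, h1]
  · change G.Γ (τ u.castSucc) (τ (Fin.last n)) = y (σ u)
    rw [h1, h2, hy]

end IsExtension

/-- The operations on a graph can be done in the presence of one more vertex. -/
theorem Reach.exists_isExtension {H K : WeightedGraph 3 n} (h : Reach H K) {y : Fin n → ZMod 3}
    {G : WeightedGraph 3 (n + 1)} (hG : IsExtension H y G) :
    ∃ y' G', IsExtension K y' G' ∧ Reach G G' := by
  induction h with
  | refl => exact ⟨y, G, hG, Reach.refl _⟩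
  | tail _ h ih =>
    obtain ⟨y', G', hG', hr⟩ := ih
    rcases h with (⟨γ, hγ, w, rfl⟩ | ⟨γ, w, rfl⟩) | h
    · exact ⟨_, _, hG'.localScaling γ w, hr.trans (Reach.of_localMove (Or.inl ⟨γ, hγ, _, rfl⟩))⟩
    · exact ⟨_, _, hG'.localComplementation γ w,
        hr.trans (Reach.of_localMove (Or.inr ⟨γ, _, rfl⟩))⟩
    · obtain ⟨σ, rfl⟩ := isomorphic_iff.1 (isomorphic_equivalence.symm h)
      obtain ⟨τ, hτ⟩ := hG'.relabel σ
      exact ⟨_, _, hτ, hr.trans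
        (Reach.of_isomorphic (isomorphic_equivalence.symm (isomorphic_relabel _ τ)))⟩

/-- The extension of the graph `c` by a vertex that is joined by edges with the weights given by the
digits of `i` in base four. -/
def extensionCode (n c i : ℕ) : ℕ :=
  encode (Nat.succ n) fun u v => Bool.rec (Nat.mod (Nat.div i (Nat.pow 4 u)) 4) (entry n c u v)
    (Nat.ble (Nat.succ v) n)

theorem isExtension_extensionCode {c i : ℕ} (hn : n < 7) :
    IsExtension (ofCode n c) (fun u => (dgt 4 i u : ℕ)) (ofCode (n + 1) (extensionCode n c i)) := by
  have hlt (u v : ℕ) : (Bool.rec (Nat.mod (Nat.div i (Nat.pow 4 u)) 4) (entry n c u v)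
      (Nat.ble (Nat.succ v) n) : ℕ) < 4 := by
    cases Nat.ble (Nat.succ v) n with
    | true => exact entry_lt _ _ _ _
    | false => exact Nat.mod_lt _ (by omega)
  have key (u v : Fin n) (huv : u < v) :
      (ofCode (n + 1) (extensionCode n c i)).Γ u.castSucc v.castSucc = (ofCode n c).Γ u v := by
    rw [ofCode_apply, ofCode_apply, extensionCode]
    refine congrArg Nat.cast ?_
    refine (entry_encode (by omega) (by simpa using huv) (by simp) hlt).trans ?_
    simp only [Fin.val_castSucc]
    rw [Nat.ble_eq_true_of_le (show Nat.succ v ≤ n from v.2)]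
  refine ⟨?_, fun u => ?_⟩
  · ext u v
    rcases lt_trichotomy u v with h | rfl | h
    · exact key u v h
    · rw [WeightedGraph.loopless, WeightedGraph.loopless]
    · rw [WeightedGraph.symm, (ofCode n c).symm]
      exact key v u h
  · rw [ofCode_apply, extensionCode]
    refine congrArg Nat.cast ?_
    refine (entry_encode (by omega) (by simp) (by simp) hlt).trans ?_
    have : Nat.ble (Nat.succ (Fin.last n).val) n = false := Bool.eq_false_iff.2 fun h => by
      have := Nat.le_of_ble_eq_true h
      simp at this
    rw [this]
    rfl

end Extensions

/-! ### All the graphs with one more vertex -/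

section Completeness

open WeightedGraph

/-- The list of the values `f 0, …, f (n - 1)`. -/
def listOf {α : Type} (n : ℕ) (f : ℕ → α) : List α := (List.range n).map f

theorem nth_listOf {α : Type} (d : α) {n u : ℕ} (f : ℕ → α) (hu : u < n) :
    nth d (listOf n f) u = f u := by
  rw [nth_eq_getD, listOf, List.getD_eq_getElem?_getD]
  simp [hu]

/-- Functions with values in `𝔽_3` on the numbers below `4 ^ n`, one for each vertex, are given by
the masks of their fibres. -/
def fibre (F : List (List ℕ)) (u x : ℕ) : ℕ := nth 0 (nth [] F u) x

/-- The fibres in `F` describe the functions `i ↦ y u`, for the number `i`. -/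
def Describes (n : ℕ) (F : List (List ℕ)) (i : ℕ) (y : Fin n → ZMod 3) : Prop :=
  ∀ u : Fin n, ∀ x < 3, (fibre F u x).testBit i = true ↔ y u = (x : ℕ)

/-- The fibres of a family of functions, from their masks. -/
def fibresOf (n : ℕ) (f : ℕ → ℕ → ℕ) : List (List ℕ) := listOf n fun u => listOf 3 (f u)

theorem fibre_fibresOf {n u x : ℕ} (f : ℕ → ℕ → ℕ) (hu : u < n) (hx : x < 3) :
    fibre (fibresOf n f) u x = f u x := by
  rw [fibre, fibresOf, nth_listOf _ _ hu, nth_listOf _ _ hx]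

/-- The effect of a local complementation on the weights of the edges at the last vertex. -/
def complementFibres (n c op : ℕ) (F : List (List ℕ)) : List (List ℕ) :=
  fibresOf n fun u x => orLt 3 fun z => Nat.land (fibre F (opVertex op) z)
    (fibre F u (Nat.mod (Nat.add x
      (Nat.mul 2 (Nat.mul (opFactor op) (Nat.mul (entry n c u (opVertex op)) z)))) 3))

theorem Describes.complementFibres {n c op i : ℕ} {F : List (List ℕ)} {y : Fin n → ZMod 3}
    (hw : opVertex op < n) (h : Describes n F i y) :
    Describes n (complementFibres n c op F) i fun u => y u + (opFactor op : ℕ) *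
      (ofCode n c).Γ u ⟨opVertex op, hw⟩ * y ⟨opVertex op, hw⟩ := by
  intro u x hx
  rw [_root_.complementFibres, fibre_fibresOf _ u.2 hx, testBit_orLt]
  have h30 : (3 : ZMod 3) = 0 := by decide
  have key (z : ℕ) (hz : z < 3) : (Nat.land (fibre F (opVertex op) z)
      (fibre F u (Nat.mod (Nat.add x (Nat.mul 2 (Nat.mul (opFactor op)
        (Nat.mul (entry n c u (opVertex op)) z)))) 3))).testBit i = true ↔
      y ⟨opVertex op, hw⟩ = (z : ℕ) ∧ y u = x + 2 * (opFactor op * (entry n c u (opVertex op) * z)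
        : ZMod 3) := by
    change (fibre F (opVertex op) z &&& fibre F u ((x + 2 * (opFactor op *
      (entry n c u (opVertex op) * z))) % 3)).testBit i = true ↔ _
    rw [Nat.testBit_and, Bool.and_eq_true, h u _ (Nat.mod_lt _ (by omega)),
      h ⟨opVertex op, hw⟩ z hz, ZMod.natCast_mod]
    push_cast
    rfl
  change _ ↔ y u + (opFactor op : ℕ) * (entry n c u (opVertex op) : ℕ) * y ⟨opVertex op, hw⟩ =
    (x : ℕ)
  constructor
  · rintro ⟨z, hz, h1⟩
    obtain ⟨h1, h2⟩ := (key z hz).1 h1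
    rw [h1, h2]
    linear_combination ((opFactor op : ZMod 3) * entry n c u (opVertex op) * z) * h30
  · intro h1
    have hz : ((y ⟨opVertex op, hw⟩).val : ZMod 3) = y ⟨opVertex op, hw⟩ := ZMod.natCast_zmod_val _
    refine ⟨(y ⟨opVertex op, hw⟩).val, ZMod.val_lt _, (key _ (ZMod.val_lt _)).2 ⟨hz.symm, ?_⟩⟩
    rw [hz, ← h1]
    linear_combination (-(opFactor op : ZMod 3) * entry n c u (opVertex op) *
      y ⟨opVertex op, hw⟩) * h30

/-- The effect of a sequence of local complementations on the weights of the edges at the last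
vertex. -/
def runFibres (n : ℕ) (W : List ℕ) : ℕ → List (List ℕ) → List (List ℕ) :=
  List.rec (fun _ F => F)
    (fun op _ ih c F => ih (complementCode n c op) (complementFibres n c op F)) W

theorem exists_runFibres {n i : ℕ} (hn : n < 7) {W : List ℕ} (hW : ∀ op ∈ W, opVertex op < n)
    {c : ℕ} {F : List (List ℕ)} {y : Fin n → ZMod 3} {G : WeightedGraph 3 (n + 1)}
    (hF : Describes n F i y) (hG : IsExtension (ofCode n c) y G) :
    ∃ y' G', Describes n (runFibres n W c F) i y' ∧
      IsExtension (ofCode n (runWord n W c)) y' G' ∧ Reach G G' := by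
  induction W generalizing c F y G with
  | nil => exact ⟨y, G, hF, hG, Reach.refl _⟩
  | cons op W ih =>
    have hw := hW op (by simp)
    have hG' := hG.localComplementation (opFactor op : ℕ) ⟨opVertex op, hw⟩
    rw [← ofCode_complementCode hn.le hw] at hG'
    obtain ⟨y', G', h1, h2, h3⟩ := ih (fun op h => hW op (by simp [h]))
      (hF.complementFibres hw) hG'
    exact ⟨y', G', h1, h2, (Reach.of_localMove (Or.inr ⟨_, _, rfl⟩)).trans h3⟩

/-- The fibres of the digits of a number. -/
def digitFibres (n : ℕ) : List (List ℕ) := fibresOf n fun u x => digitTab n u x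

theorem cast_eq_cast_of_lt {a b : ℕ} (ha : a < 3) (hb : b < 3) : (a : ZMod 3) = b ↔ a = b := by
  rw [cast_eq_cast_iff, Nat.mod_eq_of_lt ha, Nat.mod_eq_of_lt hb]

theorem describes_digitFibres {n i : ℕ} (hn : n ≤ 7) (hi : i < 4 ^ n)
    (hd : ∀ u < n, dgt 4 i u < 3) :
    Describes n (digitFibres n) i fun u => (dgt 4 i u : ℕ) := by
  intro u x hx
  rw [digitFibres, fibre_fibresOf _ u.2 hx, testBit_digitTab hn u.2 (by omega) hi,
    cast_eq_cast_of_lt (hd u u.2) hx]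

/-- The fibres after a signed permutation, which fixes the last vertex up to a sign. -/
def relabelFibres (n m : ℕ) (F : List (List ℕ)) : List (List ℕ) :=
  fibresOf n fun u x => fibre F (signedVertex m u)
    (Nat.mod (Nat.mul (Nat.mul (vertexSign m u) (vertexSign m n)) x) 3)

/-- The numbers that become smaller, where the masks of the new digits are given by fibres. -/
def decreaseMask (n : ℕ) (F : List (List ℕ)) : ℕ :=
  chainMask
    (fun u => Nat.lor (Nat.land (fibre F u 0) (Nat.lor (digitTab n u 1) (digitTab n u 2)))
      (Nat.land (fibre F u 1) (digitTab n u 2)))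
    (fun u => orLt 3 fun x => Nat.land (fibre F u x) (digitTab n u x)) 0 n

theorem testBit_decreaseMask {n i : ℕ} (hn : n ≤ 7) (hi : i < 4 ^ n)
    (hd : ∀ u < n, dgt 4 i u < 3) {F : List (List ℕ)} {y : Fin n → ZMod 3}
    (hF : Describes n F i y) (h : (decreaseMask n F).testBit i = true) :
    ∃ j < i, (∀ u < n, dgt 4 j u < 3) ∧ ∀ u : Fin n, y u = (dgt 4 j u : ℕ) := by
  obtain ⟨j, hj, hjd⟩ := exists_dgt_eq (n := n) (b := 4) (fun u => (y u).val)
    fun u => (ZMod.val_lt (y u)).trans (by omega)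
  have hy (u : Fin n) : y u = (dgt 4 j u : ℕ) := by rw [hjd]; simp
  have hj3 (u) (hu : u < n) : dgt 4 j u < 3 := by rw [hjd ⟨u, hu⟩]; exact ZMod.val_lt _
  refine ⟨j, ?_, hj3, hy⟩
  have hbit (u) (hu : u < n) (x) (hx : x < 3) : (fibre F u x).testBit i = true ↔ dgt 4 j u = x := by
    rw [hF ⟨u, hu⟩ x hx, hy, cast_eq_cast_of_lt (hj3 u hu) hx]
  rw [decreaseMask, testBit_chainMask (b := 4) (x := j) (y := i) (by omega) (fun u hu => ?_)
    fun u hu => ?_, Nat.mod_eq_of_lt hj, Nat.mod_eq_of_lt hi] at h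
  · simpa using h
  · change ((fibre F u 0 &&& (digitTab n u 1 ||| digitTab n u 2)) |||
      (fibre F u 1 &&& digitTab n u 2)).testBit i = true ↔ _
    simp only [Nat.testBit_or, Nat.testBit_and, Bool.or_eq_true, Bool.and_eq_true,
      hbit u hu 0 (by omega), hbit u hu 1 (by omega), testBit_digitTab hn hu (by omega : 1 < 4) hi,
      testBit_digitTab hn hu (by omega : 2 < 4) hi]
    have := hd u hu
    have := hj3 u hu
    omega
  · rw [testBit_orLt]
    constructor
    · rintro ⟨x, hx, h1⟩
      change (fibre F u x &&& digitTab n u x).testBit i = true at h1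
      rw [Nat.testBit_and, Bool.and_eq_true, hbit u hu x hx,
        testBit_digitTab hn hu (by omega) hi] at h1
      omega
    · intro h1
      refine ⟨_, hd u hu, ?_⟩
      change (fibre F u _ &&& digitTab n u _).testBit i = true
      rw [Nat.testBit_and, Bool.and_eq_true, hbit u hu _ (hd u hu),
        testBit_digitTab hn hu (dgt_lt (by omega) _ _) hi]
      exact ⟨h1, rfl⟩

/-- The vertices of the operations in a word are less than `n`. -/
def isWord (n : ℕ) (W : List ℕ) : Bool := W.all fun op => Nat.ble (Nat.succ (opVertex op)) n

theorem isWord_iff {n : ℕ} {W : List ℕ} : isWord n W = true ↔ ∀ op ∈ W, opVertex op < n := by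
  rw [isWord, List.all_eq_true]
  exact forall₂_congr fun op _ => ⟨fun h => Nat.le_of_ble_eq_true h, fun h =>
    Nat.ble_eq_true_of_le h⟩

/-- The word `s.2` leads from the graph `c` to a graph that is obtained from it by the signed
permutation `s.1`. -/
def isLoop (n c : ℕ) (s : ℕ × List ℕ) : Bool :=
  isWord n s.2 && isSignedRelabelling n (runWord n s.2 c) c s.1

/-- The extensions of the graph `c` that are carried to smaller ones by a loop. -/
def loopMask (n c : ℕ) (s : ℕ × List ℕ) : ℕ :=
  decreaseMask n (relabelFibres n s.1 (runFibres n s.2 c (digitFibres n)))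

theorem exists_lt_of_testBit_loopMask {n c i : ℕ} (hn : n < 7) (hi : i < 4 ^ n)
    (hd : ∀ u < n, dgt 4 i u < 3) {s : ℕ × List ℕ} (hs : isLoop n c s = true)
    (h : (loopMask n c s).testBit i = true) {G : WeightedGraph 3 (n + 1)}
    (hG : IsExtension (ofCode n c) (fun u => (dgt 4 i u : ℕ)) G) :
    ∃ j < i, (∀ u < n, dgt 4 j u < 3) ∧ ∃ G', Reach G G' ∧
      IsExtension (ofCode n c) (fun u => (dgt 4 j u : ℕ)) G' := by
  rw [isLoop, Bool.and_eq_true, isWord_iff] at hs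
  obtain ⟨y, G', h1, h2, h3⟩ := exists_runFibres hn hs.1 (describes_digitFibres hn.le hi hd) hG
  obtain ⟨σ, hσ, hc⟩ := exists_perm_of_isSignedRelabelling hs.2
  obtain ⟨τ, hτ⟩ := h2.relabel σ
  let ε : Fin n → ZMod 3 := fun v => (vertexSign s.1 v : ℕ)
  have hε (v) : ε v * ε v = 1 := vertexSign_mul_self s.1 v
  let δ : ZMod 3 := (vertexSign s.1 n : ℕ)
  have hδ : δ * δ = 1 := vertexSign_mul_self s.1 n
  have hδ0 : δ ≠ 0 := fun h0 => by rw [h0] at hδ; simp at hδ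
  have hε0 (v) : ε v ≠ 0 := fun h0 => by have := hε v; rw [h0] at this; simp at this
  have hF : Describes n (relabelFibres n s.1 (runFibres n s.2 c (digitFibres n))) i
      fun u => ε u * δ * y (σ u) := by
    intro u x hx
    rw [relabelFibres, fibre_fibresOf _ u.2 hx, ← hσ u]
    change (fibre _ (σ u) (vertexSign s.1 u * vertexSign s.1 n * x % 3)).testBit i = true ↔ _
    rw [h1 (σ u) _ (Nat.mod_lt _ (by omega)), ZMod.natCast_mod]
    push_cast
    change y (σ u) = ε u * δ * x ↔ ε u * δ * y (σ u) = x
    have h1 : ε u * δ * (ε u * δ) = 1 := by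
      linear_combination hε u * (δ * δ) + hδ
    constructor
    · intro h
      rw [h, ← mul_assoc, h1, one_mul]
    · intro h
      rw [← h, ← mul_assoc, h1, one_mul]
  obtain ⟨j, hj, hj3, hjy⟩ := testBit_decreaseMask hn.le hi hd hF h
  let ε' : Fin (n + 1) → ZMod 3 := Fin.lastCases δ ε
  let K : WeightedGraph 3 (n + 1) := ⟨fun u v => ε' u * ε' v * (G'.relabel τ).Γ u v,
    fun u v => by rw [(G'.relabel τ).symm, mul_comm (ε' u)],
    fun u => by simp [(G'.relabel τ).loopless]⟩
  refine ⟨j, hj, hj3, K, ?_, ?_⟩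
  · refine (h3.trans (Reach.of_isomorphic (isomorphic_equivalence.symm
      (isomorphic_relabel G' τ)))).trans (Reach.of_sign (ε := ε') (fun v => ?_) fun _ _ => rfl)
    induction v using Fin.lastCases with
    | last => simpa [ε'] using hδ0
    | cast v => simpa [ε'] using hε0 v
  · refine ⟨?_, fun u => ?_⟩
    · ext u v
      rw [hc]
      change ε' u.castSucc * ε' v.castSucc * (dropLast (G'.relabel τ)).Γ u v = _
      rw [hτ.dropLast]
      simp [ε', ε, WeightedGraph.relabel]
    · rw [← hjy]
      change ε' u.castSucc * ε' (Fin.last n) * (G'.relabel τ).Γ u.castSucc (Fin.last n) = _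
      rw [hτ.last]
      simp [ε']

/-- The extension of the graph `c` with the number `r.1` leads to one of the graphs `R`: the word
`r.2.2.2` leads to a graph that is obtained by the signed permutation `r.2.2.1` from the graph with
the position `r.2.1` in the list. -/
def isReduced (n c : ℕ) (R : List ℕ) (r : ℕ × ℕ × ℕ × List ℕ) : Bool :=
  (isWord (Nat.succ n) r.2.2.2 && Nat.ble (Nat.succ r.2.1) R.length) &&
    isSignedRelabelling (Nat.succ n) (runWord (Nat.succ n) r.2.2.2 (extensionCode n c r.1))
      (nth 0 R r.2.1) r.2.2.1

/-- The numbers below `4 ^ n` whose digits are weights. -/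
def weightMask (n : ℕ) : ℕ :=
  Nat.rec (allPoints n) (fun u ih => Nat.land ih
    (Nat.lor (digitTab n u 0) (Nat.lor (digitTab n u 1) (digitTab n u 2)))) n

theorem testBit_weightMask {n i : ℕ} (hn : n ≤ 7) (hi : i < 4 ^ n) (hd : ∀ u < n, dgt 4 i u < 3) :
    (weightMask n).testBit i = true := by
  suffices ∀ k ≤ n, (Nat.rec (allPoints n) (fun u ih => Nat.land ih
      (Nat.lor (digitTab n u 0) (Nat.lor (digitTab n u 1) (digitTab n u 2)))) k : ℕ).testBit i =
        true
    from this n le_rfl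
  intro k hk
  induction k with
  | zero => exact testBit_full.2 hi
  | succ k ih =>
    change (_ &&& (digitTab n k 0 ||| (digitTab n k 1 ||| digitTab n k 2))).testBit i = true
    have h := hd k hk
    simp only [Nat.testBit_and, Nat.testBit_or, Bool.and_eq_true, Bool.or_eq_true,
      testBit_digitTab hn hk (by omega : 0 < 4) hi, testBit_digitTab hn hk (by omega : 1 < 4) hi,
      testBit_digitTab hn hk (by omega : 2 < 4) hi]
    exact ⟨ih (by omega), by omega⟩

/-- The extensions of the graph `c` that are carried to smaller ones by the loops `S` or are in the
list `E`. -/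
def coveredMask (n c : ℕ) (S : List (ℕ × List ℕ)) (E : List (ℕ × ℕ × ℕ × List ℕ)) : ℕ :=
  List.rec (List.rec 0 (fun r _ ih => Nat.lor (Nat.pow 2 r.1) ih) E)
    (fun s _ ih => Nat.lor (loopMask n c s) ih) S

theorem testBit_coveredMask {n c i : ℕ} {S : List (ℕ × List ℕ)} {E : List (ℕ × ℕ × ℕ × List ℕ)} :
    (coveredMask n c S E).testBit i = true ↔
      (∃ s ∈ S, (loopMask n c s).testBit i = true) ∨ ∃ r ∈ E, r.1 = i := by
  induction S with
  | nil =>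
    simp only [List.not_mem_nil, false_and, exists_false, false_or]
    induction E with
    | nil => simp [coveredMask]
    | cons r E ih =>
      change (2 ^ r.1 ||| coveredMask n c [] E).testBit i = true ↔ _
      rw [Nat.testBit_or, Bool.or_eq_true, ih, Nat.testBit_two_pow]
      simp
  | cons s S ih =>
    change (loopMask n c s ||| coveredMask n c S E).testBit i = true ↔ _
    rw [Nat.testBit_or, Bool.or_eq_true, ih]
    simp [or_assoc]

/-- All the extensions of the graph `c` are carried by the loops `S` to one of the extensions in the
list `E`, and these lead to the graphs `R`. -/
def extendsTo (n c : ℕ) (R : List ℕ) (S : List (ℕ × List ℕ)) (E : List (ℕ × ℕ × ℕ × List ℕ)) :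
    Bool :=
  (S.all (isLoop n c) && E.all (isReduced n c R)) &&
    Nat.beq (Nat.lor (coveredMask n c S E) (weightMask n)) (coveredMask n c S E)

theorem exists_reach_of_isReduced {n c : ℕ} {R : List ℕ} {r : ℕ × ℕ × ℕ × List ℕ} (hn : n < 7)
    (h : isReduced n c R r = true) {G : WeightedGraph 3 (n + 1)}
    (hG : IsExtension (ofCode n c) (fun u => (dgt 4 r.1 u : ℕ)) G) :
    ∃ c' ∈ R, Reach G (ofCode (n + 1) c') := by
  rw [isReduced, Bool.and_eq_true, Bool.and_eq_true, isWord_iff] at h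
  obtain ⟨⟨h1, h2⟩, h3⟩ := h
  have h2 : r.2.1 < R.length := Nat.le_of_ble_eq_true h2
  rw [hG.unique (isExtension_extensionCode hn)]
  refine ⟨nth 0 R r.2.1, ?_, (reach_runWord (by omega) h1 _).trans
    (reach_of_isSignedRelabelling h3)⟩
  rw [nth_eq_getD, List.getD_eq_getElem _ _ h2]
  exact List.getElem_mem h2

/-- If the graphs `R` meet all orbits of graphs on `n` vertices and their extensions lead to the
graphs `R'`, then the latter meet all orbits of graphs on `n + 1` vertices. -/
theorem exists_reach_succ {n : ℕ} (hn : n < 7) {R R' : List ℕ}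
    (hR : ∀ G : WeightedGraph 3 n, ∃ c ∈ R, Reach G (ofCode n c))
    (h : ∀ c ∈ R, ∃ S E, extendsTo n c R' S E = true) (G : WeightedGraph 3 (n + 1)) :
    ∃ c ∈ R', Reach G (ofCode (n + 1) c) := by
  obtain ⟨c, hc, hr⟩ := hR (dropLast G)
  obtain ⟨y, G', hG', hr'⟩ := Reach.exists_isExtension hr (G := G)
    (y := fun u => G.Γ u.castSucc (Fin.last n)) ⟨rfl, fun _ => rfl⟩
  obtain ⟨S, E, h⟩ := h c hc
  rw [extendsTo, Bool.and_eq_true, Bool.and_eq_true, List.all_eq_true, List.all_eq_true] at h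
  obtain ⟨⟨hS, hE⟩, hU⟩ := h
  -- descent on the number of the vector of new weights
  have key (i : ℕ) : i < 4 ^ n → (∀ u < n, dgt 4 i u < 3) → ∀ G : WeightedGraph 3 (n + 1),
      IsExtension (ofCode n c) (fun u => (dgt 4 i u : ℕ)) G →
      ∃ c ∈ R', Reach G (ofCode (n + 1) c) := by
    induction i using Nat.strong_induction_on with | _ i ih => ?_
    intro hi hd G hG
    have hbit : (coveredMask n c S E).testBit i = true := by
      rw [← Nat.eq_of_beq_eq_true hU]
      change (_ ||| weightMask n).testBit i = true
      rw [Nat.testBit_or, testBit_weightMask hn.le hi hd, Bool.or_true]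
    rcases testBit_coveredMask.1 hbit with ⟨s, hs, h⟩ | ⟨r, hr, rfl⟩
    · obtain ⟨j, hj, hjd, G', hr, hG'⟩ := exists_lt_of_testBit_loopMask hn hi hd (hS s hs) h hG
      obtain ⟨c', hc', h'⟩ := ih j hj (hj.trans hi) hjd G' hG'
      exact ⟨c', hc', hr.trans h'⟩
    · exact exists_reach_of_isReduced hn (hE r hr) hG
  obtain ⟨i, hi, hd⟩ := exists_dgt_eq (n := n) (b := 4) (fun u => (y u).val)
    fun u => (ZMod.val_lt (y u)).trans (by omega)
  have hy : y = fun u : Fin n => ((dgt 4 i u : ℕ) : ZMod 3) := by ext u; rw [hd]; simp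
  rw [hy] at hG'
  obtain ⟨c', hc', h'⟩ := key i hi (fun u hu => by rw [hd ⟨u, hu⟩]; exact ZMod.val_lt _) G' hG'
  exact ⟨c', hc', hr'.trans h'⟩

end Completeness

/-! ### Counting isomorphism classes -/

namespace WeightedGraph

variable {n : ℕ}

/-- The permutations of the vertices act on the weighted graphs by relabelling. -/
instance : MulAction (Equiv.Perm (Fin n)) (WeightedGraph 3 n) where
  smul σ G := G.relabel σ⁻¹
  one_smul G := G.relabel_one
  mul_smul σ τ G := by
    change G.relabel (σ * τ)⁻¹ = (G.relabel τ⁻¹).relabel σ⁻¹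
    rw [relabel_relabel, mul_inv_rev]

theorem smul_def (σ : Equiv.Perm (Fin n)) (G : WeightedGraph 3 n) : σ • G = G.relabel σ⁻¹ := rfl

theorem orbitRel_eq_isoSetoid :
    MulAction.orbitRel (Equiv.Perm (Fin n)) (WeightedGraph 3 n) = isoSetoid n := by
  ext G H
  rw [MulAction.orbitRel_apply, MulAction.mem_orbit_iff]
  change _ ↔ G.Isomorphic H
  rw [isomorphic_iff]
  constructor
  · rintro ⟨σ, h⟩
    exact ⟨σ⁻¹, h.symm⟩
  · rintro ⟨σ, h⟩
    exact ⟨σ⁻¹, by rw [smul_def, inv_inv, h]⟩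

/-- The orbit-counting lemma for the relabellings. -/
theorem sum_card_fixedBy : ∑ σ : Equiv.Perm (Fin n),
    Nat.card (MulAction.fixedBy (WeightedGraph 3 n) σ) = Nat.card (GraphClass n) * n.factorial := by
  classical
  have := Fintype.ofFinite (WeightedGraph 3 n)
  have := Fintype.ofFinite (GraphClass n)
  have := Fintype.ofFinite
    (Quotient (MulAction.orbitRel (Equiv.Perm (Fin n)) (WeightedGraph 3 n)))
  have h := MulAction.sum_card_fixedBy_eq_card_orbits_mul_card_group (Equiv.Perm (Fin n))
    (WeightedGraph 3 n)
  rw [Fintype.card_perm, Fintype.card_fin, ← Nat.card_eq_fintype_card,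
    orbitRel_eq_isoSetoid] at h
  rw [← h]
  exact Finset.sum_congr rfl fun σ _ => Nat.card_eq_fintype_card

theorem card_fixedBy_conj {σ τ : Equiv.Perm (Fin n)} (h : IsConj σ τ) :
    Nat.card (MulAction.fixedBy (WeightedGraph 3 n) σ) =
      Nat.card (MulAction.fixedBy (WeightedGraph 3 n) τ) := by
  obtain ⟨g, rfl⟩ := isConj_iff.1 h
  rw [← MulAction.smul_fixedBy, Set.natCard_smul_set]

/-- `col` is a `σ`-invariant colouring of the pairs of vertices in which the pairs of distinct
vertices receive all the colours below `c`. -/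
def IsInvariantColouring (σ : Equiv.Perm (Fin n)) (col : Fin n → Fin n → ℕ) (c : ℕ) : Prop :=
  (∀ u v, col u v = col v u) ∧ (∀ u v, col (σ u) (σ v) = col u v) ∧
    ∀ k < c, ∃ u v, u ≠ v ∧ col u v = k

instance (σ : Equiv.Perm (Fin n)) (col : Fin n → Fin n → ℕ) (c : ℕ) :
    Decidable (IsInvariantColouring σ col c) := by
  unfold IsInvariantColouring
  infer_instance

/-- Every assignment of weights to the colours gives a weighted graph fixed by `σ`. -/
theorem IsInvariantColouring.pow_le_card_fixedBy {σ : Equiv.Perm (Fin n)}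
    {col : Fin n → Fin n → ℕ} {c : ℕ} (h : IsInvariantColouring σ col c) :
    3 ^ c ≤ Nat.card (MulAction.fixedBy (WeightedGraph 3 n) σ) := by
  obtain ⟨hs, hi, hc⟩ := h
  let w (f : Fin c → ZMod 3) (k : ℕ) : ZMod 3 := if hk : k < c then f ⟨k, hk⟩ else 0
  let G (f : Fin c → ZMod 3) : WeightedGraph 3 n :=
    ⟨fun u v => if u = v then 0 else w f (col u v),
      fun u v => by simp only [hs u v, eq_comm (a := u)], fun u => by simp⟩
  have hG f : G f ∈ MulAction.fixedBy (WeightedGraph 3 n) σ := by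
    rw [MulAction.mem_fixedBy, smul_eq_iff_eq_inv_smul, smul_def, inv_inv]
    ext u v
    simp only [G, relabel, EmbeddingLike.apply_eq_iff_eq, hi]
  have hinj : Function.Injective fun f => (⟨G f, hG f⟩ : MulAction.fixedBy _ σ) := by
    intro f f' hff
    have hΓ : (G f).Γ = (G f').Γ := congrArg (fun x => (Subtype.val x).Γ) hff
    ext k
    obtain ⟨u, v, huv, hk⟩ := hc k k.2
    have := congrFun (congrFun hΓ u) v
    simpa [G, w, huv, hk] using this
  have := Nat.card_le_card_of_injective _ hinj
  rwa [Nat.card_fun, Nat.card_eq_fintype_card, Nat.card_eq_fintype_card, ZMod.card,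
    Fintype.card_fin] at this

/-- The number of permutations of `n` points with the given cycle type. -/
def cycleTypeCount (n : ℕ) (m : Multiset ℕ) : ℕ :=
  n.factorial / ((n - m.sum).factorial * m.prod * (m.dedup.map fun k => (m.count k).factorial).prod)

/-- The permutation with the given cycles. -/
def ofCycles (l : List (List (Fin n))) : Equiv.Perm (Fin n) := (l.map List.formPerm).prod

/-- The lengths of the given cycles. -/
def cycleLengths (l : List (List (Fin n))) : Multiset ℕ := l.map List.length

/-- The colouring of pairs whose colours are the base `32` digits of `x`. -/
def pairColour (x : ℕ) (u v : Fin n) : ℕ := x / 32 ^ (u.val * n + v.val) % 32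

/-- A lower bound for the number of isomorphism classes, from the orbit-counting lemma: a row lists
the cycles of a permutation, a number of colours and an invariant colouring. -/
theorem le_card_graphClass {N : ℕ} (rows : List (List (List (Fin n)) × ℕ × ℕ))
    (hd : (rows.map fun r => cycleLengths r.1).Nodup)
    (h : ∀ r ∈ rows, (ofCycles r.1).cycleType = cycleLengths r.1 ∧
      IsInvariantColouring (ofCycles r.1) (pairColour r.2.2) r.2.1)
    (hN : N * n.factorial ≤
      (rows.map fun r => cycleTypeCount n (cycleLengths r.1) * 3 ^ r.2.1).sum) :
    N ≤ Nat.card (GraphClass n) := by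
  refine Nat.le_of_mul_le_mul_right (hN.trans ?_) n.factorial_pos
  rw [← sum_card_fixedBy]
  have key (s : Finset (Equiv.Perm (Fin n))) (hs : ∀ r ∈ rows, ∀ σ : Equiv.Perm (Fin n),
      σ.cycleType = cycleLengths r.1 → σ ∈ s) :
      (rows.map fun r => cycleTypeCount n (cycleLengths r.1) * 3 ^ r.2.1).sum ≤
        ∑ σ ∈ s, Nat.card (MulAction.fixedBy (WeightedGraph 3 n) σ) := by
    clear hN
    induction rows generalizing s with
    | nil => simp
    | cons r rows ih =>
      rw [List.map_cons, List.nodup_cons] at hd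
      obtain ⟨hr, hcol⟩ := h r List.mem_cons_self
      rw [List.map_cons, List.sum_cons,
        ← Finset.sum_filter_add_sum_filter_not s fun σ => σ.cycleType = cycleLengths r.1]
      refine Nat.add_le_add ?_ (ih hd.2 (fun r' hr' => h r' (List.mem_cons_of_mem _ hr')) _ ?_)
      · have hfilter : s.filter (fun σ => σ.cycleType = cycleLengths r.1) =
            Finset.univ.filter fun σ : Equiv.Perm (Fin n) => σ.cycleType = cycleLengths r.1 := by
          ext σ
          simpa using fun hσ => hs r List.mem_cons_self σ hσ
        have hcard : (s.filter fun σ => σ.cycleType = cycleLengths r.1).card =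
            cycleTypeCount n (cycleLengths r.1) := by
          rw [hfilter, Equiv.Perm.card_of_cycleType, if_pos, Fintype.card_fin]
          · rfl
          · rw [← hr]
            exact ⟨Equiv.Perm.sum_cycleType_le _,
              fun a ha => Equiv.Perm.two_le_of_mem_cycleType ha⟩
        rw [← hcard, ← smul_eq_mul]
        refine Finset.card_nsmul_le_sum _ _ _ fun σ hσ => ?_
        rw [card_fixedBy_conj (Equiv.Perm.isConj_iff_cycleType_eq.2
          ((Finset.mem_filter.1 hσ).2.trans hr.symm))]
        exact hcol.pow_le_card_fixedBy
      · intro r' hr' σ hσ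
        refine Finset.mem_filter.2 ⟨hs r' (List.mem_cons_of_mem _ hr') σ hσ, fun hσ' => ?_⟩
        exact hd.1 (List.mem_map.2 ⟨r', hr', hσ.symm.trans hσ'⟩)
  exact key _ fun _ _ σ _ => Finset.mem_univ σ

theorem le_card_graphClass_three : 10 ≤ Nat.card (GraphClass 3) :=
  le_card_graphClass
    [([[0, 1, 2]], 1, 34084892966943),
      ([[0, 1]], 2, 34120360002591),
      ([], 3, 34154753295391)]
    (by decide +kernel) (by decide +kernel) (by decide +kernel)

theorem le_card_graphClass_four : 66 ≤ Nat.card (GraphClass 4) :=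
  le_card_graphClass
    [([[0, 1, 2, 3]], 2, 1171183816143851455775775),
      ([[0, 1, 2]], 2, 1172365596713770981294111),
      ([[0, 1], [2, 3]], 4, 1174728005005774851998751),
      ([[0, 1]], 4, 1174764898458771185009695),
      ([], 6, 1177199940804534494888991)]
    (by decide +kernel) (by decide +kernel) (by decide +kernel)

theorem le_card_graphClass_five : 792 ≤ Nat.card (GraphClass 5) :=
  le_card_graphClass
    [([[0, 1, 2, 3, 4]], 2, 41207406546743622209197615072784974879),
      ([[0, 1, 2, 3]], 3, 41291824550043346833885017064211481631),
      ([[0, 1, 2], [3, 4]], 3, 41290484643397627856867872485403557919),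
      ([[0, 1, 2]], 4, 41333362964564430154097323169881817119),
      ([[0, 1], [2, 3]], 6, 41420375848758956872853208667608122399),
      ([[0, 1]], 7, 41461914263242525676797208332321489951),
      ([], 10, 41590545423910815650727758418867717151)]
    (by decide +kernel) (by decide +kernel) (by decide +kernel)

theorem le_card_graphClass_six : 25506 ≤ Nat.card (GraphClass 6) :=
  le_card_graphClass
    [([[0, 1, 2, 3, 4, 5]], 3, 1484654791984634390218820220243719582140200570137412639),
      ([[0, 1, 2, 3, 4]], 3, 1487694764005907157262456845971750061146646596525523999),
      ([[0, 1, 2, 3], [4, 5]], 5, 1490689382377380968133245837192541602078511849243935775),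
      ([[0, 1, 2, 3]], 5, 1490736196101658124979323104385353214803422251694687263),
      ([[0, 1, 2], [3, 4, 5]], 5, 1490779995478940316400393738937138500275302420363378719),
      ([[0, 1, 2], [3, 4]], 5, 1490781455553283674864923397090571901514042994127306783),
      ([[0, 1, 2]], 7, 1493822887648991085108297706619242202695507973500862495),
      ([[0, 1], [2, 3], [4, 5]], 9, 1496868658577775559681942330352218960450353927451378719),
      ([[0, 1], [2, 3]], 9, 1496915472302052716528019597545030573175264329902130207),
      ([[0, 1]], 11, 1500002163849385676656992970504422736012341561764414495),
      ([], 15, 1506181575638311201548536652098082134643125828482827295)]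
    (by decide +kernel) (by decide +kernel) (by decide +kernel)

theorem le_card_graphClass_seven : 2302938 ≤ Nat.card (GraphClass 7) :=
  le_card_graphClass
    [([[0, 1, 2, 3, 4, 5, 6]], 3,
        54774095707202576438538428176151717390962845194175524844961048403355173919),
      ([[0, 1, 2, 3, 4, 5]], 4,
        54943244207992017640717431215165040648305891942905729522784869143534437407),
      ([[0, 1, 2, 3, 4], [5, 6]], 4,
        54941463112213770614506270138481415484358833989040394964743710291508888607),
      ([[0, 1, 2, 3, 4]], 5,
        54998458178817866172964767032671814134408511603424791256348496840236237855),
      ([[0, 1, 2, 3], [4, 5, 6]], 4,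
        54943188548800518472268555359440606055023776528415814792465587968044696607),
      ([[0, 1, 2, 3], [4, 5]], 7,
        55114118089421254240565277712253199190880424099534329200975700457733227551),
      ([[0, 1, 2, 3]], 8,
        55169332060247002339088972789788311660367047382147639461190005678875345951),
      ([[0, 1, 2], [3, 4, 5]], 7,
        55114225929207927452871043397589221537234886019279492435824491911962460191),
      ([[0, 1, 2], [3, 4], [5, 6]], 7,
        55110717657544562172381703295856210333972492603354137942505214599263977503),
      ([[0, 1, 2], [3, 4]], 8,
        55169438160735356941063989349030923614176359112903195138953880590271676447),
      ([[0, 1, 2]], 11,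
        55340312042164493107188195060474101134434015233516445709438526507599298591),
      ([[0, 1], [2, 3], [4, 5]], 12,
        55399093205235389643685055960194778338885214247889094241406425391554429983),
      ([[0, 1], [2, 3]], 13,
        55454307176061137742208751037729890808371837530502404501620730612696548383),
      ([[0, 1]], 16,
        55625287157978628510307973308415680282398524516359636307840472542560191519),
      ([], 21,
        55910262482771842699303010588026854186774726249238488789740990328663507999)]
    (by decide +kernel) (by decide +kernel) (by decide +kernel)

end WeightedGraph

/-! ### The certificates of the classes -/

section Certificates

open WeightedGraph

/-- The set of vertices with the bit mask `m` is a union of components of the graph `c`. -/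
def isClosed (n c m : ℕ) : Bool :=
  allLt n fun u => allLt n fun v =>
    Nat.beq (Nat.mod (entry n c u v) 3) 0 || Nat.testBit m u == Nat.testBit m v

/-- The graph `c` is connected: no nonempty set without the last vertex is a union of components. -/
def isConnected (n c : ℕ) : Bool :=
  allLt (Nat.sub (Nat.pow 2 (Nat.sub n 1)) 1) fun m => !isClosed n c (Nat.succ m)

theorem support_adj_ofCode {n c : ℕ} {u v : Fin n} :
    (ofCode n c).support.Adj u v ↔ entry n c u v % 3 ≠ 0 := by
  change ((entry n c u v : ℕ) : ZMod 3) ≠ 0 ↔ _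
  rw [Ne, ← Nat.cast_zero, cast_eq_cast_iff]

theorem isClosed_iff {n c m : ℕ} : isClosed n c m = true ↔
    ∀ u v : Fin n, (ofCode n c).support.Adj u v → m.testBit u = m.testBit v := by
  simp only [isClosed, allLt_eq_true, Bool.or_eq_true, beq_iff_eq, support_adj_ofCode]
  constructor
  · exact fun h u v huv => (h u u.2 v v.2).resolve_left fun h0 => huv (Nat.eq_of_beq_eq_true h0)
  · intro h u hu v hv
    by_cases h0 : entry n c u v % 3 = 0
    · exact Or.inl (congrArg (Nat.beq · 0) h0)
    · exact Or.inr (h ⟨u, hu⟩ ⟨v, hv⟩ h0)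

theorem connected_ofCode_iff {n c : ℕ} (hn : 0 < n) :
    (ofCode n c).support.Connected ↔ isConnected n c = true := by
  obtain ⟨n, rfl⟩ := Nat.exists_eq_succ_of_ne_zero hn.ne'
  rw [isConnected, allLt_eq_true]
  change _ ↔ ∀ m < 2 ^ n - 1, (!isClosed (n + 1) c (m + 1)) = true
  simp only [Bool.not_eq_true', ← Bool.not_eq_true, isClosed_iff]
  constructor
  · intro h m hm hclosed
    have hall (u v : Fin (n + 1)) : (m + 1).testBit u = (m + 1).testBit v := by
      obtain ⟨p⟩ := h.preconnected u v
      induction p with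
      | nil => rfl
      | cons h _ ih => exact (hclosed _ _ h).trans ih
    refine Nat.succ_ne_zero m (Nat.eq_of_testBit_eq fun i => ?_)
    rw [Nat.zero_testBit]
    by_cases hi : i < n
    · rw [show (m + 1).testBit i = _ from hall ⟨i, by omega⟩ (Fin.last n)]
      exact Nat.testBit_lt_two_pow (by simp; omega)
    · exact Nat.testBit_lt_two_pow
        ((by omega : m + 1 < 2 ^ n).trans_le (Nat.pow_le_pow_right (by omega) (by omega)))
  · intro h
    by_contra hcon
    classical
    -- the complement of the component of the last vertex
    let G := (ofCode (n + 1) c).support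
    let m := Nat.ofBits fun i : Fin n => decide (¬ G.Reachable (Fin.last n) i.castSucc)
    have hm (v : Fin (n + 1)) : m.testBit v = decide (¬ G.Reachable (Fin.last n) v) := by
      induction v using Fin.lastCases with
      | last =>
        rw [Nat.testBit_ofBits_ge _ _ (by simp), eq_comm, decide_eq_false_iff_not, not_not]
      | cast i => exact Nat.testBit_ofBits_lt _ _ i.2
    have hlt : m < 2 ^ n := Nat.ofBits_lt_two_pow _
    have h0 : m ≠ 0 := by
      intro h0
      refine hcon ((SimpleGraph.connected_iff_exists_forall_reachable _).2
        ⟨Fin.last n, fun v => ?_⟩)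
      have := hm v
      rw [h0, Nat.zero_testBit, eq_comm, decide_eq_false_iff_not, not_not] at this
      exact this
    obtain ⟨k, hk⟩ := Nat.exists_eq_succ_of_ne_zero h0
    refine h k (by omega) fun u v huv => ?_
    change (k.succ).testBit u = (k.succ).testBit v
    rw [← hk, hm, hm, decide_eq_decide, not_iff_not]
    exact ⟨fun h => h.trans huv.reachable, fun h => h.trans huv.symm.reachable⟩

theorem forall_mem_of_getD {α : Type} [Inhabited α] {p : α → Prop} {l : List α}
    (h : ∀ i < l.length, p (l.getD i default)) : ∀ a ∈ l, p a := by
  intro a ha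
  obtain ⟨i, hi, rfl⟩ := List.mem_iff_getElem.1 ha
  simpa [hi] using h i hi

/-- The data that certify the size of the Clifford class of a graph and its minimality. -/
structure ClassCertificate where
  /-- The code of the graph. -/
  code : ℕ
  /-- The total weight of the graph. -/
  weight : ℕ
  /-- The number of isomorphism classes in its Clifford class. -/
  size : ℕ
  /-- Symmetries of the graph that suffice to identify the frames of isomorphic graphs. -/
  symmetries : List ℕ
  /-- For a connected graph, the frames of the graphs with the fewest edges. -/
  frames : List (ℕ × ℕ × ℕ)

instance : Inhabited ClassCertificate := ⟨⟨0, 0, 0, [], []⟩⟩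

/-- The symmetries are valid, and the number of frames that they leave is at most the size. -/
def ClassCertificate.isValid (n : ℕ) : ClassCertificate → Bool
  | ⟨c, _, s, L, _⟩ => L.all (isSymmetry n (entry n c)) &&
    Nat.ble (popcount (Nat.sub (Nat.mul 3 n) 6) (firstFrames n (firstPoints n c L) L)) s

theorem ClassCertificate.isSymmetry_of_isValid {n : ℕ} {z : ClassCertificate}
    (h : z.isValid n = true) : ∀ S ∈ z.symmetries, isSymmetry n (entry n z.code) S = true := by
  rw [isValid, Bool.and_eq_true, List.all_eq_true] at h
  exact h.1

theorem ClassCertificate.ncard_le {n : ℕ} {z : ClassCertificate} (h3 : 3 ≤ n) (h7 : n ≤ 7)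
    (h : z.isValid n = true) : (cliffordClass (ofCode n z.code)).ncard ≤ z.size := by
  have hL := isSymmetry_of_isValid h
  rw [isValid, Bool.and_eq_true] at h
  have h2 := Nat.le_of_ble_eq_true h.2
  exact (ncard_cliffordClass_le_popcount h3 h7 hL).trans h2

/-- The tight cover that consists of the certified classes. -/
def TightCover.ofCertificates {n : ℕ} (Z : List ClassCertificate) (h3 : 3 ≤ n) (h7 : n ≤ 7)
    (hv : ∀ z ∈ Z, z.isValid n = true)
    (hc : ∀ G : WeightedGraph 3 n, ∃ c ∈ Z.map (·.code), Reach G (ofCode n c))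
    (hs : (Z.map (·.size)).sum ≤ Nat.card (GraphClass n)) : TightCover n Z.length where
  reps i := ofCode n Z[i].code
  bound i := Z[i].size
  complete G := by
    obtain ⟨c, hc, h⟩ := hc G
    obtain ⟨z, hz, rfl⟩ := List.mem_map.1 hc
    obtain ⟨i, hi, rfl⟩ := List.mem_iff_getElem.1 hz
    exact ⟨⟨i, hi⟩, h⟩
  ncard_le i := ClassCertificate.ncard_le h3 h7 (hv _ (List.getElem_mem i.2))
  sum_le := by
    rw [← Fin.sum_univ_fun_getElem] at hs
    exact hs

/-- The graph is the one in a row of the table. -/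
def ClassCertificate.isRow (n : ℕ) (z : ClassCertificate) (r : TableRow) : Bool :=
  (isConnected n z.code && (z.size == r.orbitSize && z.weight == r.representative.sum)) &&
    ((upperPairs n).map (fun e => entry n z.code e.1 e.2 % 3) == r.representative &&
      (r.representative.countP (· ≠ 0) == r.edges && Nat.ofDigits 4 r.representative == z.code))

/-- The graph with `e` edges has the smallest key in its Clifford class. -/
def ClassCertificate.isMinimal (n e : ℕ) : ClassCertificate → Bool
  | ⟨c, w, _, L, F⟩ => isKeyMinimal n c (firstPoints n c L) e w c F

theorem ClassCertificate.le_key {n e : ℕ} {z : ClassCertificate} (hn : 0 < n) (h7 : n ≤ 7)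
    (hv : z.isValid n = true) (h : z.isMinimal n e = true) {H : WeightedGraph 3 n}
    (hH : CliffordEquiv (ofCode n z.code) H) : toLex (e, toLex (z.weight, z.code)) ≤ H.key := by
  have hL := isSymmetry_of_isValid hv
  cases z
  exact le_key_of_isKeyMinimal hn h7 hL h hH

theorem upperTriangle_ofCode (n c : ℕ) :
    (ofCode n c).upperTriangle = (upperPairs n).map fun e => entry n c e.1 e.2 % 3 := by
  rw [upperTriangle_eq_map]
  exact List.map_congr_left fun e _ => ZMod.val_natCast 3 _

/-- The table `T` lists the representatives of the orbits of graphs on `n` vertices. -/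
def ListsRepresentatives (n : ℕ) (T : List TableRow) : Prop :=
  ∃ g : Fin T.length → ConnectedGraph n,
    Function.Bijective (fun i => orbitOf (g i)) ∧
    Monotone (fun i => toLex ((g i).1.edgeCount, (g i).1.totalWeight)) ∧
    ∀ i, (g i).1.upperTriangle = T[i].representative ∧
      (g i).1.edgeCount = T[i].edges ∧
      IsRepresentative (g i) ∧
      (orbitOf (g i)).size = T[i].orbitSize

/-- Certificates for all the classes, those of the connected ones in the order of the table,
show that the graphs in the table are the representatives of the orbits. -/
theorem listsRepresentatives_of_certificates {n : ℕ} {Z : List ClassCertificate} {T : List TableRow}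
    (h3 : 3 ≤ n) (h7 : n ≤ 7) (hv : ∀ i < Z.length, (Z.getD i default).isValid n = true)
    (hc : ∀ G : WeightedGraph 3 n, ∃ c ∈ Z.map (·.code), Reach G (ofCode n c))
    (hs : (Z.map (·.size)).sum ≤ Nat.card (GraphClass n))
    (hT : T.length ≤ Z.length) (hr : ∀ p ∈ Z.zip T, p.1.isRow n p.2 = true)
    (hmin : ∀ i < T.length,
      (Z.getD i default).isMinimal n ((T.map (·.edges)).getD i default) = true)
    (hd : ∀ z ∈ Z.drop T.length, isConnected n z.code = false)
    (hm : (T.map fun r => toLex (r.edges, r.representative.sum)).Pairwise (· ≤ ·)) :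
    ListsRepresentatives n T := by
  have hv : ∀ z ∈ Z, z.isValid n = true :=
    forall_mem_of_getD (p := fun z : ClassCertificate => z.isValid n = true) hv
  let C := TightCover.ofCertificates Z h3 h7 hv hc hs
  let e (i : Fin T.length) : Fin Z.length := i.castLE hT
  have hrow (i : Fin T.length) : Z[e i].isRow n T[i] = true := by
    refine hr (Z[e i], T[i]) (List.mem_iff_getElem.2 ⟨i, by simpa using i.2.trans_le hT, ?_⟩)
    simp [e]
  simp only [ClassCertificate.isRow, Bool.and_eq_true, beq_iff_eq] at hrow
  let g (i : Fin T.length) : ConnectedGraph n :=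
    ⟨ofCode n Z[e i].code, (connected_ofCode_iff (by omega)).2 (hrow i).1.1⟩
  have hup (i) : (g i).1.upperTriangle = T[i].representative :=
    (upperTriangle_ofCode _ _).trans (hrow i).2.1
  have hedge (i) : (g i).1.edgeCount = T[i].edges := by
    rw [WeightedGraph.edgeCount, hup, (hrow i).2.2.1]
  have hweight (i) : (g i).1.totalWeight = T[i].representative.sum := by
    rw [WeightedGraph.totalWeight, hup]
  refine ⟨g, ?_, ?_, fun i => ⟨hup i, hedge i, fun H hH => ?_, ?_⟩⟩
  · refine C.bijective_orbitOf g e (Fin.castLE_injective hT) (fun _ => rfl) fun i hi => ?_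
    by_cases hlt : i < T.length
    · exact ⟨⟨i, hlt⟩, rfl⟩
    · have h0 : isConnected n Z[i].code = false :=
        hd _ (List.mem_iff_getElem.2 ⟨i - T.length, by simp; omega, by
          rw [List.getElem_drop]; congr 1; omega⟩)
      rw [(connected_ofCode_iff (by omega)).1 hi] at h0
      exact absurd h0 (by simp)
  · intro i j hij
    simp only [hedge, hweight]
    rcases hij.eq_or_lt with rfl | hij
    · exact le_rfl
    · have := List.pairwise_iff_getElem.1 hm i j (by simp) (by simp) hij
      simpa using this
  · have hi : Z[e i].isMinimal n T[i].edges = true := by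
      have := hmin i.1 i.2
      rwa [List.getD_eq_getElem _ _ (i.2.trans_le hT), List.getD_eq_getElem _ _ (by simp),
        List.getElem_map] at this
    have hk : (g i).1.key = toLex (T[i].edges, toLex (Z[e i].weight, Z[e i].code)) := by
      rw [WeightedGraph.key, hedge, hweight, WeightedGraph.encoding, hup, (hrow i).2.2.2,
        (hrow i).1.2.2]
    rw [hk]
    exact ClassCertificate.le_key (by omega) h7 (hv _ (List.getElem_mem (e i).2)) hi
      (cliffordEquiv_of_orbitOf_eq hH.symm)
  · rw [C.size_orbitOf, ← (hrow i).1.2.1]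
    exact C.ncard_eq (e i)

/-- Certificates for the extensions of the graphs on `n` vertices: the code of a graph, a list of
loops and a list of the extensions that these leave. -/
theorem exists_reach_of_extensions {n : ℕ} (hn : n < 7)
    (E : List (ℕ × List (ℕ × List ℕ) × List (ℕ × ℕ × ℕ × List ℕ))) {R' : List ℕ}
    (hE : ∀ G : WeightedGraph 3 n, ∃ c ∈ E.map (·.1), Reach G (ofCode n c))
    (h : ∀ i < E.length, extendsTo n (E.getD i default).1 R' (E.getD i default).2.1
      (E.getD i default).2.2 = true) (G : WeightedGraph 3 (n + 1)) :
    ∃ c ∈ R', Reach G (ofCode (n + 1) c) := by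
  refine exists_reach_succ hn hE (fun c hc => ?_) G
  obtain ⟨z, hz, rfl⟩ := List.mem_map.1 hc
  exact ⟨z.2.1, z.2.2,
    forall_mem_of_getD (p := fun z => extendsTo n z.1 R' z.2.1 z.2.2 = true) h z hz⟩

end Certificates

/-! ### The certificates of completeness -/

section ExtensionData

set_option maxRecDepth 100000

/-- The codes of representatives of all the classes of graphs on one vertex, each with
loops and with the extensions that remain. -/
def extensionsOne : List (ℕ × List (ℕ × List ℕ) × List (ℕ × ℕ × ℕ × List ℕ)) := [
    (0, [(98, [])], [(0, 1, 14, []), (1, 0, 14, [])])]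

/-- The codes of representatives of all the classes of graphs on two vertices, each with
loops and with the extensions that remain. -/
def extensionsTwo : List (ℕ × List (ℕ × List ℕ) × List (ℕ × ℕ × ℕ × List ℕ)) := [
    (1, [(1, [7]), (1386, []), (1373, [7])], [(0, 1, 406, []), (1, 0, 406, [])]),
    (0, [(1386, []), (1380, [])], [(0, 2, 406, []), (1, 1, 224, []), (5, 0, 198, [])])]

/-- The codes of representatives of all the classes of graphs on three vertices, each with
loops and with the extensions that remain. -/
def extensionsThree : List (ℕ × List (ℕ × List ℕ) × List (ℕ × ℕ × ℕ × List ℕ)) := [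
    (5, [(19614, []), (19237, [0, 8]), (406, [8]), (406, [1])], [(0, 3, 8638, []), (1, 0, 8638,
      []), (4, 1, 6090, []), (24, 2, 7098, [])]),
    (1, [(393, [7]), (19614, []), (20973, [0, 8])], [(0, 5, 8638, []), (1, 3, 6090, []), (16, 4,
      8638, []), (17, 1, 3178, [])]),
    (0, [(19614, []), (20980, []), (1577, [])], [(0, 6, 8638, []), (1, 5, 5726, []), (5, 3, 5687,
      []), (21, 0, 5687, [])])]

/-- The codes of representatives of all the classes of graphs on four vertices, each with
loops and with the extensions that remain. -/
def extensionsFour : List (ℕ × List (ℕ × List ℕ) × List (ℕ × ℕ × ℕ × List ℕ)) := [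
    (21, [(277550, []), (8456, [10]), (6090, [1]), (8638, [8]), (277265, [0, 1, 2]), (8638, [1])],
      [(0, 5, 162302, []), (1, 0, 162302, []), (4, 1, 121534, []), (20, 2, 140742, [1, 11, 1]),
      (24, 4, 122360, [])]),
    (81, [(277550, []), (8638, [9, 10]), (3334, [1, 9]), (8638, [10]), (277368, [1, 9, 1])], [(0,
      6, 162302, []), (1, 1, 162302, []), (5, 2, 121534, [11]), (6, 2, 142212, [4]), (16, 2,
      126448, []), (18, 4, 147126, []), (80, 3, 118440, [])]),
    (344, [(277550, []), (25292, []), (22354, [10, 1, 10]), (27938, [10, 9]), (247, []), (294204,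
      [])], [(0, 7, 162302, []), (1, 4, 162302, []), (17, 3, 126630, [4])]),
    (5, [(277550, []), (8359, [7, 1]), (8638, [1]), (8638, [8]), (296758, [])], [(0, 9, 162302,
      []), (1, 5, 126630, []), (4, 6, 121534, []), (24, 7, 122360, []), (64, 8, 162302, []), (65,
      1, 80220, []), (68, 2, 85316, []), (88, 4, 120936, [])]),
    (1025, [(295582, [9]), (298117, [10, 0]), (277550, [7]), (271805, []), (8638, [7])], [(0, 10,
      162302, []), (1, 8, 121534, []), (17, 2, 47460, [])]),
    (1, [(277550, []), (8625, [7]), (276361, [0]), (298117, [0, 8, 9])], [(0, 11, 162302, []), (1,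
      9, 121534, []), (16, 10, 126630, []), (17, 6, 118440, []), (80, 8, 39036, []), (81, 1,
      120936, [])]),
    (0, [(277550, []), (25292, []), (296674, [1, 2]), (298124, [1, 10])], [(0, 12, 162302, []), (1,
      11, 120988, []), (5, 9, 120936, []), (21, 5, 120936, []), (85, 0, 120936, [])])]

/-- The codes of representatives of all the classes of graphs on five vertices, each with
loops and with the extensions that remain. -/
def extensionsFive : List (ℕ × List (ℕ × List ℕ) × List (ℕ × ℕ × ℕ × List ℕ)) := [
    (85, [(3927070, []), (50008, []), (162302, [1]), (121534, [8]), (3891021, [0, 8, 11]),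
      (3924522, []), (153891, [0, 10, 8])], [(0, 21, 2851422, []), (1, 0, 2851422, []), (4, 1,
      2273026, []), (20, 3, 2292234, [1, 12, 1]), (24, 10, 2273670, []), (88, 11, 2568706, [1, 5,
      9])]),
    (337, [(3927070, []), (162302, [11]), (162302, [9, 10]), (162120, [1, 9]), (3795368, [0, 4,
      3]), (162302, [10]), (3891216, [1, 9, 1]), (3792625, [0, 3, 4])], [(0, 22, 2851422, []), (1,
      1, 2851422, []), (4, 2, 2280670, []), (5, 3, 2273026, [12]), (6, 3, 2293704, [5]), (16, 3,
      2280488, []), (18, 10, 2301166, []), (64, 4, 2242450, []), (68, 5, 2511460, [3, 12, 3]), (72,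
      13, 2506364, []), (80, 8, 2269750, []), (384, 14, 2541210, []), (400, 16, 2538662, [])]),
    (1348, [(3927070, []), (162302, [10, 11]), (49787, [1, 10]), (162302, [11]), (3767950, [0, 1,
      10, 1, 11])], [(0, 23, 2851422, []), (1, 3, 2851422, []), (5, 6, 2280670, []), (6, 11,
      2273026, []), (16, 4, 2851214, []), (17, 5, 2280670, [12]), (18, 5, 2570260, [5]), (21, 12,
      2280670, [9]), (22, 13, 2542036, [2, 5]), (26, 7, 2280670, [2]), (64, 5, 2349102, []), (65,
      8, 2242450, []), (66, 8, 2636144, [1, 9, 1, 12]), (96, 14, 6772334, []), (97, 17, 2272298,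
      []), (320, 9, 1238538, []), (336, 15, 2346736, [0, 11, 0])]),
    (20816, [(3927070, []), (3883546, []), (159741, []), (334138, [1, 11, 2, 10]), (39036, []),
      (4098906, [1, 11, 2, 10]), (118538, [2, 8, 3, 7]), (140742, [0, 10, 4, 8])], [(0, 24,
      2851422, []), (1, 8, 2851422, []), (6, 16, 2352014, []), (20, 9, 2280670, [12]), (21, 15,
      1666420, [3, 12, 1, 11]), (25, 9, 2261658, [4, 5, 9, 3]), (81, 17, 2848471, [10]), (90, 20,
      2299878, [2]), (341, 19, 1808842, [7, 8, 5])]),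
    (1368, [(3927070, []), (180432, []), (162302, [2, 3]), (162302, [11]), (178696, [1, 2, 3]),
      (162302, [9, 10]), (3788628, [0, 10, 1, 11]), (176050, [1, 2, 3])], [(0, 25, 2851422, []),
      (1, 10, 2851422, []), (4, 11, 2352014, []), (16, 13, 2351832, []), (17, 8, 2280670, [5]),
      (96, 14, 4889953, [1, 2, 12]), (100, 17, 2638594, [1, 5]), (256, 14, 1704822, []), (260, 16,
      1702274, []), (272, 9, 6788026, [0, 10, 1, 11, 5, 7]), (400, 18, 2236626, []), (404, 20,
      2291506, [8])]),
    (21, [(3927070, []), (4190704, []), (162302, [8]), (4187948, [0, 9, 1]), (4187571, [0, 10, 9]),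
      (4195982, [])], [(0, 27, 2851422, []), (1, 21, 2352014, []), (4, 22, 2273026, []), (20, 23,
      2292234, [1, 12, 1]), (24, 25, 2273670, []), (256, 26, 2851422, []), (257, 1, 1693902, []),
      (260, 3, 1701546, []), (276, 6, 1772890, []), (280, 11, 1774262, [])]),
    (273, [(3927070, []), (159741, []), (4187753, [0, 10]), (162302, [9]), (162302, [10]),
      (4195800, [1, 9, 1])], [(0, 29, 2851422, []), (1, 22, 2352014, []), (5, 23, 2273026, [12]),
      (6, 23, 2293704, [5]), (16, 23, 2280488, []), (18, 25, 2301166, []), (80, 24, 2269750, []),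
      (256, 28, 2851422, []), (257, 4, 1702274, []), (261, 7, 1702274, []), (262, 12, 1991864, []),
      (272, 5, 1770342, []), (274, 13, 1770342, []), (336, 8, 2272233, [])]),
    (1304, [(3927070, []), (178956, []), (174582, []), (162302, [9, 10]), (4190529, [1, 10, 1,
      11]), (4211200, [1, 10, 1, 11]), (161211, [])], [(0, 31, 2851422, []), (1, 25, 2352014, []),
      (17, 24, 2280670, [5]), (256, 30, 2851422, []), (257, 14, 1702274, []), (273, 17, 2272233,
      [])]),
    (262149, [(3927070, []), (4215008, []), (414750, [8, 10]), (126448, [8, 10]), (4214800, [8, 0,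
      9]), (162017, [0, 1, 2])], [(0, 33, 2851422, []), (1, 26, 2280670, []), (4, 28, 2273026, []),
      (24, 30, 2273670, []), (64, 32, 2851422, []), (65, 3, 1126062, []), (68, 5, 1233078, []),
      (88, 14, 1125633, [])]),
    (5, [(3927070, []), (3910606, []), (4215190, []), (4214813, [1, 9, 0, 8]), (4215288, [1, 2, 7,
      2, 8, 4, 8, 2, 7])], [(0, 34, 2851422, []), (1, 27, 2280670, []), (4, 29, 2273026, []), (24,
      31, 2273670, []), (64, 33, 2352014, []), (65, 22, 2231530, []), (68, 23, 2236626, []), (88,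
      25, 2272233, []), (320, 32, 2280670, []), (321, 2, 1125698, []), (324, 3, 2272233, []), (344,
      10, 2272233, [])]),
    (16385, [(3927070, []), (4208151, []), (162289, [1, 11, 1, 7]), (156452, []), (162289, [11,
      7]), (4216562, [4, 10, 8])], [(0, 36, 2851422, []), (1, 33, 2273026, []), (17, 23, 2198952,
      []), (256, 35, 2851422, []), (257, 28, 1693902, []), (273, 4, 2198341, [])]),
    (1, [(3927070, []), (3911965, [1]), (4194806, [8, 10]), (4216549, [1, 0, 1, 9, 4]), (4216549,
      [10, 0, 10, 11, 8, 9])], [(0, 37, 2851422, []), (1, 34, 2273026, []), (16, 36, 2280670, []),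
      (17, 29, 2269750, []), (80, 33, 2190333, []), (81, 22, 2272233, []), (336, 26, 549421, []),
      (337, 1, 2272233, [])]),
    (0, [(3927070, []), (3886400, [3]), (178962, [3, 4, 2, 4]), (4216562, [2, 1, 3]), (4214112, [9,
      3, 8, 4]), (4216660, [2])], [(0, 38, 2851422, []), (1, 37, 2272298, []), (4, 37, 2272103,
      []), (5, 34, 2272233, []), (16, 37, 2269360, []), (17, 34, 2269685, []), (20, 34, 2266955,
      []), (21, 27, 2272233, []), (80, 34, 2190333, []), (81, 27, 2198341, []), (84, 27, 2159939,
      []), (85, 21, 2272233, []), (336, 27, 549421, []), (337, 21, 700117, []), (340, 21, 162307,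
      []), (341, 0, 2272233, [])])]

/-- The codes of representatives of all the classes of graphs on six vertices, each with
loops and with the extensions that remain. -/
def extensionsSix : List (ℕ × List (ℕ × List ℕ) × List (ℕ × ℕ × ℕ × List ℕ)) := [
    (341, [(55558174, []), (2810654, [10]), (2231530, [2]), (2851240, [1, 4]), (1229555, [0, 12,
      7]), (2851422, [10, 9, 11]), (53975086, [0, 11]), (1625444, [0, 9, 8, 5, 10]), (2851422, [2,
      10, 5, 10]), (55056218, [8, 3, 11])], [(0, 73, 48028638, []), (1, 0, 48028638, []), (4, 1,
      39920902, []), (20, 3, 39940110, [1, 13, 1]), (24, 21, 39921364, []), (84, 4, 40209022, [1,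
      13, 1]), (88, 22, 40219130, [1, 6, 9]), (360, 38, 40167890, [1, 6, 10])]),
    (1361, [(55558174, []), (2851422, [12]), (2815750, [9]), (2851240, [1, 9, 10]), (2352014, [9]),
      (2428858, [10, 7, 5]), (2851422, [11]), (55522320, [1, 9, 1]), (2851422, [9]), (54603273, [7,
      4])], [(0, 74, 48028638, []), (1, 1, 48028638, []), (4, 2, 39931094, []), (5, 3, 39920902,
      [13]), (6, 3, 39941580, [6]), (16, 3, 39930912, []), (18, 21, 39951590, []), (64, 5,
      39892874, []), (68, 7, 40161884, [3, 13, 3]), (72, 24, 40154240, []), (80, 13, 39917444, []),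
      (320, 8, 43799966, [3, 13, 3]), (328, 26, 43799966, [3, 13, 3]), (336, 15, 44089556, [2, 8,
      6, 10]), (384, 25, 40188904, []), (388, 27, 43262156, [3, 6, 11]), (400, 39, 40186356, [])]),
    (5441, [(55558174, []), (2848874, [12]), (1704809, []), (2851422, [2]), (2869090, [8, 9, 10]),
      (2851422, [11]), (2352014, [9]), (56941154, [7, 12, 11])], [(0, 75, 48028638, []), (1, 2,
      48028638, []), (5, 4, 39920902, [13]), (6, 4, 40210492, [6]), (16, 6, 39931094, []), (17, 7,
      40210492, [2, 13, 2]), (18, 24, 40220684, []), (96, 28, 39940110, []), (272, 17, 39421494,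
      []), (288, 30, 43205568, []), (352, 43, 39919992, []), (1632, 61, 39919914, [])]),
    (5444, [(55558174, []), (2851422, [12]), (2851422, [10, 11]), (55058766, []), (2845962, [1,
      10]), (2159939, [0, 12]), (2851422, [11]), (55552714, [1, 10, 1])], [(0, 76, 48028638, []),
      (1, 3, 48028638, []), (4, 4, 40038110, []), (5, 11, 39931094, []), (6, 22, 39920902, []),
      (16, 6, 40037928, []), (17, 7, 39931094, [13]), (18, 7, 40220684, [6]), (20, 7, 39920902,
      [13]), (21, 23, 39931094, [9]), (22, 24, 40189912, [2, 6]), (24, 7, 40189912, [6]), (25, 24,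
      40220684, [2, 6]), (26, 12, 39931094, [2]), (64, 7, 40035198, []), (65, 13, 39892874, []),
      (66, 13, 40322240, [1, 9, 1, 13]), (96, 28, 40322324, []), (97, 40, 39919992, []), (256, 8,
      39355246, []), (260, 15, 39350150, []), (264, 15, 39355246, [9, 4, 13, 4]), (272, 10,
      43282008, [4, 13, 4]), (276, 17, 43552292, [9, 6, 11]), (280, 30, 43282008, [2, 13, 4]),
      (288, 31, 43205568, []), (292, 42, 39768218, [2, 6, 11]), (296, 42, 43205568, [9, 11]), (320,
      18, 38886414, []), (336, 32, 39151238, [1, 10, 1]), (352, 35, 37728030, [0, 1, 10, 1, 11,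
      0]), (1536, 33, 23887697, []), (1540, 43, 23887697, []), (1600, 44, 43649088, [])]),
    (278789, [(55558174, []), (2815568, []), (2851422, [11, 12]), (2851422, [10]), (2848874, [2,
      10]), (52887091, [0, 9, 3, 12]), (2851422, [12]), (55765864, [0, 8, 4, 9, 3, 7]), (52866511,
      [0, 12, 2, 10])], [(0, 77, 48028638, []), (1, 5, 48028638, []), (4, 6, 47529217, []), (5, 8,
      40038110, [13]), (6, 8, 44071888, [6]), (20, 14, 31975861, []), (21, 29, 31940189, [13]),
      (22, 16, 88431022, [6]), (24, 26, 84682620, []), (25, 41, 43695960, []), (64, 8, 40962670,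
      []), (66, 25, 44996448, []), (68, 17, 39892874, []), (69, 30, 43715168, [2, 10, 2]), (70, 42,
      39892874, []), (320, 18, 38779034, []), (321, 32, 40182366, [1, 11, 1]), (1024, 9, 31963121,
      []), (1028, 10, 84631660, [5, 13, 5]), (1032, 31, 84669880, []), (1064, 45, 32233405, []),
      (1088, 19, 38880408, []), (1096, 46, 43650460, []), (1344, 36, 38773392, [])]),
    (279824, [(55558174, []), (2851422, [11, 12]), (54864195, [0, 12]), (2851422, [12]), (52753853,
      [0, 12, 1, 11]), (2349453, []), (55442968, [11, 1, 11])], [(0, 78, 48028638, []), (1, 7,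
      48028638, []), (5, 15, 40038110, []), (6, 15, 44089920, [2, 10, 2, 13]), (16, 8, 47992758,
      []), (17, 14, 45017028, [2, 10, 2]), (18, 27, 39502848, []), (20, 10, 39931094, [13]), (21,
      17, 43947232, [13, 2, 10]), (22, 42, 39931094, [10, 13]), (24, 10, 43695960, [6]), (25, 30,
      39912082, [6, 9, 3]), (26, 42, 39912082, [9, 3, 6]), (80, 10, 39920902, [13]), (81, 29,
      45088372, [10]), (82, 31, 43704976, [3, 6]), (85, 30, 40174722, [13, 2, 3]), (86, 42,
      43938216, [2, 10, 13]), (90, 55, 86023428, [9]), (96, 10, 43704976, [6]), (97, 31, 44089920,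
      [3, 6]), (98, 16, 41034014, [3]), (101, 42, 43823556, [2, 10, 13]), (102, 17, 43670676, [6,
      9, 10]), (105, 55, 32939369, [2]), (256, 10, 40993064, []), (257, 18, 39495204, []), (258,
      32, 39495204, []), (288, 33, 39784696, []), (289, 35, 38088339, [0, 1, 10, 0, 11, 1]), (320,
      19, 18478897, []), (321, 37, 39885230, []), (322, 47, 39885230, []), (336, 19, 19554979, [9,
      6, 11]), (337, 47, 44973530, [10]), (338, 49, 39226306, [1, 11, 1]), (352, 48, 39418036, []),
      (353, 49, 43697150, [1, 10, 11, 1]), (354, 37, 40919172, [3]), (1280, 20, 39418036, []),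
      (1296, 34, 29201480, [1, 11, 1]), (1312, 50, 39919914, []), (1440, 57, 6057757, [7, 10,
      12])]),
    (21780, [(55558174, []), (2848874, [12]), (2851422, [12, 11]), (55225493, [0, 10, 0]),
      (59287095, [1, 9, 4, 3]), (2851422, [3, 9, 11]), (2352001, [4, 2, 10]), (52753853, [0, 1, 11,
      12]), (2851422, [2, 10, 4]), (54756634, [0, 9, 0])], [(0, 79, 48028638, []), (1, 11,
      48028638, []), (6, 38, 39920902, []), (16, 14, 39931094, []), (17, 15, 39931094, [13]), (80,
      9, 40200006, [2, 13, 2]), (81, 16, 35704957, [13, 2]), (82, 29, 35724263, [6, 9]), (86, 41,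
      33228861, [6, 9]), (96, 45, 39920902, []), (97, 55, 39920902, []), (272, 32, 39624158, [4,
      13, 4]), (288, 35, 38078342, [0, 10, 0]), (1296, 52, 25438070, []), (1312, 54, 39919914,
      [])]),
    (279813, [(55558174, []), (1816726, []), (2851422, [3]), (2352001, []), (2851422, [11]),
      (2848874, [2, 10]), (2851422, [10]), (2851422, [12]), (55555626, [2, 10, 2]), (55476274, [1,
      11, 2, 10])], [(0, 80, 48028638, []), (1, 12, 48028638, []), (5, 14, 40038110, [13]), (6, 26,
      44092468, [6]), (21, 9, 39931094, [13]), (22, 29, 88431022, [6]), (64, 16, 40035562, []),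
      (65, 30, 43975260, [3, 13, 3]), (66, 42, 39920902, [3, 13, 3]), (74, 45, 40305846, [2, 6]),
      (320, 37, 39919992, []), (321, 47, 43631546, [3, 9, 6, 11]), (1344, 53, 39919914, [])]),
    (279888, [(55558174, []), (2815568, []), (2851422, [12]), (3023258, [1, 11, 2, 10]), (52833205,
      [0, 12]), (52869059, [0, 12]), (55730010, [1, 11, 2, 10]), (55765864, [1, 11, 2, 10])], [(0,
      81, 48028638, []), (1, 13, 48028638, []), (4, 15, 41036926, []), (6, 39, 40038110, []), (20,
      18, 39931094, [13]), (21, 32, 39316844, [3, 13, 1, 11]), (24, 32, 40220586, [6]), (25, 18,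
      39912082, [4, 6, 9, 3]), (64, 17, 41034014, []), (65, 18, 40035562, [13]), (66, 32, 40035562,
      [6]), (68, 30, 44801512, [2, 10, 2, 4]), (69, 32, 40327602, [4, 13, 3, 9]), (70, 18,
      40307022, [4, 6, 10, 2]), (72, 43, 39892874, []), (73, 35, 37779848, [0, 11, 3, 9, 13]), (74,
      35, 90448373, [2, 6, 7, 4]), (80, 18, 39920902, [13]), (81, 42, 41034014, [10]), (82, 18,
      39595416, [1, 3, 11, 1, 6]), (88, 35, 38004268, [0, 2, 11, 0, 6]), (89, 35, 37771028, [0, 11,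
      3, 9, 13]), (90, 65, 39950302, [2]), (320, 19, 17404428, [1, 9, 4, 13]), (321, 48, 40955026,
      [13]), (322, 19, 83556899, [3, 9, 6, 11]), (324, 47, 44957234, [13, 1, 9]), (325, 49,
      42731640, [2, 13, 4]), (326, 37, 42543900, [3, 13, 4, 9]), (340, 49, 42627900, [13, 1, 2]),
      (341, 62, 39440702, [8, 10, 6]), (342, 66, 38965038, [10, 2, 11]), (344, 37, 43070790, [1, 9,
      4, 13]), (345, 66, 42044310, [11, 13, 3]), (346, 62, 39418036, [4]), (384, 46, 100940837, [1,
      9, 1, 13]), (385, 37, 39866036, [1, 9, 1, 13]), (388, 49, 39518066, [1, 9, 4, 6]), (390, 46,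
      85632049, [8, 2, 11, 13]), (392, 49, 40993064, [6, 8, 2]), (393, 66, 40167988, [9, 6]), (394,
      37, 40919452, [1, 9, 4, 13]), (408, 47, 42537082, [6, 8, 9]), (409, 62, 39431686, [2]),
      (1024, 19, 31976238, []), (1028, 36, 31940566, []), (1044, 53, 31940566, []), (1048, 56,
      32929190, []), (1088, 34, 37197286, [5, 13, 5]), (1092, 20, 37232958, [2, 10, 4, 6, 12, 2]),
      (1096, 50, 32264345, [2, 10, 11, 6, 12, 2]), (1112, 58, 37485406, [10, 11, 6, 12]), (1152,
      50, 33431146, [5, 13, 5]), (1156, 58, 39919992, []), (1160, 50, 32929190, [2, 10, 2, 4]),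
      (1184, 57, 92626842, []), (1188, 63, 2272415, [0, 2, 12, 0]), (1664, 59, 92626842, []),
      (1668, 67, 92626842, [4, 5]), (1684, 69, 1663332, [0, 8, 12, 0]), (1688, 64, 39342968, [2, 8,
      3])]),
    (1380672, [(55558174, []), (1816557, []), (55058584, []), (544143, []), (52786990, []),
      (2351832, []), (2815737, []), (55522489, []), (1115103, []), (80238, [])], [(0, 82, 48028638,
      []), (1, 18, 48028638, []), (5, 35, 48028638, []), (6, 44, 41036926, []), (21, 52, 39931094,
      []), (22, 54, 39931094, []), (65, 36, 48025726, []), (66, 36, 2848523, [0, 8, 9, 13, 0]),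
      (68, 20, 40038110, [13]), (69, 50, 65605876, [2, 11, 2, 13, 1, 12]), (70, 50, 72490754, [1,
      2, 11, 2, 12, 13]), (72, 34, 44092370, [6]), (73, 50, 70875126, [2, 11, 2, 5, 6]), (74, 50,
      9920022, [6, 8, 5]), (84, 49, 47954161, [10]), (85, 56, 40038110, [10]), (86, 56, 39931094,
      [11, 12, 13, 3]), (88, 50, 41034365, [10, 13]), (89, 58, 31076808, [8, 11, 5, 10, 13]), (90,
      58, 39250974, [9, 4, 10, 5, 13]), (104, 37, 48025687, [3]), (105, 53, 40038110, [3]), (106,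
      53, 40219214, [11, 12, 6, 10]), (325, 58, 33653538, [13, 0, 4, 9, 12]), (326, 67, 44801688,
      [2, 10, 2]), (330, 58, 29888686, [0, 2, 10, 2, 12, 0]), (337, 50, 70886130, [13, 2, 4]),
      (338, 57, 70617120, [4, 6]), (341, 63, 42651182, [10, 11, 6]), (342, 69, 45036300, [9]),
      (346, 58, 35266916, [0, 2, 4, 10, 12, 13]), (353, 57, 100735208, [2]), (354, 50, 19814214,
      [1, 12, 1, 6, 9, 11]), (357, 58, 23703812, [7, 5, 11, 13, 3]), (358, 64, 39920902, [4]),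
      (362, 63, 44801694, [2]), (390, 57, 9878994, [0, 8, 10, 2, 5, 6]), (393, 57, 75923903, [7, 5,
      11, 13, 3]), (402, 67, 15254553, [0, 8, 4, 6]), (405, 68, 62914992, [9, 13, 1, 12]), (406,
      68, 39422853, [3]), (408, 67, 24933736, [0, 2, 12, 4, 13]), (409, 68, 6422939, [7, 5, 13, 3,
      11]), (410, 70, 93671256, [10, 4]), (1365, 53, 68333320, [0, 1, 3, 4, 9, 12, 6]), (1366, 68,
      80312385, [4, 5, 7, 13, 3]), (1370, 68, 45869325, [9, 5]), (1386, 56, 81302185, [0, 1, 12, 6,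
      9]), (1430, 64, 100661134, [0, 3]), (1433, 72, 36825012, [1, 9]), (1434, 71, 623755, [0]),
      (1449, 69, 47917495, [7, 10, 1, 9])]),
    (5464, [(55558174, []), (2851422, [12]), (2851422, [2, 3]), (2370144, []), (2851422, [11]),
      (2159939, [0, 12]), (2865170, [1, 2, 3]), (2851422, [9, 10]), (2848510, [1, 10, 1]), (180437,
      [0, 12]), (55073984, [1, 10, 1])], [(0, 83, 48028638, []), (1, 21, 48028638, []), (4, 22,
      40038110, []), (16, 24, 40037928, []), (17, 13, 39931094, [6]), (96, 28, 40149508, [1, 2,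
      13]), (100, 40, 40324690, [1, 6]), (256, 25, 39355246, []), (260, 39, 39350150, []), (272,
      18, 44973530, [0, 10, 1, 11, 6, 7]), (352, 33, 40959940, [4, 13, 4]), (356, 43, 41285104, [2,
      13, 4]), (400, 60, 39884320, []), (404, 65, 39939200, [8]), (1536, 51, 23887710, []), (1540,
      61, 23887710, []), (1552, 44, 100694076, [4, 13, 4])]),
    (21784, [(55558174, []), (6133436, []), (2851422, [11]), (53156101, [0, 12]), (2851422, [12]),
      (2851422, [3, 2]), (3023258, [1, 11, 2, 3]), (2851422, [9, 10, 11]), (59111746, []),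
      (55060125, [9, 10]), (6790581, [1, 11])], [(0, 84, 48028638, []), (1, 22, 48028638, []), (5,
      38, 40038110, []), (16, 26, 39931094, []), (17, 15, 39931094, [6]), (80, 31, 40200006, [2,
      13, 2]), (81, 42, 43657740, [9, 6, 10]), (256, 27, 39355246, []), (257, 39, 39355246, []),
      (272, 18, 39624158, [4, 13, 4]), (288, 35, 38173990, [0, 10, 0, 4, 13, 4]), (416, 60,
      43452542, [1, 9, 1]), (417, 65, 39235322, [1, 10, 13]), (1280, 44, 23868502, []), (1296, 54,
      25438070, []), (1344, 52, 69894692, [4, 13, 4])]),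
    (279814, [(55558174, []), (6045068, []), (2851422, [11]), (2851422, [10, 12]), (3105158, []),
      (2848874, [2, 10]), (2352001, [5]), (55811910, []), (55555626, [2, 10, 2]), (2851422, [12])],
      [(0, 85, 48028638, []), (1, 23, 48028638, []), (5, 14, 40038110, [6]), (6, 26, 44092468,
      [13]), (21, 16, 39931094, [13]), (26, 9, 40220586, [6]), (64, 29, 40035562, []), (65, 17,
      43975260, [3, 13, 3]), (66, 42, 44089920, []), (74, 45, 40305846, [9, 13]), (320, 47,
      39919992, []), (321, 49, 43687140, [2, 10, 2, 4]), (1344, 56, 39919914, [])]),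
    (279826, [(55558174, []), (2851422, [11, 12]), (55348343, [3, 9, 3]), (3924534, [0, 10, 2,
      12]), (2851422, [12]), (2349453, []), (3002678, [1, 9, 3, 11])], [(0, 86, 48028638, []), (1,
      24, 48028638, []), (5, 15, 40038110, [6]), (16, 26, 41001072, []), (18, 27, 39118842, [2, 3,
      6]), (20, 30, 39931094, [13]), (22, 31, 39931094, [10, 13]), (24, 17, 43695960, [6]), (26,
      31, 43695960, [3, 6]), (80, 30, 39920902, [13]), (81, 41, 45088372, [10]), (82, 42, 43704976,
      [3, 6]), (85, 17, 40174722, [13, 2, 3]), (86, 42, 40327602, [9, 3, 6]), (90, 55, 43715168,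
      [9, 13]), (256, 31, 40993064, []), (257, 18, 43933582, [0, 10, 2, 13, 4, 7]), (288, 35,
      38094807, [0, 10, 0, 4, 13, 4]), (289, 60, 39784696, []), (320, 46, 17918363, []), (321, 37,
      39503128, [3, 9, 6, 11]), (322, 49, 40995612, [2, 4, 13, 4]), (352, 37, 43610966, [2, 3, 6,
      11]), (353, 66, 43472394, [10]), (354, 49, 40148682, [9, 13, 4, 10]), (1280, 50, 39418036,
      []), (1312, 58, 25723460, [1, 11, 1, 12]), (1440, 63, 100658314, [2, 3, 13, 4, 12])]),
    (344452, [(55558174, []), (2851422, [4, 5]), (6385792, [10]), (2851422, [3, 11, 12]), (5963272,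
      [1, 4, 5]), (2851422, [11, 12]), (2848874, [2, 10]), (57458744, [10, 0, 9, 3, 12, 1, 7]),
      (6385792, []), (57458744, [0, 9, 3, 12, 1, 7])], [(0, 87, 48028638, []), (1, 25, 48028638,
      []), (4, 27, 48297537, []), (16, 28, 46993942, []), (17, 33, 26018806, [13]), (18, 33,
      82490333, [6]), (20, 43, 26037832, []), (64, 33, 46456119, []), (66, 51, 40325054, []), (68,
      44, 39892874, []), (256, 31, 46830116, []), (257, 19, 40996158, [6]), (272, 35, 27891777, [0,
      9, 6, 12, 1, 7]), (273, 49, 29274716, [1, 12, 1, 13]), (274, 37, 81787197, [1, 12, 1, 6]),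
      (320, 50, 17989902, []), (322, 57, 61751634, [8, 11, 12]), (1536, 33, 23016366, [1, 4, 13]),
      (1540, 48, 23112196, [1, 6]), (1552, 45, 99923768, [0, 11, 0]), (1556, 46, 39761114, [6, 11,
      0]), (1568, 60, 82732589, [0, 11, 0]), (1572, 66, 75761709, [0, 11, 13]), (1600, 59,
      10762637, []), (1604, 67, 38057835, [2, 7, 4, 10])]),
    (1380736, [(55558174, []), (6045237, []), (3105229, []), (57586728, []), (59112942, []),
      (4424124, [0, 11, 2, 12, 1, 7]), (56841348, []), (53084718, [0, 2, 10, 2, 12, 0]), (57384852,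
      [0, 11, 2, 12, 1, 7]), (1259216, [0, 1, 10, 1, 11, 0]), (4678100, [0, 11, 2, 12, 1, 7])],
      [(0, 88, 48028638, []), (1, 32, 48028638, []), (6, 44, 104789748, []), (21, 52, 86104690, [1,
      10, 1]), (65, 36, 47954382, [2, 11, 2, 13]), (68, 34, 40038110, [13]), (70, 57, 96799220,
      []), (72, 20, 44092370, [6]), (73, 57, 13974282, [1, 12, 13]), (84, 47, 101020566, [10]),
      (85, 56, 86247378, [10]), (88, 50, 39709601, [3, 6]), (90, 63, 6337738, [0, 12, 0]), (105,
      53, 88257946, [8, 4, 5, 10, 13]), (390, 70, 95726512, []), (401, 67, 103745217, [1, 9, 12, 3,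
      11]), (405, 68, 3641797, [0, 2, 10, 12, 0]), (1365, 68, 68698873, [7, 3, 8, 5, 9, 13]),
      (1370, 63, 102840767, [1, 10, 11, 5])]),
    (345488, [(55558174, []), (53675879, [1, 12, 2, 10]), (2851422, [11, 12]), (198311, [0, 9, 11,
      0]), (55824525, []), (57458744, [1, 12, 2, 10]), (59110576, [1, 10, 11, 1, 4, 8, 2, 10])],
      [(0, 89, 48028638, []), (1, 39, 48028638, []), (16, 43, 46993942, []), (18, 61, 39931094,
      []), (20, 44, 39931094, [13]), (24, 44, 89411000, [6]), (256, 46, 40996158, []), (257, 36,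
      39503030, [6]), (272, 50, 27063708, [1, 10, 11, 6, 12, 1]), (274, 57, 92498000, [10, 13, 4]),
      (288, 58, 39719806, []), (289, 63, 6625628, [7, 3, 11, 13]), (336, 64, 43802878, [13, 2]),
      (337, 67, 42948312, [10, 2, 5]), (338, 69, 6326213, [0, 2, 4, 5])]),
    (1335569, [(55558174, []), (2769522, []), (2851422, [12]), (3062556, [2, 3, 4]), (53135157, [0,
      12, 8, 10, 11]), (52774797, [0, 12, 8, 10, 11]), (55754566, [1, 3, 9]), (55476274, []),
      (3047814, [1, 3, 9]), (52828396, [0, 1, 5, 11, 2])], [(0, 90, 48028638, []), (1, 40,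
      48028638, []), (4, 42, 48028625, []), (5, 35, 90729857, [7, 2, 11, 2, 6]), (6, 35, 37810151,
      [0, 13]), (24, 43, 39349338, [2, 4, 6]), (25, 55, 100731270, [1, 10]), (26, 65, 40925920, [1,
      2, 3]), (68, 19, 72262623, [8, 11, 2, 6]), (72, 46, 10666081, [8, 9, 6]), (73, 47, 41271454,
      [1, 3, 9, 6]), (80, 49, 39931094, [13]), (104, 37, 38962308, [6, 9, 4]), (272, 49, 39920902,
      [13]), (273, 62, 38422412, [9, 6]), (274, 37, 43358910, [8, 2, 10, 11, 6]), (288, 47,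
      43650558, [6]), (289, 66, 42352814, [2, 4, 6]), (1024, 48, 45336975, []), (1028, 50,
      38732436, [1, 11, 2, 13, 5, 8]), (1032, 57, 47337207, [0, 6]), (1048, 67, 84682698, [3, 4]),
      (1060, 67, 84647026, [5, 13, 5]), (1160, 59, 92017870, [7, 13]), (1172, 70, 30538979, [0, 12,
      0]), (1296, 68, 39919914, []), (1316, 68, 39421956, [3, 4])]),
    (1401232, [(55558174, []), (59576854, []), (4879963, []), (2851422, [3, 4, 12]), (2851422, [10,
      11, 5]), (58300454, [1, 11, 1]), (57461292, [1, 12, 1]), (59265802, [4, 9, 4]), (3105242, [0,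
      1, 9])], [(0, 91, 48028638, []), (1, 60, 48028638, []), (6, 51, 31923933, [0, 5, 6]), (17,
      54, 73347329, [2, 13, 2]), (65, 58, 63623140, [1, 12, 1, 6]), (70, 59, 96799220, [5, 6]),
      (401, 70, 96507180, [6, 10])]),
    (21316944, [(55558174, []), (1809082, []), (2349453, []), (53253274, []), (5002481, [2, 10, 4,
      12, 2]), (163595, [0, 12, 0]), (1086893, []), (6512068, [1, 7, 2, 10, 12, 11]), (711233, [1,
      10, 7, 12, 9, 11]), (128105, [0, 12, 0]), (57675745, [2, 10, 4, 12, 2]), (1646635, [0, 1, 3,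
      9, 4, 5]), (57716162, [0, 11, 1, 9, 0])], [(0, 92, 48028638, []), (1, 62, 48028638, []), (5,
      56, 37811178, [11, 0, 13]), (6, 64, 100446584, [2, 10, 2, 13]), (20, 63, 48028261, [13]),
      (22, 63, 104417491, [8, 3, 9, 4, 5, 6]), (81, 68, 31141711, [7, 4, 5, 10, 13]), (98, 53,
      95756919, [6, 9, 1, 7, 10]), (329, 69, 82911123, [9, 4, 6])]),
    (18433360, [(55558174, []), (2848861, []), (52834857, [0, 12, 0]), (2810654, [10, 4]),
      (57552310, [1, 7, 10, 4]), (2815737, [10, 4]), (2798110, [10, 2, 12]), (180339, [7, 5, 10,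
      2]), (718214, [8, 5, 9, 3])], [(0, 93, 48028638, []), (1, 65, 48028638, []), (6, 61,
      77638973, [0, 2, 5, 6]), (16, 66, 46986298, []), (17, 63, 2870611, [0, 3, 4, 6]), (18, 58,
      42940674, [3, 9, 12, 6]), (22, 67, 9381153, [8, 11, 12, 6]), (96, 57, 79765468, [11, 0, 3,
      12, 13]), (416, 54, 23867521, [6]), (418, 54, 24937681, [10, 13]), (1040, 53, 38194652, [10,
      5, 13, 5]), (1041, 64, 2368355, [10, 13, 5]), (1042, 68, 2637365, [10, 6, 12]), (1046, 71,
      60348175, [3, 4, 13]), (1056, 69, 72185903, [0, 8, 9, 6]), (1057, 72, 29487156, [0, 10, 13]),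
      (1058, 68, 80607829, [0, 4, 8, 3, 6]), (1066, 56, 35963073, [1, 11, 0, 6])]),
    (85, [(55558174, []), (3100251, []), (2848510, [4]), (59612357, [9]), (59286880, [0, 9]),
      (2851422, [1, 5, 4]), (59320394, [5]), (2810654, [8]), (3141019, [])], [(0, 95, 48028638,
      []), (1, 73, 41036926, []), (4, 74, 39920902, []), (20, 76, 39940110, [1, 13, 1]), (24, 83,
      39921364, []), (88, 84, 40219130, [1, 6, 9]), (1024, 94, 48028638, []), (1025, 1, 31812256,
      []), (1028, 3, 31822448, []), (1044, 11, 31929464, []), (1048, 22, 31930836, []), (1112, 38,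
      32929652, [])]),
    (1105, [(55558174, []), (59287270, []), (2851422, [10]), (2851422, [3, 9]), (59169282, [0,
      11]), (2697580, [1, 9, 0, 11]), (59287088, [1, 9, 1])], [(0, 97, 48028638, []), (1, 74,
      41036926, []), (4, 75, 39931094, []), (5, 76, 39920902, [13]), (6, 76, 39941580, [6]), (16,
      76, 39930912, []), (18, 83, 39951590, []), (64, 77, 39892874, []), (68, 78, 40161884, [3, 13,
      3]), (72, 86, 40154240, []), (80, 81, 39917444, []), (384, 87, 40188904, []), (400, 89,
      40186356, []), (1024, 96, 48028638, []), (1025, 5, 31823358, []), (1028, 6, 31823358, []),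
      (1029, 12, 31823358, []), (1030, 23, 32112948, []), (1040, 7, 31926916, []), (1042, 24,
      31926916, []), (1088, 8, 32928280, []), (1092, 14, 32928280, []), (1096, 26, 32948860, []),
      (1104, 15, 32925732, []), (1408, 27, 39919914, []), (1424, 39, 39919914, [])]),
    (5188, [(55558174, []), (59287257, []), (2851422, [10]), (59169282, [0, 11]), (2815737, [11]),
      (59163822, [10, 1, 0, 11, 10]), (2851422, [11])], [(0, 99, 48028638, []), (1, 76, 41036926,
      []), (5, 79, 39931094, []), (6, 84, 39920902, []), (16, 77, 41036718, []), (17, 78, 39931094,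
      [13]), (18, 78, 40220684, [6]), (21, 85, 39931094, [9]), (22, 86, 40189912, [2, 6]), (26, 80,
      39931094, [2]), (64, 78, 40035198, []), (65, 81, 39892874, []), (66, 81, 40322240, [1, 9, 1,
      13]), (96, 87, 44957838, []), (97, 90, 39919992, []), (320, 82, 38886414, []), (336, 88,
      40032832, [0, 11, 0]), (1024, 98, 48028638, []), (1025, 8, 31823358, []), (1029, 14,
      31823358, []), (1030, 26, 31823358, []), (1040, 9, 31930374, []), (1041, 16, 32928280, []),
      (1042, 29, 32928280, []), (1045, 29, 31930374, [9]), (1046, 41, 39919914, []), (1050, 16,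
      31930374, [2]), (1088, 10, 32892608, []), (1089, 17, 32892608, []), (1090, 30, 32892608, []),
      (1120, 31, 39919914, []), (1121, 42, 39919914, []), (1344, 18, 39919914, []), (1360, 32,
      39267444, [0, 11, 0])]),
    (279632, [(55558174, []), (59279418, []), (2848861, []), (3023258, [1, 11, 2, 10]), (2728156,
      []), (59494778, [1, 11, 2, 10]), (2807658, [2, 8, 3, 7]), (2829862, [0, 10, 4, 8])], [(0,
      101, 48028638, []), (1, 81, 41036926, []), (6, 89, 40038110, []), (20, 82, 39931094, [13]),
      (21, 88, 39316844, [3, 13, 1, 11]), (25, 82, 39912082, [4, 6, 9, 3]), (81, 90, 41033975,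
      [10]), (90, 93, 39950302, [2]), (341, 92, 39494938, [7, 8, 6]), (1024, 100, 48028638, []),
      (1025, 19, 31940566, []), (1030, 46, 32929190, []), (1044, 37, 39919914, []), (1045, 47,
      92324833, [0, 10, 4, 8]), (1049, 49, 92914611, [2, 10, 2, 4]), (1105, 48, 39417958, [10]),
      (1114, 66, 91584359, [2]), (1365, 62, 42110018, [0, 1, 9, 3, 11])]),
    (5208, [(55558174, []), (59341072, []), (2851422, [11]), (2865170, [1, 2, 3]), (2851422, [9,
      10]), (59184500, [0, 10, 1, 11]), (2851422, [2, 3]), (59187412, [0, 11])], [(0, 103,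
      48028638, []), (1, 83, 41036926, []), (4, 84, 40038110, []), (16, 86, 40037928, []), (17, 81,
      39931094, [6]), (96, 87, 42537634, [1, 2, 13]), (100, 90, 40324690, [1, 6]), (256, 87,
      39355246, []), (260, 89, 39350150, []), (272, 82, 44973530, [0, 10, 1, 11, 6, 7]), (400, 91,
      39884320, []), (404, 93, 39939200, [8]), (1024, 102, 48028638, []), (1025, 25, 31823358, []),
      (1028, 27, 31823358, []), (1040, 31, 32928280, []), (1041, 42, 32928280, []), (1120, 45,
      32947488, []), (1124, 55, 39939122, []), (1280, 33, 39919914, []), (1284, 43, 39919914, []),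
      (1296, 35, 104671994, [0, 10, 1, 11, 6, 7]), (1424, 60, 39919914, []), (1428, 65, 39918738,
      [8])]),
    (268435477, [(55558174, []), (6380234, [10, 11]), (2851422, [1, 5, 1, 5]), (2851045, [9, 0, 8,
      10]), (2846118, [10, 0, 9]), (55056218, [1, 5, 8, 11, 5]), (2851422, [9, 3]), (59591854, [1,
      5])], [(0, 105, 48028638, []), (1, 94, 40038110, []), (4, 96, 39920902, []), (20, 98,
      39940110, [1, 13, 1]), (24, 102, 39921364, []), (256, 104, 48028638, []), (257, 3, 23717624,
      []), (260, 7, 23860312, []), (276, 14, 27694618, [1, 13, 1]), (280, 27, 23986172, [])]),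
    (21, [(55558174, []), (55324766, [10, 11]), (59583820, [8, 0, 9, 4]), (2851240, [9, 3, 4, 5]),
      (59585095, [1, 7, 3, 4, 12]), (59607130, [7, 2, 5]), (2848874, [8, 10])], [(0, 106, 48028638,
      []), (1, 95, 40038110, []), (4, 97, 39920902, []), (20, 99, 39940110, [1, 13, 1]), (24, 103,
      39921364, []), (256, 105, 41036926, []), (257, 74, 39341596, []), (260, 76, 39349240, []),
      (276, 79, 39420584, []), (280, 84, 39421956, []), (1280, 104, 40038110, []), (1281, 2,
      23717260, []), (1284, 4, 23867592, []), (1300, 11, 39919914, []), (1304, 22, 39919914, [])]),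
    (268436497, [(2349453, [11]), (59591854, [5]), (6885102, [9]), (59588747, [0, 10]), (2851422,
      [9]), (2851422, [10, 5]), (2844481, [7, 1, 9, 3])], [(0, 108, 48028638, []), (1, 96,
      40038110, []), (5, 98, 39920902, [13]), (6, 98, 39941580, [6]), (16, 98, 39930912, []), (18,
      102, 39951590, []), (80, 100, 39917444, []), (256, 107, 48028638, []), (257, 8, 25513964,
      []), (261, 16, 23873598, []), (262, 29, 27927956, []), (272, 10, 25333056, []), (274, 31,
      25333056, []), (336, 19, 23867514, [])]),
    (1041, [(55558174, []), (55327678, []), (59589293, [9]), (2851422, [9, 11]), (59591854, []),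
      (2851422, [10, 4, 12]), (59588747, [0, 10]), (59591672, [9, 1, 9])], [(0, 109, 48028638, []),
      (1, 97, 40038110, []), (5, 99, 39920902, [13]), (6, 99, 39941580, [6]), (16, 99, 39930912,
      []), (18, 103, 39951590, []), (80, 101, 39917444, []), (256, 108, 41036926, []), (257, 77,
      39350150, []), (261, 80, 39350150, []), (262, 85, 39639740, []), (272, 78, 39418036, []),
      (274, 86, 39418036, []), (336, 81, 39919914, []), (1280, 107, 40038110, []), (1281, 6,
      39919914, []), (1285, 12, 39919914, []), (1286, 23, 39919914, []), (1296, 7, 39919914, []),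
      (1298, 24, 39919914, []), (1360, 13, 39919914, [])]),
    (268440600, [(55558174, []), (2868076, []), (2863702, []), (55571624, [11]), (6379844, [2, 3]),
      (2851422, [2, 10, 2]), (2872107, []), (2864872, [0, 1, 3, 2]), (2863702, [3, 9, 3])], [(0,
      111, 48028638, []), (1, 102, 40038110, []), (17, 100, 39931094, [6]), (256, 110, 48028638,
      []), (257, 33, 40995560, []), (273, 48, 40993012, [])]),
    (5144, [(55558174, []), (2846931, []), (55326587, [12]), (59612539, [9, 10]), (2852781, [11,
      5]), (59608216, [2, 1, 10]), (59607072, [1, 10, 1])], [(0, 112, 48028638, []), (1, 103,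
      40038110, []), (17, 101, 39931094, [6]), (256, 111, 41036926, []), (257, 87, 39350150, []),
      (273, 90, 39919914, []), (1280, 110, 40038110, []), (1281, 28, 39919914, []), (1297, 40,
      39919914, [])]),
    (83886085, [(55558174, []), (2852717, [12]), (59611062, []), (1116398, []), (2851422, [9]),
      (2851422, [8, 11]), (59610685, [0, 8]), (2851422, [8]), (5869822, [3, 11])], [(0, 113,
      48028638, []), (1, 104, 39931094, []), (4, 107, 39920902, []), (24, 110, 39921364, []), (65,
      4, 15801170, []), (68, 7, 39892471, []), (88, 28, 39878639, []), (260, 10, 17798802, []),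
      (280, 33, 39878639, []), (1560, 51, 15800546, [])]),
    (16777221, [(59575390, [10]), (59610880, [11]), (55558174, []), (2851422, [8, 4]), (2851130,
      [7, 2, 11]), (59322760, []), (59611062, [])], [(0, 115, 48028638, []), (1, 105, 39931094,
      []), (4, 108, 39920902, []), (24, 111, 39921364, []), (64, 113, 41036926, []), (65, 76,
      38773938, []), (68, 78, 38880954, []), (88, 87, 38773314, []), (1024, 114, 48028638, []),
      (1025, 96, 31812256, []), (1028, 98, 31822448, []), (1048, 102, 31929386, []), (1088, 107,
      15608939, []), (1089, 6, 15800624, []), (1092, 8, 38773314, []), (1112, 25, 38773314, [])]),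
    (5, [(55558174, []), (5546030, [8, 5]), (2851240, [1, 5]), (2851130, [7, 2, 3, 5]), (2851422,
      [8, 2, 3]), (3084662, [1, 11]), (6045438, [3, 4])], [(0, 116, 48028638, []), (1, 106,
      39931094, []), (4, 109, 39920902, []), (24, 112, 39921364, []), (64, 115, 40038110, []), (65,
      97, 39879224, []), (68, 99, 39884320, []), (88, 103, 39919914, []), (320, 113, 39931094, []),
      (321, 75, 38773392, []), (324, 76, 39919914, []), (344, 83, 39919914, []), (1344, 104,
      15611448, []), (1345, 2, 39919914, []), (1348, 3, 39919914, []), (1368, 21, 39919914, [])]),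
    (268697601, [(55558174, []), (2871989, [7, 8, 2, 3]), (1725402, [1, 5]), (59612434, [8, 7, 8,
      7, 8, 7]), (2349453, [7, 2]), (2872002, [8, 10]), (1704822, [3, 9, 12]), (2851422, [8, 0, 3,
      5]), (2851422, [8, 7, 8, 7])], [(0, 117, 48028638, []), (1, 114, 39920902, []), (16, 114,
      39838612, []), (17, 98, 39846828, []), (272, 98, 7659738, []), (273, 9, 9352364, [])]),
    (262145, [(55558174, []), (59609873, [9, 11, 5]), (59612421, [0, 3, 4]), (6116769, [10, 12]),
      (2851409, [7, 1, 3, 11, 5]), (2872002, [0, 12])], [(0, 118, 48028638, []), (1, 115, 39920902,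
      []), (16, 115, 39838612, []), (17, 99, 39846828, []), (256, 117, 41036926, []), (257, 108,
      39341596, []), (272, 108, 38194606, []), (273, 77, 39846022, []), (1280, 114, 23703714, []),
      (1281, 96, 23867514, []), (1296, 96, 7733214, []), (1297, 5, 39846022, [])]),
    (1, [(55558174, []), (59611062, [10, 4]), (6045438, [0, 12]), (3086034, [0, 2, 10]), (2851422,
      [8, 0, 9, 12]), (2851422, [8, 2, 4]), (59612434, [1, 9, 10, 4])], [(0, 119, 48028638, []),
      (1, 116, 39920902, []), (16, 118, 39931094, []), (17, 109, 39917444, []), (64, 118, 39892874,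
      []), (65, 109, 39879224, []), (80, 115, 39838014, []), (81, 97, 39919914, []), (320, 115,
      38762576, []), (321, 97, 38885426, []), (336, 105, 38197102, []), (337, 74, 39919914, []),
      (1344, 105, 15611448, []), (1345, 74, 17910290, []), (1360, 94, 7733214, []), (1361, 1,
      39919914, [])]),
    (0, [(55558174, []), (59287368, [1]), (55257804, [10, 4]), (59611062, [8, 9, 3]), (3086034, [2,
      12, 1]), (2851520, [7, 8, 5]), (59612532, [10, 4, 12, 3, 11, 5])], [(0, 120, 48028638, []),
      (1, 119, 39919992, []), (4, 119, 39919797, []), (5, 116, 39919914, []), (16, 119, 39917054,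
      []), (17, 116, 39917366, []), (20, 116, 39914636, []), (21, 106, 39919914, []), (64, 119,
      39878639, []), (65, 116, 39879146, []), (68, 116, 39876416, []), (69, 106, 39884242, []),
      (80, 116, 39838014, []), (81, 106, 39846022, []), (84, 106, 39807620, []), (85, 95, 39919914,
      []), (320, 116, 38762576, []), (321, 106, 38773314, []), (324, 106, 38734912, []), (325, 95,
      38885426, []), (336, 106, 38197102, []), (337, 95, 38347798, []), (340, 95, 37809988, []),
      (341, 73, 39919914, []), (1344, 106, 15611448, []), (1345, 95, 15800546, []), (1348, 95,
      15262736, []), (1349, 73, 17910290, []), (1360, 95, 7733214, []), (1361, 73, 10380950, []),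
      (1364, 73, 2851428, []), (1365, 0, 39919914, [])])]

end ExtensionData

/-! ### The certificates of the classes of graphs on three to seven vertices -/

section ClassData

set_option maxRecDepth 100000

/-- Certificates for all the classes of graphs on three vertices, the connected ones first. -/
def certificatesThree : List ClassCertificate := [
    ⟨5, 2, 7, [1256192, 2434544, 402683, 3009825, 1243124, 2996527], [(0, 5, 219)]⟩,
    ⟨1, 1, 2, [1251516, 1256192, 2434530, 1259769], []⟩,
    ⟨0, 0, 1, [3630606, 1249164, 1249018, 1249185], []⟩]

/-- Certificates for all the classes of graphs on four vertices, the connected ones first. -/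
def certificatesFour : List ClassCertificate := [
    ⟨21, 3, 10, [414956521, 515730383, 510408837, 215779928, 214629632, 214594506, 510420729,
      214617803, 214616564], [(0, 21, 1755)]⟩,
    ⟨81, 3, 37, [215810322, 209908987, 213823050, 102612051, 168995039, 510420562, 135803552,
      213614898], [(0, 81, 1755)]⟩,
    ⟨344, 5, 6, [282984472, 84794731, 216400507, 213983954, 405418323, 206861133, 77663636,
      209909217, 510420666], [(0, 344, 1755)]⟩,
    ⟨5, 2, 7, [412532892, 217007567, 515137672, 216383265, 216398190, 214594506, 214616564,
      216369967], []⟩,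
    ⟨1025, 2, 3, [548925168, 780463180, 214624956, 214629632, 214633209, 205083188], []⟩,
    ⟨1, 1, 2, [414383691, 217001408, 513347772, 214629632, 216400674, 214633209], []⟩,
    ⟨0, 0, 1, [414900319, 514544961, 209919780, 214566346, 499159355, 214622625], []⟩]

/-- Certificates for all the classes of graphs on five vertices, the connected ones first. -/
def certificatesFive : List ClassCertificate := [
    ⟨85, 4, 11, [70512823942, 36953402291, 69524249970, 87344451847, 68721773254, 36056682368,
      86168031174, 34468228746, 86542619961, 35268661667, 5786096996, 86201166549, 35914370507,
      22810316169, 36853185138, 85741284489, 36856910588], [(0, 85, 14043)]⟩,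
    ⟨337, 4, 88, [104072970904, 37058290976, 36067289874, 36709747189, 86552046777, 36856946994,
      36644581200, 86134783060, 36857155146, 28395930336, 22819771041, 5795523478, 36856737666,
      36710964181, 86549840769, 86550048921], [(0, 337, 14043)]⟩,
    ⟨1348, 4, 255, [70314910064, 37057105554, 86552046610, 36715724850, 17243611732, 28395930336,
      36066101947, 22819771041, 36682522842, 23237030456, 28021337040, 16869018436, 28846391759,
      16902220444], [(0, 1348, 14043)]⟩,
    ⟨20816, 5, 219, [9203751739, 36853241083, 86552018721, 37315859989, 5626216450, 37311146414,
      29356495200, 34468116188, 73322877526, 6017431151, 36066074058, 84954060851, 112486984487,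
      8416612269, 28555187784, 7209977817, 74595680384, 29648771586, 85736542524], [(0, 20816,
      14043), (62, 67152, 27939)]⟩,
    ⟨1368, 6, 139, [70314910064, 37058289793, 37156049658, 37153752762, 37354087904, 17336436177,
      36716335040, 37051364665, 22819771041, 28395930336, 17243611732, 22518042537, 28094201832,
      16941883228], [(0, 1368, 14043)]⟩,
    ⟨21, 3, 10, [70313869271, 87243714587, 36859147129, 37153739694, 37156434309, 87339722512,
      87043391281, 36853241250, 36857921676, 36857920437, 36853236491, 36857948660, 37148999302,
      37153696713, 36857926602], []⟩,
    ⟨273, 3, 37, [37258040512, 87344493201, 70166911909, 37153752658, 36857155146, 37158466233,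
      36745944147, 36812327135, 36853241083, 36779135648, 36856946994], []⟩,
    ⟨1304, 5, 6, [70535004305, 36823794155, 37156687954, 87409431853, 86910243309, 37190281612,
      87234183507, 37158466233, 36843701939, 86906428820, 37153752762, 37142424588, 37144213388,
      36853241313], []⟩,
    ⟨262149, 3, 14, [87343902856, 48208183452, 15087361744, 86552639488, 36859743417, 36065255675,
      36859715361, 36856910588, 36859702063], []⟩,
    ⟨5, 2, 7, [37158469768, 70616614096, 87441688369, 86252720624, 86251535202, 36067890873,
      87042541307, 36859702063, 36857948660, 36859715361], []⟩,
    ⟨16385, 2, 3, [104096608807, 87377672635, 87242937125, 87339176296, 37158458954, 36853251897,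
      87339189281, 37153742011, 36843701709, 37148916212], []⟩,
    ⟨1, 1, 2, [104265616098, 37258640279, 86552637031, 35570039484, 36859746952, 36067880226,
      35271314274, 85753691899, 36857965305, 37158455586], []⟩,
    ⟨0, 0, 1, [36859143490, 85754792868, 37156691628, 34555300063, 37144259146, 34472952738,
      36345869554, 85436013373, 36857954721, 36857965242], []⟩]

/-- Certificates for all the classes of graphs on six vertices, the connected ones first. -/
def certificatesSix : List ClassCertificate := [
    ⟨341, 5, 14, [11981186601097, 6360422259059, 6193724881164, 14808402045530, 6325177681294,
      14689711824256, 14706450325000, 14406930304201, 14406134261176, 4769724438336, 973652790357,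
      14610047664992, 6326766133009, 14273092986201, 6325176077732, 1909641379958, 14407707946737,
      14405744854785, 6191197540071, 6192150602892, 6192131748021, 6326756113482, 6326760854946,
      14539146042225, 6325964204826, 6326765563595], [(0, 341, 112347)]⟩,
    ⟨1361, 5, 116, [6360420872785, 6193932481856, 6325973715810, 14675024488799, 6325974903570,
      14675371046553, 6326618577877, 14540758111929, 6059118400818, 6326764351362, 6193520167992,
      974454041494, 6290126977872, 3833735792289, 6192149836362, 4770530543328, 14470657824340,
      6326764768842, 6326764560690], [(0, 1361, 112347)]⟩,
    ⟨5441, 5, 66, [11981085891649, 14824758735976, 6326766756114, 14439583884384, 6193593274218,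
      14675365886433, 6034425045420, 1105896878446, 14539162897834, 14675368331001, 3029967611499,
      6289946804425, 6057526276411, 6290117522833, 6326760854946, 14615623767841, 14538742985866,
      6326623366602, 6295698395543, 14604471449237, 6193558937202, 14610047608546, 6301269841430,
      6193733123970, 14539164979858], [(0, 5441, 112347)]⟩,
    ⟨5444, 5, 666, [17618788524736, 14825132749504, 6326964719250, 1911101821094, 14675373044409,
      6326590136538, 4771317654241, 14610052321954, 6295698395543, 37654548817, 6326623338546,
      2897728152149, 6326556933354, 6301274554838, 14674998451113, 14675031653121, 14674965246753],
      [(0, 5444, 112347)]⟩,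
    ⟨278789, 5, 420, [6326965112034, 14825132750673, 17618788524736, 6325973687754, 6326596280802,
      4771317654241, 6290918827410, 6326631250338, 2897728152149, 6296494998402, 3834522903202,
      2828424441701, 6302071168218, 3765219192754, 2834000613869, 4770525773641, 2839576783685,
      4702013943793, 3776371534738, 4707590115961, 3770795364922, 4712795676433, 3833731022602],
      [(0, 278789, 112347)]⟩,
    ⟨279824, 5, 1850, [6360222526098, 14675368330834, 6302071168218, 4771317654241, 3834522903202,
      6290918827410, 6296494998402, 2897728152149, 6193729627387, 4702013943793, 4707590115961,
      3770795364922, 2834000613869, 2828424441701, 2839576783685, 3776371534738, 4713166285777,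
      3765219192754], [(0, 279824, 112347)]⟩,
    ⟨21780, 6, 162, [11947534074224, 6360417553938, 14790582224817, 14675473803922, 6193729627387,
      6109303610279, 6109883387519, 6376114745658, 6193734340795, 4771312940833, 6302266196058,
      6326760854946, 14610047604538, 6326960596194, 3834522903202, 17166774747335, 14675373044242,
      1910543502999, 6302071168218, 19977510925256, 1108277121263, 4846192799928, 6045388325951,
      14490184531706, 14675469090514, 6326861614626, 3903821879073, 14675568072082, 3903922638753,
      4707590115961, 14675368330834], [(0, 21780, 112347)]⟩,
    ⟨279813, 6, 164, [17635616775448, 14825132750673, 14675002434898, 14808504043641,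
      6325829942922, 14540758055483, 171482370217, 6059911232636, 6167446752643, 14675373044242,
      6325973687754, 6302071168218, 6326631250338, 2897728152149, 4771317654241, 6326596280802,
      6161870582827, 2828424441701, 2839576783685, 6296494998402, 4770180707017, 6156089957179,
      3833731022602, 2834000613869, 6193734340795, 4713166285777, 4707590115961, 4770525773641],
      [(0, 279813, 112347)]⟩,
    ⟨279888, 6, 4698, [11947534074224, 6319556385282, 6325973687754, 2897728152149, 6318764504682,
      4771317654241, 3834522903202, 4691183732737, 2817594230645, 4690391852137, 2816802350045,
      2896936271549, 3833731022602, 3754388981698, 3753597101098, 4770525773641], [(0, 279888,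
      112347), (752, 545092, 112950)]⟩,
    ⟨1380672, 6, 7572, [5788263220535, 6325973715643, 14675373016353, 5922086328694, 5655231965087,
      14271485629404, 14404516884852, 6193734312906, 5656023817798, 5789846925957, 5922878181405,
      14403725032141, 14136870668534], [(0, 1380672, 112347)]⟩,
    ⟨5464, 7, 180, [14825132749504, 6193934676097, 3835114441708, 14675071315905, 6327061366458,
      6327063663354, 14808199216216, 6193592721344, 14675465868791, 14675373044409, 974449299863,
      6301274554838, 14610052321954, 2897728152149, 4771012429321, 4771317654241, 37952643817,
      14675067819489, 37654548817], [(0, 5464, 112347)]⟩,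
    ⟨21784, 7, 331, [11947534074224, 14808504441143, 6360222526098, 14675371266130, 14727743221408,
      6244017610041, 6193736118907, 6302071168218, 4771317654241, 6377246799546, 2897728152149,
      2045273392775, 3834522903202, 6587384690, 4720826996233, 6178596122875, 2834000613869,
      2839576783685, 960406398600, 4707590115961, 3903824814369, 1076415141407, 4713166285777,
      3784032245194], [(0, 21784, 112347)]⟩,
    ⟨279814, 7, 164, [6360422069778, 14675037404434, 6302270711898, 6193933884475, 14491364492411,
      6193734340795, 6376459632354, 2961455669260, 2839576783685, 6302071168218, 4771317654241,
      171482370217, 6376079596194, 6296360680386, 6109304795708, 6314325282090, 2897728152149,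
      2834000613869, 6296494998402, 86136617810, 2846450326949, 4707590115961, 3834522903202,
      36688667090, 4720039829041, 3893976400857, 6326631250338, 6242636524195, 3783245078002], [(0,
      279814, 112347)]⟩,
    ⟨279826, 7, 1008, [6360222526098, 14624687358394, 6290918827410, 6193729627387, 6376845538938,
      2897728152149, 4771317654241, 3834522903202, 6302071168218, 6296494998402, 6318694170474,
      6307541828490, 3783832503946, 14675368330834, 2839576783685, 2834000613869, 6313118000658,
      4720627254985, 2828424441701, 3770795364922, 4713166285777, 2847037752893, 4707590115961,
      3776371534738, 3765219192754, 4702013943793], [(0, 279826, 112347)]⟩,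
    ⟨344452, 7, 980, [11981190574465, 6326965112034, 6291219328401, 20329298005856, 6326596280802,
      11783435693449, 14675072543418, 6194034841953, 2061800358800, 6326631250338, 6326561113698,
      6193664232609, 6193699202145, 6193628867937, 6290848719057, 6290883688593], [(0, 344452,
      112347)]⟩,
    ⟨1380736, 7, 1892, [3232290519575, 6376459649659, 14675373016290, 6307433928120, 6306643857028,
      14086384723934, 14221298418204, 6193734312969, 5922086328694, 354485159976, 3246936835801,
      14322088339273, 14219716490894, 3246145575794, 3114782950779, 14354030950836, 5907562702294,
      14623303366331, 5840034137157, 3096077206089, 268666348818, 486045748127, 6242636552084,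
      6156092271173, 3078557468323, 284602381162], [(0, 1380736, 112347)]⟩,
    ⟨345488, 8, 1200, [12014443272602, 14743514256283, 17485351324448, 6376946287867,
      6301936850265, 1023673573546, 171681911072, 4855124013409, 2898619791257, 9037371094689,
      949222480070, 6173518217280, 6312952442913, 2848373098561, 973879354992, 4771476911689,
      3765346260960, 20312464053882, 1008101091859, 4904809842450, 1107311248617], [(0, 345488,
      112347)]⟩,
    ⟨1335569, 8, 1572, [11947534074224, 6321379306256, 6330122453648, 1980811140495, 6319795545056,
      6403309370353, 6325162953522, 3834522903202, 6314909515537, 6331706214848, 6398731866954,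
      2897728152149, 4771317654241, 6397129252122, 6313325866561, 3832920288370, 2896125537317,
      4765082187241, 4769715039409, 3828287436202, 3826684821370, 2889890070317], [(0, 1335569,
      112347), (40, 1335617, 103134)]⟩,
    ⟨1401232, 10, 119, [5378753517803, 6377251502203, 16687604313366, 11964126456794,
      8261268449343, 6376845528354, 4349808787691, 7186741698320, 21892792840370, 14271000194157,
      4250430884590, 6376459649826, 16687496271727, 17181243653067, 6870100380784, 6326561113531,
      15351920536494, 6325973715643, 6193626998435, 5972572262877, 5922878181405, 6193622302395,
      14674859131320, 8073423891773, 14354030950669], [(0, 1401232, 112347)]⟩,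
    ⟨21316944, 9, 462, [10169304328505, 6326555691479, 6325973687754, 6193729627387, 6373560170149,
      22211120569678, 5841435261249, 9633059797807, 9827420299607, 2897726335397, 18280900387001,
      21603975393579, 5925267963429, 6291203325396, 14675368330834, 13379265977752, 14272282251301,
      17990918182205, 14222501579034, 9498562605838, 35952384554, 36859715282, 22141681175279,
      5889734170257, 6291714881110], [(0, 21316944, 112347), (28, 139499856, 59179), (331,
      289433124, 210821)]⟩,
    ⟨18433360, 10, 940, [11925095882497, 6326760854779, 6314021106849, 9863033609697,
      16554462371673, 7060506212895, 10036127865221, 7070861743887, 16554457658098, 1960793748975,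
      6314987356658, 21863161388275, 1061576064624, 9976738904366, 16395263272348, 7142139315733,
      4747118978761, 3784562517706, 1195776243753, 7142134602158, 16400043058067, 21893430515981,
      9742816154872, 22141807332423, 4881682109010], [(0, 18433360, 112347), (16, 35198288,
      103115), (32, 1680720, 126195), (53, 272918864, 59235), (62, 139487568, 204067)]⟩,
    ⟨85, 4, 11, [6360420628150, 11998209699310, 14808503818024, 14807609999190, 14757771340460,
      14823539621135, 6325973691289, 14806809058777, 14757117054848, 6375658296945, 6325973715810,
      6374861787105, 6326764721915, 6326759782820, 6324370197926, 6318298830624, 6324195660645,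
      6326765540298, 6326760798834, 6375646612184, 6326764524284, 6375648898185], []⟩,
    ⟨1105, 4, 88, [14825132749504, 17618889286768, 6326766756114, 6326963917400, 6376457454465,
      6326550977904, 6312732126368, 6377249515161, 6376042396756, 6318303544032, 6376905373919,
      6377251513017, 6376459660473, 6312727384737, 6301279296469, 6326764768842, 6376457662617,
      6295701920182, 6290125970208, 6325972498818, 6326764560690, 6326585386390, 6326552194896],
      []⟩,
    ⟨5188, 4, 255, [12014056219313, 6393979990720, 14808503847249, 6376459660306, 6377251513017,
      14757742895322, 6307151225428, 6312727384737, 6318303544032, 6326623338546, 6325973715643,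
      6317962152744, 6326590136538, 6306776632132, 6313144644152, 6317928950736, 6306809834140],
      []⟩,
    ⟨279632, 5, 219, [17559999813192, 6298706009675, 6377175179097, 6377251513017, 6326760854779,
      14757126446538, 6364027057007, 6327218760110, 6318764504682, 6374861674547, 6327223473685,
      6298324225965, 6363230491222, 6376459632417, 6295925044847, 6324375729884, 6364503294080,
      6402394598183, 6297117591513, 6374060366964, 6318462801480, 6319556385282, 6325973687754],
      []⟩,
    ⟨5208, 6, 139, [11981286827720, 14825132749504, 14808199216216, 6327163645705, 6377251513017,
      14758216422138, 6307244049873, 14757878029489, 6327061366458, 6327063663354, 14749082933505,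
      6312727384737, 6306849496924, 6307151225428, 6317998319112, 6312425656233, 6318001815528,
      6318303544032], []⟩,
    ⟨268435477, 4, 20, [17624160212660, 15762020103315, 6194132200845, 6326766136544,
      6193928770163, 6327066068037, 6327156171280, 6327056625057, 6326760854946, 6326759980451,
      6193733296892, 6327059306541, 6326585358334, 6326765540298, 6326765562356], []⟩,
    ⟨21, 3, 10, [6360617827784, 6193933493034, 14757919512560, 6326619146087, 6377251513017,
      6326552195230, 6326618606267, 6244310405032, 14625187614856, 6194032820613, 6326719941165,
      6193733296725, 6326759980117, 6193729621556, 6327061310409, 6326765540298, 6326760798834],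
      []⟩,
    ⟨268436497, 4, 74, [15761825129792, 22296779555738, 6194135020696, 14675167987418,
      6326764560690, 14674965292010, 6326960003337, 6193729627387, 6326719940831, 6327066079929,
      6326653557843, 6327061366354, 6326764768842, 6326760854779, 14674993713824, 6326686749344],
      []⟩,
    ⟨1041, 3, 37, [17601618502428, 6360420455312, 14758118663456, 14625185613465, 14808499132505,
      14757918921018, 14625187611321, 6377246799442, 6326686749344, 6193688713439, 6327066079929,
      6326760854779, 6193733333298, 6326764351362, 6326584586878, 6193620124443, 6326551395384,
      6326651559987, 6326655854906, 6326764768842, 6327061366354], []⟩,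
    ⟨268440600, 6, 12, [11958719788764, 15761579365975, 14675005763131, 14675140894744,
      14808297135824, 6193736118907, 14808622798663, 6327064301650, 14675264513836, 6327056540555,
      14675060068581, 6327050038284, 6326760855009, 6327061366458, 6326767346299], []⟩,
    ⟨5144, 5, 6, [6327098832831, 14825159837356, 14625453875586, 14675404859788, 6244253012656,
      14675074310779, 6326790291320, 14675105928924, 6194023534884, 6376948076563, 6327059577658,
      6194033074258, 6326760855009, 6327061366458, 6376951001442], []⟩,
    ⟨83886085, 4, 28, [6326765575424, 14208429011592, 6326765131009, 6326766747827, 5922878181405,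
      4235880252501, 4769879236125, 14675371255650, 4235883057441, 6193734307980, 6326767345221,
      6193734336203, 14271485657460, 5894437844613, 6170378822433, 14208429205402, 2313262275836,
      1375376949500, 1375379742214, 14214304522415, 6326767329057, 6326767315759, 6326765562356,
      6326765540298], []⟩,
    ⟨16777221, 3, 14, [17567513094741, 6382924611156, 6349504653654, 6326767953359, 6377249731328,
      14807609593547, 14808401636603, 6326767357113, 6376457871714, 6325973687754, 6326767329057,
      6326767315759, 6326765562356], []⟩,
    ⟨5, 2, 7, [14758318964258, 14491066387029, 14675073690200, 14675074308462, 14541548169716,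
      6376160897542, 6109603558388, 14624887099746, 14757918334208, 14491063173371, 6192152411502,
      6326767329057, 6327064291170, 6326765540298, 6326767315759, 6326765562356], []⟩,
    ⟨268697601, 3, 4, [17624149697143, 8233907097171, 14808467133719, 14675638372214,
      6326833150625, 6194034846685, 14539160254892, 6057521570073, 14808103773267, 14538845400182,
      6326765579001, 6326756028980, 6057507197830], []⟩,
    ⟨262145, 2, 3, [6394033293223, 6194068635545, 14807974154540, 14757913632518, 6377246784370,
      6377436794298, 14757918338982, 14624887110226, 6194034841890, 6194025313163, 6326765579001,
      6326756028980], []⟩,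
    ⟨1, 1, 2, [11963070086661, 6360225496626, 6193929366485, 14756331685676, 6208074910758,
      11597336141119, 6191643378796, 5974974508139, 6192437008422, 5926379255202, 6059911260859,
      14540742182946, 6242634802425, 6326767346466, 6326765579001], []⟩,
    ⟨0, 0, 1, [14791774751103, 6244213727367, 14808499065927, 6074553494730, 14772257089548,
      6357834586530, 14356434947106, 6376160898954, 5925571428210, 14622508606860, 6326765568417,
      6376951001442], []⟩]

/-- Certificates for all the classes of graphs on seven vertices, the connected ones first. -/
def certificatesSeven : List ClassCertificate := [
    ⟨1365, 6, 15, [2035423589896559, 1090734253397867, 995690469678230, 2510461072177129,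
      1090867539378380, 2510462383125286, 2465527196245349, 2488080370493200, 2487844594986579,
      1085513375115478, 1084979015651653, 6325983851805, 2442980410804053, 2510296785208912,
      2465464721091430, 2464991903332978, 1080161205921828, 1917255220767985, 1939601100460790,
      3342303454600257, 973098962794486, 2487346716176360, 163842898721470, 1062495132160602,
      1040147498023691, 2410461034868181, 1013648787994907, 801449923154304, 1084979007400440,
      1085514318696241, 1085379689507778, 1085514313923186, 2465059613887689, 1085514318664650,
      1085513517413346, 2442576539864433, 1085514318686708, 2442576146337345], [(0, 1365, 898779)]⟩,
    ⟨5457, 6, 137, [2985401487836831, 1085547594666685, 2465532783795560, 1079225311989205,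
      2510462485717144, 2487814310217369, 2465479418933440, 1040549582644582, 2442981997919337,
      1040681210139522, 163709878108487, 1017932080807698, 2442981994525569, 6459805062001,
      1085247311436278, 1013649579846616, 2465196198837462, 163842908148119, 2453553591093534,
      2442910301257782, 1018199539639223, 1056742933977888, 1085513375108054, 1085381139467173,
      1011776785931042, 2442847379382585, 163708296740278, 1040255038214103, 486952972988499,
      801715201033130, 2488080028530911, 1085343847539026, 6060707055674, 1062898796662608,
      2465196232447619, 486686104456278, 1040249456513665, 2442846952846110, 1062765185739138,
      320956783676917, 801583767735719, 1040517102673537, 1085381073084192, 1018167865954943,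
      1085513526840162, 2465197419853497, 1085379703760226, 1085514317893194, 1085514138510742,
      1085514317685042, 1085514171702229, 2465131307278498, 2465136883437793, 1085514317475714,
      2465197417647489, 1085477680102224, 2465197417855641], [(0, 5457, 898779)]⟩,
    ⟨21825, 6, 156, [2513256831168335, 1063198623468968, 1080162096237599, 1085514512277930,
      1063134004518527, 1040549763034698, 1040549589598386, 2487814305057249, 2499456730534929,
      2465598192696681, 1040656508641671, 1085483346381935, 2488080467109825, 1057679726182727,
      2488080033278721, 2477909453283410, 1085514413554746, 6461385270673, 2477911048705824,
      2454491179931362, 1081097995867671, 1035196649754552, 1080161996883239, 1040549757875754,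
      486954547238548, 1040682794262090, 2476972257710243, 163576049099160, 1085514319880466,
      486819586144926, 1062860564908659, 486820717182917, 1085477670647185, 801583385865169,
      163575247791577, 2476974251928873, 644202242294434, 2455427976979297, 321224420353694,
      321223628500983, 1080160997223096, 1081098791426126, 1079225206665505, 486819519766614,
      801582556066634, 1085514313979298, 1085514317685042, 1085381287465314, 2487814312215225,
      1085483251519895, 1085488827679190, 1085514317475714, 1085514317893194, 2455427974682401,
      2454491177486794, 2453554382735741], [(0, 21825, 898779)]⟩,
    ⟨21828, 6, 852, [2513256325804847, 2488097103147712, 2510296181846817, 1063134204468935,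
      1040682994212498, 1040682586426602, 1040682652831794, 1085381287465314, 2488080374670009,
      1063128429158737, 486820724130389, 1081098797175254, 801582963864290, 163709701488911,
      163709876920727, 1040549588402394, 644201867701138, 2454490843253482, 486819552942918,
      1085514143260890, 2455427638004521, 644201037902603, 2455427571598153, 1085514110057706,
      801582589270994, 2454491184644770, 2453554048502429, 1085514176462898], [(0, 21828, 898779)]⟩,
    ⟨87300, 6, 483, [2985384758767607, 2513256733603672, 2488022327606697, 1079258067184106,
      2510446448926185, 2488080033278721, 1045902886180041, 2510462485124433, 1085513379868890,
      2465196234441634, 1085513526840162, 1040281325821627, 2488080374670009, 2442847381798930,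
      2476035870728790, 6459801537362, 163842111553944, 6460417958090, 801715203239138,
      1063164930261042, 644334476927651, 1081073306180943, 2442787632500986, 1063134806662362,
      1081097208728535, 2433018201526560, 666485385400545, 1040282117674171], [(0, 87300, 898779)]⟩,
    ⟨4261125, 6, 565, [2510446349350737, 2035440232552489, 1091104816628624, 1085514518236386,
      1063141378941810, 1080161205830040, 1085513383067274, 2510361118468833, 1079223619198394,
      1063129225749906, 644333685047051, 2510372270810817, 2488017448439145, 1085513526812106,
      2488022223301545, 1085484048122754, 2488080374670009, 2475966567018342, 644334476927651,
      1085478302664210, 321222837837375, 801646691381234, 1063135424513946, 486952958763606,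
      1085489624292570, 6460593389906, 1085514149405154, 2488016647131729, 321223495399959,
      1063141179398130, 1063164938172834, 2477909460230882, 321223460430423, 1085490281855154,
      321223629717975, 1085514184374690, 2488016276522385, 2488022679542337, 2488021852692201,
      2488079582789409], [(0, 4261125, 898779)]⟩,
    ⟨4265217, 6, 1069, [2985314849932247, 1085514518236386, 1085547775650450, 1091104682310608,
      163817212699152, 1081067525556471, 1063164868036194, 1085478471951762, 2476972665479843,
      2477909460230882, 6460593389906, 2476035870728790, 1085514184374690, 1085484048122754,
      2488080374670009, 321198935317839, 2488011070959561, 1080136511429904, 1063140378090714,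
      1085514149405154, 2488022223301545, 321187578522375, 321223629717975, 163841942266392,
      1080125359089096, 1080161205830040, 2488010735319753, 1085483843668098, 2488021852692201,
      2488016647131729, 1085514114238050, 2488010700350217, 2488010664985545, 2488016241157713,
      2488021817327529, 2488016311491921], [(0, 4265217, 898779)]⟩,
    ⟨4265232, 6, 5052, [2513240005124800, 1063198529448594, 1080161205830040, 2488022223301545,
      1081098000581079, 2476035870728790, 2488080374670009, 801715995091682, 1063140378090714,
      644334476927651, 1063134801920898, 1079224411078994, 2488016647131729, 1063129225749906,
      2488011070959561], [(0, 4265232, 898779)]⟩,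
    ⟨4523076, 6, 5853, [2035424196184736, 1085514518236386, 1091135087200914, 644334070953635,
      1080294899342442, 1085514149405154, 801715995091682, 486952958763606, 1085514184374690,
      1081231828422018, 644334476927651, 1085514114238050, 1079358238897722, 1080295033660458,
      790875941540642, 477049699974126, 791812736302202, 789939146776730, 634431218138171,
      632557628612699, 633494423376611, 476112905212566, 475176110448654], [(0, 4523076, 898779)]⟩,
    ⟨21251088, 6, 1155, [2035457653535264, 1091135087200914, 2488097103345106, 1085381287437258,
      2488080374669842, 366057543075158, 1085490424084962, 486952958763606, 801715995091682,
      1057678131815635, 1080295033660458, 486819927508158, 2044275297651, 801582963836234,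
      644334476927651, 1063165072490683, 159425793461689, 1080398592370818, 655843669578634,
      791812736302202, 343706703741231, 476112905212566, 644201445672203, 790875941540642,
      476986768300398, 477049699974126, 678396046617825, 476183004794286, 814099050830497,
      1085484846147618, 790946041122362, 791888413821266, 477125377493190], [(0, 21251088,
      898779)]⟩,
    ⟨21251136, 6, 13923, [2029803427676528, 1091135087200914, 2488079582817298, 1081231828422018,
      801715995091682, 644334476927651, 486952958763606, 1080295033660458, 1079358238897722,
      1063164280638139, 790875941540642, 791812736302202, 633494423376611, 632557628612699,
      789939146776730, 477049699974126, 476112905212566, 634431218138171, 497524564798133,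
      475176110448654, 655842877726090, 814161190651681], [(0, 21251136, 898779)]⟩,
    ⟨87316, 7, 576, [2035472748765673, 2510446349350737, 2510429721631545, 2513221386483808,
      2488080369956601, 2499404248385770, 1085596328244330, 801664503974186, 1085579942275458,
      6376457243883, 2488080374670009, 2510378163538497, 2488028951120769, 1063214764166394,
      1085514414738978, 1063140378090714, 1063165267518690, 163842111553944, 801715990378274,
      1081098000581079, 2488029095655873, 486952958763606, 1063134801920898, 1079224606106834,
      644283197913515, 1079224411078994, 1085484043409346, 2476914514111379, 801664716077546,
      2476972660766435, 163708279018969, 2488016642418321, 2477909460230882, 1085563667870010,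
      321223625004567, 1063140373377306, 2476972761526115, 1085484243150594, 644334671955491,
      1085564010368250, 2488022223301545, 2488016647131729, 1085514313979298, 1085514513720546,
      2488022218588137], [(0, 87316, 898779)]⟩,
    ⟨4265221, 7, 577, [1091134882743920, 2488097202920721, 1079224276760978, 2510361118468833,
      2510429720643705, 2510428448955105, 1085514149405154, 2476035078848190, 2488017448439145,
      2476971873599243, 1085484048122754, 1085478471951762, 1063164280610250, 2488016647131729,
      163842111553944, 2488022223301545, 801715995091682, 486952958763606, 321223629717975,
      1085514184374690, 2488011070959561, 6430322819954, 2476972665479843, 1063140378090714,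
      6435898989770, 2488080374670009, 1085478267497106, 6460593389906, 2488021852692201,
      2488011456866145, 1063164868036194, 2488010700350217, 2488010735319753, 1085513526812106,
      2488079582789409], [(0, 4265221, 898779)]⟩,
    ⟨4265296, 7, 6451, [1091135087198576, 1063164280610250, 1079217201895922, 1085506317629034,
      2488080374670009, 1085507109509634, 1081098000581079, 1080161205830040, 2476972665479843,
      2477909460230882, 1079224411078994, 2476035870728790, 2488079582789409, 2487999448867905,
      1085513526812106, 2488000240748505], [(0, 4265296, 898779), (752, 8471876, 899382)]⟩,
    ⟨4527172, 7, 3144, [2510429720643705, 2985384559617880, 1091135087200914, 2488080374669842,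
      1081231694104002, 1085514149405154, 1085514114238050, 1085514184374690, 644334476927651,
      486952958763606, 801715995091682, 1080295033660458, 1063165072490683, 1081231828422018,
      476112905212566, 791812736302202, 477049699974126, 633494423376611, 790875941540642], [(0,
      4527172, 898779), (771, 274901237889, 902876)]⟩,
    ⟨4527184, 7, 14703, [1091135087200914, 2488080369956434, 1081231828422018, 644334476927651,
      486952958763606, 801715995091682, 1079358238897722, 1080295033660458, 1063165067777275,
      791812736302202, 790875941540642, 477049699974126, 476112905212566, 475176110448654,
      632557628612699, 634431218138171, 633494423376611, 789939146776730], [(0, 4527184, 898779),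
      (752, 8733764, 899382)]⟩,
    ⟨21251089, 7, 3153, [1091168544551442, 1063135599945595, 2500543090757649, 1063198529841211,
      2488080374669842, 801715995091682, 486952958763606, 1085490424084962, 644334476927651,
      1085479268012706, 28943667413162, 1085484846147618, 1081231828422018, 1107480536091,
      1063141177882939, 1063165072490683, 1080295033660458, 814161982504225, 476112905212566,
      477049699974126, 475176110448654, 790875941540642, 2488023020933458, 2488011864663634,
      497456846644469, 2488017442996114, 791749804628474, 476044395206358, 476055551476182,
      475118756712270, 476986768300398, 790807431534434, 476992346237742, 476049973538838,
      497462424976949, 476981189967918, 790813009866914, 791755382565818, 790818587804258], [(0,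
      21251089, 898779)]⟩,
    ⟨21251137, 7, 14724, [1091135087200914, 2488079582817298, 1080295033660458, 801715995091682,
      1081231828422018, 1079358238897722, 486952958763606, 644334476927651, 1063164280638139,
      475176110448654, 789939146776730, 476112905212566, 477049699974126, 790875941540642,
      791812736302202, 633494423376611, 634431218138171, 632557628612699, 497524564798133,
      814161190651681, 655842877726090], [(0, 21251137, 898779)]⟩,
    ⟨21251392, 7, 71046, [2029803427676528, 1085381287437258, 486952958763606, 801715995091682,
      644334476927651, 644201445672203, 486819927508158, 801582963836234], [(0, 21251392, 898779)]⟩,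
    ⟨1141904656, 7, 35091, [1085547842030946, 181094123799057, 1063165072462794, 1085491753266018,
      203505632398761, 1085485878383970, 1085479970310498, 836728401293778, 2488080374641953,
      814379155063866, 181156386168849, 2488018112272161, 2488012171007265, 2488023987154209,
      203437428764073, 181088182534161, 203443370028969, 181099998681105, 203449244911017], [(0,
      1141904656, 898779), (11312, 1209271316, 931638)]⟩,
    ⟨1146160384, 7, 48207, [1062765172787516, 1085381282751739, 972429008217120, 1018062721008860,
      2488079582789409, 950212006075631, 2419828176300302, 2397743418219013, 2374994272313823,
      1063164280610250, 972828116039854, 2442978023188019, 950078970134664, 994912874121143], [(0,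
      1146160384, 898779)]⟩,
    ⟨21848, 8, 239, [2985417814824767, 1085514519027841, 2510446541561231, 2465597689471161,
      1085477533741031, 1063165265900857, 2510429415816280, 1040549622214592, 2487748194898595,
      2510429319143361, 1040656507453911, 1057679724994967, 163575252504985, 1085381585560314,
      2488009972653916, 2465527200358997, 1063128429158737, 2477909155005962, 1085381583263418,
      487087583179348, 1085514614490810, 1085489125774190, 2453553593299542, 2488021124972520,
      2454490388050595, 1040650931294616, 2455427674170889, 321224426312150, 1085349721793328,
      1034259059626323, 1085483549614895, 2476035870728790, 2453553291571038, 801583458729961,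
      2487814312215225, 1085381287465314, 2455427979395809, 2454490882916266], [(0, 21848,
      898779)]⟩,
    ⟨87320, 8, 896, [1091168544156320, 1063232482536056, 2498519044921618, 1063165272825985,
      2487994137449800, 2487999713619616, 2488029984181336, 1085489624292570, 2477909460230882,
      2476972665479843, 1063215553722042, 1080161205830040, 1079224411078994, 486952958763606,
      1063129225749906, 2488011070959561, 321223629717975, 1085501072385618, 1063134801920898,
      2488022223301545, 1085506648555434, 2488080374670009, 2488029884012001, 2488016647131729],
      [(0, 87320, 898779)]⟩,
    ⟨4265222, 8, 577, [2513256733603672, 2488045925095521, 1081131457538823, 1085514518236386,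
      1063198395130578, 1085501878406442, 1063158208374402, 1085564012756706, 321187782977031,
      644334476927651, 163842111553944, 2488080374670009, 2488010664985545, 1079224411078994,
      321223629717975, 2487994843291881, 1063164938172834, 1063134801920898, 486883655053158,
      801646320771890, 1085478302664210, 1063140378090714, 2477909460230882, 1063146640631586,
      2476035870728790, 2488011070959561, 1057642285065673, 1063164868036194, 2488022223301545,
      1085563632720546, 2488029096844809, 1085478471951762, 6326596280787, 1058614757270104,
      1085514149405154, 2488016647131729, 1085478337633746, 2488021852692201, 2488010700350217,
      1085514184374690, 2488010735319753], [(0, 4265222, 898779)]⟩,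
    ⟨4265234, 8, 2695, [2982574175363776, 2513181853756336, 1085547775650450, 1081073306180943,
      1063215152461434, 1085484048122754, 2476972665479843, 2476035870728790, 2488080374670009,
      801715995091682, 163842111553944, 6460593389906, 1085489624292570, 1081098000581079,
      1085478471951762, 2488022223301545, 2488011070959561, 1085495094952842, 2488029684270753,
      1085500671125010, 321081730498528, 2488016647131729, 6452521992026, 1063157001092970], [(0,
      4265234, 898779)]⟩,
    ⟨4523396, 8, 1597, [2510429720643705, 2985400882122729, 1096747889769049, 177711015713608,
      2504641958200984, 1093926218866698, 1085514149405154, 1090970988817801, 1093862491349754,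
      801715995091682, 644334476927651, 1093862456380218, 1085514114238050, 1093862625667770,
      1085514184374690, 1081249353483152, 1093926353184714, 486952958763606, 793101625661834,
      478338253693950, 478435773820206, 635816956344443, 793198439538938, 478338589333758,
      635720107497803, 635816921374907, 793198810148282, 635817291984251], [(0, 4523396, 898779)]⟩,
    ⟨4527176, 8, 3132, [2029803627220208, 1091135087200914, 1063165472763451, 666951078271546,
      1063165372991611, 1085514149405154, 1085514184374690, 801715995091682, 486952958763606,
      644334476927651, 1081231828422018, 2488080074168914, 163708079277721, 1085514114238050,
      1080295033660458, 477049699974126, 1063164967017595, 476112905212566, 790875941540642,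
      28943967914090, 655843369077706, 791812736302202, 497525056149749, 28943597304746,
      1063165037351803, 343706633632815, 1063165002382267], [(0, 4527176, 898779)]⟩,
    ⟨4527488, 8, 4872, [2035457653138938, 1085514518236386, 1091168544155137, 638546919729774,
      1099516815991328, 1085514149405154, 1093862926168698, 1085514184374690, 486952958763606,
      801715995091682, 644334476927651, 1085514114238050, 1088341431425696, 1093862555559354,
      1093862590528890, 1093862520194682], [(0, 4527488, 898779)]⟩,
    ⟨21071105, 8, 1360, [2982591003813232, 1091201964193544, 1063198728793530, 1080211285790040,
      1063180868308818, 2510378930483193, 2488095969166185, 321223629717975, 2488080374670009,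
      2510395171533585, 1063214766572322, 2477909460230882, 1085490526596882, 644334476927651,
      1080161205830040, 486952958763606, 6460593389906, 1085564398652706, 1085564012774178,
      2488029096883449, 2488029684281337], [(0, 21071105, 898779)]⟩,
    ⟨21251090, 8, 3153, [2985384559617880, 1085547776043234, 2513182651389585, 2488080374669842,
      1081207933814274, 1085479268012706, 1085484846147618, 486952958763606, 801715995091682,
      1063165072490683, 644334476927651, 1085490424084962, 1081231828422018, 1107480536091,
      22519931975378, 476112905212566, 475176110448654, 655843669578634, 2488023020933458,
      476981189967918, 790818587804258, 790875941540642, 497462424976949, 2488011864663634,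
      2488017442996114, 476986768300398, 790807431534434, 477049699974126, 476044395206358,
      633431491702883, 497456846644469, 476055551476182, 655786315842250, 790813009866914,
      476992346237742, 476049973538838, 497468002914293], [(0, 21251090, 898779)]⟩,
    ⟨21251138, 8, 14724, [1091135087200914, 2488079582817298, 1081231828422018, 486952958763606,
      801715995091682, 644334476927651, 1080295033660458, 1079358238897722, 1063164280638139,
      476112905212566, 790875941540642, 475176110448654, 477049699974126, 791812736302202,
      789939146776730, 634431218138171, 633494423376611, 632557628612699, 814161190651681,
      497524564798133, 655842877726090], [(0, 21251138, 898779)]⟩,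
    ⟨21251168, 8, 14679, [1091135087200914, 2029803427676528, 1093927447389882, 1081231828422018,
      801715995091682, 486952958763606, 644334476927651, 1080295033660458, 1079358238897722,
      1084024188600402, 1083087393838842, 1082150599074930, 635817787544267, 478436269380222,
      793199305708298, 633494423376611, 476112905212566, 789939146776730, 632557628612699,
      790875941540642, 634431218138171, 791812736302202, 477049699974126, 475176110448654], [(0,
      21251168, 898779)]⟩,
    ⟨21251456, 8, 35418, [2029803427676528, 1082150599074930, 1093862926140642, 801715995091682,
      1079456219473170, 644334476927651, 486952958763606, 632622149861939, 629661707749283,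
      478338288804774, 790003668025970, 793101325132850, 475240631697894, 787043225913314,
      472280189585238, 635719806968819], [(0, 21251456, 898779)]⟩,
    ⟨21333248, 8, 7440, [2029837083979208, 1085581195687674, 163791634117705, 1085564398652706,
      1085564012774178, 1085597669078034, 1085546811573882, 644334476927651, 801715995091682,
      1085490526596882, 486952958763606], [(0, 21333248, 898779)]⟩,
    ⟨1146160640, 8, 48207, [2479198836263291, 1093862921444539, 2388913157637495, 1063164280610313,
      1026493873767644, 950212006075694, 994912874121143, 981259569299566, 2488079582789346,
      958560608838048, 2389311964959301, 2366512633610439, 2419828176300302, 2434546870429235],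
      [(0, 1146160640, 898779)]⟩,
    ⟨22299968, 8, 71244, [2032613811929442, 1085513526839995, 2488080374670009, 3435179867906745,
      2965845697667769, 2488079582817298, 2965844905815058, 3435179076054034], [(0, 22299968,
      898779), (3075, 1168252224001, 931548), (3315, 1169313305089, 932124)]⟩,
    ⟨1141921088, 8, 57072, [634910934766627, 1085381282751906, 1085245079400763, 671396035660643,
      1085112043459963, 656991733557474, 648776758286411, 657124769498274, 648643722345611,
      671529071601443, 327283956100912, 338458979878761, 327416992041712, 338592015819561], [(0,
      1141921088, 898779), (8176, 2283078676, 936201), (9152, 2215712016, 903414)]⟩,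
    ⟨1145373716, 8, 71400, [2029803427676528, 1085381282751906, 486952958763606, 644334476927651,
      801715995091682, 801582959150882, 486819922822806, 644201440986851], [(0, 1145373716,
      898779)]⟩,
    ⟨349272, 9, 357, [2985401288687097, 2513240205461104, 1085547875222370, 1049113774763701,
      2510462385548985, 1093862518371042, 2488080473653776, 1026630666953665, 2501655642190600,
      186324395502768, 2488079581039186, 2479332495719808, 644334476927651, 1063165074268795,
      1026497663586014, 1081231036569474, 486952166911062, 1085513526840162, 1026459620284585,
      2456962233992955, 1026497696183495, 801715203239138, 476112113360022, 1048942694308008,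
      1038102640756968, 2434479159969532, 633493631524067, 814161188873569, 790875149688098], [(0,
      349272, 898779)]⟩,
    ⟨4527504, 9, 7818, [2035457653138938, 1091168544155137, 172125824288137, 1096672904448800,
      1093931859248466, 1099500017178234, 1079359235035424, 1084092362966802, 801715995091682,
      644334476927651, 486952958763606, 1080329486764122, 478446491342070, 635828009506115,
      793209527670146, 481181925586494, 795944961914570, 638563443750539, 630633383904467,
      788014902068498, 473251865740422], [(0, 4527504, 898779)]⟩,
    ⟨21071121, 9, 2162, [2035412340129560, 1085508932430608, 1091135087198576, 644466702134386,
      1085507348669408, 1085590862494705, 2510428018257033, 2488080374670009, 2510356523479511,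
      1085517675578000, 1085584682376474, 1081098000581079, 1085586284991306, 163842111553944,
      644334476927651, 6460593389906, 801715995091682, 2476035870728790, 2510440201488520,
      2510354939830535, 1057676529191785, 1085512716077874, 2488072536588177, 2488074139203009,
      2488078772055177], [(0, 21071121, 898779), (40, 21071169, 889566)]⟩,
    ⟨21251094, 9, 2062, [1091135087200914, 1065709593776409, 2500543090757649, 2510446349547129,
      366190674103559, 2487814411931969, 644334476927651, 486952958763606, 1085484846147618,
      801715995091682, 1080295033660458, 1085490424084962, 51427637775686, 1081231828422018,
      1079358238897722, 1085479268012706, 1036132748880987, 475176110448654, 477049699974126,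
      789939146776730, 633494423376611, 790875941540642, 634431218138171, 476049973538838,
      476044395206358, 791744226295994, 791749804628474, 632500274876315, 476112905212566,
      632494696938971, 632557628612699, 476986768300398, 633425913370403, 634368286464443,
      791755382565818, 634362708131963, 790813009866914, 634373864401787, 476992346237742,
      633431491702883, 789876215103002, 475118756712270, 475113178774926, 790807431534434,
      476981189967918, 789881793040346, 633437069640227, 790818587804258], [(0, 21251094, 898779)]⟩,
    ⟨21251169, 9, 29340, [2035424196184736, 1091135087200914, 789939146776730, 1081231828422018,
      1080295033660458, 1079358238897722, 486952958763606, 644334476927651, 801715995091682,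
      790875941540642, 791812736302202, 477049699974126, 475176110448654, 476112905212566,
      634431218138171, 632557628612699, 633494423376611], [(0, 21251169, 898779), (640, 21255264,
      898673), (816, 1107575829, 902939), (864, 1090929688, 906766)]⟩,
    ⟨21333252, 9, 15600, [2035389150218137, 1085547974995386, 1091100041234336, 801715995091682,
      644334476927651, 1091111295101576, 1088357195827993, 486952958763606, 1091105820293552,
      1085531147142162], [(0, 21333252, 898779)]⟩,
    ⟨22300224, 9, 37260, [2041044172836698, 1093944679598779, 1082034590887829, 1079323188217785,
      2968789503758895, 1555115940132025, 2972602406557441, 3443810166308960, 1082167622143298,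
      1079189365106098], [(0, 22300224, 898779)]⟩,
    ⟨25510992, 9, 2631, [2985384559617880, 2513240005125969, 1063164282416251, 1085564299671138,
      1080295033660458, 1063165072490683, 1085513528618274, 644334476927651, 1081231828422018,
      801715995091682, 2488080374669842, 486952958763606, 790875941540642, 633494423376611,
      791812736302202, 655793078171530, 814111391097121, 476112111581910, 2488079581039186,
      476062313805462, 477049699974126, 2488029783262738, 476112905212566, 476999108567022,
      790825350133538], [(0, 25510992, 898779)]⟩,
    ⟨1141920840, 9, 23634, [1091135087593698, 172111789822162, 1093944681376891, 815795463449378,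
      1081365659469858, 1080428862940770, 1079492066214114, 186162917456145, 824142681633978,
      163746359047921, 801742752110474, 1084175251474939, 1083238454945851, 1082301658021627,
      812499658278714, 814373251732026, 791036525679434, 813436455202938, 790099728755210,
      791973322208522], [(0, 1141920840, 898779), (9152, 2215711768, 903414)]⟩,
    ⟨1145373720, 9, 35589, [2029803427676528, 1093862921455290, 1080400422642618, 486952958763606,
      1084303175936610, 644334476927651, 801715995091682, 788253496279010, 473490459950934,
      478338284119422, 630871978114979, 635719802283467, 634508659527371, 477127141363326,
      793101320447498, 791890177691402], [(0, 1145373720, 898779), (812, 68790928904, 1002726)]⟩,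
    ⟨1145382144, 9, 11802, [2031671470632440, 1087391062431450, 321160330549456, 1085513526812106,
      1085585639226354, 1085584847345754, 1086438041359650, 644334476927651, 801715995091682,
      1087381560341202, 486952958763606, 1086438833184138, 1087391863738866], [(0, 1145382144,
      898779), (136, 69797750016, 988763)]⟩,
    ⟨1145439297, 9, 71400, [2029803427676528, 1085244282750810, 644334476927651, 801715995091682,
      486952958763606, 801445959149786, 644064440985755, 486682922821710], [(0, 1145439297,
      898779)]⟩,
    ⟨1146160416, 9, 338868, [1040148266229285, 2465063568408444], [(0, 1146160416, 898779), (3120,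
      5504042004, 931611)]⟩,
    ⟨22283872, 10, 1030, [2985401388066160, 2510446449318983, 2465146715296545, 2510395171532416,
      1085564398652706, 2510445215365703, 2465146142038881, 2488029888735930, 1063215558424929,
      826940943357865, 3437989460308256, 1085490526594544, 1040282117646282, 509535411252280,
      346517088003128, 1085564012774178, 1063164868036257, 2465197419825441, 1063164280638369,
      1017932079591945], [(0, 22283872, 898779)]⟩,
    ⟨89212176, 9, 10084, [2979780143566354, 1093945264538219, 1093812228597419, 2488080374641953,
      1085564292512976, 1549445148978267, 2962752151187447, 1085381287465147, 1093995551411323,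
      1515654661575146, 1063165072462794, 3404299556405041, 3404232503272057, 1063215046339176,
      2957164830224529, 2488029774926139, 1093862520184098, 2457033503678754], [(0, 89212176,
      898779), (780, 276555765008, 902883)]⟩,
    ⟨1146115392, 9, 59454, [700880590546962, 1085381282751906, 2488080374641953, 361750897519809,
      656182098087138, 384366215631321, 1063165072462794, 678664380257850, 339401651289897,
      656049062146338, 339534687230697, 701013626487762, 678398308376250], [(0, 1146115392,
      898779), (8096, 69861704744, 1007625)]⟩,
    ⟨89212192, 10, 19872, [2035441124206098, 1093659801219426, 1538153567936034, 2488080374641953,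
      2018281108267578, 2451011251200225, 2924126125780545, 1510452561157554, 37158041080545,
      821221726897530, 2434479954779082, 361806227623617, 3381725419339218, 1063165072462794,
      1510317941511666, 181122037786641, 523305024271218, 497792217562458, 3397190715121833,
      843705592773330, 1026460418643345, 500821158395418, 197383470798801, 814462403896890,
      357558609779049, 1037337686380842, 661046587917282, 836811650126802, 22786795258017,
      678476706519738, 1983517150498842, 203471284016553, 520141463792370, 45136041487929,
      339456981393705], [(0, 89212192, 898779)]⟩,
    ⟨25510996, 10, 5016, [1091135087200914, 2488029853599305, 343739470196463, 2488096508665426,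
      2488005994129272, 486952958763606, 801715995091682, 644334476927651, 1085580401294984,
      1063215088637409, 1081231828422018, 1080295033660458, 1063197838945915, 1063152626753330,
      1079358238897722, 790875941540642, 633494423376611, 791812736302202, 477049699974126,
      476112905212566, 634431218138171, 632557628612699, 789939146776730, 654856353754685,
      499348425079873, 813174666680290, 475176110448654], [(0, 25510996, 898779), (16, 1099252772,
      889561), (32, 2172994692, 912606)]⟩,
    ⟨1146119488, 10, 59454, [1509381343718346, 1084303175936610, 1063165072462794, 45114267913785,
      503665265925402, 3395317520170233, 2488080374641953, 239558636334465, 526149131801202,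
      497730747045210, 22765021683873, 1509515963364234, 42795972911265, 860676091438506,
      520079993275122], [(0, 1146119488, 898779), (11200, 2232493328, 903601)]⟩,
    ⟨1146177856, 10, 170580, [1540957418221305, 497793009415002, 679435175281233, 22787587110561,
      360863690745642, 3435217678048506], [(0, 1146177856, 898779), (4352, 1146161504, 897782),
      (7472, 5504043092, 930614), (7584, 148244596776, 961073)]⟩,
    ⟨1146230080, 10, 173784, [568371643266212, 2442978023188019, 37223274647265, 500920045695258,
      104674872218219, 1018062721008860], [(0, 1146230080, 898779), (3008, 2232460560, 903582)]⟩,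
    ⟨1146423616, 10, 9669, [297747164899115, 1093995957395986, 1084303175936610, 1085381282751906,
      2559894611375332, 2856896640800818, 478471320070806, 1084170139995810, 14808404261139,
      2546591974117156, 1893910800899622, 2867805672787762, 2867940292433650, 2546725000631140,
      1080533458583314, 1080400422642514, 2857031260446706, 1093862921455186, 1212869507667,
      1345905448467, 14675368320339], [(0, 1146423616, 898779), (245, 4321511744, 1796379)]⟩,
    ⟨21333392, 11, 4107, [2029803427676528, 1091218437582721, 1085564398652706, 1085564012774178,
      1083172732302752, 644334476927651, 1082219109081138, 1084058249256577, 801715995091682,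
      1084029972562369, 486952958763606, 1083171498349472, 1084126354897537, 1082168418692466],
      [(0, 21333392, 898779), (204, 10838107650, 899299)]⟩,
    ⟨22287968, 11, 2136, [2035457852485064, 1085547974994217, 1040282117646282, 1091167580080914,
      2488113239118920, 2455695294720066, 531787081158767, 689167218476457, 214028455223968,
      2488079582817402, 1063164280638369, 1080294864372969, 2468006587399360, 666817180337826,
      824136234849025, 365922779759922, 1035464132650521, 343572741621417, 2903423991943209,
      1956301796356866, 1017932079591945, 2442847381770978, 2465197419825441], [(0, 22287968,
      898779)]⟩,
    ⟨1145378128, 10, 15288, [2029803427676528, 1082403514084746, 1085513526812106,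
      1093524871582794, 644334476927651, 1093410054703386, 1082417766336354, 486952958763606,
      801715995091682, 635367507917099, 478034288662062, 1082537337192738, 792797324990138,
      629929273314851, 792749026081130, 635415806826107, 472547755150806, 787310791478882,
      477985989753054, 792664298504210, 630082103156435, 787463621320466, 472700584992390], [(0,
      1145378128, 898779), (28, 8673977680, 845611), (188, 146112799825, 833326), (448, 2240038210,
      904089), (1180, 8678671441, 909550), (1428, 77314004116, 868561)]⟩,
    ⟨1163150656, 10, 88380, [1080127651454322, 1085513526839995, 1082352934030075,
      1080260687395122, 1080143488508208, 1082352142177698], [(0, 1163150656, 898779), (112,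
      5512500544, 989531), (208, 141760173376, 891699), (2512, 139671409936, 801526), (3008,
      2236941584, 903286), (12291, 1375551506433, 1160924), (12355, 1375534671873, 1152588),
      (12419, 1375568156673, 1173428), (12680, 1685859598378, 1419843), (14723, 1668678703105,
      1682164)]⟩,
    ⟨5453714704, 10, 58908, [641490534955747, 1085112043459963, 1085381282751739, 660910614923747,
      1085245079400930, 354765420659433, 638563744251467, 641221295663971, 663571333746594,
      638294504959691, 661179854215523, 334806862092016, 663840573038370, 335076101383792,
      354496181367657], [(0, 5453714704, 898779), (304, 68892591376, 1001291)]⟩,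
    ⟨1099240784, 11, 8214, [2035401757990650, 1091112649006849, 486879112616315, 1085502366083912,
      1083105283593018, 1085501743915225, 1083154976645497, 644334476927651, 1082146844883097,
      1082156980872968, 1084069235233362, 801715995091682, 486952958763606, 1082217217226418,
      1084029334050817, 472313945856150, 474238945114206, 630721848899603, 631620463278251,
      789001981442282, 788103367063634, 473340330735558, 629695464020195, 787076982184226], [(0,
      1099240784, 898779), (16, 2172933456, 889547), (32, 25597264, 912627), (128, 1082463640,
      911262), (172, 6610261522, 910886)]⟩,
    ⟨1145378324, 11, 24702, [2029803427676528, 1081760826989514, 1089796865573514,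
      1093524871582794, 486952958763606, 1083233343466722, 644334476927651, 801715995091682,
      635415806826107, 474294220539222, 650490577946915, 789057256867298, 807872096110946,
      792797324990138, 493109059782870, 631675738703267, 478034288662062], [(0, 1145378324,
      898779), (116, 137460225680, 832913), (188, 146112799890, 833326), (528, 9735050502, 833241),
      (636, 146046215320, 997235), (756, 137598616738, 900446), (796, 8673969556, 845537), (812,
      146112922708, 1005286), (960, 2231649862, 903387), (992, 70951126150, 1005790), (2084,
      70892692744, 963430), (2212, 69798089992, 957150), (2276, 69831574792, 977430)]⟩,
    ⟨1146423620, 11, 114528, [169329052640112, 1079463625917048, 653222016193698, 357675283515794,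
      790953381172898, 342228697242537, 159531184200793], [(0, 1146423620, 898779), (240,
      141760465168, 899355), (960, 2232707344, 903387), (3201, 2269091725829, 976628), (3205,
      70067161350, 1795794), (3213, 1169580098565, 419571), (3779, 2204696060421, 920668), (3783,
      2204427625993, 396702), (3787, 2204964497921, 1707229), (5120, 1146431808, 898678), (11200,
      2232699156, 903561)]⟩,
    ⟨5470491920, 11, 175464, [639561912118667, 1085245079400930, 336635907122416, 336905146414192,
      639292672826891], [(0, 5470491920, 898779), (6544, 73053799492, 961161), (12776,
      1170790678610, 1100993), (13016, 173284524418, 1510083)]⟩,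
    ⟨1167345984, 12, 58908, [1086220972661538, 489701872695386, 1098491266187064, 831532611152250,
      1080417084738552, 201920089074822, 491384255548250, 479286462551574, 184004579800209,
      475258659399894, 200271095609094, 189900495276177, 811595793766842, 16554697962963,
      354205393107], [(0, 1167345984, 898779), (800, 77335906376, 912409)]⟩,
    ⟨5470492752, 12, 38388, [2028632463761281, 3419488502231819, 169362542589360, 2488029876261093,
      3114708207514, 631921974615009, 380258481624649, 203489149135522, 22971894348822,
      47813679025061, 2002034179511474, 181173357195515, 242566348722315, 542624848816115,
      386013347770234, 1063215542393868, 517197735371042, 357708773465042, 67619822437820,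
      497876348355651, 472499165235427], [(0, 5470492752, 898779)]⟩,
    ⟨5655238032, 12, 16745, [461252962683817, 1096162524453680, 3479447404505876, 1784512982041732,
      2614426732880966, 862728711703012, 951309370320530, 1648970278693610, 879770121129341,
      1330849439981959, 996798621026940, 678728103100027, 3712913795748576, 2593389246865575,
      973904404974870, 2610441941558456, 2795492541810475, 2801547298181338, 1761477853860921,
      371177303574206, 250368632785348, 1007706308277802, 1363749746777890, 629864289748349,
      362041659126610, 2588089665073068, 1642999163297843, 1742702124961090, 986290695541701,
      3500219397801546, 3434618469497559], [(0, 5655238032, 898779), (156, 555460666896, 321326)]⟩,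
    ⟨5655258688, 13, 16745, [309596033134645, 1091911233332207, 2809566503072097, 762041404405178,
      3122515187226838, 1132470059570826, 1896934237334470, 758461022531380, 343544437549945,
      1003742641667518, 1235086424726456, 484062363503457, 1986405324239689, 2536258579990757,
      703593207375762, 2752894019593097, 477948155961929, 3034936579035373, 849527565135203,
      3077601469098849, 1001464355436714, 391335131343582, 101582065456522, 3209618368516390,
      666761162020011, 1271806638365798, 3116639301398290, 2279396744044434, 1180292704302104,
      2411795040862309, 1272471878174671, 666494849964509, 2334488404949942, 1361207098393644,
      2626872270213952], [(0, 5655258688, 898779), (97, 1105165641280, 988891)]⟩,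
    ⟨341, 5, 14, [2040962419412553, 1091168743867153, 2510445936806475, 2501412679130830,
      2501963118102022, 1094027027088242, 1093996052264073, 2501547494418728, 2507033448031989,
      1085513308729235, 1085512725564337, 1096271039846416, 2499455734797645, 2501680320747203,
      1093460653561390, 1081095606142093, 1093591704903345, 1085112688265751, 1093461437977521,
      1085514309237834, 1093726699166577, 1085245060463130, 1085514313979298, 1085514318686708,
      1085514318687947, 1093860526987977], []⟩,
    ⟨4433, 5, 116, [2988211672941201, 1091168743896378, 2501981224950910, 2501948182504736,
      1085215601806152, 1093995546061827, 1093727920216426, 2501680335000882, 1085513376295814,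
      2510225702839851, 1085514319880466, 1082085288761907, 1093995163127097, 1093727922422434,
      1093995611257055, 1093995955190145, 1085247464385378, 1085477679094560, 1080160418719127,
      1079225211197808, 1085513526040650, 1085247463377714, 1093658203790549, 1085246514842103,
      1085343856222776, 1093663780368514, 1093861342463673, 1085483255044534, 1093658210948692,
      1093669361061288, 1085354998640631, 1085355008123893, 1093669360850784, 1085514138510742,
      1085514171702229, 1085514317475714, 1093663787108001, 1093669363267296, 1085514317685042,
      1085514317893194], []⟩,
    ⟨20801, 5, 66, [1096822729897391, 2032228113461673, 1085547776835872, 2496595864051391,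
      2510429616752337, 2501947807932594, 1093659007599146, 1085514176490954, 1093743057764225,
      1093726718104210, 2501922586016942, 2515664845254058, 1093760175059616, 1096404071129753,
      1079224405538018, 1079357447132519, 1082085281276501, 1093995952682745, 1093792029286997,
      1085477675360593, 1083022872621729, 1079225032241353, 1085477466753649, 1085349418157352,
      1085514143288946, 1079356649209128, 1085514313979298, 1093803176892193, 1093797600732898,
      1085245079400763, 1085483251519895, 1085488827679190, 1093726296110218, 1093862921455353],
      []⟩,
    ⟨20804, 5, 666, [1094012685873856, 1093862926168761, 2510370772478328, 2029670254219314,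
      1085381078830314, 1093862551575465, 1085381387040762, 1093996056971601, 1093995957396153,
      1085483251519895, 1085514176462898, 1085514143260890, 1093791654693701, 1083958870778593,
      1085477675360593, 1085488619044190, 1083021668229898, 1082085281276501, 1081098797175254,
      1093797605446306, 1093862584777473, 1093862518371105], []⟩,
    ⟨4260101, 5, 420, [2513256833375512, 2972467785035761, 2501981439126162, 2500392634026145,
      2501948181712098, 1093995165515553, 2510429250262521, 1093937435418345, 1093995957396153,
      1085513383067274, 1085514149405154, 1085514184374690, 1082085281276501, 1085484849430170,
      1083021705418210, 1083022076027554, 1083889567068145, 1085513348097738, 1079188395050498,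
      1085478337633746, 1081097208700479, 1080125359089096, 1085484048122754, 1080160413949440,
      1085489624292570, 1083958078897993, 1085513526812106, 1081062153840135, 1082952772317106,
      1085478471951762, 1082015977566053, 1083958870778593, 1082021553738221, 1083021284146954,
      1082027129908037, 1082957977879930, 1083895143240313, 1082963924659090, 1083900719410129],
      []⟩,
    ⟨4264208, 5, 1850, [2510446349350737, 1085381282751739, 1093926653685705, 2969844295208606,
      1093995957396153, 1083958870778593, 1083022076027554, 1085478471951762, 1085484048122754,
      1081073306180943, 1082021553738221, 1085489624292570, 1082015977566053, 1093862921455186,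
      1082085281276501, 1083900719410129, 1083895143240313, 1082963924659090, 1082952772317106,
      1082958348489274, 1083889567068145, 1082027129908037], []⟩,
    ⟨86292, 6, 162, [1096823065414552, 2024547699041711, 1094012880902865, 1099298891871175,
      1093978135349169, 2501814946227451, 2510112236223314, 2510111786840954, 1085564010368250,
      1085514513720546, 1096354679796743, 1093678915245842, 1093996053442425, 1080161201116632,
      1093995952682745, 1093797605442298, 1087973259204205, 1093996152423993, 1085489819320410,
      1083900719410129, 1083022271055394, 1083958866065185, 1085514313979298, 1083958870778593,
      1083091379716833, 1085381383511419, 1083022071314146, 1085381482492987, 1081232620283246,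
      1080295825532207, 1085349423707179, 1093803176898706, 1085233129196351, 1093862926168594,
      1085381287465147, 1085296856734631, 1085514414738978, 1085489624292570, 1093677737656058,
      1083895143240313, 1093862921455186, 1093863022214866, 1093863121196434], []⟩,
    ⟨4264197, 6, 164, [2029645911019315, 1085547775650450, 1093862520194578, 1081264498193198,
      1093878070886266, 1088057669895555, 1093862926168594, 2501947046542986, 2510328462840850,
      2499454947622666, 1085479273259178, 1085247464356988, 1082027586148829, 1093937435418345,
      1080161205830040, 1079194941816458, 1085489624292570, 1083895143240313, 1079224276760978,
      1082015977566053, 1084091911432968, 1082021553738221, 1085513348097738, 1093669013437331,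
      1085484670715802, 1079357451733369, 1083021284146954, 1083958870778593, 1080263832169631,
      1082026759298693, 1085478471951762, 1079199716678858, 1080161071512024, 1082084910667157,
      1085379515562763, 1080428682758806, 1082027129908037, 1085513526812106, 1085381287465147,
      1079194140509042, 1081098000581079, 1085514184374690, 1085484048122754, 1084033750637688,
      1083958078897993], []⟩,
    ⟨4264272, 6, 4698, [1091135087198576, 2029803427676514, 1093995165515553, 1093995957396153,
      1085507109509634, 1083958870778593, 1085506317629034, 1083022076027554, 1082085281276501,
      1085513526812106, 1083021284146954, 1082941942106050, 1082941150225450, 1082084489395901,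
      1083877944976489, 1083878736857089, 1082005147354997, 1083958078897993, 1082004355474397],
      []⟩,
    ⟨21250368, 6, 7572, [2029803427676514, 1085379703731836, 1093995165543442, 1093995957396153,
      1084977400050309, 1093862926140705, 1093591278156493, 1093324423792886, 1085513526839995,
      1093592070009204, 1085381287437258, 1084975816344887, 1093459038753756, 1085109639453046,
      1084843576942150, 1085110431305757, 1084842785089439], []⟩,
    ⟨20824, 7, 180, [2510446449518889, 1093863026338103, 1093930958520600, 2970697379424436,
      1093995655667649, 1093995957396153, 1093995448249641, 2510296384588888, 1085514616787706,
      2510429247502624, 1080162298222319, 1085381583263418, 1093791554539738, 1083959362147848,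
      1083022567396809, 1085514278395057, 1085477675360593, 1093862926168761, 1081098797175254,
      1085483251519895, 1083021770802634, 1093802876380681, 1082084979547997, 1093797303717802,
      1083959365644264, 1093862620943841, 1085514614490810, 1093803181605601, 1093792029286997,
      1093797605446306], []⟩,
    ⟨86296, 7, 331, [2510446449516551, 1093812834994272, 2501917911920665, 2027253033642898,
      1085381488985690, 2501998663734752, 2510296587866194, 1093932229857873, 1093862924390482,
      1085484048122754, 1085489624292570, 1085501072385618, 1080211687061232, 1085564799923898,
      1080295832023727, 1093945466738145, 1093995957396153, 1081232626774766, 1083958870778593,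
      1085355001655107, 1082085281276501, 1085371725417043, 1085381289243259, 1082958348489274,
      1082027129908037, 1083022076027554, 1083908380120585, 1082971585369546, 1082021553738221,
      1083895143240313, 1084033748859576], []⟩,
    ⟨4264198, 7, 164, [2979431171803018, 2501981638669842, 1093862926168594, 1093931894218065,
      1085514518236386, 2501731313276372, 2501947847850402, 1085381287465147, 1080210899894040,
      1079194140509042, 1093932229857873, 1093791693630322, 1083884491741273, 1085501878406442,
      1085489624292570, 1093776379601578, 1082303552783379, 1085564012756706, 1093652249992451,
      1079194006191026, 1085381153147131, 1079273725106834, 1081415697923053, 1093641062286971,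
      1093995957396153, 1082133582433348, 1085514149405154, 1079188564338050, 1082148602819596,
      1082957977879930, 1082010758494349, 1080210519857880, 1082947696990234, 1093678125736163,
      1082148673153804, 1083894772630969, 1082021183128877, 1082085281276501, 1083958870778593,
      1093810856462794, 1082970798202354, 1082027129908037, 1082021553738221, 1082149008793612,
      1083895143240313, 1085514184374690, 1082034003451301, 1083907592953393], []⟩,
    ⟨4264210, 7, 1008, [2507568750674288, 1085547775650450, 2969790030749798, 1093812240482746,
      1093995957396153, 1085484048122754, 1093797600728890, 1085564398663290, 2501814946227451,
      1085489624292570, 1083022076027554, 1083958870778593, 1082085281276501, 1085506247294826,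
      1085495094952842, 1082015977566053, 1079188564338050, 1085381282751739, 1082958348489274,
      1085478471951762, 1093862921455186, 1083900719410129, 1082021553738221, 1082027129908037,
      1082952772317106, 1082941115058346, 1083895143240313, 1082971385628298, 1085500671125010,
      1083883485979201, 1083908180379337, 1082963924659090, 1083889567068145, 1081998744136301,
      1082034590877245], []⟩,
    ⟨4522372, 7, 980, [2513256833376695, 1093996057167993, 2041036829465305, 1093926183897162,
      1099516646675552, 1093995957396153, 1085514184374690, 1090970988817801, 1093862625667770,
      1085381252326497, 1085478772452753, 1085381587966305, 2497682847671312, 1085514149405154,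
      1081249219165136, 1085514114238050, 2499623820880816, 1085478401843409, 1085381181992289,
      1085381217356961, 1085478436812945], []⟩,
    ⟨21250432, 7, 1892, [2029803427676514, 1093325215645534, 1093908719055121, 1093862926140642,
      1085564012774011, 1093995957396153, 1085494987052472, 1093408851542556, 1082433698700146,
      1085381287437321, 1093509641463625, 1093273937848286, 1079542038284328, 1085494196981380,
      1093407269615246, 1079674391317894, 1085095115826646, 1082302336075131, 1085027587261509,
      1093810856490683, 1079673598872479, 1082283630330441, 1085343645395525, 1085430189676436,
      1085109639453046, 1093541584075188, 1079472155505514, 1079456219473170, 1082266110592675],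
      []⟩,
    ⟨4526480, 8, 1200, [1096789608460176, 2041112179112951, 1085488698080914, 1096622624738033,
      1085564499412219, 2501923153450329, 1093995957396153, 2498653668922768, 2500342017901267,
      1084042677137761, 1079225402496921, 1088224924219041, 1083895270307217, 1085489489974617,
      2501794734817344, 1085500505567265, 2495709124152556, 1081062418013351, 1083942972679214,
      1083959030036041, 1080161432479344, 1080294864372969, 1099500017178234, 1084092362966802],
      []⟩,
    ⟨21070097, 8, 1572, [1091129700936457, 2968737821182824, 1085508932430608, 1083022076027554,
      1093995957396153, 1093916397928480, 2510416910765015, 2501946379553586, 1094004954251608,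
      2501952922814912, 1085502462639889, 1085586284991306, 1083958870778593, 1085584682376474,
      1085500878990913, 1082085281276501, 1080159603215208, 1085512716077874, 1082083678661669,
      1083020473412722, 1083957268163761, 1083015840560554, 1083014237945722, 1083952635311593,
      1082077443194669], []⟩,
    ⟨21332368, 10, 119, [2978696295379017, 1081761533515796, 1087448821573695, 2512264336333206,
      2501998062128418, 1096608596777787, 2497078091102235, 1087260972324761, 1085564804626555,
      1091018705801720, 1085564012774178, 2501544094781469, 1096208692372234, 2512497772424459,
      1096436110566002, 1093944679609593, 1093812328171628, 2510943142362798, 1085431259490083,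
      1085514114237883, 1085110431305757, 1093541584075021, 1085160917239606, 1093995957396153,
      1085381175426747, 1085513526839995, 1093862412255672], []⟩,
    ⟨1145377104, 9, 462, [2037746177571386, 1092652378792429, 2505388896043759, 1093995957396153,
      1085478756449748, 1093994755318753, 1093862511230163, 2510360800779430, 2501814946227451,
      1101398673694030, 1085112821087781, 1085513526812106, 1085514108815831, 2508867771555703,
      1100926148220098, 1097498543038289, 1085428086780350, 1085561113294501, 1100926289639706,
      1093410054703386, 1097178471306557, 1092566819102104, 1093862921455186, 1093457459733853,
      1085381282751739, 1100791528517931, 1079223505508906, 1088686115730190, 1084975821030406,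
      1093459835375653, 1079224412839634, 1082084487635261, 1085028988385601, 1101329356725160,
      1089063274633559, 1085479268005462], []⟩,
    ⟨1099239760, 10, 940, [2036269726314029, 1091112649006849, 1093995952682578, 1093921875579401,
      1095742015496025, 1093995957396153, 1086248233730671, 1101184509345181, 1089223680989573,
      2512021259658131, 1095742010782450, 1098323939862419, 1080138032760144, 1085514313979131,
      1085502540481010, 2498580508358809, 1095582816396700, 1080249129188976, 1085501574231201,
      1086248059337247, 1082972115642058, 1081148346873327, 1080383329368105, 1101080983640333,
      1086329692440085, 1095587596182419, 1083934672103113, 1086329687726510, 1084069235233362,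
      1086258414868239, 1088930369279224, 1101329360456775], []⟩,
    ⟨1099511627861, 5, 22, [2983511162292333, 2670652974565969, 1063215559013973, 2510377395905928,
      2510429810565551, 2510429275946425, 2488079580788839, 2488078085062024, 2510377741452378,
      2510443957140310, 1063145462925078, 1085563201994481, 1085511932805373, 1085564799912069,
      1085514508361850, 1063139576764427, 1085512915198376, 1063163468973133, 2488027497899085,
      1085514313923186, 1085513517329178, 1085514318664650, 1085514318686708, 1085563199736536,
      1085514318687947], []⟩,
    ⟨85, 4, 11, [2513189617907733, 1071629501998701, 1085514513122950, 2502014405317869,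
      1085564796371433, 1093937014172264, 2510342491658661, 1071596225225113, 2488079996528694,
      2479680286861516, 1093960009345653, 2488111446584855, 2488079198717193, 1063164272312744,
      1085564010555103, 1085564799854384, 2479648427828959, 1085488822965782, 1085511748756607,
      1063214415674184, 1063213168641096, 1085563202022537, 1093945471451490, 1085514318686708,
      1085514309237834, 1085513517329178, 1085514313979298, 1085514318687947, 1085563199736536],
      []⟩,
    ⟨1099511631953, 5, 176, [2031759752150097, 1405889659504320, 2488097203909751,
      2488029889913106, 1085564901795136, 1063156613210303, 1085564458498271, 1063165071273858,
      1085563595521108, 2488029095865138, 1085514171702229, 1063214766582969, 1085500278092577,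
      1085483256261526, 1085564425306784, 1063128433900368, 2488029096073290, 1085564392115283,
      2488080372672153, 1063164280638306, 1063165071483186, 1063164891509374, 1085477679094560,
      2488021431442655, 1085488831203829, 2488079580819609, 1085564802431361, 2487993250134864,
      2488029740727205, 1085514104102256, 2488021424495016, 2488029887508354, 1063128433100856,
      1085564012784825, 1085563661904096, 1085563628712609, 1085514317893194, 1085513526840162,
      1085564010578817, 1085564010786969], []⟩,
    ⟨4177, 4, 88, [1093996056970432, 2979729887841094, 1085513525623170, 1096755956466457,
      1093945258078032, 1093995578659448, 1093944680786706, 1093945324461013, 1085514138510742,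
      1063164128906198, 2479598555784598, 1085505861410015, 1085563593104596, 1063214766582969,
      1085564010578817, 1063214413285728, 1085514105319248, 1085483256261526, 1063214382510753,
      1085514170485237, 1063214349319252, 1063164858109728, 1063215143707419, 1093945471451490,
      1085513526840162, 1085514317893194, 1085514317685042, 1085514171702229, 1085563661904096,
      1085564010786969], []⟩,
    ⟨1099511648324, 5, 510, [2031645741370655, 2670653804315232, 1063165271641746,
      2488028945159899, 2510429246278569, 1085505856668384, 1063146259483563, 1063215558435513,
      2488079582817298, 1085484052855534, 2488080374670009, 2488010274382420, 1085514176462898,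
      1085513526839995, 1063145116756636, 1085564012784658, 1063164897059034, 1063145458147924,
      1063151034307233, 2488015475948433, 1085500280509089, 2488029713293530, 2488021877162447,
      1063150659713937, 1063156235873232, 1085494329756484, 1063157060927951, 1085505482075088,
      1085494362958492], []⟩,
    ⟨20548, 4, 255, [1085547775648112, 2988194602478337, 2507652793149791, 2488080474245457,
      2479598735966562, 1063140382812973, 1071595433396923, 1085477675360593, 1085505856668384,
      1063164280638139, 1085564804637369, 1063134621738934, 1085494329756484, 1063151034307233,
      1085506658004023, 1085564012784658, 1085505482075088, 1063128253726921, 1085514143260890,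
      1085494362958492, 1085483109290087, 1085500697768504, 1063157060927951, 1085494704349780,
      1085514176462898], []⟩,
    ⟨1099515891792, 6, 438, [2983499004181089, 2670565920897812, 2510373518875533,
      2488029884011771, 1085563998616211, 1085514776598037, 1063215558435513, 1063241498086464,
      2510378343046602, 2510371935114166, 2510349095711111, 1085511914713678, 1085564804637369,
      1063200750359084, 1085561556236144, 1085550783615574, 1085484670715865, 1063240701520679,
      1085483478169199, 1085506015925832, 2488079582789409, 1085484265308669, 1063157863307778,
      1085514313979131, 2488079506483712, 1085511928854236, 1085563197280572, 1085564012756769,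
      1085562414798899, 2488029096844746, 2488001447382957, 1085513526812106, 1085589947722535,
      1085507109509634, 1085506317629034, 1085552046822946, 1085485471966501, 1085552056418432],
      []⟩,
    ⟨4264016, 5, 219, [1096726598886500, 1071590604484724, 1085564804637369, 2510429616158290,
      2479597944085962, 2479569889240357, 1071596683154965, 2488077984831539, 2479598735966562,
      2510415284149930, 1085484279476615, 1063241535811430, 1085514771884462, 1085562414798899,
      1085483478169199, 1063165067777275, 1085564012756769, 1063165530396181, 1085506015925832,
      1063240701520679, 1063136631148461, 1063164280610250, 1085484670715865, 1063213951078716,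
      1063161881344797, 1063157863307778, 1085511122833078, 1063162682652380, 1085552056418432,
      1085550783615574], []⟩,
    ⟨1099511648344, 7, 278, [1085547775648112, 1405866847746743, 2983477038440024,
      2510429721041207, 1063165370585850, 2488080069445089, 1063156237097217, 2488080467494391,
      1085514614490810, 2488080169614424, 1063215253210593, 2487993245393233, 1085488827679190,
      1085494704349780, 1085505551443464, 2487998821552535, 1085477675360593, 1085505554939880,
      2488030186820346, 2488080072941505, 1085500280509089, 1063145156419420, 2488080374670009,
      2488021426701024, 1085483549614895, 2488009972653916, 1085564804637369, 1085505856668384,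
      1085499978780585], []⟩,
    ⟨20568, 6, 139, [2032630836205249, 2513190016644776, 1071663439672000, 2488080474839351,
      2479584492727276, 1093996149607816, 1071646409465793, 2479648920182721, 1093945767249594,
      1085564804637369, 2479562092634449, 1063165368288954, 2488029848427697, 1093936636057857,
      1063165370585850, 1093914404278679, 2488030082135353, 1093995957396153, 2479578916568184,
      2501948478301664, 1085499975284169, 1085505856668384, 1085500280509089, 1063156308738024,
      1085494704349780, 1085499978780585, 1085494402621276], []⟩,
    ⟨343597383701, 5, 70, [2513245270442916, 1063165472563489, 1080736345780988, 2510429810537495,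
      2510429320354292, 2488080065864442, 1085514319885177, 2488080075308445, 891810495892736,
      1063164925528596, 1081723622738951, 2488080369960136, 891810491116146, 1085514607689262,
      1085514318658485, 253681501871049, 1059241040091853, 2477487263087839, 411112830907040,
      1085514308165541, 2477486954278654, 253681127310318, 1058254059940938, 1080736337370186,
      1063165072457868, 2488080369956601, 1085514239874030, 253681201410827, 1081723326162683,
      1059241049573876, 1085514614434761, 1085514318664650, 1085514313923186, 1085514318686708,
      1085514318687947, 2477486964805986], []⟩,
    ⟨68719476757, 4, 20, [1091146427947789, 1094949478599650, 2036200574972259, 1085514517001637,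
      1085381286625798, 2510429415216332, 1085514319257361, 2510296288095947, 2501948273232191,
      2501814950935028, 2501815346850071, 1093995443518246, 1085514138510742, 1085514619204281,
      1085514318699776, 1093995656884578, 1085514318664650, 1085514614434761, 1085514318686708,
      1085514318687947], []⟩,
    ⟨21, 3, 10, [1091202200233362, 2479632381546861, 1040683193115295, 1085564504693984,
      1049164523870038, 1063165373602185, 2510246103693812, 1093862926140705, 2479649221914760,
      1063215110905572, 1085564494664757, 2479332594664712, 1049164123798602, 1085514614434761,
      1085514318664650, 1093945471451490, 1085514313923186, 1085564504125794, 1085514318686708,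
      1085514318687947], []⟩,
    ⟨343597387793, 5, 259, [2982579848891272, 2513245240508494, 1085514516624272, 2488080375263889,
      734379088086610, 2488079931937644, 2488080367902466, 1063165368288850, 1085514211451882,
      2488079860784976, 1080736346825058, 1063165373002425, 1085514273065183, 1085514204684339,
      891677464658274, 1085514317893194, 2488079893176958, 2488080374670009, 2477486919178463,
      1085514239873696, 2477486754929111, 734246059366785, 1085514312706027, 1081723622807122,
      1059240937569363, 1080736345817394, 1085514614490706, 1063165365816226, 1081723625522841,
      2477487265317561, 1058254064682235, 411112701122279, 1080736232608539, 1059240835198752,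
      1063164960480339, 1085514612018082, 1085514619204281, 1085514313979131, 1085514317685042,
      1085514206682195], []⟩,
    ⟨68719480849, 4, 74, [1094949476505130, 1096811817633056, 2029803280686037, 1093996054764424,
      2501948477114976, 1085514616787769, 1085514619798161, 1085381583263314, 1093862580029663,
      1093995656884578, 1085514313979131, 1085381073292344, 1085514104311584, 1085381239631783,
      1085514110088935, 1093862444675710, 1085514619204281, 1085514206682195, 1085514239873696,
      1085514273065183, 1085514317893194, 1085514614490706], []⟩,
    ⟨4113, 3, 37, [1091202194688705, 1071646811362456, 1093979126338448, 2479382751704042,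
      2501948176603401, 2457166738831106, 1093812440224098, 1062899009028402, 2479648741217686,
      1048981217104569, 1085431468184827, 1040682581688144, 1085381107283350, 1040682680845083,
      1085514137711230, 1085514619204281, 1085514273065183, 1085514206682195, 1085514313979131,
      1085514239873696, 1085514614490706, 1085514317893194], []⟩,
    ⟨343597404184, 7, 42, [1091146627372613, 1063165167946840, 411246139104983, 1085514716754770,
      1085514616787706, 2488080264954195, 2510429653598896, 734246128354326, 2488080140939967,
      1085514604951436, 1085514651019660, 2510429713696247, 2510429741002648, 1063165064729421,
      1080736342111713, 891677450405555, 2477487260604090, 891810863178774, 1081723622807226,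
      411112911503995, 1085514607886628, 891810791683770, 253814223103667, 411245936240097,
      2488080363352356, 1085514614490810, 1085514313979361, 1085514320470651, 2488080074158434],
      []⟩,
    ⟨68719497240, 6, 12, [2036333099461356, 1096811879710610, 1087421884188487, 2510429654267955,
      2510296652624334, 2510296483315141, 1085381289243259, 2510296709775256, 2510296423460518,
      1085514643060997, 2510429652687244, 1085381620703920, 2501815313520684, 1085514313979361,
      1085514614490810, 1093995656884578, 1085514320470651], []⟩,
    ⟨20504, 5, 6, [1094012917411548, 2465547533688569, 2510429519295924, 1062899538500985,
      1085431471649722, 1071646743947199, 2501998560937463, 1071380345303059, 1093995952682682,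
      1071380707033646, 1093812466056327, 1048980740904680, 1040683090859706, 2457033614520955,
      1085564504125794, 1085514313979361, 1085514387054616, 1085514352088796, 1085514320470651],
      []⟩,
    ⟨5368709125, 4, 28, [2513240035684317, 2985194047690836, 2510446379711447, 2510429618240132,
      2497934481099443, 1085381287459316, 1085381288037018, 2501947982736608, 2510296586620965,
      1093995957976902, 1093862926168761, 1085110433674012, 2510042492522136, 1093401856608695,
      2510042493365277, 1080159835549296, 1083019548781546, 1093799870157666, 1080563724747333,
      1081096928210703, 1085514318686708, 1083019547006085, 1085491752419412, 1085514320453409,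
      1085381287437258, 1085110431305757, 1085514320440111, 1085514318664650], []⟩,
    ⟨1100585369605, 4, 21, [2983465368018060, 1405909477926382, 1085570478141318, 1085547843826775,
      1085564010555270, 2488080374655625, 1040281325821794, 2465146144423509, 2510379136719496,
      2442796895854434, 1085564012744710, 2488079581022708, 1063214763749973, 1085514320453409,
      1085564802848610, 1085514318664650, 1085514320440111, 1085514318686708], []⟩,
    ⟨1073741829, 3, 14, [2502015227972456, 1094001634287023, 2979724659579311, 1091201541136821,
      1071646708170789, 2501947191495347, 1071645917545750, 2479597944678673, 1085564804637369,
      1071596226407000, 2479648430045550, 1085513526596830, 1085514318687947, 1063164279594236,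
      2488079579984469, 1085514320481465, 1093945471451490, 1085514320453409, 1085514320440111,
      1085514318686708], []⟩,
    ⟨5, 2, 7, [1096805546773029, 2488062554399898, 2479615169824633, 1085513824723462,
      2434500658511649, 2442797196354117, 2442931513126946, 1018249122306479, 1018200024259461,
      2465464766662674, 1026498147808393, 2479249037022296, 2479332675272481, 1026363530255099,
      1040550061710420, 1063164279594069, 1071195054698421, 1085514320453409, 1085514617415522,
      1085564504125794, 1085514318664650, 1085514320440111, 1085514318686708], []⟩,
    ⟨68723671041, 3, 4, [1087421865198193, 1091146439073580, 1093862625659580, 2973420977361615,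
      2510429446160862, 1085381277936587, 1096273187214538, 1085514444500453, 2499564076303648,
      1093862921464754, 1085514318703353, 1084975830569780, 1085245079400930], []⟩,
    ⟨4194305, 2, 3, [2988044749338481, 2510446275489747, 2510246503965334, 2488080141738367,
      1085514470012388, 1040733136520835, 1093812226240548, 2510246404199660, 2479383159455154,
      1071380401556286, 1093996042917605, 1040683086023156, 1062899305818827, 1085564504125794,
      1085514318695100, 1085514309153332, 1085514318703353], []⟩,
    ⟨1, 1, 2, [2040811173785629, 2513238317719948, 1093979223601698, 1093812838515355,
      2442797989395708, 2434500547749858, 2457116759040636, 2501946687766400, 1085514318703353,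
      1085514320470818, 1085514617415522, 1085564504125794, 1093945471451490], []⟩,
    ⟨0, 0, 1, [1093979029762836, 1049128485748770, 1062899408340252, 2443063751354247,
      2442794801951154, 1048628837998476, 2479647334759266, 1026363213525090, 1085514617415522,
      1085514318692769, 1085514318703290, 1085514320470818], []⟩]

end ClassData

/-! ### Verification of the certificates -/

section Verification

open WeightedGraph

set_option maxRecDepth 100000

theorem exists_reach_one (G : WeightedGraph 3 1) :
    ∃ c ∈ extensionsOne.map (·.1), Reach G (ofCode 1 c) := by
  refine ⟨0, by decide, ?_⟩
  rw [show G = ofCode 1 0 from ?_]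
  · exact Reach.refl _
  · ext u v
    rw [Subsingleton.elim v u, G.loopless, (ofCode 1 0).loopless]

theorem exists_reach_two : ∀ G : WeightedGraph 3 2,
    ∃ c ∈ extensionsTwo.map (·.1), Reach G (ofCode 2 c) :=
  exists_reach_of_extensions (by decide) extensionsOne exists_reach_one (by decide +kernel)

theorem exists_reach_three : ∀ G : WeightedGraph 3 3,
    ∃ c ∈ extensionsThree.map (·.1), Reach G (ofCode 3 c) :=
  exists_reach_of_extensions (by decide) extensionsTwo exists_reach_two (by decide +kernel)

theorem exists_reach_four : ∀ G : WeightedGraph 3 4,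
    ∃ c ∈ extensionsFour.map (·.1), Reach G (ofCode 4 c) :=
  exists_reach_of_extensions (by decide) extensionsThree exists_reach_three (by decide +kernel)

theorem exists_reach_five : ∀ G : WeightedGraph 3 5,
    ∃ c ∈ extensionsFive.map (·.1), Reach G (ofCode 5 c) :=
  exists_reach_of_extensions (by decide) extensionsFour exists_reach_four (by decide +kernel)

theorem exists_reach_six : ∀ G : WeightedGraph 3 6,
    ∃ c ∈ extensionsSix.map (·.1), Reach G (ofCode 6 c) :=
  exists_reach_of_extensions (by decide) extensionsFive exists_reach_five (by decide +kernel)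

theorem exists_reach_seven : ∀ G : WeightedGraph 3 7,
    ∃ c ∈ certificatesSeven.map (·.code), Reach G (ofCode 7 c) :=
  exists_reach_of_extensions (by decide) extensionsSix exists_reach_six (by
    intro i hi
    change i < 39 at hi
    -- one evaluation for each graph, which bounds the memory that is needed
    interval_cases i <;> decide +kernel)

theorem isValid_certificatesThree : ∀ i < 3,
    (certificatesThree.getD i default).isValid 3 = true := by
  decide +kernel

theorem isMinimal_certificatesThree : ∀ i < 1,
    (certificatesThree.getD i default).isMinimal 3
      (((orbitTable 3).map (·.edges)).getD i default) = true := by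
  decide +kernel

theorem isValid_certificatesFour : ∀ i < 7,
    (certificatesFour.getD i default).isValid 4 = true := by
  decide +kernel

theorem isMinimal_certificatesFour : ∀ i < 3,
    (certificatesFour.getD i default).isMinimal 4
      (((orbitTable 4).map (·.edges)).getD i default) = true := by
  decide +kernel

theorem isValid_certificatesFive : ∀ i < 13,
    (certificatesFive.getD i default).isValid 5 = true := by
  decide +kernel

theorem isMinimal_certificatesFive : ∀ i < 5,
    (certificatesFive.getD i default).isMinimal 5
      (((orbitTable 5).map (·.edges)).getD i default) = true := by
  decide +kernel

theorem isValid_certificatesSix (i : ℕ) (hi : i < 39) :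
    (certificatesSix.getD i default).isValid 6 = true := by
  interval_cases i <;> decide +kernel

theorem isMinimal_certificatesSix (i : ℕ) (hi : i < 21) :
    (certificatesSix.getD i default).isMinimal 6
      (((orbitTable 6).map (·.edges)).getD i default) = true := by
  interval_cases i <;> decide +kernel

set_option maxHeartbeats 4000000 in
theorem isValid_certificatesSeven (i : ℕ) (hi : i < 121) :
    (certificatesSeven.getD i default).isValid 7 = true := by
  interval_cases i <;> decide +kernel

set_option maxHeartbeats 4000000 in
theorem isMinimal_certificatesSeven (i : ℕ) (hi : i < 73) :
    (certificatesSeven.getD i default).isMinimal 7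
      (((orbitTable 7).map (·.edges)).getD i default) = true := by
  interval_cases i <;> decide +kernel

theorem listsRepresentatives_three : ListsRepresentatives 3 (orbitTable 3) :=
  listsRepresentatives_of_certificates (Z := certificatesThree) (by decide) (by decide)
    isValid_certificatesThree
    (by
      rw [show certificatesThree.map (·.code) = extensionsThree.map (·.1) by decide +kernel]
      exact exists_reach_three)
    (le_trans (by decide +kernel) le_card_graphClass_three) (by decide) (by decide +kernel)
    isMinimal_certificatesThree (by decide +kernel) (by decide +kernel)

theorem listsRepresentatives_four : ListsRepresentatives 4 (orbitTable 4) :=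
  listsRepresentatives_of_certificates (Z := certificatesFour) (by decide) (by decide)
    isValid_certificatesFour
    (by
      rw [show certificatesFour.map (·.code) = extensionsFour.map (·.1) by decide +kernel]
      exact exists_reach_four)
    (le_trans (by decide +kernel) le_card_graphClass_four) (by decide) (by decide +kernel)
    isMinimal_certificatesFour (by decide +kernel) (by decide +kernel)

theorem listsRepresentatives_five : ListsRepresentatives 5 (orbitTable 5) :=
  listsRepresentatives_of_certificates (Z := certificatesFive) (by decide) (by decide)
    isValid_certificatesFive
    (by
      rw [show certificatesFive.map (·.code) = extensionsFive.map (·.1) by decide +kernel]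
      exact exists_reach_five)
    (le_trans (by decide +kernel) le_card_graphClass_five) (by decide) (by decide +kernel)
    isMinimal_certificatesFive (by decide +kernel) (by decide +kernel)

theorem listsRepresentatives_six : ListsRepresentatives 6 (orbitTable 6) :=
  listsRepresentatives_of_certificates (Z := certificatesSix) (by decide) (by decide)
    isValid_certificatesSix
    (by
      rw [show certificatesSix.map (·.code) = extensionsSix.map (·.1) by decide +kernel]
      exact exists_reach_six)
    (le_trans (by decide +kernel) le_card_graphClass_six) (by decide) (by decide +kernel)
    isMinimal_certificatesSix (by decide +kernel) (by decide +kernel)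

theorem listsRepresentatives_seven : ListsRepresentatives 7 (orbitTable 7) :=
  listsRepresentatives_of_certificates (Z := certificatesSeven) (by decide) (by decide)
    isValid_certificatesSeven
    exists_reach_seven
    (le_trans (by decide +kernel) le_card_graphClass_seven) (by decide) (by decide +kernel)
    isMinimal_certificatesSeven (by decide +kernel) (by decide +kernel)

theorem ListsRepresentatives.card_orbit {n : ℕ} {T : List TableRow}
    (h : ListsRepresentatives n T) :
    Nat.card (Orbit n) = T.length := by
  obtain ⟨g, hg, -⟩ := h
  rw [← Nat.card_eq_of_bijective _ hg, Nat.card_eq_fintype_card, Fintype.card_fin]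

end Verification

theorem mainTheorem1 :
    (Nat.card (Orbit 3) = 1 ∧ Nat.card (Orbit 4) = 3 ∧ Nat.card (Orbit 5) = 5 ∧
      Nat.card (Orbit 6) = 21 ∧ Nat.card (Orbit 7) = 73 ∧
      ∑ n ∈ Finset.Icc 3 7, Nat.card (Orbit n) = 103) ∧
    ∀ n ∈ Finset.Icc 3 7, ∃ g : Fin (orbitTable n).length → ConnectedGraph n,
      Function.Bijective (fun i => orbitOf (g i)) ∧
      Monotone (fun i => toLex ((g i).1.edgeCount, (g i).1.totalWeight)) ∧
      ∀ i, (g i).1.upperTriangle = (orbitTable n)[i].representative ∧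
        (g i).1.edgeCount = (orbitTable n)[i].edges ∧
        IsRepresentative (g i) ∧
        (orbitOf (g i)).size = (orbitTable n)[i].orbitSize := by
  have h : ∀ n ∈ Finset.Icc 3 7, ListsRepresentatives n (orbitTable n) := by
    intro n hn
    obtain ⟨h3, h7⟩ := Finset.mem_Icc.1 hn
    interval_cases n
    · exact listsRepresentatives_three
    · exact listsRepresentatives_four
    · exact listsRepresentatives_five
    · exact listsRepresentatives_six
    · exact listsRepresentatives_seven
  have h3 := listsRepresentatives_three.card_orbit
  have h4 := listsRepresentatives_four.card_orbit
  have h5 := listsRepresentatives_five.card_orbit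
  have h6 := listsRepresentatives_six.card_orbit
  have h7 := listsRepresentatives_seven.card_orbit
  exact ⟨⟨h3, h4, h5, h6, h7,
    Finset.sum_congr rfl fun n hn => (h n hn).card_orbit⟩, h⟩
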